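/- **Setting.** Let $m\ge 1$, $0<\alpha<1$, and let $M\subset\mathbb R^m$ be compact with $\overline{\operatorname{int}M}=M$ and $\nu(M)=1$, where $\nu$ is Lebesgue measure and $d$ the Euclidean distance. Write $B_\varepsilon(A)=\{x\in\mathbb R^m: d(x,A)\le\varepsilon\}$, $B_\varepsilon(x)=B_\varepsilon(\{x\})$, and $\gamma_k$ for the volume of the unit ball of $\mathbb R^k$. Let $T:M\to M$ satisfy the following four assumptions. *Assumption 1 (piecewise smoothness).* There are finitely many disjoint open sets $U_1,\dots,U_K$ with $M=\bigcup_i\overline{U_i}$ such that for each $i$: (a) $T_i:=T|_{U_i}$ is injective and $C^{1+\alpha}$; (b) $T_i$ extends to a $C^{1+\alpha}$ map $T_i:\tilde U_i\to\mathbb R^m$ on an open set $\tilde U_i\supset\overline{U_i}$ with $T_i\tilde U_i\supset B_{\varepsilon_1}(T_iU_i)$, for some $\varepsilon_1>0$ independent of $i$. (Here $C^{1+\alpha}$ means differentiable with locally $\alpha$-Hölder derivative.) *Assumption 2 (fixed point).* There is $p\in U_1$ with $Tp=p$ and $T^{-1}p\cap\partial U_j=\emptyset$ for all $j$. Write $|x|=d(x,p)$.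 For a map $F$ with domain $D$ and $x\in D$ let $s(x,F)$ be the least $\sigma$ with $d(x,y)\le\sigma\, d(Fx,Fy)$ for all $y\in D$ with $d(x,y)\le\min\{\varepsilon_1,0.1|x|\}$. Put $s(x)=s(x,T_i)$ for $x\in U_i$. *Assumption 3 (expanding rates).* There is a connected open set $R\ni p$, bounded by a smooth surface, with $\overline R\subset TR$, $\overline{TR}\subset U_1$ and, for each $j$, either $\overline R\subset TU_j$ or $\overline R\cap TU_j=\emptyset$, such that: (a) $0<s(x)\le1$ for all $x\in\bigcup_iU_i\setminus\{p\}$, and if $s(x)=1$ then $x\in R$ and $|Tx|>|x|$; (b) there are $\eta_0\in(0,1)$ and $\varepsilon_2>0$ with $s^\alpha+\lambda\le\eta_0$, where $s=\sup\{s(x):x\in\bigcup_iU_i\setminus R\}$, $$\lambda=\max\Bigl\{2\sup_{0<\varepsilon_0\le\varepsilon_2}\ \sup_{0<\varepsilon\le\varepsilon_0}\frac{G_U(\varepsilon,\varepsilon_0)}{\varepsilon^\alpha}\varepsilon_0^\alpha,\ \frac{3s\gamma_{m-1}}{(1-s)\gamma_m}\Bigr\},$$ $$G_U(\varepsilon,\varepsilon_0)=\sup_{x\in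 M}\sum_{j=1}^K\frac{\nu\bigl(T_j^{-1}B_\varepsilon(\partial TU_j)\cap B_{(1-s)\varepsilon_0}(x)\bigr)}{\nu\bigl(B_{(1-s)\varepsilon_0}(x)\bigr)},$$ the preimage $T_j^{-1}$ in the last formula being taken in $\tilde U_j$ under the extended map; (c) with $R_0=TR\setminus R$, there are an integer $N_s>0$ and $\varepsilon_3>0$ such that for all $x\in B_{\varepsilon_3}(R_0)$ $$s(T_1^{-N_s}x,T_1^{N_s})\le\frac{s}{5m}\Bigl(\frac{\lambda(1-s)^m}{2C_\xi I^2}\Bigr)^{1/\alpha},$$ with $I$ and $C_\xi$ as in Assumption 4(c). (Here and below $T_1^{-n}$ is the $n$-th iterate of the inverse of $T_1:U_1\to TU_1$.) *Assumption 4 (distortions).* (a) There is $c>0$ such that for all $j$ and all $x,y\in TU_j$ with $d(x,y)\le\varepsilon_1$, where $T_j^{-1}$ is the inverse of $T_j:U_j\to TU_j$: $|\det DT_j^{-1}(x)-\det DT_j^{-1}(y)|\le c\,|\det DT_j^{-1}(x)|\,d(x,y)^\alpha$. (b) For every $b>0$ there are $J>0$, $\varepsilon_4>0$ such that for every $\varepsilon\in(0,\varepsilon_4]$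 there is $0<N=N(\varepsilon)\le\infty$ such that for all $x\in B_{\varepsilon_4}(R_0)$: $$\frac{|\det DT_1^{-n}(y)|}{|\det DT_1^{-n}(x)|}\le1+J\varepsilon^\alpha\quad\text{for all }y\in B_\varepsilon(x)\text{ and integers }n\in(0,N],\qquad \sum_{n=N}^\infty\ \sup_{y\in B_\varepsilon(x)}|\det DT_1^{-n}(y)|\le b\,\varepsilon^{m+\alpha},$$ the sum being empty if $N=\infty$. (c) There are $I>1$, $C_\xi>0$, $\varepsilon_5>0$ such that for all $0<\varepsilon_0\le\varepsilon_5$ and integers $n>0$ there is a finite or countable measurable partition $\xi$ of $B_{\varepsilon_0}(R_0)$ such that for every $A\in\xi$: $\operatorname{diam}(A\cap B_{\varepsilon_0}(\partial R_0))\le5m\varepsilon_0$; $\nu(B_\varepsilon(\partial R_0)\cap A)\le C_\xi(\varepsilon/\varepsilon_0)^\alpha\,\nu(B_{\varepsilon_0}(\partial R_0)\cap A)$ for all $0<\varepsilon\le\varepsilon_0$; and $|\det DT_1^{-n}(y)|\le I\,|\det DT_1^{-n}(x)|$ for all $x,y\in A$. **The induced operator.** Let $\hat M=M\setminus R$, let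 $\hat T$ be the first-return map of $T$ to $\hat M$, let $\hat g=|\det D\hat T|^{-1}$ (so $\hat g(y)=|\det DT^{n}(y)|^{-1}$ with $n$ the return time of $y$), and for $f:\mathbb R^m\to\mathbb R$ let $$\hat Pf(x)=\sum_{\hat Ty=x}f(y)\hat g(y)\quad(x\in\hat M),\qquad \hat Pf(x)=0\quad(x\notin\hat M),$$ the sum running over those $y\in\hat M\cap\bigcup_jU_j$ for which $\hat T$ is defined. **Function space.** For $f\in L^1(\mathbb R^m)$ and $\varepsilon_0>0$ let $$|f|_\alpha=\sup_{0<\varepsilon\le\varepsilon_0}\varepsilon^{-\alpha}\int_{\mathbb R^m}\operatorname{osc}(f,B_\varepsilon(x))\,dx,\qquad \operatorname{osc}(f,\Omega)=\operatorname*{ess\,sup}_\Omega f-\operatorname*{ess\,inf}_\Omega f,$$ and $V_\alpha(\varepsilon_0)=\{f\in L^1(\mathbb R^m):|f|_\alpha<\infty\}$. **Proposition (Lasota–Yorke type inequality).** There are $\eta<1$ and $\varepsilon_*>0$ such that for every $\varepsilon_0\in(0,\varepsilon_*]$ there is $D<\infty$ such that for all $f\in V_\alpha(\varepsilon_0)$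 one has $\hat Pf\in V_\alpha(\varepsilon_0)$ and $$|\hat Pf|_\alpha\le\eta\,|f|_\alpha+D\,\|f\|_1 .$$ -/

import Mathlib

open Set Filter Topology MeasureTheory
open scoped ENNReal NNReal

noncomputable section

/-- Euclidean space `ℝ^m`. -/
abbrev Eucl (m : ℕ) : Type := EuclideanSpace ℝ (Fin m)

/-- `γ_k`, the Lebesgue volume of the unit ball of `ℝ^k`. -/
def unitBallVol (k : ℕ) : ℝ := (volume (Metric.ball (0 : Eucl k) 1)).toReal

/-! ### Quasi-Hölder spaces -/

/-- Oscillation of `f` over `Ω`: essential supremum minus essential infimum of `f` over `Ω`.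
Both are taken in the extended reals, so that the oscillation of a function which is essentially
unbounded on `Ω` is `∞`. -/
def osc {m : ℕ} (f : Eucl m → ℝ) (Ω : Set (Eucl m)) : ℝ≥0∞ :=
  (essSup (fun y => (f y : EReal)) (volume.restrict Ω)
    - essInf (fun y => (f y : EReal)) (volume.restrict Ω)).toENNReal

/-- The seminorm `|f|_α = sup_{0 < ε ≤ ε₀} ε^{-α} ∫_{ℝ^m} osc(f, B_ε(x)) dx`. -/
def quasiSeminorm {m : ℕ} (α ε₀ : ℝ) (f : Eucl m → ℝ) : ℝ≥0∞ :=
  ⨆ ε ∈ Ioc (0 : ℝ) ε₀,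
    ENNReal.ofReal (ε ^ (-α)) * ∫⁻ x, osc f (Metric.closedBall x ε)

/-- Membership in `V_α(ε₀)`: `f ∈ L¹(ℝ^m)` and `|f|_α < ∞`. -/
def MemQuasiHolder {m : ℕ} (α ε₀ : ℝ) (f : Eucl m → ℝ) : Prop :=
  Integrable f ∧ quasiSeminorm α ε₀ f < ∞

/-! ### Regularity of maps and of surfaces -/

/-- `F` is `C^{1+α}` on the open set `Ω`: it is differentiable there and its derivative is locally
`α`-Hölder. -/
def IsC1Holder {m : ℕ} (α : ℝ) (F : Eucl m → Eucl m) (Ω : Set (Eucl m)) : Prop :=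
  DifferentiableOn ℝ F Ω ∧
    ∀ x ∈ Ω, ∃ V ∈ 𝓝 x, ∃ C : ℝ, ∀ y ∈ V ∩ Ω, ∀ z ∈ V ∩ Ω,
      ‖fderiv ℝ F y - fderiv ℝ F z‖ ≤ C * dist y z ^ α

/-- The open set `R` is bounded by a smooth surface: near every boundary point it is the sublevel
set of a function with non-vanishing derivative (`C¹` regularity is all that is asked for). -/
def HasSmoothBoundary {m : ℕ} (R : Set (Eucl m)) : Prop :=
  ∀ q ∈ frontier R, ∃ V : Set (Eucl m), IsOpen V ∧ q ∈ V ∧ ∃ φ : Eucl m → ℝ,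
    ContDiffOn ℝ 1 φ V ∧ (∀ x ∈ V, fderiv ℝ φ x ≠ 0) ∧ R ∩ V = {x ∈ V | φ x < 0}

/-! ### The system -/

/-- The data of a piecewise smooth map on a subset `M` of `ℝ^m`; all its properties are stated in
the assumptions below. -/
structure PiecewiseSystem (m : ℕ) where
  /-- the phase space -/
  M : Set (Eucl m)
  /-- the map (only its values on `M` matter) -/
  T : Eucl m → Eucl m
  /-- the number of pieces -/
  K : ℕ
  /-- the pieces `U_1, …, U_K` -/
  U : Fin K → Set (Eucl m)
  /-- the index of the piece `U_1` -/
  one : Fin K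
  /-- the neighbourhoods `Ũ_i` of the pieces -/
  Ut : Fin K → Set (Eucl m)
  /-- the extensions of `T_i = T|_{U_i}` to `Ũ_i` -/
  Tt : Fin K → Eucl m → Eucl m
  /-- the constant `ε₁` -/
  ε₁ : ℝ
  /-- the indifferent fixed point -/
  p : Eucl m
  /-- the region around `p` outside of which one induces -/
  R : Set (Eucl m)

namespace PiecewiseSystem

variable {m : ℕ} (S : PiecewiseSystem m)

/-- Standing assumptions: `M` is compact, it is the closure of its interior, it has Lebesgue
measure `1`, and `T` maps `M` to `M`. -/
structure Standing : Prop where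
  compact : IsCompact S.M
  regular : closure (interior S.M) = S.M
  volume_eq : volume S.M = 1
  mapsTo : MapsTo S.T S.M S.M

/-- Piecewise smoothness. Here `B_ε(A) = {x : d(x, A) ≤ ε}` is `Metric.cthickening ε A`. -/
structure Assumption1 (α : ℝ) : Prop where
  isOpen_U : ∀ i, IsOpen (S.U i)
  disjoint_U : Pairwise (fun i j => Disjoint (S.U i) (S.U j))
  cover : S.M = ⋃ i, closure (S.U i)
  injOn : ∀ i, InjOn S.T (S.U i)
  smooth : ∀ i, IsC1Holder α S.T (S.U i)
  ε₁_pos : 0 < S.ε₁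
  isOpen_Ut : ∀ i, IsOpen (S.Ut i)
  closure_subset : ∀ i, closure (S.U i) ⊆ S.Ut i
  extends_T : ∀ i, EqOn (S.Tt i) S.T (S.U i)
  smooth_ext : ∀ i, IsC1Holder α (S.Tt i) (S.Ut i)
  image_ext : ∀ i, Metric.cthickening S.ε₁ (S.T '' S.U i) ⊆ S.Tt i '' S.Ut i

/-- Fixed point. -/
structure Assumption2 : Prop where
  mem : S.p ∈ S.U S.one
  fixed : S.T S.p = S.p
  preimage : ∀ x ∈ S.M, S.T x = S.p → ∀ j, x ∉ frontier (S.U j)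

/-- The least `σ` with `d(x, y) ≤ σ d(F x, F y)` for all `y` in the domain `D` of `F` such that
`d(x, y) ≤ min {ε₁, 0.1 |x|}`, where `|x| = d(x, p)`; it is `∞` if there is no finite one. -/
def rate (F : Eucl m → Eucl m) (D : Set (Eucl m)) (x : Eucl m) : ℝ≥0∞ :=
  sInf {σ : ℝ≥0∞ | ∀ y ∈ D, dist x y ≤ min S.ε₁ (dist x S.p / 10) →
    edist x y ≤ σ * edist (F x) (F y)}

/-- `s`, the supremum of `s(x) = s(x, T)` over the points outside `R`. -/
def s : ℝ := (⨆ i, ⨆ x ∈ S.U i \ S.R, S.rate S.T (S.U i) x).toReal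

/-- `G_U(x, ε, ε₀)`; the preimage under `T_j` is taken for the extended map on `Ũ_j`. -/
def GUAt (x : Eucl m) (ε ε₀ : ℝ) : ℝ≥0∞ :=
  ∑ j, volume ((S.Ut j ∩ S.Tt j ⁻¹' Metric.cthickening ε (frontier (S.T '' S.U j)))
        ∩ Metric.closedBall x ((1 - S.s) * ε₀))
      / volume (Metric.closedBall x ((1 - S.s) * ε₀))

/-- `G_U(ε, ε₀)`. -/
def GU (ε ε₀ : ℝ) : ℝ≥0∞ := ⨆ x ∈ S.M, S.GUAt x ε ε₀

/-- The constant `λ`. -/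
def lam (α ε₂ : ℝ) : ℝ≥0∞ :=
  max (2 * ⨆ ε₀ ∈ Ioc (0 : ℝ) ε₂, ⨆ ε ∈ Ioc (0 : ℝ) ε₀,
        S.GU ε ε₀ / ENNReal.ofReal (ε ^ α) * ENNReal.ofReal (ε₀ ^ α))
    (ENNReal.ofReal (3 * S.s * unitBallVol (m - 1) / ((1 - S.s) * unitBallVol m)))

/-- `R₀ = TR \ R`. -/
def R₀ : Set (Eucl m) := S.T '' S.R \ S.R

/-- The inverse of `T_j`, defined on `T U_j`. -/
def branchInv (j : Fin S.K) : Eucl m → Eucl m := Function.invFunOn S.T (S.U j)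

/-- `|det D T_1^{-n}(y)|`. -/
def absDetInv (n : ℕ) (y : Eucl m) : ℝ :=
  |(fderiv ℝ ((S.branchInv S.one)^[n]) y).det|

/-- The domain of `T_1^n`. -/
def domIter (n : ℕ) : Set (Eucl m) := {z | ∀ k < n, S.T^[k] z ∈ S.U S.one}

/-- Expanding rates. -/
structure Assumption3 (α η₀ ε₂ I Cξ : ℝ) : Prop where
  isOpen_R : IsOpen S.R
  connected_R : IsConnected S.R
  boundary_R : HasSmoothBoundary S.R
  mem_R : S.p ∈ S.R
  closure_R : closure S.R ⊆ S.T '' S.R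
  closure_TR : closure (S.T '' S.R) ⊆ S.U S.one
  images : ∀ j, closure S.R ⊆ S.T '' S.U j ∨ closure S.R ∩ S.T '' S.U j = ∅
  rate_pos : ∀ i, ∀ x ∈ S.U i, x ≠ S.p → 0 < S.rate S.T (S.U i) x
  rate_le : ∀ i, ∀ x ∈ S.U i, x ≠ S.p → S.rate S.T (S.U i) x ≤ 1
  rate_eq_one : ∀ i, ∀ x ∈ S.U i, x ≠ S.p → S.rate S.T (S.U i) x = 1 →
    x ∈ S.R ∧ dist x S.p < dist (S.T x) S.p
  η₀_mem : η₀ ∈ Ioo (0 : ℝ) 1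
  ε₂_pos : 0 < ε₂
  rate_lam : ENNReal.ofReal (S.s ^ α) + S.lam α ε₂ ≤ ENNReal.ofReal η₀
  rate_iter : ∃ N : ℕ, 0 < N ∧ ∃ ε₃ : ℝ, 0 < ε₃ ∧ ∀ x ∈ Metric.cthickening ε₃ S.R₀,
    S.rate (S.T^[N]) (S.domIter N) ((S.branchInv S.one)^[N] x) ≤
      ENNReal.ofReal (S.s / (5 * m) *
        ((S.lam α ε₂).toReal * (1 - S.s) ^ m / (2 * Cξ * I ^ 2)) ^ (1 / α))

/-- Distortions. -/
structure Assumption4 (α I Cξ : ℝ) : Prop where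
  det_inv : ∃ c : ℝ, 0 < c ∧ ∀ j, ∀ x ∈ S.T '' S.U j, ∀ y ∈ S.T '' S.U j, dist x y ≤ S.ε₁ →
    |(fderiv ℝ (S.branchInv j) x).det - (fderiv ℝ (S.branchInv j) y).det| ≤
      c * |(fderiv ℝ (S.branchInv j) x).det| * dist x y ^ α
  det_iter : ∀ b : ℝ, 0 < b → ∃ J : ℝ, 0 < J ∧ ∃ ε₄ : ℝ, 0 < ε₄ ∧ ∀ ε ∈ Ioc (0 : ℝ) ε₄,
    ∃ N : ℕ∞, 0 < N ∧
      (∀ x ∈ Metric.cthickening ε₄ S.R₀, ∀ y ∈ Metric.closedBall x ε,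
        ∀ n : ℕ, 0 < n → (n : ℕ∞) ≤ N →
          S.absDetInv n y ≤ (1 + J * ε ^ α) * S.absDetInv n x) ∧
      (∀ x ∈ Metric.cthickening ε₄ S.R₀,
        ∑' n : {n : ℕ // N ≤ (n : ℕ∞)},
          (⨆ y ∈ Metric.closedBall x ε, ENNReal.ofReal (S.absDetInv n y)) ≤
            ENNReal.ofReal (b * ε ^ ((m : ℝ) + α)))
  one_lt_I : 1 < I
  Cξ_pos : 0 < Cξ
  partitions : ∃ ε₅ : ℝ, 0 < ε₅ ∧ ∀ ε₀ ∈ Ioc (0 : ℝ) ε₅, ∀ n : ℕ, 0 < n →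
    ∃ ξ : Set (Set (Eucl m)), ξ.Countable ∧ (∀ A ∈ ξ, MeasurableSet A) ∧
      ξ.PairwiseDisjoint id ∧ ⋃₀ ξ = Metric.cthickening ε₀ S.R₀ ∧
      ∀ A ∈ ξ,
        Metric.diam (A ∩ Metric.cthickening ε₀ (frontier S.R₀)) ≤ 5 * m * ε₀ ∧
        (∀ ε ∈ Ioc (0 : ℝ) ε₀,
          volume (Metric.cthickening ε (frontier S.R₀) ∩ A) ≤
            ENNReal.ofReal (Cξ * (ε / ε₀) ^ α) *
              volume (Metric.cthickening ε₀ (frontier S.R₀) ∩ A)) ∧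
        (∀ x ∈ A, ∀ y ∈ A, S.absDetInv n y ≤ I * S.absDetInv n x)

/-! ### The induced system -/

/-- The first return time of `y` to the complement of `R`. -/
def returnTime (y : Eucl m) : ℕ := sInf {n : ℕ | 0 < n ∧ S.T^[n] y ∉ S.R}

/-- The first return map. -/
def inducedMap (y : Eucl m) : Eucl m := S.T^[S.returnTime y] y

/-- The weight `ĝ(y) = |det D T̂(y)|⁻¹`, the derivative being that of the iterate of `T` which
the return time prescribes at `y`. -/
def inducedWeight (y : Eucl m) : ℝ := |(fderiv ℝ (S.T^[S.returnTime y]) y).det|⁻¹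

/-- The points of `M \ R` lying in a piece `U_j` and returning to `M \ R`. Up to a null set these
are all the points of `M \ R`. -/
def inducedDomain : Set (Eucl m) :=
  {y | (∃ j, y ∈ S.U j) ∧ y ∉ S.R ∧ ∃ n : ℕ, 0 < n ∧ S.T^[n] y ∉ S.R}

/-- The Perron-Frobenius operator of the first return map, `P̂ f(x) = ∑_{T̂ y = x} f(y) ĝ(y)`.
It vanishes off `M \ R`, since there the sum is empty. -/
def inducedPF (f : Eucl m → ℝ) (x : Eucl m) : ℝ :=
  ∑' y : {y : Eucl m // y ∈ S.inducedDomain ∧ S.inducedMap y = x},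
    f y * S.inducedWeight y

end PiecewiseSystem

end

noncomputable section

set_option linter.unusedSectionVars false

/-! ### Slicing Euclidean space: thin sets and the overlap of two balls. -/

section

/-! The inverse branches of the first return map are iterates `T_1^{-n}` followed by some
`T_j^{-1}`. The iterates do not expand, and the last factor contracts by `s` because it ends outside
`R`. Thus the induced operator is a sum over pairs `(j, n)`, and its oscillation over a ball of
radius `ε` about `x` can be estimated branch by branch. A branch present on the whole ball
contributes the oscillation of `f` over a ball of radius `s₁ ε`, with `s₁` slightly above `s`, plus
a small distortion multiple of `f`. By change of variables these contributions add up to about `s₁^α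
ε^α |f|_α` plus a weak term. The task is to show that the branches which begin or end inside the
ball cost only about `λ`, since `s^α + λ < 1`.

There are three such losses. If the ball meets the boundary of `TU_j`, the lost value is carried by
the extended map to a layer along the boundary of `U_j`, whose density in balls is measured by
`G_U`; this costs `λ (ε/ε₀)^α` times an integral of local suprema of `f`
(`eventually_lintegral_layer_le`). If the ball meets `∂R` or `∂TR`, the loss lives on one-sided
collars of a smooth surface, whose density in suitable balls is about a third of the volume ratio in
`λ`, times `ε/ε₀` (`exists_lintegral_collar_le`). There are four such terms; the exponent one beats
`α` for small `ε/ε₀`, and otherwise two of them are weak terms (`collar_sum_le`). Finally, branches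
with `n ≥ N` have no distortion control, but their total weight is at most `b ε^(m+α)`, which
suffices against a supremum bound for `f` (`tail_mul_essSup_le`).

Layers and collars could each cost the full `λ`. They do not add up, because the collars are mapped
by the branches into a compact set, the `trap`, inside the open pieces, while neighbourhoods of thin
layers avoid the trap. The two integrals of local suprema are therefore over complementary regions,
and `λ` is paid once (`exists_layer_separation`, `accumulate_le`).

The layer estimate rests on a packing inequality (`eventually_packing`): a measure of density at
most `θ` in moderately large balls about points of `M` has density at most `2θ` in a neighbourhood
of the set considered. It is proved by a second-moment argument with balls about midpoints. The
constant 2, which matches the factor 2 in `λ`, is available because the volume ratio in `λ` is below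
`1 - s`, which makes `s` small relative to the dimension.

All this is done for nonnegative functions; the oscillations of the positive and negative parts of
`f` sum to at most the oscillation of `f`. -/

theorem exists_slicing {k : ℕ} (e : Eucl (k + 1)) (he : ‖e‖ = 1) :
    ∃ Θ : ℝ × Eucl k → Eucl (k + 1), MeasurePreserving Θ volume volume ∧
      Function.Surjective Θ ∧
      (∀ t s x, Θ (t + s, x) = Θ (t, x) + s • e) ∧
      ∀ t x t' x', dist (Θ (t, x)) (Θ (t', x')) ^ 2 = (t - t') ^ 2 + dist x x' ^ 2 := by
  have he0 : e ≠ 0 := by rintro rfl; simp at he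
  have hfin : Module.finrank ℝ (ℝ ∙ e)ᗮ = k := by
    have : Fact (Module.finrank ℝ (Eucl (k + 1)) = k + 1) := ⟨by simp⟩
    exact Submodule.finrank_orthogonal_span_singleton he0
  let b := (stdOrthonormalBasis ℝ (ℝ ∙ e)ᗮ).reindex (finCongr hfin)
  let ι : Eucl k ≃ₗᵢ[ℝ] (ℝ ∙ e)ᗮ := b.repr.symm
  have horth : ∀ x, inner ℝ e ((ι x : (ℝ ∙ e)ᗮ) : Eucl (k + 1)) = 0 := fun x =>
    Submodule.mem_orthogonal_singleton_iff_inner_right.1 (ι x).2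
  let L0 : WithLp 2 (ℝ × Eucl k) →ₗ[ℝ] Eucl (k + 1) :=
    { toFun := fun z => z.fst • e + ((ι z.snd : (ℝ ∙ e)ᗮ) : Eucl (k + 1))
      map_add' := by intro x y; simp [add_smul]; abel
      map_smul' := by intro c x; simp [smul_smul] }
  have hL0 : ∀ z, ‖L0 z‖ = ‖z‖ := by
    intro z
    have h1 : ‖L0 z‖ ^ 2 = ‖z‖ ^ 2 := by
      have := norm_add_sq_real (z.fst • e) ((ι z.snd : (ℝ ∙ e)ᗮ) : Eucl (k + 1))
      rw [inner_smul_left, horth] at this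
      change ‖z.fst • e + ((ι z.snd : (ℝ ∙ e)ᗮ) : Eucl (k + 1))‖ ^ 2 = _
      rw [this, WithLp.prod_norm_sq_eq_of_L2, norm_smul, he]
      simpa using (Submodule.coe_norm (ι z.snd)).symm.trans (ι.norm_map z.snd)
    exact (sq_eq_sq₀ (norm_nonneg _) (norm_nonneg _)).1 h1
  let L1 : WithLp 2 (ℝ × Eucl k) →ₗᵢ[ℝ] Eucl (k + 1) := ⟨L0, hL0⟩
  have hdim : Module.finrank ℝ (WithLp 2 (ℝ × Eucl k)) = Module.finrank ℝ (Eucl (k + 1)) := by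
    rw [LinearEquiv.finrank_eq (WithLp.linearEquiv 2 ℝ (ℝ × Eucl k))]
    simp [add_comm]
  let L := L1.toLinearIsometryEquiv hdim
  refine ⟨fun z => L (WithLp.toLp 2 z), ?_, ?_, ?_, ?_⟩
  · exact (LinearIsometryEquiv.measurePreserving L).comp (WithLp.volume_preserving_toLp ℝ (Eucl k))
  · exact L.surjective.comp (WithLp.toLp_surjective 2)
  · intro t s x
    change (t + s) • e + ((ι x : (ℝ ∙ e)ᗮ) : Eucl (k + 1)) =
      (t • e + ((ι x : (ℝ ∙ e)ᗮ) : Eucl (k + 1))) + s • e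
    rw [add_smul]
    abel
  · intro t x t' x'
    rw [LinearIsometryEquiv.dist_map, WithLp.prod_dist_eq_of_L2, Real.sq_sqrt (by positivity)]
    simp [Real.dist_eq]

theorem exists_unit_direction {k : ℕ} (c c' : Eucl (k + 1)) :
    ∃ e : Eucl (k + 1), ‖e‖ = 1 ∧ c' = c + dist c c' • e := by
  rcases eq_or_ne c c' with rfl | h
  · exact ⟨EuclideanSpace.single 0 1, by simp, by simp⟩
  · have h1 : ‖c' - c‖ ≠ 0 := by simpa [sub_eq_zero] using h.symm
    refine ⟨‖c' - c‖⁻¹ • (c' - c), by rw [norm_smul]; simp [h1], ?_⟩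
    rw [dist_comm, dist_eq_norm, smul_smul, mul_inv_cancel₀ h1]
    simp

theorem volume_eq_lintegral_slice {k : ℕ} {Θ : ℝ × Eucl k → Eucl (k + 1)}
    (hΘ : MeasurePreserving Θ volume volume) {B : Set (Eucl (k + 1))} (hB : MeasurableSet B) :
    volume B = ∫⁻ x, volume {t | Θ (t, x) ∈ B} := by
  rw [← hΘ.measure_preimage hB.nullMeasurableSet, Measure.volume_eq_prod,
    Measure.prod_apply_symm (hΘ.measurable hB)]
  rfl

/-- A measurable subset of a ball which is thin in one direction has small volume. -/
theorem volume_thin_le {k : ℕ} {e : Eucl (k + 1)} (he : ‖e‖ = 1) {B : Set (Eucl (k + 1))}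
    (hB : MeasurableSet B) {w : Eucl (k + 1)} {r ℓ : ℝ} (hr : 0 ≤ r)
    (hBw : B ⊆ Metric.closedBall w r) (hthin : ∀ u ∈ B, ∀ h : ℝ, u + h • e ∈ B → |h| ≤ ℓ) :
    volume B ≤ ENNReal.ofReal ℓ * volume (Metric.closedBall (0 : Eucl k) r) := by
  obtain ⟨Θ, hmp, hsurj, hadd, hdist⟩ := exists_slicing e he
  obtain ⟨⟨t0, x0⟩, rfl⟩ := hsurj w
  rw [volume_eq_lintegral_slice hmp hB]
  calc ∫⁻ x, volume {t | Θ (t, x) ∈ B}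
      ≤ ∫⁻ x, (Metric.closedBall x0 r).indicator (fun _ => ENNReal.ofReal ℓ) x := by
        refine lintegral_mono fun x => ?_
        by_cases hx : x ∈ Metric.closedBall x0 r
        · rw [indicator_of_mem hx]
          refine (Real.volume_le_diam _).trans (Metric.ediam_le_of_forall_dist_le ?_)
          intro t ht t' ht'
          have h1 := hthin _ ht (t' - t) (by
            rw [← hadd]; simpa using ht')
          rw [dist_comm]
          exact h1
        · rw [indicator_of_notMem hx, nonpos_iff_eq_zero]
          convert measure_empty (μ := (volume : Measure ℝ))
          ext t
          simp only [mem_ofPred_eq, mem_empty_iff_false, iff_false]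
          intro ht
          have h1 := hBw ht
          rw [Metric.mem_closedBall] at h1 hx
          have h2 := hdist t x t0 x0
          have h3 : dist (Θ (t, x)) (Θ (t0, x0)) ^ 2 ≤ r ^ 2 :=
            pow_le_pow_left₀ dist_nonneg h1 2
          exact hx (abs_le_of_sq_le_sq' (by nlinarith [sq_nonneg (t - t0)]) hr).2
    _ = ENNReal.ofReal ℓ * volume (Metric.closedBall (0 : Eucl k) r) := by
        rw [lintegral_indicator Metric.isClosed_closedBall.measurableSet, setLIntegral_const,
          Measure.addHaar_closedBall_center]

/-- The volume of the intersection of two balls of radius `a` in `ℝ^(k+1)` whose centres are at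
distance `t`. -/
def ballOverlap (k : ℕ) (a t : ℝ) : ℝ≥0∞ :=
  ∫⁻ x : Eucl k, ENNReal.ofReal (2 * √(a ^ 2 - ‖x‖ ^ 2) - t)

/-- Every line parallel to the segment of centres cuts the two balls in intervals of equal length,
shifted by the distance of the centres. Integrating the length of the common part over all such
lines gives the overlap, which depends on that distance only. -/
theorem volume_inter_closedBall {k : ℕ} {a : ℝ} (ha : 0 ≤ a) (c c' : Eucl (k + 1)) :
    volume (Metric.closedBall c a ∩ Metric.closedBall c' a) = ballOverlap k a (dist c c') := by
  obtain ⟨e, he, hc'⟩ := exists_unit_direction c c'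
  set t := dist c c' with ht
  have ht0 : 0 ≤ t := dist_nonneg
  obtain ⟨Θ, hmp, hsurj, hadd, hdist⟩ := exists_slicing e he
  obtain ⟨⟨t0, x0⟩, rfl⟩ := hsurj c
  rw [volume_eq_lintegral_slice hmp
    (Metric.isClosed_closedBall.measurableSet.inter Metric.isClosed_closedBall.measurableSet),
    ballOverlap, ← lintegral_sub_right_eq_self
      (fun x : Eucl k => ENNReal.ofReal (2 * √(a ^ 2 - ‖x‖ ^ 2) - t)) x0]
  refine lintegral_congr fun x => ?_
  have hmem : ∀ h b, Θ (h, x) ∈ Metric.closedBall (Θ (b, x0)) a ↔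
      (h - b) ^ 2 ≤ a ^ 2 - ‖x - x0‖ ^ 2 := by
    intro h b
    rw [Metric.mem_closedBall, ← dist_eq_norm, ← sq_le_sq₀ dist_nonneg ha, hdist]
    constructor <;> intro h <;> linarith
  rw [hc', ← hadd]
  simp only [mem_inter_iff, hmem]
  set q := a ^ 2 - ‖x - x0‖ ^ 2
  rcases lt_or_ge q 0 with hq | hq
  -- The line misses both balls; the square root of a negative number is zero by convention and the
  -- distance is nonnegative, so the integrand vanishes too.
  · rw [Real.sqrt_eq_zero_of_nonpos hq.le, ENNReal.ofReal_of_nonpos (by linarith)]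
    convert measure_empty (μ := (volume : Measure ℝ))
    ext h
    simp only [mem_ofPred_eq, mem_empty_iff_false, iff_false, not_and]
    intro h1
    nlinarith [sq_nonneg (h - t0)]
  · have : {h | (h - t0) ^ 2 ≤ q ∧ (h - (t0 + t)) ^ 2 ≤ q} = Icc (t0 + t - √q) (t0 + √q) := by
      ext h
      simp only [mem_ofPred_eq, mem_Icc, Real.sq_le hq]
      constructor
      · rintro ⟨⟨_, h2⟩, h3, _⟩; constructor <;> linarith
      · rintro ⟨h1, h2⟩
        exact ⟨⟨by linarith, by linarith⟩, by linarith, by linarith⟩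
    rw [this, Real.volume_Icc]
    congr 1
    ring

theorem ballOverlap_antitone (k : ℕ) (a : ℝ) : Antitone (ballOverlap k a) := fun _ _ h =>
  lintegral_mono fun _ => ENNReal.ofReal_le_ofReal (by linarith)

/-- The integrand is a positive part of a decreasing affine function of the distance, so the overlap
is convex and decreasing. -/
theorem two_mul_ballOverlap_le (k : ℕ) {a t t₁ t₂ : ℝ} (h : t₁ + t₂ ≤ 2 * t) :
    2 * ballOverlap k a t ≤ ballOverlap k a t₁ + ballOverlap k a t₂ := by
  have hm : ∀ t, Measurable fun x : Eucl k => ENNReal.ofReal (2 * √(a ^ 2 - ‖x‖ ^ 2) - t) :=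
    fun t => by fun_prop
  rw [ballOverlap, ballOverlap, ballOverlap, ← lintegral_add_left (hm _),
    ← lintegral_const_mul _ (hm _)]
  refine lintegral_mono fun x => ?_
  simp only
  rw [two_mul]
  set q := 2 * √(a ^ 2 - ‖x‖ ^ 2)
  rcases le_total (q - t) 0 with h0 | h0
  · simp [ENNReal.ofReal_of_nonpos h0]
  · rw [← ENNReal.ofReal_add h0 h0]
    refine (ENNReal.ofReal_le_ofReal ?_).trans ENNReal.ofReal_add_le
    linarith

/-- The density of the overlap function. -/
def overlapDensity (k : ℕ) (a h : ℝ) : ℝ≥0∞ :=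
  volume {x : Eucl k | h < 2 * √(a ^ 2 - ‖x‖ ^ 2)}

theorem overlapDensity_eq_zero {k : ℕ} {a h : ℝ} (ha : 0 ≤ a) (h2 : 2 * a ≤ h) :
    overlapDensity k a h = 0 := by
  rw [overlapDensity]
  convert measure_empty (μ := (volume : Measure (Eucl k)))
  ext x
  simp only [mem_ofPred_eq, mem_empty_iff_false, iff_false, not_lt]
  have : √(a ^ 2 - ‖x‖ ^ 2) ≤ √(a ^ 2) := Real.sqrt_le_sqrt (by nlinarith [sq_nonneg ‖x‖])
  rw [Real.sqrt_sq ha] at this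
  linarith

theorem measurableSet_overlap (k : ℕ) (a : ℝ) :
    MeasurableSet {z : ℝ × Eucl k | z.1 < 2 * √(a ^ 2 - ‖z.2‖ ^ 2)} :=
  measurableSet_lt measurable_fst (by fun_prop)

theorem measurable_overlapDensity (k : ℕ) (a : ℝ) : Measurable (overlapDensity k a) :=
  measurable_measure_prodMk_left (measurableSet_overlap k a)

/-- The positive part in the integrand is the length of an interval of values `h > t`; Tonelli then
exchanges `h` and `x`. -/
theorem ballOverlap_eq_lintegral_density (k : ℕ) (a t : ℝ) :
    ballOverlap k a t = ∫⁻ h in Ioi t, overlapDensity k a h := by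
  have h1 : ∀ x : Eucl k, ENNReal.ofReal (2 * √(a ^ 2 - ‖x‖ ^ 2) - t) =
      ∫⁻ h in Ioi t, {z : ℝ × Eucl k | z.1 < 2 * √(a ^ 2 - ‖z.2‖ ^ 2)}.indicator
        (fun _ => (1 : ℝ≥0∞)) (h, x) := by
    intro x
    have : ∀ h : ℝ, {z : ℝ × Eucl k | z.1 < 2 * √(a ^ 2 - ‖z.2‖ ^ 2)}.indicator
        (fun _ => (1 : ℝ≥0∞)) (h, x) =
        (Iio (2 * √(a ^ 2 - ‖x‖ ^ 2))).indicator (fun _ => (1 : ℝ≥0∞)) h := fun h => rfl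
    simp_rw [this]
    rw [lintegral_indicator measurableSet_Iio, setLIntegral_one,
      Measure.restrict_apply measurableSet_Iio, Iio_inter_Ioi, Real.volume_Ioo]
  have hm : Measurable ({z : ℝ × Eucl k | z.1 < 2 * √(a ^ 2 - ‖z.2‖ ^ 2)}.indicator
      (fun _ => (1 : ℝ≥0∞))) := measurable_const.indicator (measurableSet_overlap k a)
  rw [ballOverlap]
  simp_rw [h1]
  rw [lintegral_lintegral_swap (f := fun (x : Eucl k) (h : ℝ) =>
    {z : ℝ × Eucl k | z.1 < 2 * √(a ^ 2 - ‖z.2‖ ^ 2)}.indicator (fun _ => (1 : ℝ≥0∞)) (h, x))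
    (hm.comp measurable_swap).aemeasurable]
  refine lintegral_congr fun h => ?_
  have : ∀ x : Eucl k, {z : ℝ × Eucl k | z.1 < 2 * √(a ^ 2 - ‖z.2‖ ^ 2)}.indicator
        (fun _ => (1 : ℝ≥0∞)) (h, x) =
        {x : Eucl k | h < 2 * √(a ^ 2 - ‖x‖ ^ 2)}.indicator (fun _ => (1 : ℝ≥0∞)) x := fun h => rfl
  simp_rw [this]
  rw [lintegral_indicator (measurableSet_lt measurable_const (by fun_prop)), setLIntegral_one]
  rfl

end

/-! ### A second-moment packing inequality for measures with controlled ball growth. -/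

section

/-- The lower bound for the distance of two midpoints in terms of a cross distance `D`. -/
def packDist (σ D : ℝ) : ℝ := if D ^ 2 < 3 * σ ^ 2 then 0 else √(D ^ 2 - σ ^ 2)

theorem packDist_nonneg (σ D : ℝ) : 0 ≤ packDist σ D := by
  rw [packDist]; split_ifs <;> positivity

theorem measurable_packDist (σ : ℝ) : Measurable (packDist σ) :=
  Measurable.ite (measurableSet_lt (by fun_prop) measurable_const) measurable_const (by fun_prop)

/-- Parallelogram law for the cross vectors `v - y'` and `v' - y`. Their difference is twice the
difference of the midpoints, and their sum is `(v - y) + (v' - y')`, of norm at most `2σ`. The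
cutoff `3σ²` in `packDist` is what the mixed case needs, where one of the two cross distances is
discarded. -/
theorem packDist_add_le {m : ℕ} {σ : ℝ} {y v y' v' : Eucl m} (h : dist y v ≤ σ)
    (h' : dist y' v' ≤ σ) :
    packDist σ (dist v y') + packDist σ (dist v' y) ≤
      2 * dist ((1 / 2 : ℝ) • (y + v)) ((1 / 2 : ℝ) • (y' + v')) := by
  have e1 : 2 * dist ((1 / 2 : ℝ) • (y + v)) ((1 / 2 : ℝ) • (y' + v')) =
      ‖(v - y') - (v' - y)‖ := by
    rw [dist_eq_norm, ← smul_sub, norm_smul]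
    simp only [Real.norm_eq_abs]
    rw [abs_of_pos (by norm_num : (0 : ℝ) < 1 / 2), ← mul_assoc]
    norm_num
    congr 1
    abel
  have e2 : ‖(v - y') + (v' - y)‖ ≤ 2 * σ := by
    have : (v - y') + (v' - y) = (v - y) + (v' - y') := by abel
    rw [this]
    refine (norm_add_le _ _).trans ?_
    rw [← dist_eq_norm, ← dist_eq_norm, dist_comm v, dist_comm v']
    linarith
  have e3 := parallelogram_law_with_norm ℝ (v - y') (v' - y)
  rw [e1, dist_eq_norm, dist_eq_norm]
  set X := ‖v - y'‖
  set Z := ‖v' - y‖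
  set P := ‖(v - y') + (v' - y)‖
  set Q := ‖(v - y') - (v' - y)‖
  have hP : P * P ≤ 4 * σ ^ 2 := by nlinarith [norm_nonneg ((v - y') + (v' - y))]
  have hQ : 0 ≤ Q := norm_nonneg _
  refine abs_le_of_sq_le_sq' (a := packDist σ X + packDist σ Z) ?_ hQ |>.2
  rw [packDist, packDist]
  split_ifs with h1 h2 h2
  · simpa using sq_nonneg Q
  · rw [zero_add, Real.sq_sqrt (by nlinarith [sq_nonneg σ])]
    nlinarith [sq_nonneg X]
  · rw [add_zero, Real.sq_sqrt (by nlinarith [sq_nonneg σ])]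
    nlinarith [sq_nonneg Z]
  · have a1 := Real.sq_sqrt (show 0 ≤ X ^ 2 - σ ^ 2 by nlinarith [sq_nonneg σ])
    have a2 := Real.sq_sqrt (show 0 ≤ Z ^ 2 - σ ^ 2 by nlinarith [sq_nonneg σ])
    nlinarith [sq_nonneg (√(X ^ 2 - σ ^ 2) - √(Z ^ 2 - σ ^ 2))]

theorem packDist_lt_subset {m : ℕ} {σ h : ℝ} (hσ : 0 ≤ σ) (hh : 0 < h) (v : Eucl m) :
    {y | packDist σ (dist v y) < h} ⊆
      Metric.closedBall v (max (√3 * σ) (√(h ^ 2 + σ ^ 2))) := by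
  intro y hy
  rw [mem_ofPred_eq, packDist] at hy
  rw [Metric.mem_closedBall, dist_comm]
  split_ifs at hy with h1
  · refine le_max_of_le_left ?_
    refine abs_le_of_sq_le_sq' ?_ (by positivity) |>.2
    rw [mul_pow, Real.sq_sqrt (by norm_num)]
    exact h1.le
  · refine le_max_of_le_right (Real.le_sqrt_of_sq_le ?_)
    have := (Real.sqrt_lt' hh).1 hy
    linarith

/-- A layer-cake formula: averages of overlaps are controlled by the measures of the sets where the
distance is small. -/
theorem lintegral_ballOverlap {k : ℕ} (ν : Measure (Eucl (k + 1))) [SFinite ν] {a : ℝ}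
    {t : Eucl (k + 1) → ℝ} (ht : Measurable t) (ht0 : ∀ y, 0 ≤ t y) :
    ∫⁻ y, ballOverlap k a (t y) ∂ν =
      ∫⁻ h in Ioi (0 : ℝ), overlapDensity k a h * ν {y | t y < h} := by
  have hm : Measurable fun z : Eucl (k + 1) × ℝ =>
      overlapDensity k a z.2 * {z : Eucl (k + 1) × ℝ | t z.1 < z.2}.indicator (fun _ => 1) z :=
    ((measurable_overlapDensity k a).comp measurable_snd).mul
      (measurable_const.indicator (measurableSet_lt (ht.comp measurable_fst) measurable_snd))
  have h1 : ∀ y, ballOverlap k a (t y) = ∫⁻ h in Ioi (0 : ℝ), overlapDensity k a h *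
      {z : Eucl (k + 1) × ℝ | t z.1 < z.2}.indicator (fun _ => 1) (y, h) := by
    intro y
    rw [ballOverlap_eq_lintegral_density]
    have : ∀ h, overlapDensity k a h *
        {z : Eucl (k + 1) × ℝ | t z.1 < z.2}.indicator (fun _ => 1) (y, h) =
        (Ioi (t y)).indicator (overlapDensity k a) h := by
      intro h
      by_cases hh : t y < h <;> simp [indicator, hh]
    simp_rw [this]
    rw [lintegral_indicator measurableSet_Ioi, Measure.restrict_restrict measurableSet_Ioi,
      inter_eq_left.2 (Ioi_subset_Ioi (ht0 y))]
  simp_rw [h1]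
  rw [lintegral_lintegral_swap (f := fun (y : Eucl (k + 1)) (h : ℝ) => overlapDensity k a h *
      {z : Eucl (k + 1) × ℝ | t z.1 < z.2}.indicator (fun _ => 1) (y, h)) hm.aemeasurable]
  refine lintegral_congr fun h => ?_
  have h2 : ∀ y, {z : Eucl (k + 1) × ℝ | t z.1 < z.2}.indicator (fun _ => (1 : ℝ≥0∞)) (y, h) =
      {y | t y < h}.indicator (fun _ => 1) y := fun y => rfl
  simp_rw [h2]
  have hs : MeasurableSet {y | t y < h} := measurableSet_lt ht measurable_const
  rw [lintegral_const_mul _ (measurable_const.indicator hs), lintegral_indicator hs,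
    setLIntegral_one]

/-- Both sides are the integral over `y` of the volume of the intersection of the balls of radius
`a` about `y` and about `0`; integrating first over `y` gives the square. This is the Lebesgue model
with which a growth bound is compared. -/
theorem lintegral_density_mul_volume_ball (k : ℕ) {a : ℝ} (ha : 0 ≤ a) :
    ∫⁻ h in Ioi (0 : ℝ), overlapDensity k a h * volume (Metric.ball (0 : Eucl (k + 1)) h) =
      volume (Metric.closedBall (0 : Eucl (k + 1)) a) ^ 2 := by
  have h1 := lintegral_ballOverlap (volume : Measure (Eucl (k + 1))) (a := a)
    (t := fun y => dist y 0) (by fun_prop) (fun _ => dist_nonneg)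
  change _ = ∫⁻ h in Ioi (0 : ℝ), overlapDensity k a h * volume (Metric.ball (0 : Eucl (k + 1)) h)
    at h1
  rw [← h1]
  have hm : MeasurableSet {z : Eucl (k + 1) × Eucl (k + 1) |
      dist z.2 z.1 ≤ a ∧ dist z.2 0 ≤ a} := by
    measurability
  have h2 : ∀ y : Eucl (k + 1), ballOverlap k a (dist y 0) =
      volume (Prod.mk y ⁻¹' {z : Eucl (k + 1) × Eucl (k + 1) |
        dist z.2 z.1 ≤ a ∧ dist z.2 0 ≤ a}) := fun y => by
    rw [← volume_inter_closedBall ha]; rfl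
  simp_rw [h2]
  rw [← Measure.prod_apply hm, Measure.prod_apply_symm hm]
  have h3 : ∀ z : Eucl (k + 1), volume ((fun x => (x, z)) ⁻¹'
      {z : Eucl (k + 1) × Eucl (k + 1) | dist z.2 z.1 ≤ a ∧ dist z.2 0 ≤ a}) =
      (Metric.closedBall (0 : Eucl (k + 1)) a).indicator
        (fun _ => volume (Metric.closedBall (0 : Eucl (k + 1)) a)) z := by
    intro z
    by_cases hz : z ∈ Metric.closedBall (0 : Eucl (k + 1)) a
    · rw [indicator_of_mem hz, ← Measure.addHaar_closedBall_center volume z]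
      congr 1
      ext x
      simp only [mem_preimage, mem_ofPred_eq, Metric.mem_closedBall, dist_comm x z]
      exact and_iff_left hz
    · rw [indicator_of_notMem hz]
      convert measure_empty (μ := (volume : Measure (Eucl (k + 1))))
      ext x
      simp only [mem_preimage, mem_ofPred_eq, mem_empty_iff_false, iff_false, not_and]
      exact fun _ => hz
  simp_rw [h3]
  rw [lintegral_indicator Metric.isClosed_closedBall.measurableSet, setLIntegral_const, sq]

theorem lintegral_measure_closedBall {X Y : Type*} [MeasurableSpace X] [PseudoMetricSpace X]
    [OpensMeasurableSpace X] [SecondCountableTopology X] [MeasurableSpace Y]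
    (ρ : Measure X) [SFinite ρ] (ν : Measure Y) [SFinite ν]
    {c : Y → X} (hc : Measurable c) (a : ℝ) :
    ∫⁻ z, ν {y | z ∈ Metric.closedBall (c y) a} ∂ρ = ∫⁻ y, ρ (Metric.closedBall (c y) a) ∂ν := by
  have hm : MeasurableSet {q : X × Y | dist q.1 (c q.2) ≤ a} :=
    measurableSet_le (measurable_fst.dist (hc.comp measurable_snd)) measurable_const
  exact (Measure.prod_apply (μ := ρ) (ν := ν) hm).symm.trans (Measure.prod_apply_symm hm)

theorem measurable_measure_closedBall {X Y : Type*} [MeasurableSpace X] [PseudoMetricSpace X]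
    [OpensMeasurableSpace X] [SecondCountableTopology X] [MeasurableSpace Y]
    (ν : Measure Y) [SFinite ν] {c : Y → X} (hc : Measurable c) (a : ℝ) :
    Measurable fun z => ν {y | z ∈ Metric.closedBall (c y) a} := by
  have hm : MeasurableSet {q : X × Y | dist q.1 (c q.2) ≤ a} :=
    measurableSet_le (measurable_fst.dist (hc.comp measurable_snd)) measurable_const
  exact measurable_measure_prodMk_left hm

/-- Cauchy–Schwarz against the indicator of `Z`, replaced by a measurable hull of the same measure
since `Z` need not be measurable. -/
theorem sq_lintegral_le {X : Type*} [MeasurableSpace X] (μ : Measure X) {W : X → ℝ≥0∞}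
    (hW : Measurable W) {Z : Set X} (hZ : ∀ z ∉ Z, W z = 0) :
    (∫⁻ z, W z ∂μ) ^ 2 ≤ (∫⁻ z, W z * W z ∂μ) * μ Z := by
  set Z' := toMeasurable μ Z
  have hZ' : MeasurableSet Z' := measurableSet_toMeasurable _ _
  have h1 : ∫⁻ z, W z ∂μ = ∫⁻ z, W z * Z'.indicator (fun _ => 1) z ∂μ := by
    refine lintegral_congr fun z => ?_
    by_cases hz : z ∈ Z'
    · simp [hz]
    · rw [hZ z fun h => hz (subset_toMeasurable _ _ h), zero_mul]
  have h2 := ENNReal.lintegral_mul_le_Lp_mul_Lq μ Real.HolderConjugate.two_two hW.aemeasurable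
    (measurable_const.indicator hZ').aemeasurable (g := Z'.indicator (fun _ => 1))
  have h3 : ∫⁻ z, Z'.indicator (fun _ => (1 : ℝ≥0∞)) z ^ (2 : ℝ) ∂μ = μ Z := by
    rw [← measure_toMeasurable, ← lintegral_indicator_one hZ']
    refine lintegral_congr fun z => ?_
    by_cases hz : z ∈ Z' <;> simp [hz]
  rw [h3] at h2
  have h4 : ∀ z, W z ^ (2 : ℝ) = W z * W z := fun z => by
    rw [ENNReal.rpow_two, sq]
  simp_rw [h4] at h2
  rw [h1]
  refine (pow_le_pow_left₀ zero_le h2 2).trans_eq ?_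
  rw [mul_pow, ← ENNReal.rpow_two, ← ENNReal.rpow_two, ← ENNReal.rpow_mul, ← ENNReal.rpow_mul]
  norm_num

theorem lintegral_lintegral_add_swap {X : Type*} [MeasurableSpace X] (ν : Measure X) [SFinite ν]
    {g : X × X → ℝ≥0∞} (hg : Measurable g) :
    ∫⁻ y, ∫⁻ y', g (y, y') + g (y', y) ∂ν ∂ν = 2 * ∫⁻ y, ∫⁻ y', g (y, y') ∂ν ∂ν := by
  have h1 : ∀ y, ∫⁻ y', g (y, y') + g (y', y) ∂ν =
      ∫⁻ y', g (y, y') ∂ν + ∫⁻ y', g (y', y) ∂ν := fun y =>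
    lintegral_add_left (hg.comp measurable_prodMk_left) _
  simp_rw [h1]
  rw [lintegral_add_left hg.lintegral_prod_right', two_mul]
  congr 1
  exact lintegral_lintegral_swap (f := fun y y' => g (y', y))
    (hg.comp measurable_swap).aemeasurable

/-- A set `A` whose points are close to points `v y` around which `μ` has controlled growth has
`μ`-measure controlled by the volume of a neighbourhood. -/
theorem measure_le_of_ball_growth {k : ℕ} (μ : Measure (Eucl (k + 1))) {A : Set (Eucl (k + 1))}
    (hA : MeasurableSet A) (hμA : μ A ≠ ∞) {v : Eucl (k + 1) → Eucl (k + 1)} (hv : Measurable v)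
    {σ a : ℝ} (hσ : 0 ≤ σ) (ha : 0 < a) (hyv : ∀ y ∈ A, dist y (v y) ≤ σ) {θ A₁ B₁ : ℝ≥0∞}
    (hball : ∀ y ∈ A, ∀ h ∈ Ioo 0 (2 * a),
      μ (Metric.closedBall (v y) (max (√3 * σ) (√(h ^ 2 + σ ^ 2)))) ≤
        θ * (A₁ * volume (Metric.closedBall (0 : Eucl (k + 1)) a) +
          B₁ * volume (Metric.ball (0 : Eucl (k + 1)) h)))
    {Z : Set (Eucl (k + 1))}
    (hZ : ∀ y ∈ A, Metric.closedBall ((1 / 2 : ℝ) • (y + v y)) a ⊆ Z) :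
    μ A ≤ θ * (A₁ + B₁) * volume Z := by
  set ν := μ.restrict A with hν
  have : IsFiniteMeasure ν := ⟨by rw [Measure.restrict_apply_univ]; exact hμA.lt_top⟩
  set c : Eucl (k + 1) → Eucl (k + 1) := fun y => (1 / 2 : ℝ) • (y + v y) with hc
  have hcm : Measurable c := by fun_prop
  set V := volume (Metric.closedBall (0 : Eucl (k + 1)) a) with hV
  have hV0 : V ≠ 0 := (Metric.measure_closedBall_pos _ _ ha).ne'
  have hVt : V ≠ ∞ := measure_closedBall_lt_top.ne
  -- Second-moment method: `W z` is the `ν`-mass of points whose midpoint is within `a` of `z`. Its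
  -- integral is `μ A * V` and it vanishes off `Z`, so by Cauchy–Schwarz an upper bound for its
  -- second moment bounds `μ A`.
  set W := fun z => ν {y | z ∈ Metric.closedBall (c y) a} with hW
  have hWm : Measurable W := measurable_measure_closedBall ν hcm a
  have hW1 : ∫⁻ z, W z = μ A * V := by
    rw [lintegral_measure_closedBall volume ν hcm a]
    simp_rw [Measure.addHaar_closedBall_center]
    rw [lintegral_const, Measure.restrict_apply_univ, mul_comm]
  have hae : ∀ᵐ y ∂ν, y ∈ A := ae_restrict_mem hA
  -- the second moment
  have hW2 : ∫⁻ z, W z * W z =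
      ∫⁻ y, ∫⁻ y', ballOverlap k a (dist (c y) (c y')) ∂ν ∂ν := by
    have h1 : ∫⁻ z, W z * W z = ∫⁻ z, W z ∂(volume.withDensity W) :=
      (lintegral_withDensity_eq_lintegral_mul _ hWm hWm).symm
    rw [h1, lintegral_measure_closedBall (volume.withDensity W) ν hcm a]
    refine lintegral_congr fun y => ?_
    rw [withDensity_apply _ Metric.isClosed_closedBall.measurableSet,
      lintegral_measure_closedBall (volume.restrict _) ν hcm a]
    refine lintegral_congr fun y' => ?_
    rw [Measure.restrict_apply Metric.isClosed_closedBall.measurableSet, inter_comm,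
      volume_inter_closedBall ha.le]
  have hom : Measurable (ballOverlap k a) := (ballOverlap_antitone k a).measurable
  have hm2 : Measurable fun q : Eucl (k + 1) × Eucl (k + 1) =>
      ballOverlap k a (packDist σ (dist (v q.1) q.2)) :=
    hom.comp ((measurable_packDist σ).comp ((hv.comp measurable_fst).dist measurable_snd))
  -- Growth is known about the points `v y` but not about the midpoints. Convexity of the overlap
  -- trades the distance of two midpoints for the two cross distances, whose double integrals agree
  -- by symmetry.
  have hW3 : 2 * ∫⁻ z, W z * W z ≤
      2 * ∫⁻ y, ∫⁻ y', ballOverlap k a (packDist σ (dist (v y) y')) ∂ν ∂ν := by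
    rw [hW2]
    calc 2 * ∫⁻ y, ∫⁻ y', ballOverlap k a (dist (c y) (c y')) ∂ν ∂ν
        = ∫⁻ y, ∫⁻ y', 2 * ballOverlap k a (dist (c y) (c y')) ∂ν ∂ν := by
          rw [← lintegral_const_mul' _ _ (by norm_num)]
          refine lintegral_congr fun y => ?_
          rw [← lintegral_const_mul' _ _ (by norm_num)]
      _ ≤ ∫⁻ y, ∫⁻ y', ballOverlap k a (packDist σ (dist (v y) y')) +
            ballOverlap k a (packDist σ (dist (v y') y)) ∂ν ∂ν := by
          refine lintegral_mono_ae (hae.mono fun y hy => lintegral_mono_ae (hae.mono fun y' hy' => ?_))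
          exact two_mul_ballOverlap_le k (packDist_add_le (hyv y hy) (hyv y' hy'))
      _ = _ := lintegral_lintegral_add_swap ν hm2
  have hW4 : ∫⁻ z, W z * W z ≤ μ A * (θ * (A₁ + B₁) * V ^ 2) := by
    refine ((ENNReal.mul_le_mul_iff_right (by norm_num) (by norm_num)).1 hW3).trans ?_
    have : ∀ y ∈ A, ∫⁻ y', ballOverlap k a (packDist σ (dist (v y) y')) ∂ν ≤
        θ * (A₁ + B₁) * V ^ 2 := by
      intro y hy
      have hpd : Measurable fun y' => packDist σ (dist (v y) y') :=
        (measurable_packDist σ).comp (measurable_const.dist measurable_id)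
      rw [lintegral_ballOverlap ν hpd fun _ => packDist_nonneg _ _]
      calc ∫⁻ h in Ioi (0 : ℝ), overlapDensity k a h * ν {y' | packDist σ (dist (v y) y') < h}
          ≤ ∫⁻ h in Ioi (0 : ℝ), (θ * (A₁ * V) * overlapDensity k a h +
              θ * B₁ * (overlapDensity k a h * volume (Metric.ball (0 : Eucl (k + 1)) h))) := by
            refine setLIntegral_mono' measurableSet_Ioi fun h hh => ?_
            -- Balls of radius `a` are disjoint beyond distance `2a`, so the density vanishes there
            -- and growth is needed only for `h < 2a`.
            rcases lt_or_ge h (2 * a) with h2 | h2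
            · have hb := hball y hy h ⟨hh, h2⟩
              have hs : ν {y' | packDist σ (dist (v y) y') < h} ≤ _ :=
                (Measure.restrict_apply_le _ _).trans
                  ((measure_mono (packDist_lt_subset hσ hh (v y))).trans hb)
              calc _ ≤ overlapDensity k a h * (θ * (A₁ * V +
                    B₁ * volume (Metric.ball (0 : Eucl (k + 1)) h))) := by gcongr
                _ = _ := by ring
            · rw [overlapDensity_eq_zero ha.le h2]; simp
        _ = θ * (A₁ * V) * V + θ * B₁ * V ^ 2 := by
            rw [lintegral_add_left ((measurable_overlapDensity k a).const_mul _),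
              lintegral_const_mul _ (measurable_overlapDensity k a),
              ← ballOverlap_eq_lintegral_density, lintegral_const_mul'' _ ?_,
              lintegral_density_mul_volume_ball k ha.le]
            · congr 2
              have := volume_inter_closedBall ha.le (0 : Eucl (k + 1)) 0
              rw [inter_self, dist_self] at this
              exact this.symm
            · refine ((measurable_overlapDensity k a).mul ?_).aemeasurable
              exact (Monotone.measurable fun h h' hh =>
                measure_mono (Metric.ball_subset_ball hh))
        _ = θ * (A₁ + B₁) * V ^ 2 := by ring
    calc _ ≤ ∫⁻ y, θ * (A₁ + B₁) * V ^ 2 ∂ν :=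
          lintegral_mono_ae (hae.mono fun y hy => this y hy)
      _ = _ := by rw [lintegral_const, Measure.restrict_apply_univ, mul_comm]
  rcases eq_or_ne (μ A) 0 with h0 | h0
  · rw [h0]; exact zero_le
  have hCS := sq_lintegral_le volume hWm (Z := Z) (by
    intro z hz
    rw [hW]
    change μ.restrict A _ = 0
    rw [Measure.restrict_apply₀' hA.nullMeasurableSet]
    convert measure_empty (μ := μ)
    ext y
    simp only [mem_inter_iff, mem_ofPred_eq, mem_empty_iff_false, iff_false, not_and]
    exact fun h1 h2 => hz (hZ y h2 h1))
  rw [hW1] at hCS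
  have hfin := hCS.trans (mul_le_mul_left hW4 (volume Z))
  have h5 : (μ A * V ^ 2) * μ A ≤ (μ A * V ^ 2) * (θ * (A₁ + B₁) * volume Z) := by
    calc _ = (μ A * V) ^ 2 := by ring
      _ ≤ _ := hfin
      _ = _ := by ring
  exact (ENNReal.mul_le_mul_iff_right (mul_ne_zero h0 (pow_ne_zero 2 hV0))
    (ENNReal.mul_ne_top hμA (ENNReal.pow_ne_top hVt))).1 h5

end

/-! ### Volumes of unit balls and the size of the packing constants. -/

section

theorem unitBallVol_eq (k : ℕ) : unitBallVol k = √Real.pi ^ k / Real.Gamma (k / 2 + 1) := by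
  rcases Nat.eq_zero_or_pos k with rfl | hk
  · have h1 : Metric.ball (0 : Eucl 0) 1 = univ := by
      ext x; simp [Subsingleton.elim x 0]
    rw [unitBallVol, h1]
    have h2 : volume (univ : Set (Eucl 0)) = volume (univ : Set (Fin 0 → ℝ)) :=
      ((PiLp.volume_preserving_toLp (Fin 0)).measure_preimage nullMeasurableSet_univ).symm
    rw [h2]
    simp [volume_pi]
  · have : Nonempty (Fin k) := ⟨⟨0, hk⟩⟩
    rw [unitBallVol, EuclideanSpace.volume_ball]
    have : 0 ≤ √Real.pi ^ k / Real.Gamma (k / 2 + 1) :=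
      div_nonneg (by positivity) (Real.Gamma_pos_of_pos (by positivity)).le
    simp [ENNReal.toReal_ofReal this]

theorem unitBallVol_pos (k : ℕ) : 0 < unitBallVol k := by
  rw [unitBallVol_eq]
  exact div_pos (by positivity) (Real.Gamma_pos_of_pos (by positivity))

theorem volume_closedBall_eucl {k : ℕ} (x : Eucl k) {r : ℝ} (hr : 0 ≤ r) :
    volume (Metric.closedBall x r) = ENNReal.ofReal (unitBallVol k * r ^ k) := by
  rw [Measure.addHaar_closedBall _ _ hr, unitBallVol, mul_comm, ENNReal.ofReal_mul (by positivity),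
    ENNReal.ofReal_toReal measure_ball_lt_top.ne]
  simp

/-- Log-convexity of the Gamma function gives `Γ(x + 1/2)² ≤ Γ(x) Γ(x + 1)`; take `x = (k + 1)/2` in
the formula for ball volumes. -/
theorem sq_unitBallVol_ratio (k : ℕ) :
    ((k + 1 : ℕ) : ℝ) / (2 * Real.pi) * unitBallVol (k + 1) ^ 2 ≤ unitBallVol k ^ 2 := by
  have hx : (0 : ℝ) < ((k + 1 : ℕ) : ℝ) / 2 := by positivity
  set x : ℝ := ((k + 1 : ℕ) : ℝ) / 2 with hxd
  have e1 : ((k : ℕ) : ℝ) / 2 + 1 = x + 1 / 2 := by rw [hxd]; push_cast; ring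
  have hG : Real.Gamma (x + 1 / 2) ^ 2 ≤ Real.Gamma x * Real.Gamma (x + 1) := by
    have := Real.Gamma_mul_add_mul_le_rpow_Gamma_mul_rpow_Gamma hx (show 0 < x + 1 by linarith)
      (show (0 : ℝ) < 1 / 2 by norm_num) (show (0 : ℝ) < 1 / 2 by norm_num) (by norm_num)
    rw [show 1 / 2 * x + 1 / 2 * (x + 1) = x + 1 / 2 by ring, ← Real.sqrt_eq_rpow,
      ← Real.sqrt_eq_rpow] at this
    have h0 : 0 ≤ Real.Gamma (x + 1 / 2) := (Real.Gamma_pos_of_pos (by linarith)).le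
    refine (pow_le_pow_left₀ h0 this 2).trans_eq ?_
    rw [mul_pow, Real.sq_sqrt (Real.Gamma_pos_of_pos hx).le,
      Real.sq_sqrt (Real.Gamma_pos_of_pos (by linarith)).le]
  have hGx : Real.Gamma (x + 1) = x * Real.Gamma x := Real.Gamma_add_one hx.ne'
  have p1 : 0 < Real.Gamma (x + 1) := Real.Gamma_pos_of_pos (by linarith)
  have p2 : 0 < Real.Gamma (x + 1 / 2) := Real.Gamma_pos_of_pos (by linarith)
  have hπ := Real.pi_pos
  rw [unitBallVol_eq, unitBallVol_eq, e1, ← hxd, div_pow, div_pow, pow_succ (√Real.pi) k, mul_pow,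
    Real.sq_sqrt hπ.le]
  have e2 : ((k + 1 : ℕ) : ℝ) / (2 * Real.pi) = x / Real.pi := by rw [hxd]; field_simp
  rw [e2]
  have : x / Real.pi * ((√Real.pi ^ k) ^ 2 * Real.pi / Real.Gamma (x + 1) ^ 2) =
      (√Real.pi ^ k) ^ 2 * (x / Real.Gamma (x + 1) ^ 2) := by field_simp
  rw [this, div_eq_mul_inv _ (Real.Gamma (x + 1 / 2) ^ 2)]
  refine mul_le_mul_of_nonneg_left ?_ (by positivity)
  rw [div_le_iff₀ (by positivity), inv_mul_eq_div, le_div_iff₀ (by positivity)]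
  calc x * Real.Gamma (x + 1 / 2) ^ 2 ≤ x * (Real.Gamma x * Real.Gamma (x + 1)) := by gcongr
    _ = _ := by rw [hGx]; ring

/-- The contraction rate is small if the surface constant is. -/
theorem rate_sq_lt {k : ℕ} {s : ℝ} (hs0 : 0 < s) (hs1 : s < 1)
    (hq : 3 * s * unitBallVol k / ((1 - s) * unitBallVol (k + 1)) < 1 - s) :
    9 * s ^ 2 * (k + 1 : ℕ) < 2 * 3.1416 * (1 - s) ^ 4 := by
  have h1 := unitBallVol_pos k
  have h2 := unitBallVol_pos (k + 1)
  have hs' : 0 < 1 - s := by linarith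
  rw [div_lt_iff₀ (by positivity)] at hq
  have h3 : (3 * s * unitBallVol k) ^ 2 < ((1 - s) * ((1 - s) * unitBallVol (k + 1))) ^ 2 :=
    pow_lt_pow_left₀ hq (by positivity) (by norm_num)
  have h4 := sq_unitBallVol_ratio k
  rw [div_mul_eq_mul_div, div_le_iff₀ (by positivity)] at h4
  have h5 : 9 * s ^ 2 * (k + 1 : ℕ) * unitBallVol (k + 1) ^ 2 <
      2 * Real.pi * (1 - s) ^ 4 * unitBallVol (k + 1) ^ 2 := by
    calc 9 * s ^ 2 * (k + 1 : ℕ) * unitBallVol (k + 1) ^ 2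
        ≤ 9 * s ^ 2 * (unitBallVol k ^ 2 * (2 * Real.pi)) := by
          rw [mul_assoc]; exact mul_le_mul_of_nonneg_left h4 (by positivity)
      _ = 2 * Real.pi * (3 * s * unitBallVol k) ^ 2 := by ring
      _ < 2 * Real.pi * ((1 - s) * ((1 - s) * unitBallVol (k + 1))) ^ 2 := by
          have := Real.pi_pos; gcongr
      _ = _ := by ring
  have h6 := lt_of_mul_lt_mul_right h5 (by positivity)
  have h7 := Real.pi_lt_d4
  have : 0 < (1 - s) ^ 4 := by positivity
  nlinarith

/-- With `t = s/(2 - s)` the two bases are `1 - t` and `√(1 + 4t²)`. For `n = k + 1` the first power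
is at most `1/(1 + nt)`, while the second is at most `exp(2nt²)`. The hypothesis makes `nt²` so
small that the excess of the second over 1 is less than the deficit of the first. -/
theorem packing_constant_lt {k : ℕ} (hk : 1 ≤ k) {s : ℝ} (hs0 : 0 < s) (hs1 : s < 1)
    (h : 9 * s ^ 2 * (k + 1 : ℕ) < 2 * 3.1416 * (1 - s) ^ 4) :
    ((1 - s) / (1 - s / 2)) ^ (k + 1) + √(1 + (s / (1 - s / 2)) ^ 2) ^ (k + 1) < 2 := by
  set t := s / (2 - s) with ht
  have h2s : 0 < 2 - s := by linarith
  have ht0 : 0 < t := by positivity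
  have hst : s = 2 * t / (1 + t) := by rw [ht]; field_simp; ring
  have hts : t < 1 := by rw [ht, div_lt_one h2s]; linarith
  have e1 : (1 - s) / (1 - s / 2) = 1 - t := by rw [ht]; field_simp; ring
  have e2 : s / (1 - s / 2) = 2 * t := by rw [ht]; field_simp
  have e3 : 1 - s = (1 - t) / (1 + t) := by rw [hst]; field_simp; ring
  rw [e1, e2]
  set n : ℝ := ((k + 1 : ℕ) : ℝ) with hn
  have hn2 : (2 : ℝ) ≤ n := by rw [hn]; exact_mod_cast (by omega : 2 ≤ k + 1)
  -- The constant 0.1746 is an upper bound for `2 * 3.1416 / 36`.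
  have hb : n * t ^ 2 < 0.1746 * (1 - t) ^ 4 := by
    rw [e3, hst] at h
    have h1 : 9 * (2 * t / (1 + t)) ^ 2 * n = 36 * (n * t ^ 2) / (1 + t) ^ 2 := by field_simp; ring
    have h2 : 2 * 3.1416 * ((1 - t) / (1 + t)) ^ 4 =
      (6.2832 * (1 - t) ^ 4 / (1 + t) ^ 2) / (1 + t) ^ 2 := by field_simp; ring
    rw [h1, h2, div_lt_div_iff_of_pos_right (by positivity)] at h
    have h3 : 6.2832 * (1 - t) ^ 4 / (1 + t) ^ 2 ≤ 6.2832 * (1 - t) ^ 4 :=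
      div_le_self (by positivity) (by nlinarith)
    have : 0 < (1 - t) ^ 4 := by have : 0 < 1 - t := by linarith
                                 positivity
    linarith
  have h1t : 0 < 1 - t := by linarith
  have h4le : (1 - t) ^ 4 ≤ 1 - t := by
    calc (1 - t) ^ 4 ≤ (1 - t) ^ 1 := pow_le_pow_of_le_one h1t.le (by linarith) (by norm_num)
      _ = _ := pow_one _
  have h4le2 : (1 - t) ^ 4 ≤ (1 - t) ^ 2 :=
    pow_le_pow_of_le_one h1t.le (by linarith) (by norm_num)
  have ht2 : t < 0.23 := by
    by_contra hc
    push Not at hc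
    have h1 : 2 * t ^ 2 < 0.1746 * (1 - t) ^ 2 := by
      have : 2 * t ^ 2 ≤ n * t ^ 2 := by gcongr
      linarith
    have h2 : (1 - t) ^ 2 ≤ 0.77 ^ 2 := pow_le_pow_left₀ h1t.le (by linarith) 2
    have h3 : (0.23 : ℝ) ^ 2 ≤ t ^ 2 := pow_le_pow_left₀ (by norm_num) hc 2
    norm_num at h2 h3
    linarith
  set K := n * t ^ 2 with hK
  have hK0 : 0 < K := by positivity
  have hK1 : K < 0.1746 * (1 - t) := by linarith
  have b1 : (1 - t) ^ (k + 1) ≤ 1 / (1 + n * t) := by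
    rw [le_div_iff₀ (by positivity)]
    have h1 := one_add_mul_le_pow (show (-2 : ℝ) ≤ t by linarith) (k + 1)
    calc (1 - t) ^ (k + 1) * (1 + n * t) ≤ (1 - t) ^ (k + 1) * (1 + t) ^ (k + 1) := by gcongr
      _ = (1 - t ^ 2) ^ (k + 1) := by rw [← mul_pow]; ring
      _ ≤ 1 := pow_le_one₀ (by nlinarith) (by nlinarith)
  have b2 : √(1 + (2 * t) ^ 2) ^ (k + 1) ≤ 1 + 2 * K + (2 * K) ^ 2 := by
    have h1 : √(1 + (2 * t) ^ 2) ≤ Real.exp (2 * t ^ 2) := by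
      rw [Real.sqrt_le_left (Real.exp_pos _).le, ← Real.exp_nat_mul]
      have := Real.add_one_le_exp (4 * t ^ 2)
      calc 1 + (2 * t) ^ 2 = 4 * t ^ 2 + 1 := by ring
        _ ≤ _ := this
        _ = _ := by congr 1; push_cast; ring
    have h2 : √(1 + (2 * t) ^ 2) ^ (k + 1) ≤ Real.exp (2 * K) := by
      refine (pow_le_pow_left₀ (Real.sqrt_nonneg _) h1 _).trans_eq ?_
      rw [← Real.exp_nat_mul]
      congr 1
      rw [hK, hn]; ring
    have h3 := Real.abs_exp_sub_one_sub_id_le (x := 2 * K) (by rw [abs_of_pos] <;> linarith)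
    have := abs_le.1 h3
    linarith [this.2]
  have b3 : 2 * t * (1 + n * t) * (1 + 2 * K) < 1 := by
    have : 2 * t * (1 + n * t) = 2 * (t + K) := by rw [hK]; ring
    rw [this]
    nlinarith
  have b4 : 2 * K + (2 * K) ^ 2 < n * t / (1 + n * t) := by
    rw [lt_div_iff₀ (by positivity)]
    have : (2 * K + (2 * K) ^ 2) * (1 + n * t) = (2 * t * (1 + n * t) * (1 + 2 * K)) * (n * t) := by
      rw [hK]; ring
    rw [this]
    have : 0 < n * t := by positivity
    nlinarith
  have b5 : 1 / (1 + n * t) = 1 - n * t / (1 + n * t) := by field_simp; ring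
  linarith

end

/-! ### The packing inequality with constant two. -/

section

/-- Convexity of `z ↦ z^((k+1)/2)`, where `k ≥ 1` is needed, with weights `1/(1 + t²)` and `t²/(1 +
t²)`; equality holds at `h = a`. -/
theorem sqrt_add_sq_pow_le {k : ℕ} (hk : 1 ≤ k) {h a t : ℝ} (hh : 0 ≤ h) (ha : 0 ≤ a) :
    √(h ^ 2 + (t * a) ^ 2) ^ (k + 1) ≤
      √(1 + t ^ 2) ^ (k + 1) / (1 + t ^ 2) * (h ^ (k + 1) + t ^ 2 * a ^ (k + 1)) := by
  have hT : 0 < 1 + t ^ 2 := by positivity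
  have hp : (1 : ℝ) ≤ ((k + 1 : ℕ) : ℝ) / 2 := by
    rw [le_div_iff₀ (by norm_num)]
    have : 2 ≤ k + 1 := by omega
    exact_mod_cast by omega
  have hsq : ∀ z : ℝ, 0 ≤ z → √z ^ (k + 1) = z ^ (((k + 1 : ℕ) : ℝ) / 2) := by
    intro z hz
    rw [Real.sqrt_eq_rpow, ← Real.rpow_natCast, ← Real.rpow_mul hz]
    congr 1
    ring
  have h1 := (convexOn_rpow hp).2 (show h ^ 2 ∈ Ici (0 : ℝ) from sq_nonneg h)
    (show a ^ 2 ∈ Ici (0 : ℝ) from sq_nonneg a) (show 0 ≤ 1 / (1 + t ^ 2) by positivity)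
    (show 0 ≤ t ^ 2 / (1 + t ^ 2) by positivity) (by field_simp)
  simp only [smul_eq_mul] at h1
  have e1 : 1 / (1 + t ^ 2) * h ^ 2 + t ^ 2 / (1 + t ^ 2) * a ^ 2 =
      (h ^ 2 + (t * a) ^ 2) / (1 + t ^ 2) := by field_simp
  rw [e1, ← hsq _ (by positivity), ← hsq _ (by positivity), ← hsq _ (by positivity),
    Real.sqrt_sq hh, Real.sqrt_sq ha, Real.sqrt_div' _ hT.le, div_pow,
    div_le_iff₀ (by positivity)] at h1
  refine h1.trans_eq ?_
  field_simp

/-- The radii that occur in the packing argument, raised to the dimension, must lie below a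
combination of `a^(k+1)` and `h^(k+1)` whose coefficients sum to at most 2. At `s` the required
inequalities are strict, so they persist for `s₁` slightly above `s`. -/
theorem eventually_packing_rate (k : ℕ) {s : ℝ} (hs0 : 0 < s) (hs1 : s < 1)
    (hq : 3 * s * unitBallVol k / ((1 - s) * unitBallVol (k + 1)) < 1 - s) :
    ∀ᶠ s₁ in 𝓝[>] s, √3 * s₁ ≤ 1 - s ∧ ∀ ε₀ σ : ℝ, 0 < ε₀ → 0 ≤ σ → σ ≤ s₁ * ε₀ →
      ∃ A₁ B₁ : ℝ, 0 ≤ A₁ ∧ 0 ≤ B₁ ∧ A₁ + B₁ ≤ 2 ∧ ∀ h ∈ Ioo 0 (2 * (ε₀ - σ / 2)),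
        max ((1 - s) * ε₀) (√(h ^ 2 + σ ^ 2)) ^ (k + 1) ≤
          A₁ * (ε₀ - σ / 2) ^ (k + 1) + B₁ * h ^ (k + 1) := by
  have hb := rate_sq_lt hs0 hs1 hq
  have h3 : √3 * s < 1 - s := by
    have h1 : 9 * s ^ 2 * (1 : ℕ) < 2 * 3.1416 * (1 - s) ^ 4 := by
      refine lt_of_le_of_lt ?_ hb
      gcongr; omega
    norm_num at h1
    have h2 : s < 0.36 := by
      by_contra hc
      push Not at hc
      have : (1 - s) ^ 4 ≤ 0.64 ^ 4 := pow_le_pow_left₀ (by linarith) (by linarith) 4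
      norm_num at this
      nlinarith
    have h4 : √3 < 1.7333 := by
      rw [Real.sqrt_lt' (by norm_num)]; norm_num
    nlinarith
  have e1 : ∀ᶠ s₁ in 𝓝[>] s, √3 * s₁ < 1 - s := by
    refine Filter.Eventually.filter_mono nhdsWithin_le_nhds ?_
    exact (continuous_const.mul continuous_id).continuousAt.eventually_lt continuousAt_const h3
  have e2 : ∀ᶠ s₁ in 𝓝[>] s, s₁ < 1 ∧ s₁ < 2 * s := by
    refine Filter.Eventually.filter_mono nhdsWithin_le_nhds ?_
    exact (eventually_lt_nhds hs1).and (eventually_lt_nhds (by linarith))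
  have e3 : ∀ᶠ s₁ in 𝓝[>] s, s < s₁ := eventually_mem_nhdsWithin
  have e4 : ∀ᶠ s₁ in 𝓝[>] s, 1 ≤ k →
      ((1 - s) / (1 - s₁ / 2)) ^ (k + 1) + √(1 + (s₁ / (1 - s₁ / 2)) ^ 2) ^ (k + 1) < 2 := by
    by_cases hk : 1 ≤ k
    · refine Filter.Eventually.filter_mono nhdsWithin_le_nhds ?_
      have hne : (1 - s / 2) ≠ 0 := by linarith
      have hc : ContinuousAt (fun s₁ : ℝ => ((1 - s) / (1 - s₁ / 2)) ^ (k + 1) +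
          √(1 + (s₁ / (1 - s₁ / 2)) ^ 2) ^ (k + 1)) s := by
        have hd : ContinuousAt (fun s₁ : ℝ => 1 - s₁ / 2) s := by fun_prop
        refine ((continuousAt_const.div hd hne).pow _).add (ContinuousAt.pow ?_ _)
        exact (continuousAt_const.add ((continuousAt_id.div hd hne).pow 2)).sqrt
      exact (hc.eventually_lt continuousAt_const (packing_constant_lt hk hs0 hs1 hb)).mono
        fun _ h _ => h
    · exact Eventually.of_forall fun _ h => absurd h hk
  filter_upwards [e1, e2, e3, e4] with s₁ h1 h2 h3' h4
  refine ⟨h1.le, fun ε₀ σ hε hσ hσ1 => ?_⟩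
  have hs1pos : 0 < s₁ := hs0.trans h3'
  set a := ε₀ - σ / 2 with ha
  have hsε : s₁ * ε₀ < ε₀ := by nlinarith
  have ha1 : (1 - s₁ / 2) * ε₀ ≤ a := by rw [ha]; linarith
  have ha0 : 0 < a := by nlinarith
  have hρa : (1 - s) * ε₀ ≤ a := by rw [ha]; nlinarith
  have h1s : 0 < 1 - s := by linarith
  have h1s1 : 0 < 1 - s₁ / 2 := by linarith
  have hρ : (1 - s) * ε₀ ≤ (1 - s) / (1 - s₁ / 2) * a := by
    rw [div_mul_eq_mul_div, le_div_iff₀ h1s1]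
    nlinarith
  have hσa : σ ≤ s₁ / (1 - s₁ / 2) * a := by
    rw [div_mul_eq_mul_div, le_div_iff₀ h1s1]
    nlinarith
  rcases Nat.eq_zero_or_pos k with rfl | hk
  · have hσρ : σ ≤ (1 - s) * ε₀ := by
      have : (1 : ℝ) ≤ √3 := by rw [Real.one_le_sqrt]; norm_num
      nlinarith
    set ρ := (1 - s) * ε₀
    have hρ0 : 0 < ρ := by positivity
    -- In dimension one, `√(h² + σ²) ≤ h + σ`, and these coefficients describe the chord of the
    -- convex function `max ρ (h + σ)` over the interval from `0` to `2a`.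
    refine ⟨ρ / a, (σ + 2 * a - ρ) / (2 * a), by positivity,
      div_nonneg (by linarith) (by linarith), ?_, ?_⟩
    · rw [div_add_div _ _ ha0.ne' (by positivity), div_le_iff₀ (by positivity)]
      nlinarith
    · rintro h ⟨hh0, hh2⟩
      simp only [zero_add, pow_one]
      have e : ρ / a * a + (σ + 2 * a - ρ) / (2 * a) * h =
          ρ * (1 - h / (2 * a)) + (h / (2 * a)) * (σ + 2 * a) := by field_simp; ring
      rw [e]
      have hu : h / (2 * a) ≤ 1 := by rw [div_le_one (by positivity)]; exact hh2.le
      have hu0 : 0 ≤ h / (2 * a) := by positivity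
      have hh : h = h / (2 * a) * (2 * a) := by field_simp
      set u := h / (2 * a)
      refine max_le (by nlinarith) ?_
      have : √(h ^ 2 + σ ^ 2) ≤ h + σ := by
        rw [Real.sqrt_le_left (by positivity)]
        nlinarith
      nlinarith
  · set t := s₁ / (1 - s₁ / 2) with ht
    have ht0 : 0 ≤ t := by positivity
    set x := (1 - s) / (1 - s₁ / 2) with hx
    have hx0 : 0 ≤ x := by positivity
    set B := √(1 + t ^ 2) ^ (k + 1) / (1 + t ^ 2) with hB
    have hB0 : 0 ≤ B := by positivity
    -- The maximum is bounded by a sum, its second term through `sqrt_add_sq_pow_le`. The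
    -- coefficients then add up to `x^(k+1) + √(1 + t²)^(k+1)`, the quantity kept below 2 by
    -- `packing_constant_lt`.
    refine ⟨x ^ (k + 1) + B * t ^ 2, B, by positivity, hB0, ?_, ?_⟩
    · have : B * t ^ 2 + B = √(1 + t ^ 2) ^ (k + 1) := by rw [hB]; field_simp; ring
      have := h4 hk
      linarith
    · rintro h ⟨hh0, hh2⟩
      have h5 : √(h ^ 2 + σ ^ 2) ≤ √(h ^ 2 + (t * a) ^ 2) := by
        apply Real.sqrt_le_sqrt
        have : σ ^ 2 ≤ (t * a) ^ 2 := pow_le_pow_left₀ hσ hσa 2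
        linarith
      have h6 := (pow_le_pow_left₀ (Real.sqrt_nonneg _) h5 (k + 1)).trans
        (sqrt_add_sq_pow_le hk hh0.le ha0.le (t := t))
      have h7 : ((1 - s) * ε₀) ^ (k + 1) ≤ x ^ (k + 1) * a ^ (k + 1) := by
        rw [← mul_pow]; exact pow_le_pow_left₀ (by positivity) hρ _
      have h8 : 0 ≤ x ^ (k + 1) * a ^ (k + 1) := by positivity
      have h9 : 0 ≤ B * (h ^ (k + 1) + t ^ 2 * a ^ (k + 1)) := by positivity
      have h10 : (x ^ (k + 1) + B * t ^ 2) * a ^ (k + 1) + B * h ^ (k + 1) =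
        x ^ (k + 1) * a ^ (k + 1) + B * (h ^ (k + 1) + t ^ 2 * a ^ (k + 1)) := by ring
      rw [h10]
      rcases max_cases ((1 - s) * ε₀) (√(h ^ 2 + σ ^ 2)) with ⟨he, _⟩ | ⟨he, _⟩ <;> rw [he]
      · linarith
      · linarith

/-- If `μ` has density at most `θ` in all balls of radius at least `(1 - s) ε₀` about points close
to `A`, then it has density at most `2 θ` in a neighbourhood of `A`. -/
theorem eventually_packing (k : ℕ) {s : ℝ} (hs0 : 0 < s) (hs1 : s < 1)
    (hq : 3 * s * unitBallVol k / ((1 - s) * unitBallVol (k + 1)) < 1 - s) :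
    ∀ᶠ s₁ in 𝓝[>] s, ∀ ε₀ σ : ℝ, 0 < ε₀ → 0 ≤ σ → σ ≤ s₁ * ε₀ →
      ∀ (μ : Measure (Eucl (k + 1))) (A Z : Set (Eucl (k + 1))) (v : Eucl (k + 1) → Eucl (k + 1))
        (θ : ℝ≥0∞), MeasurableSet A → μ A ≠ ∞ → Measurable v → (∀ y ∈ A, dist y (v y) ≤ σ) →
        (∀ y ∈ A, ∀ r, (1 - s) * ε₀ ≤ r → r ≤ 3 * ε₀ →
          μ (Metric.closedBall (v y) r) ≤ θ * volume (Metric.closedBall (0 : Eucl (k + 1)) r)) →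
        (∀ y ∈ A, Metric.closedBall ((1 / 2 : ℝ) • (y + v y)) (ε₀ - σ / 2) ⊆ Z) →
        μ A ≤ 2 * θ * volume Z := by
  have e2 : ∀ᶠ s₁ in 𝓝[>] s, s₁ < 1 :=
    Filter.Eventually.filter_mono nhdsWithin_le_nhds (eventually_lt_nhds hs1)
  filter_upwards [eventually_packing_rate k hs0 hs1 hq, e2] with s₁ hs hs1'
  obtain ⟨h3, hr⟩ := hs
  intro ε₀ σ hε hσ hσ1 μ A Z v θ hA hμA hv hyv hgrow hZ
  obtain ⟨A₁, B₁, hA1, hB1, hAB, hmax⟩ := hr ε₀ σ hε hσ hσ1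
  have hσε : σ ≤ ε₀ := hσ1.trans (by nlinarith)
  have ha0 : 0 < ε₀ - σ / 2 := by linarith
  have key := measure_le_of_ball_growth μ hA hμA hv hσ ha0 hyv (θ := θ)
    (A₁ := ENNReal.ofReal A₁) (B₁ := ENNReal.ofReal B₁) (Z := Z) (fun y hy h hh => by
      -- Since `√3 σ ≤ (1 - s) ε₀`, the cutoff radius of `packDist` never exceeds the smallest
      -- radius for which growth is assumed.
      have hle : max (√3 * σ) (√(h ^ 2 + σ ^ 2)) ≤ max ((1 - s) * ε₀) (√(h ^ 2 + σ ^ 2)) := by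
        refine max_le_max ?_ le_rfl
        calc √3 * σ ≤ √3 * (s₁ * ε₀) := by gcongr
          _ = √3 * s₁ * ε₀ := by ring
          _ ≤ _ := by gcongr
      set r := max ((1 - s) * ε₀) (√(h ^ 2 + σ ^ 2)) with hrd
      have hr0 : 0 ≤ r := le_max_of_le_right (Real.sqrt_nonneg _)
      have hr3 : r ≤ 3 * ε₀ := by
        refine max_le (by nlinarith) ?_
        rw [Real.sqrt_le_left (by positivity)]
        nlinarith [hh.1, hh.2]
      refine (measure_mono (Metric.closedBall_subset_closedBall hle)).trans
        ((hgrow y hy r (le_max_left _ _) hr3).trans ?_)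
      gcongr
      rw [Measure.addHaar_ball volume 0 hh.1.le, volume_closedBall_eucl _ hr0,
        volume_closedBall_eucl _ ha0.le,
        show volume (Metric.ball (0 : Eucl (k + 1)) 1) = ENNReal.ofReal (unitBallVol (k + 1)) from
          (ENNReal.ofReal_toReal measure_ball_lt_top.ne).symm, finrank_euclideanSpace,
        Fintype.card_fin]
      have hu := (unitBallVol_pos (k + 1)).le
      have hhp := hh.1.le
      rw [← ENNReal.ofReal_mul (by positivity), ← ENNReal.ofReal_mul (by positivity),
        ← ENNReal.ofReal_mul (by positivity), ← ENNReal.ofReal_add (by positivity) (by positivity)]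
      refine ENNReal.ofReal_le_ofReal ?_
      have := mul_le_mul_of_nonneg_left (hmax h hh) hu
      linarith) hZ
  refine key.trans ?_
  have : ENNReal.ofReal A₁ + ENNReal.ofReal B₁ ≤ 2 := by
    rw [← ENNReal.ofReal_add hA1 hB1]
    exact (ENNReal.ofReal_le_ofReal hAB).trans_eq (by norm_num)
  rw [mul_comm 2 θ]
  gcongr

end

/-! ### Local essential bounds, oscillation and layer-cake comparison. -/

section

variable {m : ℕ}

/-- Essential supremum of `φ` over the closed ball of radius `r` about `y`. -/
def ballSup (φ : Eucl m → ℝ≥0∞) (r : ℝ) (y : Eucl m) : ℝ≥0∞ :=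
  essSup φ (volume.restrict (Metric.closedBall y r))

/-- Essential infimum of `φ` over the closed ball of radius `r` about `y`. -/
def ballInf (φ : Eucl m → ℝ≥0∞) (r : ℝ) (y : Eucl m) : ℝ≥0∞ :=
  essInf φ (volume.restrict (Metric.closedBall y r))

/-- Oscillation of `φ` over the closed ball of radius `r` about `y`. -/
def ballOsc (φ : Eucl m → ℝ≥0∞) (r : ℝ) (y : Eucl m) : ℝ≥0∞ := ballSup φ r y - ballInf φ r y

/-- The value of `φ` at `v` lies between its essential bounds over any ball containing `v` in its
interior. -/
def GoodPoint (φ : Eucl m → ℝ≥0∞) (v : Eucl m) : Prop :=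
  ∀ y r, dist y v < r → ballInf φ r y ≤ φ v ∧ φ v ≤ ballSup φ r y

/-- Rewriting local essential bounds through volumes of level sets in balls makes them measurable
functions of the centre. -/
theorem lt_ballSup_iff {φ : Eucl m → ℝ≥0∞} (hφ : Measurable φ) {t : ℝ≥0∞} {r : ℝ} {y : Eucl m} :
    t < ballSup φ r y ↔ 0 < volume ({z | t < φ z} ∩ Metric.closedBall y r) := by
  have hm : MeasurableSet {z | t < φ z} := measurableSet_lt measurable_const hφ
  rw [← Measure.restrict_apply hm, pos_iff_ne_zero, ← not_iff_not, not_lt, not_not]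
  constructor
  · intro h
    have := ae_le_essSup (μ := volume.restrict (Metric.closedBall y r)) (f := φ)
    rw [← nonpos_iff_eq_zero]
    refine (measure_mono fun z hz => ?_).trans (ae_iff.1 this).le
    exact not_le.2 (lt_of_le_of_lt h hz)
  · intro h
    refine essSup_le_of_ae_le _ ?_
    rw [EventuallyLE, ae_iff]
    simpa using h

theorem ballInf_lt_iff {φ : Eucl m → ℝ≥0∞} (hφ : Measurable φ) {t : ℝ≥0∞} {r : ℝ} {y : Eucl m} :
    ballInf φ r y < t ↔ 0 < volume ({z | φ z < t} ∩ Metric.closedBall y r) := by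
  have hm : MeasurableSet {z | φ z < t} := measurableSet_lt hφ measurable_const
  rw [← Measure.restrict_apply hm, pos_iff_ne_zero, ← not_iff_not, not_lt, not_not]
  constructor
  · intro h
    have := ae_essInf_le (μ := volume.restrict (Metric.closedBall y r)) (f := φ)
    rw [← nonpos_iff_eq_zero]
    refine (measure_mono fun z hz => ?_).trans (ae_iff.1 this).le
    exact not_le.2 (lt_of_lt_of_le hz h)
  · intro h
    refine le_essInf_of_ae_le _ ?_
    rw [EventuallyLE, ae_iff]
    simpa using h

theorem measurable_measure_inter_closedBall {A : Set (Eucl m)} (hA : MeasurableSet A) (r : ℝ) :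
    Measurable fun y => volume (A ∩ Metric.closedBall y r) := by
  have hs : MeasurableSet {p : Eucl m × Eucl m | p.2 ∈ A ∧ dist p.2 p.1 ≤ r} :=
    (measurable_snd hA).inter
      (measurableSet_le (measurable_snd.dist measurable_fst) measurable_const)
  exact measurable_measure_prodMk_left hs

theorem measurable_ballSup {φ : Eucl m → ℝ≥0∞} (hφ : Measurable φ) (r : ℝ) :
    Measurable (ballSup φ r) := by
  refine measurable_of_Ioi fun t => ?_
  have : ballSup φ r ⁻¹' Ioi t =
      (fun y => volume ({z | t < φ z} ∩ Metric.closedBall y r)) ⁻¹' Ioi 0 := by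
    ext y
    simp only [mem_preimage, mem_Ioi]
    exact lt_ballSup_iff hφ
  rw [this]
  exact measurable_measure_inter_closedBall (measurableSet_lt measurable_const hφ) r
    measurableSet_Ioi

theorem measurable_ballInf {φ : Eucl m → ℝ≥0∞} (hφ : Measurable φ) (r : ℝ) :
    Measurable (ballInf φ r) := by
  refine measurable_of_Iio fun t => ?_
  have : ballInf φ r ⁻¹' Iio t =
      (fun y => volume ({z | φ z < t} ∩ Metric.closedBall y r)) ⁻¹' Ioi 0 := by
    ext y
    simp only [mem_preimage, mem_Ioi, mem_Iio]
    exact ballInf_lt_iff hφ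
  rw [this]
  exact measurable_measure_inter_closedBall (measurableSet_lt hφ measurable_const) r
    measurableSet_Ioi

theorem measurable_ballOsc {φ : Eucl m → ℝ≥0∞} (hφ : Measurable φ) (r : ℝ) :
    Measurable (ballOsc φ r) :=
  (measurable_ballSup hφ r).sub (measurable_ballInf hφ r)

theorem ballSup_mono_ball (φ : Eucl m → ℝ≥0∞) {r r' : ℝ} {y z : Eucl m} (h : dist y z + r ≤ r') :
    ballSup φ r y ≤ ballSup φ r' z :=
  essSup_mono_measure (Measure.restrict_mono (Metric.closedBall_subset_closedBall' (by linarith))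
    le_rfl).absolutelyContinuous

theorem ballSup_mono_fun {φ ψ : Eucl m → ℝ≥0∞} (h : φ ≤ ψ) (r : ℝ) (y : Eucl m) :
    ballSup φ r y ≤ ballSup ψ r y :=
  essSup_mono_ae (ae_of_all _ h)

/-- Almost every point of `A` belongs to the topological support of Lebesgue measure restricted to
`A`. -/
theorem ae_forall_measure_inter_pos {A : Set (Eucl m)} (hA : MeasurableSet A) :
    ∀ᵐ v : Eucl m, v ∈ A → ∀ y r, dist y v < r → 0 < volume (A ∩ Metric.closedBall y r) := by
  rw [← ae_restrict_iff' hA]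
  filter_upwards [(volume.restrict A).support_mem_ae] with v hv y r h
  rw [Measure.mem_support_iff_forall] at hv
  have h1 := hv (Metric.closedBall y r) (Filter.mem_of_superset
    (Metric.ball_mem_nhds v (sub_pos.2 h)) fun z hz => ?_)
  · rwa [Measure.restrict_apply Metric.isClosed_closedBall.measurableSet, inter_comm] at h1
  · rw [Metric.mem_ball] at hz
    rw [Metric.mem_closedBall]
    linarith [dist_triangle z v y, dist_comm v y]

/-- If the value at `v` violated a local essential bound, a number from a fixed countable dense set
would separate the two. Hence only countably many sub- and superlevel sets, each with a null set of
bad points, are involved. -/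
theorem ae_goodPoint {φ : Eucl m → ℝ≥0∞} (hφ : Measurable φ) : ∀ᵐ v, GoodPoint φ v := by
  obtain ⟨Q, hQc, hQd⟩ := TopologicalSpace.exists_countable_dense ℝ≥0∞
  have h1 : ∀ᵐ v : Eucl m, ∀ t ∈ Q, v ∈ {z | t < φ z} → ∀ y r, dist y v < r →
      0 < volume ({z | t < φ z} ∩ Metric.closedBall y r) :=
    (ae_ball_iff hQc).2 fun t _ => ae_forall_measure_inter_pos (measurableSet_lt measurable_const hφ)
  have h2 : ∀ᵐ v : Eucl m, ∀ t ∈ Q, v ∈ {z | φ z < t} → ∀ y r, dist y v < r →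
      0 < volume ({z | φ z < t} ∩ Metric.closedBall y r) :=
    (ae_ball_iff hQc).2 fun t _ => ae_forall_measure_inter_pos (measurableSet_lt hφ measurable_const)
  filter_upwards [h1, h2] with v hv1 hv2 y r hr
  constructor
  · by_contra! hc
    obtain ⟨t, ht, h3, h4⟩ := hQd.exists_between hc
    exact absurd ((ballInf_lt_iff hφ).2 (hv2 t ht h3 y r hr)) (not_lt.2 h4.le)
  · by_contra! hc
    obtain ⟨t, ht, h3, h4⟩ := hQd.exists_between hc
    exact absurd ((lt_ballSup_iff hφ).2 (hv1 t ht h4 y r hr)) (not_lt.2 h3.le)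

theorem GoodPoint.ballSup_le {φ : Eucl m → ℝ≥0∞} {v : Eucl m} (hv : GoodPoint φ v) {r : ℝ}
    (hr : 0 < r) : ballSup φ r v ≤ φ v + ballOsc φ r v := by
  refine le_add_tsub.trans (add_le_add (hv v r (by simpa)).1 le_rfl)

/-- Values of `φ` at two good points of a ball differ by at most the oscillation. -/
theorem GoodPoint.le_add_ballOsc {φ : Eucl m → ℝ≥0∞} {u v y : Eucl m} {r : ℝ}
    (hu : GoodPoint φ u) (hv : GoodPoint φ v) (h1 : dist y u < r) (h2 : dist y v < r) :
    φ u ≤ φ v + ballOsc φ r y :=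
  ((hu y r h1).2.trans le_add_tsub).trans (add_le_add (hv y r h2).1 le_rfl)

theorem ae_le_ballSup_indicator {φ : Eucl m → ℝ≥0∞} (hφ : Measurable φ) {M : Set (Eucl m)}
    (hM : MeasurableSet M) :
    ∀ᵐ v, v ∈ M → ∀ y r, dist y v < r → φ v ≤ ballSup (M.indicator φ) r y := by
  filter_upwards [ae_goodPoint (hφ.indicator hM)] with v hv hvM y r hr
  simpa [hvM] using (hv y r hr).2

theorem osc_le_of_forall {f : Eucl m → ℝ} {Ω : Set (Eucl m)} {c : ℝ≥0∞}
    (hΩ : MeasurableSet Ω) {G : Set (Eucl m)} (hG : ∀ᵐ u, u ∈ G)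
    (h : ∀ u ∈ G ∩ Ω, ∀ v ∈ G ∩ Ω, ENNReal.ofReal (f u - f v) ≤ c) : osc f Ω ≤ c := by
  rcases eq_or_ne c ∞ with rfl | hc
  · exact le_top
  have hG' : ∀ᵐ u ∂volume.restrict Ω, u ∈ G ∩ Ω := by
    filter_upwards [ae_restrict_of_ae hG, ae_restrict_mem hΩ] with u h1 h2 using ⟨h1, h2⟩
  have key : essSup (fun y => (f y : EReal)) (volume.restrict Ω)
      - essInf (fun y => (f y : EReal)) (volume.restrict Ω) ≤ (c.toReal : EReal) := by
    rw [EReal.sub_le_iff_le_add (by simp) (by simp), add_comm,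
      ← EReal.sub_le_iff_le_add (by simp) (by simp)]
    refine le_essInf_of_ae_le _ (hG'.mono fun v hv => ?_)
    rw [EReal.sub_le_iff_le_add (by simp) (by simp)]
    refine essSup_le_of_ae_le _ (hG'.mono fun u hu => ?_)
    have := h u hu v hv
    rw [ENNReal.ofReal_le_iff_le_toReal hc] at this
    have h2 : f u ≤ f v + c.toReal := by linarith
    change (f u : EReal) ≤ (f v : EReal) + (c.toReal : EReal)
    exact_mod_cast h2
  refine (EReal.toENNReal_le_toENNReal key).trans ?_
  rw [EReal.toENNReal_of_ne_top (by simp), EReal.toReal_coe, ENNReal.ofReal_toReal hc]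

/-- If `f` ranges between `b` and `a`, its positive part ranges between `b⁺` and `a⁺`, its negative
part between `(-a)⁺` and `(-b)⁺`, and the two lengths sum to `a - b`. This reduces the problem to
nonnegative functions. -/
theorem ballOsc_add_le_osc (f : Eucl m → ℝ) (r : ℝ) (y : Eucl m) :
    ballOsc (fun z => ENNReal.ofReal (f z)) r y + ballOsc (fun z => ENNReal.ofReal (-f z)) r y ≤
      osc f (Metric.closedBall y r) := by
  have hof : ∀ x : ℝ, ENNReal.ofReal x = (x : EReal).toENNReal := fun x => by
    rw [EReal.toENNReal_of_ne_top (by simp), EReal.toReal_coe]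
  set μ := volume.restrict (Metric.closedBall y r)
  have hs := ae_le_essSup (μ := μ) (f := fun y => (f y : EReal))
  have hi := ae_essInf_le (μ := μ) (f := fun y => (f y : EReal))
  unfold osc
  change _ ≤ (essSup (fun y => (f y : EReal)) μ - essInf (fun y => (f y : EReal)) μ).toENNReal
  generalize essSup (fun y => (f y : EReal)) μ = a at hs ⊢
  generalize essInf (fun y => (f y : EReal)) μ = b at hi ⊢
  have h1 : ballSup (fun z => ENNReal.ofReal (f z)) r y ≤ a.toENNReal :=
    essSup_le_of_ae_le _ (hs.mono fun z hz => by
      simp only [hof]; exact EReal.toENNReal_le_toENNReal hz)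
  have h2 : b.toENNReal ≤ ballInf (fun z => ENNReal.ofReal (f z)) r y :=
    le_essInf_of_ae_le _ (hi.mono fun z hz => by
      simp only [hof]; exact EReal.toENNReal_le_toENNReal hz)
  have h3 : ballSup (fun z => ENNReal.ofReal (-f z)) r y ≤ (-b).toENNReal :=
    essSup_le_of_ae_le _ (hi.mono fun z hz => by
      simp only [hof, EReal.coe_neg]
      exact EReal.toENNReal_le_toENNReal (EReal.neg_le_neg_iff.2 hz))
  have h4 : (-a).toENNReal ≤ ballInf (fun z => ENNReal.ofReal (-f z)) r y :=
    le_essInf_of_ae_le _ (hs.mono fun z hz => by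
      simp only [hof, EReal.coe_neg]
      exact EReal.toENNReal_le_toENNReal (EReal.neg_le_neg_iff.2 hz))
  refine (add_le_add (tsub_le_tsub h1 h2) (tsub_le_tsub h3 h4)).trans ?_
  induction a using EReal.rec with
  | bot => induction b using EReal.rec <;> simp
  | top => induction b using EReal.rec <;> simp
  | coe a =>
    induction b using EReal.rec with
    | bot => simp
    | top => simp
    | coe b =>
      rw [← EReal.coe_neg, ← EReal.coe_neg, ← EReal.coe_sub, ← hof, ← hof, ← hof, ← hof, ← hof]
      rcases le_total b a with hab | hab
      · rcases le_total 0 a with ha | ha <;> rcases le_total 0 b with hb | hb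
        · rw [← ENNReal.ofReal_sub _ hb, ENNReal.ofReal_of_nonpos (p := -b) (by linarith)]; simp
        · rw [ENNReal.ofReal_of_nonpos hb, ENNReal.ofReal_of_nonpos (p := -a) (by linarith),
            tsub_zero, tsub_zero, ← ENNReal.ofReal_add ha (by linarith), sub_eq_add_neg]
        · obtain rfl : a = 0 := le_antisymm ha (hb.trans hab)
          obtain rfl : b = 0 := le_antisymm hab hb
          simp
        · rw [ENNReal.ofReal_of_nonpos ha, ENNReal.ofReal_of_nonpos hb,
            ← ENNReal.ofReal_sub _ (by linarith : 0 ≤ -a)]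
          simp [add_comm, sub_eq_add_neg]
      · rw [tsub_eq_zero_of_le (ENNReal.ofReal_le_ofReal hab),
          tsub_eq_zero_of_le (ENNReal.ofReal_le_ofReal (neg_le_neg hab))]
        simp

theorem osc_congr_ae {f g : Eucl m → ℝ} (h : f =ᵐ[volume] g) (Ω : Set (Eucl m)) :
    osc f Ω = osc g Ω := by
  have h1 : (fun y => (f y : EReal)) =ᵐ[volume.restrict Ω] fun y => (g y : EReal) :=
    (ae_restrict_of_ae h).mono fun y hy => by simp [hy]
  rw [osc, osc, essSup_congr_ae h1, essInf_congr_ae h1]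

theorem volume_setOf_ofReal_lt (a : ℝ≥0∞) :
    volume (Ioi (0 : ℝ) ∩ {t : ℝ | ENNReal.ofReal t < a}) = a := by
  rcases eq_or_ne a ∞ with rfl | ha
  · simp
  · have : Ioi (0 : ℝ) ∩ {t : ℝ | ENNReal.ofReal t < a} = Ioo 0 a.toReal := by
      ext t
      simp only [mem_inter_iff, mem_Ioi, mem_ofPred_eq, mem_Ioo]
      refine and_congr_right fun ht => ?_
      rw [ENNReal.ofReal_lt_iff_lt_toReal ht.le ha]
    rw [this, Real.volume_Ioo, sub_zero, ENNReal.ofReal_toReal ha]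

theorem lintegral_eq_lintegral_measure_lt {X : Type*} [MeasurableSpace X] (μ : Measure X)
    [SFinite μ] {g : X → ℝ≥0∞} (hg : Measurable g) :
    ∫⁻ x, g x ∂μ = ∫⁻ t in Ioi (0 : ℝ), μ {x | ENNReal.ofReal t < g x} := by
  have hs : MeasurableSet {p : X × ℝ | ENNReal.ofReal p.2 < g p.1} :=
    measurableSet_lt (ENNReal.measurable_ofReal.comp measurable_snd) (hg.comp measurable_fst)
  have h1 := Measure.prod_apply (μ := μ) (ν := volume.restrict (Ioi (0 : ℝ))) hs
  have h2 := Measure.prod_apply_symm (μ := μ) (ν := volume.restrict (Ioi (0 : ℝ))) hs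
  rw [h1] at h2
  refine Eq.trans (lintegral_congr fun x => ?_) (h2.trans (lintegral_congr fun t => rfl))
  rw [Measure.restrict_apply (measurable_prodMk_left hs), inter_comm]
  exact (volume_setOf_ofReal_lt (g x)).symm

/-- Comparison of integrals through comparison of the measures of superlevel sets. -/
theorem lintegral_le_of_measure_lt_le {X Y : Type*} [MeasurableSpace X] [MeasurableSpace Y]
    (μ : Measure X) (ν : Measure Y) [SFinite μ] [SFinite ν] {g : X → ℝ≥0∞} {h : Y → ℝ≥0∞}
    (hg : Measurable g) (hh : Measurable h) (c : ℝ≥0∞)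
    (H : ∀ t : ℝ, 0 < t → μ {x | ENNReal.ofReal t < g x} ≤ c * ν {y | ENNReal.ofReal t < h y}) :
    ∫⁻ x, g x ∂μ ≤ c * ∫⁻ y, h y ∂ν := by
  rw [lintegral_eq_lintegral_measure_lt μ hg, lintegral_eq_lintegral_measure_lt ν hh,
    ← lintegral_const_mul]
  · exact setLIntegral_mono' measurableSet_Ioi H
  · have hs : MeasurableSet {p : ℝ × Y | ENNReal.ofReal p.1 < h p.2} :=
      measurableSet_lt (ENNReal.measurable_ofReal.comp measurable_fst) (hh.comp measurable_snd)
    exact measurable_measure_prodMk_left hs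

/-- A ball of radius `r` about any `z` within `r/2` of `v` contains `v`, so `φ v ≤ φ z + ballOsc φ r
z`; integrate over these `z`. This is the source of the supremum bound for `φ`. -/
theorem GoodPoint.mul_volume_le {φ : Eucl m → ℝ≥0∞} (hφ : Measurable φ) {v : Eucl m}
    (hv : GoodPoint φ v) {r : ℝ} (hr : 0 < r) :
    φ v * volume (Metric.closedBall v (r / 2)) ≤ ∫⁻ z, (φ z + ballOsc φ r z) := by
  rw [← setLIntegral_const]
  refine le_trans (setLIntegral_mono_ae' Metric.isClosed_closedBall.measurableSet ?_)
    (setLIntegral_le_lintegral (Metric.closedBall v (r / 2)) _)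
  filter_upwards [ae_goodPoint hφ] with z hz hzv
  refine hv.le_add_ballOsc hz ?_ (by simpa)
  rw [Metric.mem_closedBall] at hzv
  linarith
end

/-! ### Majorants along the fibres of a map that need not be injective. -/

section

variable {m : ℕ}

theorem HasStrictFDerivAt.exists_injOn {F : Eucl m → Eucl m} {F' : Eucl m →L[ℝ] Eucl m}
    {y : Eucl m} (h : HasStrictFDerivAt F F' y) (hd : F'.det ≠ 0) :
    ∃ V : Set (Eucl m), IsOpen V ∧ y ∈ V ∧ InjOn F V := by
  have h' : HasStrictFDerivAt F
      ((F'.toContinuousLinearEquivOfDetNeZero hd : Eucl m ≃L[ℝ] Eucl m) : Eucl m →L[ℝ] Eucl m) y := by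
    simpa using h
  refine ⟨(h'.toOpenPartialHomeomorph F).source, (h'.toOpenPartialHomeomorph F).open_source,
    h'.mem_toOpenPartialHomeomorph_source, ?_⟩
  have := (h'.toOpenPartialHomeomorph F).injOn
  rwa [h'.toOpenPartialHomeomorph_coe] at this

/-- A measurable function that dominates `c` along the fibres of `F`, with an integral bounded by
the change of variables formula. -/
theorem exists_measurable_fiber_majorant {F : Eucl m → Eucl m} {F' : Eucl m → Eucl m →L[ℝ] Eucl m}
    {E : Set (Eucl m)} (hE : MeasurableSet E) (hF : ∀ y ∈ E, HasStrictFDerivAt F (F' y) y)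
    (hd : ∀ y ∈ E, (F' y).det ≠ 0) {c : Eucl m → ℝ≥0∞} (hc : Measurable c) :
    ∃ G : Eucl m → ℝ≥0∞, Measurable G ∧ (∀ y ∈ E, c y ≤ G (F y)) ∧
      ∫⁻ x, G x ≤ ∫⁻ y in E, ENNReal.ofReal |(F' y).det| * c y := by
  -- Countably many domains of injectivity, made disjoint, cover `E`. The majorant sums `c` over the
  -- preimages found in the separate pieces, and change of variables applies on each piece.
  choose! V hVo hyV hVi using fun y hy => (hF y hy).exists_injOn (hd y hy)
  obtain ⟨t, htE, htc, htV⟩ := TopologicalSpace.countable_cover_nhdsWithin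
    (fun y hy => mem_nhdsWithin_of_mem_nhds ((hVo y hy).mem_nhds (hyV y hy)))
  rcases t.eq_empty_or_nonempty with rfl | htn
  · have : E = ∅ := by simpa using htV
    subst this
    exact ⟨0, measurable_zero, fun y hy => hy.elim, by simp⟩
  obtain ⟨v, hv⟩ := htc.exists_eq_range htn
  set D : ℕ → Set (Eucl m) := fun n => E ∩ disjointed (fun n => V (v n)) n with hD
  have hvE : ∀ n, v n ∈ E := fun n => htE (hv ▸ mem_range_self n)
  have hDm : ∀ n, MeasurableSet (D n) := fun n =>
    hE.inter (MeasurableSet.disjointed (fun n => (hVo _ (hvE n)).measurableSet) n)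
  have hDE : ∀ n, D n ⊆ E := fun n => inter_subset_left
  have hDi : ∀ n, InjOn F (D n) := fun n =>
    (hVi _ (hvE n)).mono (inter_subset_right.trans (disjointed_subset _ n))
  have hDd : Pairwise (Function.onFun Disjoint D) := fun i j hij =>
    ((disjoint_disjointed _) hij).mono inter_subset_right inter_subset_right
  have hDU : ⋃ n, D n = E := by
    rw [hD, ← inter_iUnion, iUnion_disjointed, inter_eq_left]
    refine htV.trans ?_
    rw [hv]
    intro z hz
    simpa using hz
  have hemb : ∀ n, MeasurableEmbedding ((D n).domRestrict F) := fun n =>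
    ContinuousOn.measurableEmbedding (hDm n)
      (fun y hy => (hF y (hDE n hy)).continuousAt.continuousWithinAt) (hDi n)
  set g : ℕ → Eucl m → ℝ≥0∞ := fun n =>
    Function.extend ((D n).domRestrict F) (fun y => c y) 0 with hgdef
  have hgm : ∀ n, Measurable (g n) := fun n =>
    (hemb n).measurable_extend (hc.comp measurable_subtype_coe) measurable_zero
  have hgF : ∀ n, ∀ y ∈ D n, g n (F y) = c y := fun n y hy =>
    (hemb n).injective.extend_apply (fun y : D n => c y) 0 ⟨y, hy⟩
  have hg0 : ∀ n, ∀ x ∉ F '' D n, g n x = 0 := by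
    intro n x hx
    refine Function.extend_apply' _ _ _ ?_
    rintro ⟨y, rfl⟩
    exact hx ⟨y, y.2, rfl⟩
  have hpt : ∀ y ∈ E, c y ≤ ∑' n, g n (F y) := by
    intro y hy
    obtain ⟨n, hn⟩ := mem_iUnion.1 (hDU.symm ▸ hy : y ∈ ⋃ n, D n)
    exact (hgF n y hn).symm.le.trans (ENNReal.le_tsum n)
  refine ⟨fun x => ∑' n, g n x, Measurable.tsum hgm, hpt, le_of_eq ?_⟩
  calc ∫⁻ x, ∑' n, g n x
    _ = ∑' n, ∫⁻ x, g n x := lintegral_tsum fun n => (hgm n).aemeasurable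
    _ = ∑' n, ∫⁻ y in D n, ENNReal.ofReal |(F' y).det| * c y := by
        congr 1
        ext n
        have h1 : ∫⁻ x, g n x = ∫⁻ x in F '' D n, g n x :=
          (setLIntegral_eq_of_support_subset fun x hx => by_contra fun h => hx (hg0 n x h)).symm
        rw [h1, lintegral_image_eq_lintegral_abs_det_fderiv_mul volume (hDm n)
          (fun y hy => (hF y (hDE n hy)).hasFDerivAt.hasFDerivWithinAt) (hDi n)]
        exact setLIntegral_congr_fun (hDm n) fun y hy => by rw [hgF n y hy]
    _ = ∫⁻ y in E, ENNReal.ofReal |(F' y).det| * c y := by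
        rw [← lintegral_iUnion hDm hDd, hDU]
end

/-! ### Volume of the collars of a smooth hypersurface. -/

section

/-- Near a boundary point, a domain with smooth boundary is the sublevel set of a function which is
nearly affine, in a form that is uniform in the point. -/
theorem HasSmoothBoundary.exists_uniform {m : ℕ} {R : Set (Eucl m)} (hR : HasSmoothBoundary R)
    (hRo : IsOpen R) (hc : IsCompact (frontier R)) {c : ℝ} (hc0 : 0 < c) :
    ∃ δ > 0, ∀ b ∈ frontier R, ∃ φ : Eucl m → ℝ, ∃ L : Eucl m →L[ℝ] ℝ, L ≠ 0 ∧
      (∀ x ∈ Metric.ball b δ, x ∈ R ↔ φ x < 0) ∧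
      (∀ x ∈ Metric.ball b δ, x ∈ frontier R → φ x = 0) ∧
      ∀ x ∈ Metric.ball b δ, ∀ y ∈ Metric.ball b δ,
        |φ y - φ x - L (y - x)| ≤ c * ‖L‖ * ‖y - x‖ := by
  have hloc : ∀ q ∈ frontier R, ∃ W : Set (Eucl m), IsOpen W ∧ q ∈ W ∧
      ∃ φ : Eucl m → ℝ, ∃ L : Eucl m →L[ℝ] ℝ, L ≠ 0 ∧
      (∀ x ∈ W, x ∈ R ↔ φ x < 0) ∧ (∀ x ∈ W, x ∈ frontier R → φ x = 0) ∧
      ∀ x ∈ W, ∀ y ∈ W, |φ y - φ x - L (y - x)| ≤ c * ‖L‖ * ‖y - x‖ := by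
    intro q hq
    obtain ⟨V, hVo, hqV, φ, hφ, hφ0, hφR⟩ := hR q hq
    have hL : 0 < ‖fderiv ℝ φ q‖ := norm_pos_iff.2 (hφ0 q hqV)
    have hcont : ContinuousAt (fderiv ℝ φ) q :=
      (hφ.continuousOn_fderiv_of_isOpen hVo le_rfl).continuousAt (hVo.mem_nhds hqV)
    have hev : ∀ᶠ x in 𝓝 q, x ∈ V ∧ ‖fderiv ℝ φ x - fderiv ℝ φ q‖ < c * ‖fderiv ℝ φ q‖ := by
      refine Filter.Eventually.and (hVo.eventually_mem hqV) ?_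
      have := Metric.continuousAt_iff'.1 hcont (c * ‖fderiv ℝ φ q‖) (by positivity)
      simpa [dist_eq_norm] using this
    obtain ⟨ρ, hρ, hball⟩ := Metric.eventually_nhds_iff_ball.1 hev
    have hmemR : ∀ x ∈ V, x ∈ R ↔ φ x < 0 := fun x hx =>
      ⟨fun h => (hφR.subset ⟨h, hx⟩).2, fun h => (hφR.symm.subset ⟨hx, h⟩).1⟩
    refine ⟨Metric.ball q ρ, Metric.isOpen_ball, Metric.mem_ball_self hρ, φ, fderiv ℝ φ q,
      hφ0 q hqV, fun x hx => hmemR x (hball x hx).1, fun x hx hxf => ?_, fun x hx y hy => ?_⟩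
    -- A positive value at a frontier point would keep nearby points out of `R`; a negative one
    -- would put the point into the open set `R`.
    · have hxV := (hball x hx).1
      refine le_antisymm ?_ (not_lt.1 fun h => ?_)
      · by_contra! hpos
        have h1 : ∀ᶠ z in 𝓝 x, 0 < φ z :=
          (hφ.continuousOn.continuousAt (hVo.mem_nhds hxV)).eventually_const_lt hpos
        have h2 := mem_closure_iff_frequently.1 (frontier_subset_closure hxf)
        obtain ⟨z, hz1, hz2, hz3⟩ := (h2.and_eventually (h1.and (hVo.mem_nhds hxV))).exists
        exact absurd ((hmemR z hz3).1 hz1) (not_lt.2 hz2.le)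
      · rw [hRo.frontier_eq] at hxf
        exact hxf.2 ((hmemR x hxV).2 h)
    · have := (convex_ball q ρ).norm_image_sub_le_of_norm_fderiv_le' (𝕜 := ℝ) (f := φ)
        (φ := fderiv ℝ φ q) (C := c * ‖fderiv ℝ φ q‖)
        (fun z hz => (hφ.differentiableOn one_ne_zero).differentiableAt
          (hVo.mem_nhds (hball z hz).1)) (fun z hz => (hball z hz).2.le) hx hy
      simpa using this
  choose! W hWo hqW hW using hloc
  obtain ⟨δ, hδ, hleb⟩ := lebesgue_number_lemma_of_metric (ι := frontier R) hc
    (fun q : frontier R => hWo q q.2) (fun q hq => mem_iUnion.2 ⟨⟨q, hq⟩, hqW q hq⟩)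
  refine ⟨δ, hδ, fun b hb => ?_⟩
  obtain ⟨q, hq⟩ := hleb b hb
  obtain ⟨φ, L, hL, h1, h2, h3⟩ := hW q q.2
  exact ⟨φ, L, hL, fun x hx => h1 x (hq hx), fun x hx => h2 x (hq hx),
    fun x hx y hy => h3 x (hq hx) y (hq hy)⟩

theorem exists_unit_eq_norm {m : ℕ} {L : Eucl m →L[ℝ] ℝ} (hL : L ≠ 0) :
    ∃ e : Eucl m, ‖e‖ = 1 ∧ L e = ‖L‖ := by
  set v := (InnerProductSpace.toDual ℝ (Eucl m)).symm L with hv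
  have hvL : ‖v‖ = ‖L‖ := by simp [hv]
  have hL0 : ‖L‖ ≠ 0 := norm_ne_zero_iff.2 hL
  have hLv : L v = ‖L‖ ^ 2 := by
    have := InnerProductSpace.toDual_symm_apply (𝕜 := ℝ) (E := Eucl m) (x := v) (y := L)
    rw [← this, ← hv, real_inner_self_eq_norm_sq, hvL]
  refine ⟨‖L‖⁻¹ • v, ?_, ?_⟩
  · rw [norm_smul, hvL, norm_inv, norm_norm, inv_mul_cancel₀ hL0]
  · rw [map_smul, hLv, smul_eq_mul]
    field_simp

/-- Volume of the part of a one-sided collar of a smooth surface that lies in a small ball. -/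
theorem HasSmoothBoundary.volume_collar_le {k : ℕ} {R : Set (Eucl (k + 1))}
    (hR : HasSmoothBoundary R) (hRo : IsOpen R) (hc : IsCompact (frontier R)) {κ : ℝ}
    (hκ : 0 < κ) :
    ∃ ρ > 0, ∀ ε r : ℝ, 0 ≤ ε → 0 ≤ r → ε + r ≤ ρ → ∀ w,
      volume (R ∩ Metric.cthickening ε (frontier R) ∩ Metric.closedBall w r) ≤
        ENNReal.ofReal ((1 + κ) * ε) * volume (Metric.closedBall (0 : Eucl k) r) ∧
      volume (Metric.cthickening ε (frontier R) \ R ∩ Metric.closedBall w r) ≤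
        ENNReal.ofReal ((1 + κ) * ε) * volume (Metric.closedBall (0 : Eucl k) r) := by
  -- Chosen so that `(1 + c)/(1 - c) = 1 + κ`.
  set c := κ / (κ + 2) with hcdef
  have hc0 : 0 < c := by positivity
  have hc1 : c < 1 := by rw [hcdef, div_lt_one (by positivity)]; linarith
  have hcκ : (1 + c) = (1 + κ) * (1 - c) := by rw [hcdef]; field_simp; ring
  obtain ⟨δ, hδ, hloc⟩ := hR.exists_uniform hRo hc hc0
  refine ⟨δ / 3, by positivity, fun ε r hε hr hle w => ?_⟩
  have main : ∀ B : Set (Eucl (k + 1)), MeasurableSet B →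
      B ⊆ Metric.cthickening ε (frontier R) → B ⊆ Metric.closedBall w r →
      (B ⊆ R ∨ B ⊆ Rᶜ) →
      volume B ≤ ENNReal.ofReal ((1 + κ) * ε) * volume (Metric.closedBall (0 : Eucl k) r) := by
    intro B hBm hB1 hB2 hB3
    rcases B.eq_empty_or_nonempty with rfl | ⟨x₀, hx₀⟩
    · simp
    have hnear : ∀ x ∈ B, ∃ b ∈ frontier R, dist x b ≤ ε := by
      intro x hx
      have h1 := hB1 hx
      rw [hc.cthickening_eq_biUnion_closedBall hε] at h1
      simpa using h1
    obtain ⟨b₀, hb₀, hxb₀⟩ := hnear x₀ hx₀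
    obtain ⟨φ, L, hL, hφR, hφ0, hφL⟩ := hloc b₀ hb₀
    obtain ⟨e, he, hLe⟩ := exists_unit_eq_norm hL
    have hL0 : 0 < ‖L‖ := norm_pos_iff.2 hL
    have hBball : ∀ x ∈ B, dist x b₀ ≤ 2 * r + ε := fun x hx => by
      have h1 := hB2 hx
      have h2 := hB2 hx₀
      rw [Metric.mem_closedBall] at h1 h2
      linarith [dist_triangle x w b₀, dist_triangle w x₀ b₀, dist_comm w x₀]
    have hBδ : ∀ x ∈ B, x ∈ Metric.ball b₀ δ := fun x hx => by
      rw [Metric.mem_ball]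
      linarith [hBball x hx]
    have hval : ∀ x ∈ B, |φ x| ≤ (1 + c) * ‖L‖ * ε := by
      intro x hx
      obtain ⟨b, hb, hxb⟩ := hnear x hx
      have hbδ : b ∈ Metric.ball b₀ δ := by
        rw [Metric.mem_ball]
        linarith [hBball x hx, dist_triangle b x b₀, dist_comm b x]
      have h1 := hφL b hbδ x (hBδ x hx)
      rw [hφ0 b hbδ hb, sub_zero] at h1
      have h2 := L.le_opNorm (x - b)
      rw [Real.norm_eq_abs] at h2
      have h3 : |φ x| ≤ |φ x - L (x - b)| + |L (x - b)| := by
        simpa using abs_add_le (φ x - L (x - b)) (L (x - b))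
      rw [dist_eq_norm] at hxb
      calc |φ x| ≤ (1 + c) * ‖L‖ * ‖x - b‖ := by linarith
        _ ≤ _ := by gcongr
    refine volume_thin_le he hBm hr hB2 fun u hu h huh => ?_
    have h1 := hφL u (hBδ u hu) _ (hBδ _ huh)
    rw [add_sub_cancel_left, map_smul, hLe, smul_eq_mul, norm_smul, he, mul_one,
      Real.norm_eq_abs] at h1
    -- On one side of the surface `φ` has constant sign, so two values bounded by the same constant
    -- differ by at most this constant and not by twice as much. Along the gradient direction `e`
    -- this limits the thickness to `(1 + κ) ε`.
    have h2 : |φ (u + h • e) - φ u| ≤ (1 + c) * ‖L‖ * ε := by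
      have a1 := abs_le.1 (hval u hu)
      have a2 := abs_le.1 (hval _ huh)
      rcases hB3 with hB3 | hB3
      · have b1 := (hφR u (hBδ u hu)).1 (hB3 hu)
        have b2 := (hφR _ (hBδ _ huh)).1 (hB3 huh)
        rw [abs_le]; constructor <;> linarith
      · have b1 := not_lt.1 fun h => hB3 hu ((hφR u (hBδ u hu)).2 h)
        have b2 := not_lt.1 fun h => hB3 huh ((hφR _ (hBδ _ huh)).2 h)
        rw [abs_le]; constructor <;> linarith
    have h3 : |h * ‖L‖| ≤ |φ (u + h • e) - φ u| + |φ (u + h • e) - φ u - h * ‖L‖| := by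
      have := abs_sub_abs_le_abs_sub (h * ‖L‖) (φ (u + h • e) - φ u)
      rw [abs_sub_comm (h * ‖L‖) _] at this
      linarith
    rw [abs_mul, abs_of_pos hL0] at h3
    have h4 : (1 - c) * ‖L‖ * |h| ≤ (1 - c) * ‖L‖ * ((1 + κ) * ε) := by
      calc (1 - c) * ‖L‖ * |h| ≤ (1 + c) * ‖L‖ * ε := by linarith
        _ = _ := by rw [hcκ]; ring
    exact le_of_mul_le_mul_left h4 (mul_pos (by linarith) hL0)
  have hcl : MeasurableSet (Metric.cthickening ε (frontier R)) :=
    Metric.isClosed_cthickening.measurableSet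
  exact ⟨main _ ((hRo.measurableSet.inter hcl).inter Metric.isClosed_closedBall.measurableSet)
      (fun x hx => hx.1.2) (fun x hx => hx.2) (Or.inl fun x hx => hx.1.1),
    main _ ((hcl.diff hRo.measurableSet).inter Metric.isClosed_closedBall.measurableSet)
      (fun x hx => hx.1.1) (fun x hx => hx.2) (Or.inr fun x hx => hx.1.2)⟩
end

/-! ### Integrals of local suprema against a measure of small density. -/

section

/-- The first member of a dense sequence of `G` within distance `σ` is a measurable choice;
strictness of the inequality ensures that the sequence has such a member whenever `G` does. -/
theorem exists_measurable_nearby {m : ℕ} {G : Set (Eucl m)} (hG : G.Nonempty) {σ : ℝ} :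
    ∃ v : Eucl m → Eucl m, Measurable v ∧ (∀ y, v y ∈ G) ∧
      ∀ y, (∃ g ∈ G, dist y g < σ) → dist y (v y) < σ := by
  classical
  obtain ⟨t, htG, htc, htd⟩ := (TopologicalSpace.IsSeparable.of_separableSpace
    G).exists_countable_dense_subset
  have htn : t.Nonempty := by
    obtain ⟨g, hg⟩ := hG
    exact closure_nonempty_iff.1 ⟨g, htd hg⟩
  obtain ⟨g, rfl⟩ := htc.exists_eq_range htn
  have hp : ∀ y, ∃ n, dist y (g n) < σ ∨ ∀ k, ¬ dist y (g k) < σ := by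
    intro y
    by_cases h : ∃ k, dist y (g k) < σ
    · obtain ⟨k, hk⟩ := h
      exact ⟨k, Or.inl hk⟩
    · exact ⟨0, Or.inr (not_exists.1 h)⟩
  have hms : ∀ n, MeasurableSet {y | dist y (g n) < σ} := fun n =>
    measurableSet_lt (measurable_id.dist measurable_const) measurable_const
  have hm : Measurable fun y => Nat.find (hp y) := by
    have : {y | ∀ k, ¬ dist y (g k) < σ} = ⋂ k, {y | dist y (g k) < σ}ᶜ := by
      ext y; simp
    have h2 : MeasurableSet {y | ∀ k, ¬ dist y (g k) < σ} := by
      rw [this]; exact MeasurableSet.iInter fun k => (hms k).compl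
    exact measurable_find hp fun n => (hms n).union h2
  refine ⟨fun y => g (Nat.find (hp y)), (measurable_from_top (f := g)).comp hm,
    fun y => htG (mem_range_self _), fun y hy => ?_⟩
  obtain ⟨w, hw, hyw⟩ := hy
  have h1 : ∃ k, dist y (g k) < σ := by
    have h2 := Metric.mem_closure_iff.1 (htd hw) (σ - dist y w) (by linarith)
    obtain ⟨_, ⟨k, rfl⟩, hk⟩ := h2
    exact ⟨k, by linarith [dist_triangle y w (g k)]⟩
  rcases Nat.find_spec (hp y) with h | h
  · exact h
  · exact absurd h1 (not_exists.2 h)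

/-- Local suprema, integrated against a measure whose mass in balls about points of `M` is small,
are controlled by local suprema integrated against Lebesgue measure. -/
theorem eventually_lintegral_ballSup_le (k : ℕ) {s : ℝ} (hs0 : 0 < s) (hs1 : s < 1)
    (hq : 3 * s * unitBallVol k / ((1 - s) * unitBallVol (k + 1)) < 1 - s) :
    ∀ᶠ s₁ in 𝓝[>] s, ∀ ε₀ σ : ℝ, 0 < ε₀ → 0 < σ → σ ≤ s₁ * ε₀ →
      ∀ (μ : Measure (Eucl (k + 1))) [IsFiniteMeasure μ] (M Y Z : Set (Eucl (k + 1)))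
        (θ : ℝ≥0∞) (φ : Eucl (k + 1) → ℝ≥0∞), MeasurableSet M → MeasurableSet Y →
        MeasurableSet Z → Measurable φ → μ Yᶜ = 0 →
        (∀ y ∈ Y, Metric.ball y ε₀ ⊆ Z) →
        (∀ v ∈ M, ∀ r, (1 - s) * ε₀ ≤ r → r ≤ 3 * ε₀ →
          μ (Metric.closedBall v r) ≤ θ * volume (Metric.closedBall (0 : Eucl (k + 1)) r)) →
        ∫⁻ y, ballSup (M.indicator φ) σ y ∂μ ≤ 2 * θ * ∫⁻ z in Z, ballSup φ ε₀ z := by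
  filter_upwards [eventually_packing k hs0 hs1 hq] with s₁ hs₁ ε₀ σ hε₀ hσ hσε μ _ M Y Z θ φ
    hM hY hZ hφ hμY hYZ hgr
  refine lintegral_le_of_measure_lt_le _ _ (measurable_ballSup (hφ.indicator hM) σ)
    (measurable_ballSup hφ ε₀) _ fun t ht => ?_
  set V : Set (Eucl (k + 1)) := {z | ENNReal.ofReal t < M.indicator φ z} with hVdef
  have hV : MeasurableSet V := measurableSet_lt measurable_const (hφ.indicator hM)
  have hVM : ∀ z ∈ V, z ∈ M ∧ ENNReal.ofReal t < φ z := by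
    intro z hz
    by_cases hzM : z ∈ M
    · exact ⟨hzM, by simpa [hVdef, hzM] using hz⟩
    · simp [hVdef, hzM] at hz
  -- The part of the superlevel set that is detected, with positive volume, by every ball containing
  -- the point in its interior. Passing to it discards a null set only.
  set G : Set (Eucl (k + 1)) :=
    {v | v ∈ V ∧ ∀ y r, dist y v < r → 0 < volume (V ∩ Metric.closedBall y r)} with hGdef
  have hGae : ∀ᵐ v, v ∈ V → v ∈ G := (ae_forall_measure_inter_pos hV).mono
    fun v hv hvV => ⟨hvV, hv hvV⟩
  set A : Set (Eucl (k + 1)) := {y | ENNReal.ofReal t < ballSup (M.indicator φ) σ y} ∩ Y with hA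
  have hAm : MeasurableSet A :=
    (measurableSet_lt measurable_const (measurable_ballSup (hφ.indicator hM) σ)).inter hY
  have hAμ : μ {y | ENNReal.ofReal t < ballSup (M.indicator φ) σ y} ≤ μ A := by
    rw [hA, measure_inter_conull hμY]
  refine hAμ.trans ?_
  have hAG : ∀ y ∈ A, ∃ g ∈ G, dist y g < σ := by
    intro y hy
    have h1 := (lt_ballSup_iff (hφ.indicator hM)).1 hy.1
    -- Spheres are null sets, so a point of `G` strictly closer than `σ` can be found.
    have h2 : volume (V ∩ Metric.ball y σ) ≠ 0 := by
      intro h0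
      refine h1.ne' ?_
      rw [← Metric.ball_union_sphere, inter_union_distrib_left]
      refine measure_union_null h0 (measure_mono_null inter_subset_right ?_)
      exact Measure.addHaar_sphere _ _ _
    by_contra! hc
    refine h2 ?_
    have h3 : volume {v | ¬ (v ∈ V → v ∈ G)} = 0 := ae_iff.1 hGae
    refine measure_mono_null (fun z hz => ?_) h3
    intro himp
    have := hc z (himp hz.1)
    rw [dist_comm] at this
    exact absurd hz.2 (by rw [Metric.mem_ball]; exact not_lt.2 this)
  rcases A.eq_empty_or_nonempty with h0 | ⟨y₀, hy₀⟩
  · rw [h0, measure_empty]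
    exact zero_le
  obtain ⟨g₀, hg₀, -⟩ := hAG y₀ hy₀
  obtain ⟨v, hvm, hvG, hvd⟩ := exists_measurable_nearby (G := G) ⟨g₀, hg₀⟩ (σ := σ)
  have hvA : ∀ y ∈ A, dist y (v y) < σ := fun y hy => hvd y (hAG y hy)
  rw [Measure.restrict_apply (measurableSet_lt measurable_const (measurable_ballSup hφ ε₀))]
  refine hs₁ ε₀ σ hε₀ hσ.le hσε μ A _ v θ hAm (measure_ne_top μ A) hvm
    (fun y hy => (hvA y hy).le) (fun y hy r hr1 hr2 => hgr _ (hVM _ (hvG y).1).1 r hr1 hr2)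
    fun y hy z hz => ?_
  have hyv := hvA y hy
  rw [Metric.mem_closedBall] at hz
  have hmv : dist ((1 / 2 : ℝ) • (y + v y)) (v y) = dist y (v y) / 2 := by
    rw [dist_eq_norm, dist_eq_norm,
      show (1 / 2 : ℝ) • (y + v y) - v y = (1 / 2 : ℝ) • (y - v y) by module, norm_smul]
    norm_num; ring
  have hmy : dist ((1 / 2 : ℝ) • (y + v y)) y = dist y (v y) / 2 := by
    rw [dist_comm y, dist_eq_norm, dist_eq_norm,
      show (1 / 2 : ℝ) • (y + v y) - y = (1 / 2 : ℝ) • (v y - y) by module, norm_smul]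
    norm_num; ring
  -- A point within `ε₀ - σ/2` of the midpoint is at distance less than `ε₀` from both `y` and `v
  -- y`. The first fact puts it into `Z`, the second makes its ball of radius `ε₀` see the level at
  -- `v y`.
  refine ⟨?_, hYZ y hy.2 ?_⟩
  · refine (lt_ballSup_iff hφ).2 (((hvG y).2 z ε₀ ?_).trans_le (measure_mono ?_))
    · linarith [dist_triangle z ((1 / 2 : ℝ) • (y + v y)) (v y)]
    · exact inter_subset_inter_left _ fun z hz => (hVM z hz).2
  · rw [Metric.mem_ball]
    linarith [dist_triangle z ((1 / 2 : ℝ) • (y + v y)) y]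
end

/-! ### Change of variables, averaging over balls, and the variation of one branch. -/

section

variable {m : ℕ}

/-- Change of variables along countably many injective maps with disjoint images. -/
theorem tsum_lintegral_branch_le {ι : Type*} [Countable ι] {B : ι → Set (Eucl m)}
    {Ψ : ι → Eucl m → Eucl m} {Ψ' : ι → Eucl m → Eucl m →L[ℝ] Eucl m} {Z : Set (Eucl m)}
    (hB : ∀ i, MeasurableSet (B i)) (hΨ : ∀ i, ∀ w ∈ B i, HasFDerivAt (Ψ i) (Ψ' i w) w)
    (hinj : ∀ i, InjOn (Ψ i) (B i)) (hdisj : Pairwise fun i j => Disjoint (Ψ i '' B i) (Ψ j '' B j))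
    (hZ : ∀ i, Ψ i '' B i ⊆ Z) (g : Eucl m → ℝ≥0∞) :
    ∑' i, ∫⁻ w in B i, ENNReal.ofReal |(Ψ' i w).det| * g (Ψ i w) ≤ ∫⁻ y in Z, g y := by
  have h1 : ∀ i, ∫⁻ w in B i, ENNReal.ofReal |(Ψ' i w).det| * g (Ψ i w) =
      ∫⁻ y in Ψ i '' B i, g y := fun i =>
    (lintegral_image_eq_lintegral_abs_det_fderiv_mul volume (hB i)
      (fun w hw => (hΨ i w hw).hasFDerivWithinAt) (hinj i) g).symm
  simp only [h1]
  rw [← lintegral_iUnion (fun i => measurable_image_of_fderivWithin (hB i)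
    (fun w hw => (hΨ i w hw).hasFDerivWithinAt) (hinj i)) hdisj]
  exact lintegral_mono_set (iUnion_subset hZ)

/-- Averaging over balls: an integral over a thin set is controlled by the density of this set. -/
theorem lintegral_le_of_thin {H W : Set (Eucl m)} (hH : MeasurableSet H) (hW : MeasurableSet W)
    {r : ℝ} (hr : 0 < r) {β : ℝ≥0∞}
    (hβ : ∀ w, volume (H ∩ Metric.closedBall w r) ≤ β * volume (Metric.closedBall (0 : Eucl m) r))
    {a h : Eucl m → ℝ≥0∞} (hh : Measurable h)
    (hah : ∀ x ∈ H, ∀ᵐ w, w ∈ Metric.closedBall x r → w ∈ W ∧ a x ≤ h w) :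
    ∫⁻ x in H, a x ≤ β * ∫⁻ w in W, h w := by
  set v := volume (Metric.closedBall (0 : Eucl m) r) with hv
  have hv0 : v ≠ 0 := (Metric.measure_closedBall_pos _ _ hr).ne'
  have hvt : v ≠ ∞ := measure_closedBall_lt_top.ne
  have hvx : ∀ x : Eucl m, volume (Metric.closedBall x r) = v := fun x => by
    rw [hv, Measure.addHaar_closedBall_center]
  have hms : MeasurableSet {p : Eucl m × Eucl m | dist p.2 p.1 ≤ r} :=
    measurableSet_le (measurable_snd.dist measurable_fst) measurable_const
  have h1 : ∀ x ∈ H, a x * v ≤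
      ∫⁻ w in W, {p : Eucl m × Eucl m | dist p.2 p.1 ≤ r}.indicator (fun p => h p.2) (x, w) := by
    intro x hx
    calc a x * v = ∫⁻ w in Metric.closedBall x r, a x := by rw [setLIntegral_const, hvx]
      _ ≤ ∫⁻ w in Metric.closedBall x r, W.indicator h w := by
          refine setLIntegral_mono_ae' Metric.isClosed_closedBall.measurableSet ?_
          filter_upwards [hah x hx] with w hw hwx
          rw [indicator_of_mem (hw hwx).1]
          exact (hw hwx).2
      _ = ∫⁻ w, (Metric.closedBall x r).indicator (W.indicator h) w :=
          (lintegral_indicator Metric.isClosed_closedBall.measurableSet _).symm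
      _ = ∫⁻ w, W.indicator ((Metric.closedBall x r).indicator h) w := by
          rw [indicator_indicator, indicator_indicator, inter_comm]
      _ = ∫⁻ w in W, (Metric.closedBall x r).indicator h w := lintegral_indicator hW _
      _ = _ := by
          refine lintegral_congr fun w => ?_
          simp only [indicator, Metric.mem_closedBall, mem_ofPred_eq]
  have h2 : v * ∫⁻ x in H, a x ≤ v * (β * ∫⁻ w in W, h w) := by
    calc v * ∫⁻ x in H, a x = ∫⁻ x in H, a x * v := by
          rw [lintegral_mul_const' _ _ hvt, mul_comm]
      _ ≤ ∫⁻ x in H, ∫⁻ w in W,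
            {p : Eucl m × Eucl m | dist p.2 p.1 ≤ r}.indicator (fun p => h p.2) (x, w) :=
          setLIntegral_mono' hH h1
      _ = ∫⁻ w in W, ∫⁻ x in H,
            {p : Eucl m × Eucl m | dist p.2 p.1 ≤ r}.indicator (fun p => h p.2) (x, w) :=
          lintegral_lintegral_swap
            ((hh.comp measurable_snd).indicator hms).aemeasurable
      _ ≤ ∫⁻ w in W, β * v * h w := by
          refine lintegral_mono fun w => ?_
          have : ∀ x, {p : Eucl m × Eucl m | dist p.2 p.1 ≤ r}.indicator (fun p => h p.2) (x, w) =
              (Metric.closedBall w r).indicator (fun _ => h w) x := fun x => by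
            simp only [indicator, Metric.mem_closedBall, mem_ofPred_eq, dist_comm]
          simp only [this]
          rw [lintegral_indicator_const Metric.isClosed_closedBall.measurableSet,
            Measure.restrict_apply Metric.isClosed_closedBall.measurableSet, inter_comm, mul_comm]
          exact mul_le_mul_left (hβ w) _
      _ = v * (β * ∫⁻ w in W, h w) := by
          rw [lintegral_const_mul _ hh]; ring
  exact (ENNReal.mul_le_mul_iff_right hv0 hvt).1 h2

/-- Variation of one branch of a transfer operator over a ball centred at `x`: `ω` is the weight of
the branch, `Ψ` its inverse map and `C` the set where the branch is present. -/
theorem branch_variation {φ : Eucl m → ℝ≥0∞} {ω : Eucl m → ℝ≥0∞} {Ψ : Eucl m → Eucl m}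
    {C M H : Set (Eucl m)} {x u u' : Eucl m} {σ : ℝ} {a : ℝ≥0∞}
    (h1 : ω u ≤ (1 + a) * ω u') (h2 : ω u ≤ (1 + a) * ω x) (h3 : ω u' ≤ (1 + a) * ω x)
    (hσ : 0 < σ) (hu : dist (Ψ x) (Ψ u) < σ) (hu' : dist (Ψ x) (Ψ u') < σ)
    (hGu : GoodPoint φ (Ψ u)) (hGu' : GoodPoint φ (Ψ u')) (hGx : GoodPoint φ (Ψ x))
    (hMu : φ (Ψ u) ≤ ballSup (M.indicator φ) σ (Ψ x))
    (hH : u ∈ C → (u' ∉ C ∨ x ∉ C) → x ∈ H) :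
    C.indicator (fun z => ω z * φ (Ψ z)) u ≤
      C.indicator (fun z => ω z * φ (Ψ z)) u' + (1 + a) *
        (C.indicator (fun z => ω z * (a * φ (Ψ z) + (1 + 2 * a) * ballOsc φ σ (Ψ z))) x +
        (H.indicator (fun z =>
          C.indicator (fun z => ω z * φ (Ψ z)) z +
          Cᶜ.indicator (fun z => ω z * ballSup (M.indicator φ) σ (Ψ z)) z) x)) := by
  classical
  by_cases hC : u ∈ C
  swap
  · rw [indicator_of_notMem hC]; exact zero_le
  rw [indicator_of_mem hC]
  by_cases hx : x ∈ C
  · have hφx : φ (Ψ u) ≤ φ (Ψ x) + ballOsc φ σ (Ψ x) :=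
      hGu.le_add_ballOsc hGx hu (by simpa)
    by_cases hu'C : u' ∈ C
    · rw [indicator_of_mem hu'C, indicator_of_mem hx]
      refine le_trans ?_ (add_le_add le_rfl (mul_le_mul_right le_self_add (1 + a)))
      have e1 : φ (Ψ u) ≤ φ (Ψ u') + ballOsc φ σ (Ψ x) := hGu.le_add_ballOsc hGu' hu hu'
      have e2 : φ (Ψ u') ≤ φ (Ψ x) + ballOsc φ σ (Ψ x) :=
        hGu'.le_add_ballOsc hGx hu' (by simpa)
      generalize ballOsc φ σ (Ψ x) = o at *
      calc ω u * φ (Ψ u) ≤ ((1 + a) * ω u') * (φ (Ψ u') + o) := mul_le_mul' h1 e1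
        _ = ω u' * φ (Ψ u') + ω u' * (a * φ (Ψ u') + (1 + a) * o) := by ring
        _ ≤ ω u' * φ (Ψ u') + (1 + a) * ω x * (a * (φ (Ψ x) + o) + (1 + a) * o) := by gcongr
        _ = _ := by ring
    -- The branch is lost at `u'` but present at the centre, so its whole value is charged to `H`,
    -- still compared with the value of `φ` at the centre.
    · rw [indicator_of_notMem hu'C, zero_add, indicator_of_mem hx,
        indicator_of_mem (hH hC (Or.inl hu'C)), indicator_of_mem hx,
        indicator_of_notMem (by simpa using hx), add_zero]
      generalize ballOsc φ σ (Ψ x) = o at *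
      calc ω u * φ (Ψ u) ≤ ((1 + a) * ω x) * (φ (Ψ x) + o) := mul_le_mul' h2 hφx
        _ ≤ (1 + a) * ω x * (φ (Ψ x) + o) + (1 + a) * ω x * (a * φ (Ψ x) + 2 * a * o) :=
            le_self_add
        _ = _ := by ring
  -- The branch is absent at the centre, and only the local supremum is used for the loss there.
  · rw [indicator_of_notMem hx, indicator_of_mem (hH hC (Or.inr hx)), indicator_of_notMem hx,
      zero_add, zero_add, indicator_of_mem (show x ∈ Cᶜ from hx), ← mul_assoc]
    exact (mul_le_mul' h2 hMu).trans le_add_self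
end

/-! ### Expansion, derivatives and inverse branches of the piecewise smooth map. -/

section

theorem IsC1Holder.continuousAt_fderiv {m : ℕ} {α : ℝ} (hα : 0 < α) {F : Eucl m → Eucl m}
    {Ω : Set (Eucl m)} (hF : IsC1Holder α F Ω) (hΩ : IsOpen Ω) {x : Eucl m} (hx : x ∈ Ω) :
    ContinuousAt (fderiv ℝ F) x := by
  obtain ⟨V, hV, C, hC⟩ := hF.2 x hx
  rw [ContinuousAt, tendsto_iff_norm_sub_tendsto_zero]
  have h1 : Tendsto (fun y => C * dist y x ^ α) (𝓝 x) (𝓝 0) := by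
    have : ContinuousAt (fun y => C * dist y x ^ α) x :=
      continuousAt_const.mul ((continuousAt_id.dist continuousAt_const).rpow_const
        (Or.inr hα.le))
    simpa [ContinuousAt, Real.zero_rpow hα.ne'] using this
  refine squeeze_zero' (Eventually.of_forall fun y => norm_nonneg _) ?_ h1
  filter_upwards [hV, hΩ.mem_nhds hx] with y hy1 hy2
  exact hC y ⟨hy1, hy2⟩ x ⟨mem_of_mem_nhds hV, hx⟩

theorem IsC1Holder.hasStrictFDerivAt {m : ℕ} {α : ℝ} (hα : 0 < α) {F : Eucl m → Eucl m}
    {Ω : Set (Eucl m)} (hF : IsC1Holder α F Ω) (hΩ : IsOpen Ω) {x : Eucl m} (hx : x ∈ Ω) :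
    HasStrictFDerivAt F (fderiv ℝ F x) x :=
  hasStrictFDerivAt_of_hasFDerivAt_of_continuousAt
    ((hΩ.eventually_mem hx).mono fun _ hy =>
      (hF.1.differentiableAt (hΩ.mem_nhds hy)).hasFDerivAt)
    (hF.continuousAt_fderiv hα hΩ hx)

theorem HasFDerivAt.norm_le_of_expanding {m : ℕ} {F : Eucl m → Eucl m}
    {F' : Eucl m →L[ℝ] Eucl m} {x : Eucl m} (h : HasFDerivAt F F' x) {c : ℝ}
    (hc : ∀ᶠ y in 𝓝 x, dist x y ≤ c * dist (F x) (F y)) (v : Eucl m) : ‖v‖ ≤ c * ‖F' v‖ := by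
  have h1 := (h.hasLineDerivAt v).tendsto_slope_zero
  have h2 : Tendsto (fun t : ℝ => c * ‖t⁻¹ • (F (x + t • v) - F x)‖) (𝓝[≠] 0) (𝓝 (c * ‖F' v‖)) :=
    h1.norm.const_mul c
  refine ge_of_tendsto h2 ?_
  have h3 : Tendsto (fun t : ℝ => x + t • v) (𝓝[≠] 0) (𝓝 x) := by
    have : Continuous fun t : ℝ => x + t • v := by fun_prop
    simpa using (this.tendsto 0).mono_left nhdsWithin_le_nhds
  filter_upwards [h3.eventually hc, self_mem_nhdsWithin] with t ht ht0
  have ht0' : 0 < |t| := abs_pos.2 ht0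
  rw [dist_comm, dist_comm (F x), dist_eq_norm, dist_eq_norm, add_sub_cancel_left, norm_smul,
    Real.norm_eq_abs] at ht
  rw [norm_smul, norm_inv, Real.norm_eq_abs, ← mul_assoc, mul_comm c, mul_assoc,
    le_inv_mul_iff₀ ht0']
  exact ht

/-- Such a map sends the unit ball into itself, and the determinant is the ratio of volumes. -/
theorem abs_det_le_one {m : ℕ} {A : Eucl m →L[ℝ] Eucl m} (hA : ‖A‖ ≤ 1) : |A.det| ≤ 1 := by
  have h1 := Measure.addHaar_image_continuousLinearMap volume A (Metric.closedBall (0 : Eucl m) 1)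
  have h2 : A '' Metric.closedBall 0 1 ⊆ Metric.closedBall 0 1 := by
    rintro _ ⟨x, hx, rfl⟩
    rw [mem_closedBall_zero_iff] at hx ⊢
    calc ‖A x‖ ≤ ‖A‖ * ‖x‖ := A.le_opNorm x
      _ ≤ 1 * 1 := by gcongr
      _ = 1 := one_mul 1
  have h3 := measure_mono (μ := volume) h2
  rw [h1] at h3
  have h0 : volume (Metric.closedBall (0 : Eucl m) 1) ≠ 0 :=
    (Metric.measure_closedBall_pos _ _ one_pos).ne'
  by_contra! hc
  have h4 : 1 < ENNReal.ofReal |A.det| := by simpa using hc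
  have h5 : 1 * volume (Metric.closedBall (0 : Eucl m) 1) <
      ENNReal.ofReal |A.det| * volume (Metric.closedBall (0 : Eucl m) 1) :=
    (ENNReal.mul_lt_mul_iff_left h0 measure_closedBall_lt_top.ne).2 h4
  rw [one_mul] at h5
  exact absurd h3 (not_le.2 h5)

theorem det_ne_zero_of_norm_le {m : ℕ} {A : Eucl m →L[ℝ] Eucl m} {c : ℝ}
    (hA : ∀ v, ‖v‖ ≤ c * ‖A v‖) : A.det ≠ 0 := by
  have hinj : Function.Injective A := by
    rw [injective_iff_map_eq_zero]
    intro v hv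
    have := hA v
    rw [hv, norm_zero, mul_zero] at this
    exact norm_le_zero_iff.1 this
  intro h0
  have h1 : LinearMap.det (A : Eucl m →ₗ[ℝ] Eucl m) = 0 := h0
  have h2 := LinearMap.bot_lt_ker_of_det_eq_zero h1
  rw [LinearMap.ker_eq_bot.2 hinj] at h2
  exact lt_irrefl _ h2

namespace PiecewiseSystem

variable {m : ℕ} {S : PiecewiseSystem m} {α η₀ ε₂ I Cξ : ℝ}

/-- All the assumptions on the system. -/
structure Assumptions (S : PiecewiseSystem m) (α η₀ ε₂ I Cξ : ℝ) : Prop where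
  m_pos : 1 ≤ m
  α_pos : 0 < α
  α_lt : α < 1
  standing : S.Standing
  a1 : S.Assumption1 α
  a2 : S.Assumption2
  a3 : S.Assumption3 α η₀ ε₂ I Cξ
  a4 : S.Assumption4 α I Cξ

variable (h : S.Assumptions α η₀ ε₂ I Cξ)
include h

namespace Assumptions

theorem R_subset_TR : S.R ⊆ S.T '' S.R := subset_closure.trans h.a3.closure_R

theorem TR_subset : S.T '' S.R ⊆ S.U S.one := subset_closure.trans h.a3.closure_TR

theorem R_subset : S.R ⊆ S.U S.one := h.R_subset_TR.trans h.TR_subset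

theorem closure_R_subset : closure S.R ⊆ S.U S.one := h.a3.closure_R.trans h.TR_subset

theorem closure_U_subset (j : Fin S.K) : closure (S.U j) ⊆ S.M := by
  rw [h.a1.cover]; exact subset_iUnion (fun i => closure (S.U i)) j

theorem isCompact_closure_U (j : Fin S.K) : IsCompact (closure (S.U j)) :=
  h.standing.compact.of_isClosed_subset isClosed_closure (h.closure_U_subset j)

theorem isCompact_closure_R : IsCompact (closure S.R) :=
  (h.isCompact_closure_U S.one).of_isClosed_subset isClosed_closure (closure_mono h.R_subset)

theorem eq_of_mem {i j : Fin S.K} {y : Eucl m} (hi : y ∈ S.U i) (hj : y ∈ S.U j) : i = j := by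
  by_contra hne
  exact disjoint_left.1 (h.a1.disjoint_U hne) hi hj

theorem notMem_R_of_ne {j : Fin S.K} (hj : j ≠ S.one) {y : Eucl m} (hy : y ∈ S.U j) : y ∉ S.R :=
  fun hR => hj (h.eq_of_mem hy (h.R_subset hR))

theorem isOpen_U (j : Fin S.K) : IsOpen (S.U j) := h.a1.isOpen_U j

theorem hasStrictFDerivAt_T {j : Fin S.K} {y : Eucl m} (hy : y ∈ S.U j) :
    HasStrictFDerivAt S.T (fderiv ℝ S.T y) y :=
  (h.a1.smooth j).hasStrictFDerivAt h.α_pos (h.isOpen_U j) hy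

theorem hasStrictFDerivAt_Tt {j : Fin S.K} {y : Eucl m} (hy : y ∈ S.Ut j) :
    HasStrictFDerivAt (S.Tt j) (fderiv ℝ (S.Tt j) y) y :=
  (h.a1.smooth_ext j).hasStrictFDerivAt h.α_pos (h.a1.isOpen_Ut j) hy

theorem fderiv_Tt {j : Fin S.K} {y : Eucl m} (hy : y ∈ S.U j) :
    fderiv ℝ (S.Tt j) y = fderiv ℝ S.T y :=
  Filter.EventuallyEq.fderiv_eq ((h.a1.extends_T j).eventuallyEq_of_mem
    ((h.isOpen_U j).mem_nhds hy))

/-- The rate is an infimum, so the metric inequality holds near `y` for every larger constant;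
differentiate it and let the constant decrease. Away from `p` the admissible distance is positive.
-/
theorem norm_le_of_rate_le {j : Fin S.K} {y : Eucl m} (hy : y ∈ S.U j) (hyp : y ≠ S.p) {σ : ℝ}
    (hσ : 0 ≤ σ) (hr : S.rate S.T (S.U j) y ≤ ENNReal.ofReal σ) (v : Eucl m) :
    ‖v‖ ≤ σ * ‖fderiv ℝ S.T y v‖ := by
  have key : ∀ σ' > σ, ‖v‖ ≤ σ' * ‖fderiv ℝ S.T y v‖ := by
    intro σ' hσ'
    refine (h.hasStrictFDerivAt_T hy).hasFDerivAt.norm_le_of_expanding ?_ v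
    have h1 : S.rate S.T (S.U j) y < ENNReal.ofReal σ' :=
      hr.trans_lt ((ENNReal.ofReal_lt_ofReal_iff (hσ.trans_lt hσ')).2 hσ')
    obtain ⟨t, ht, htσ⟩ := sInf_lt_iff.1 h1
    have hpos : 0 < min S.ε₁ (dist y S.p / 10) :=
      lt_min h.a1.ε₁_pos (div_pos (dist_pos.2 hyp) (by norm_num))
    filter_upwards [(h.isOpen_U j).mem_nhds hy, Metric.closedBall_mem_nhds y hpos] with z hz1 hz2
    have h2 := (ht z hz1 (by rwa [Metric.mem_closedBall, dist_comm] at hz2)).trans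
      (mul_le_mul_left htσ.le _)
    rw [edist_dist, edist_dist, ← ENNReal.ofReal_mul (hσ.trans hσ'.le)] at h2
    exact (ENNReal.ofReal_le_ofReal_iff (mul_nonneg (hσ.trans hσ'.le) dist_nonneg)).1 h2
  refine le_of_forall_pos_le_add fun e he => ?_
  set A := ‖fderiv ℝ S.T y v‖
  have hA : 0 ≤ A := norm_nonneg _
  have h1 := key (σ + e / (A + 1)) (by linarith [div_pos he (by linarith : 0 < A + 1)])
  have h2 : e / (A + 1) * A ≤ e := by
    rw [div_mul_eq_mul_div, div_le_iff₀ (by linarith)]; nlinarith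
  nlinarith

theorem ne_p_of_notMem {y : Eucl m} (hy : y ∉ S.R) : y ≠ S.p := fun hp => hy (hp ▸ h.a3.mem_R)

theorem iSup_rate_le : (⨆ i, ⨆ x ∈ S.U i \ S.R, S.rate S.T (S.U i) x) ≤ 1 :=
  iSup_le fun i => iSup₂_le fun x hx => h.a3.rate_le i x hx.1 (h.ne_p_of_notMem hx.2)

theorem s_nonneg : 0 ≤ S.s := ENNReal.toReal_nonneg

theorem rate_le_s {j : Fin S.K} {y : Eucl m} (hy : y ∈ S.U j) (hyR : y ∉ S.R) :
    S.rate S.T (S.U j) y ≤ ENNReal.ofReal S.s := by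
  rw [s, ENNReal.ofReal_toReal (h.iSup_rate_le.trans_lt ENNReal.one_lt_top).ne]
  exact le_iSup_of_le j (le_iSup₂_of_le y ⟨hy, hyR⟩ le_rfl)

theorem norm_le_s {j : Fin S.K} {y : Eucl m} (hy : y ∈ S.U j) (hyR : y ∉ S.R) (v : Eucl m) :
    ‖v‖ ≤ S.s * ‖fderiv ℝ S.T y v‖ :=
  h.norm_le_of_rate_le hy (h.ne_p_of_notMem hyR) h.s_nonneg (h.rate_le_s hy hyR) v

theorem nontrivial : Nontrivial (Eucl m) := by
  obtain ⟨k, rfl⟩ : ∃ k, m = k + 1 := ⟨m - 1, by have := h.m_pos; omega⟩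
  infer_instance

/-- At the fixed point, where no rate is available, the bound follows from continuity of the
derivative and the bound at nearby points. -/
theorem norm_le_one {j : Fin S.K} {y : Eucl m} (hy : y ∈ S.U j) (v : Eucl m) :
    ‖v‖ ≤ ‖fderiv ℝ S.T y v‖ := by
  have key : ∀ z ∈ S.U j, z ≠ S.p → ‖v‖ ≤ ‖fderiv ℝ S.T z v‖ := fun z hz hzp => by
    simpa using h.norm_le_of_rate_le hz hzp zero_le_one (by simpa using h.a3.rate_le j z hz hzp) v
  by_cases hyp : y = S.p
  · have := h.nontrivial
    have hc : ContinuousAt (fun z => ‖fderiv ℝ S.T z v‖) y :=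
      (((h.a1.smooth j).continuousAt_fderiv h.α_pos (h.isOpen_U j) hy).clm_apply
        continuousAt_const).norm
    refine ge_of_tendsto (hc.tendsto.mono_left (nhdsWithin_le_nhds (s := {y}ᶜ))) ?_
    filter_upwards [self_mem_nhdsWithin,
      mem_nhdsWithin_of_mem_nhds ((h.isOpen_U j).mem_nhds hy)] with z hz1 hz2
    exact key z hz2 fun hz => hz1 (by rw [mem_singleton_iff, hz, hyp])
  · exact key y hy hyp

theorem det_fderiv_T_ne_zero {j : Fin S.K} {y : Eucl m} (hy : y ∈ S.U j) :
    (fderiv ℝ S.T y).det ≠ 0 :=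
  det_ne_zero_of_norm_le (c := 1) fun v => by simpa using h.norm_le_one hy v

/-! Expansion constants. -/

theorem lam_ne_top : S.lam α ε₂ ≠ ∞ := by
  intro hc
  have := h.a3.rate_lam
  rw [hc, add_top, top_le_iff] at this
  exact ENNReal.ofReal_ne_top this

theorem rpow_s_add_lam_le : S.s ^ α + (S.lam α ε₂).toReal ≤ η₀ := by
  have h1 := h.a3.rate_lam
  rw [← ENNReal.ofReal_toReal h.lam_ne_top,
    ← ENNReal.ofReal_add (Real.rpow_nonneg h.s_nonneg _) ENNReal.toReal_nonneg] at h1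
  exact (ENNReal.ofReal_le_ofReal_iff h.a3.η₀_mem.1.le).1 h1

theorem s_lt_one : S.s < 1 := by
  by_contra! hc
  have h1 := Real.one_le_rpow hc h.α_pos.le
  have h2 := h.rpow_s_add_lam_le
  have h3 : 0 ≤ (S.lam α ε₂).toReal := ENNReal.toReal_nonneg
  linarith [h.a3.η₀_mem.2]

/-- If `s` vanished, every piece would lie in `R`, and `M` would be contained in the closure of `R`,
hence equal to `U_1`. Then `M` would be both open and closed and nonempty, so the whole space,
against `ν(M) = 1`. -/
theorem s_pos : 0 < S.s := by
  by_contra! hc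
  have hs0 : S.s = 0 := le_antisymm hc h.s_nonneg
  have hsub : ∀ i, S.U i ⊆ S.R := by
    intro i x hx
    by_contra hxR
    have h1 := h.a3.rate_pos i x hx (h.ne_p_of_notMem hxR)
    have h2 := h.rate_le_s hx hxR
    rw [hs0, ENNReal.ofReal_zero] at h2
    exact absurd h1 (not_lt.2 h2)
  have hM : S.M ⊆ S.U S.one := by
    rw [h.a1.cover]
    exact iUnion_subset fun i => (closure_mono (hsub i)).trans h.closure_R_subset
  have hMU : S.M = S.U S.one := hM.antisymm (subset_closure.trans (h.closure_U_subset S.one))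
  have hcl : IsClopen S.M := ⟨h.standing.compact.isClosed, hMU ▸ h.isOpen_U S.one⟩
  rcases isClopen_iff.1 hcl with h0 | h0
  · have := h.a2.mem
    rw [← hMU, h0] at this
    exact this
  · have := h.nontrivial
    have : NoncompactSpace (Eucl m) := NormedSpace.noncompactSpace ℝ (Eucl m)
    have h1 := h.standing.volume_eq
    rw [h0, measure_univ_of_isAddLeftInvariant] at h1
    exact ENNReal.top_ne_one h1

theorem packing_ratio_le :
    3 * S.s * unitBallVol (m - 1) / ((1 - S.s) * unitBallVol m) ≤ (S.lam α ε₂).toReal := by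
  have h1 : ENNReal.ofReal (3 * S.s * unitBallVol (m - 1) / ((1 - S.s) * unitBallVol m)) ≤
      S.lam α ε₂ := le_max_right _ _
  exact (ENNReal.ofReal_le_iff_le_toReal h.lam_ne_top).1 h1

/-- The ratio is at most `λ ≤ η₀ - s^α`, and `s ≤ s^α`. This is the smallness of `s` on which the
packing constant depends. -/
theorem packing_ratio_lt :
    3 * S.s * unitBallVol (m - 1) / ((1 - S.s) * unitBallVol m) < 1 - S.s := by
  have h1 := h.packing_ratio_le
  have h2 := h.rpow_s_add_lam_le
  have h3 : S.s ≤ S.s ^ α := by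
    simpa using Real.rpow_le_rpow_of_exponent_ge h.s_pos h.s_lt_one.le h.α_lt.le
  linarith [h.a3.η₀_mem.2]

/-! Inverse branches. -/

theorem mapsTo_branchInv (j : Fin S.K) : MapsTo (S.branchInv j) (S.T '' S.U j) (S.U j) := by
  rintro _ ⟨y, hy, rfl⟩
  exact Function.invFunOn_mem ⟨y, hy, rfl⟩

theorem T_branchInv {j : Fin S.K} {w : Eucl m} (hw : w ∈ S.T '' S.U j) :
    S.T (S.branchInv j w) = w := Function.invFunOn_eq hw

theorem branchInv_T {j : Fin S.K} {y : Eucl m} (hy : y ∈ S.U j) : S.branchInv j (S.T y) = y :=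
  (h.a1.injOn j).leftInvOn_invFunOn hy

theorem injOn_branchInv (j : Fin S.K) : InjOn (S.branchInv j) (S.T '' S.U j) :=
  fun w hw w' hw' he => by rw [← h.T_branchInv hw, ← h.T_branchInv hw', he]

/-- The derivative of `T` as an equivalence. -/
theorem exists_hasStrictFDerivAt_equiv {j : Fin S.K} {y : Eucl m} (hy : y ∈ S.U j) :
    ∃ L : Eucl m ≃L[ℝ] Eucl m, (L : Eucl m →L[ℝ] Eucl m) = fderiv ℝ S.T y ∧
      HasStrictFDerivAt S.T (L : Eucl m →L[ℝ] Eucl m) y ∧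
      HasStrictFDerivAt (S.branchInv j) (L.symm : Eucl m →L[ℝ] Eucl m) (S.T y) := by
  refine ⟨(fderiv ℝ S.T y).toContinuousLinearEquivOfDetNeZero (h.det_fderiv_T_ne_zero hy),
    by simp, ?_, ?_⟩
  · simpa using h.hasStrictFDerivAt_T hy
  · refine HasStrictFDerivAt.to_local_left_inverse (by simpa using h.hasStrictFDerivAt_T hy) ?_
    filter_upwards [(h.isOpen_U j).mem_nhds hy] with z hz using h.branchInv_T hz

theorem isOpen_image {j : Fin S.K} {V : Set (Eucl m)} (hV : IsOpen V) (hVU : V ⊆ S.U j) :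
    IsOpen (S.T '' V) := by
  rw [isOpen_iff_mem_nhds]
  rintro _ ⟨y, hy, rfl⟩
  obtain ⟨L, -, hL, -⟩ := h.exists_hasStrictFDerivAt_equiv (hVU hy)
  rw [← hL.map_nhds_eq_of_equiv]
  exact image_mem_map (hV.mem_nhds hy)

theorem isOpen_TU (j : Fin S.K) : IsOpen (S.T '' S.U j) := h.isOpen_image (h.isOpen_U j) Subset.rfl

theorem isOpen_TR : IsOpen (S.T '' S.R) := h.isOpen_image h.a3.isOpen_R h.R_subset

theorem hasStrictFDerivAt_branchInv {j : Fin S.K} {w : Eucl m} (hw : w ∈ S.T '' S.U j) :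
    HasStrictFDerivAt (S.branchInv j) (fderiv ℝ (S.branchInv j) w) w := by
  obtain ⟨y, hy, rfl⟩ := hw
  obtain ⟨L, -, -, hL⟩ := h.exists_hasStrictFDerivAt_equiv hy
  rwa [hL.hasFDerivAt.fderiv]

theorem continuousOn_branchInv (j : Fin S.K) : ContinuousOn (S.branchInv j) (S.T '' S.U j) :=
  fun _ hw => (h.hasStrictFDerivAt_branchInv hw).continuousAt.continuousWithinAt

theorem norm_fderiv_branchInv_le {j : Fin S.K} {y : Eucl m} (hy : y ∈ S.U j) {c : ℝ} (hc : 0 ≤ c)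
    (hyc : ∀ v, ‖v‖ ≤ c * ‖fderiv ℝ S.T y v‖) : ‖fderiv ℝ (S.branchInv j) (S.T y)‖ ≤ c := by
  obtain ⟨L, hL1, -, hL⟩ := h.exists_hasStrictFDerivAt_equiv hy
  rw [hL.hasFDerivAt.fderiv]
  refine ContinuousLinearMap.opNorm_le_bound _ hc fun w => ?_
  have := hyc (L.symm w)
  rw [← hL1] at this
  simpa using this

theorem norm_fderiv_branchInv_le_one {j : Fin S.K} {w : Eucl m} (hw : w ∈ S.T '' S.U j) :
    ‖fderiv ℝ (S.branchInv j) w‖ ≤ 1 := by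
  obtain ⟨y, hy, rfl⟩ := hw
  exact h.norm_fderiv_branchInv_le hy zero_le_one fun v => by simpa using h.norm_le_one hy v

theorem norm_fderiv_branchInv_le_s {j : Fin S.K} {w : Eucl m} (hw : w ∈ S.T '' S.U j)
    (hR : S.branchInv j w ∉ S.R) : ‖fderiv ℝ (S.branchInv j) w‖ ≤ S.s := by
  obtain ⟨y, hy, rfl⟩ := hw
  rw [h.branchInv_T hy] at hR
  exact h.norm_fderiv_branchInv_le hy h.s_nonneg fun v => h.norm_le_s hy hR v

theorem continuousAt_fderiv_branchInv {j : Fin S.K} {w : Eucl m} (hw : w ∈ S.T '' S.U j) :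
    ContinuousAt (fderiv ℝ (S.branchInv j)) w := by
  have h1 : fderiv ℝ (S.branchInv j) =ᶠ[𝓝 w]
      fun z => (fderiv ℝ S.T (S.branchInv j z)).inverse := by
    filter_upwards [(h.isOpen_TU j).mem_nhds hw]
    rintro _ ⟨y, hy, rfl⟩
    obtain ⟨L, hL1, -, hL⟩ := h.exists_hasStrictFDerivAt_equiv hy
    rw [hL.hasFDerivAt.fderiv, h.branchInv_T hy, ← hL1, ContinuousLinearMap.inverse_equiv]
  refine ContinuousAt.congr ?_ h1.symm
  have h2 : ContinuousAt (fun z => fderiv ℝ S.T (S.branchInv j z)) w :=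
    ContinuousAt.comp (f := S.branchInv j) (g := fderiv ℝ S.T)
      ((h.a1.smooth j).continuousAt_fderiv h.α_pos (h.isOpen_U j) (h.mapsTo_branchInv j hw))
      (h.hasStrictFDerivAt_branchInv hw).continuousAt
  obtain ⟨L, hL1, -, -⟩ := h.exists_hasStrictFDerivAt_equiv (h.mapsTo_branchInv j hw)
  refine ContinuousAt.comp (f := fun z => fderiv ℝ S.T (S.branchInv j z))
    (g := ContinuousLinearMap.inverse) ?_ h2
  rw [← hL1]
  exact (contDiffAt_map_inverse (n := 0) L).continuousAt

theorem contDiffOn_branchInv (j : Fin S.K) : ContDiffOn ℝ 1 (S.branchInv j) (S.T '' S.U j) :=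
  fun _ hw => (contDiffAt_one_iff.2 ⟨fderiv ℝ (S.branchInv j), S.T '' S.U j,
    (h.isOpen_TU j).mem_nhds hw,
    fun _ hz => (h.continuousAt_fderiv_branchInv hz).continuousWithinAt,
    fun _ hz => (h.hasStrictFDerivAt_branchInv hz).hasFDerivAt⟩).contDiffWithinAt

theorem det_fderiv_branchInv {j : Fin S.K} {y : Eucl m} (hy : y ∈ S.U j) :
    (fderiv ℝ (S.branchInv j) (S.T y)).det = (fderiv ℝ S.T y).det⁻¹ := by
  obtain ⟨L, hL1, -, hL⟩ := h.exists_hasStrictFDerivAt_equiv hy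
  rw [hL.hasFDerivAt.fderiv, ← hL1, L.det_coe_symm]

end Assumptions
end PiecewiseSystem
end

/-! ### Geometry of `R` and `TR`, and room around them. -/

section

/-- A continuous map which sends the closure of `X` into the open set `X` does so, with some room, for
a neighbourhood of this closure. -/
theorem exists_absorbing {m : ℕ} {f : Eucl m → Eucl m} {V K X : Set (Eucl m)}
    (hf : ContinuousOn f V) (hV : IsOpen V) (hK : IsCompact K) (hKV : K ⊆ V)
    (hX : IsOpen X) {Q : Set (Eucl m)} (hQ : IsClosed Q) (hfK : ∀ y ∈ K, f y ∈ X ∧ f y ∉ Q) :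
    ∃ τ > 0, Metric.cthickening τ K ⊆ V ∧
      ∀ y ∈ Metric.cthickening τ K, f y ∈ X ∧ f y ∉ Metric.cthickening τ Q := by
  have hK' : IsCompact (f '' K) := hK.image_of_continuousOn (hf.mono hKV)
  have hd : Disjoint (f '' K) Q := by
    rw [disjoint_left]; rintro _ ⟨y, hy, rfl⟩; exact (hfK y hy).2
  obtain ⟨δ, hδ, hdis⟩ := hd.exists_cthickenings hK' hQ
  have hsub : f '' K ⊆ X ∩ Metric.thickening δ (f '' K) := by
    rintro _ ⟨y, hy, rfl⟩
    exact ⟨(hfK y hy).1, Metric.self_subset_thickening hδ _ ⟨y, hy, rfl⟩⟩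
  obtain ⟨τ, hτ, hτV⟩ := hK.exists_cthickening_subset_open
    (hf.isOpen_inter_preimage hV (hX.inter Metric.isOpen_thickening))
    (fun y hy => ⟨hKV hy, hsub ⟨y, hy, rfl⟩⟩)
  refine ⟨min τ δ, lt_min hτ hδ, ?_, ?_⟩
  · exact (Metric.cthickening_mono (min_le_left _ _) _).trans (hτV.trans inter_subset_left)
  · intro y hy
    have h1 := hτV (Metric.cthickening_mono (min_le_left _ _) _ hy)
    refine ⟨h1.2.1, fun h2 => ?_⟩
    exact disjoint_left.1 hdis (Metric.thickening_subset_cthickening _ _ h1.2.2)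
      (Metric.cthickening_mono (min_le_right _ _) _ h2)

namespace PiecewiseSystem

variable {m : ℕ} {S : PiecewiseSystem m} {α η₀ ε₂ I Cξ : ℝ}

/-- The pieces other than the first one whose image contains `R`. -/
def Feeds (S : PiecewiseSystem m) (j : Fin S.K) : Prop :=
  j ≠ S.one ∧ closure S.R ⊆ S.T '' S.U j

namespace Assumptions

variable (h : S.Assumptions α η₀ ε₂ I Cξ)
include h

theorem TR_subset_image : S.T '' closure S.R ⊆ S.T '' S.U S.one := image_mono h.closure_R_subset

theorem isCompact_T_closure_R : IsCompact (S.T '' closure S.R) :=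
  h.isCompact_closure_R.image_of_continuousOn fun _ hy =>
    (h.hasStrictFDerivAt_T (h.closure_R_subset hy)).continuousAt.continuousWithinAt

theorem closure_TR : closure (S.T '' S.R) = S.T '' closure S.R := by
  refine Subset.antisymm ?_ ?_
  · exact closure_minimal (image_mono subset_closure) h.isCompact_T_closure_R.isClosed
  · rintro _ ⟨y, hy, rfl⟩
    exact (h.hasStrictFDerivAt_T (h.closure_R_subset hy)).continuousAt.continuousWithinAt.mem_closure
      hy (fun z hz => ⟨z, hz, rfl⟩)

theorem closure_TR_subset : closure (S.T '' S.R) ⊆ S.T '' S.U S.one :=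
  h.closure_TR ▸ h.TR_subset_image

theorem isCompact_closure_TR : IsCompact (closure (S.T '' S.R)) :=
  h.closure_TR ▸ h.isCompact_T_closure_R

theorem frontier_TR : frontier (S.T '' S.R) = closure (S.T '' S.R) \ S.T '' S.R :=
  h.isOpen_TR.frontier_eq

theorem frontier_R : frontier S.R = closure S.R \ S.R := h.a3.isOpen_R.frontier_eq

theorem isCompact_frontier_R : IsCompact (frontier S.R) :=
  h.isCompact_closure_R.of_isClosed_subset isClosed_frontier frontier_subset_closure

theorem isCompact_frontier_TR : IsCompact (frontier (S.T '' S.R)) :=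
  h.isCompact_closure_TR.of_isClosed_subset isClosed_frontier frontier_subset_closure

theorem branchInv_mem_closure_R {w : Eucl m} (hw : w ∈ closure (S.T '' S.R)) :
    S.branchInv S.one w ∈ closure S.R := by
  rw [h.closure_TR] at hw
  obtain ⟨y, hy, rfl⟩ := hw
  rwa [h.branchInv_T (h.closure_R_subset hy)]

theorem branchInv_mem_R {w : Eucl m} (hw : w ∈ S.T '' S.R) : S.branchInv S.one w ∈ S.R := by
  obtain ⟨y, hy, rfl⟩ := hw
  rwa [h.branchInv_T (h.R_subset hy)]

theorem branchInv_notMem_R {w : Eucl m} (hw : w ∈ S.T '' S.U S.one) (hwR : w ∉ S.T '' S.R) :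
    S.branchInv S.one w ∉ S.R := fun hR => hwR ⟨_, hR, h.T_branchInv hw⟩

/-- A defining function of `R` is transported by `T_1^{-1}`, a `C¹` diffeomorphism near the closure
of `TR`. -/
theorem hasSmoothBoundary_TR : HasSmoothBoundary (S.T '' S.R) := by
  intro q hq
  have hqT : q ∈ S.T '' S.U S.one := h.closure_TR_subset (frontier_subset_closure hq)
  have hb : S.branchInv S.one q ∈ frontier S.R := by
    rw [h.frontier_TR] at hq
    rw [h.frontier_R]
    exact ⟨h.branchInv_mem_closure_R hq.1, h.branchInv_notMem_R hqT hq.2⟩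
  obtain ⟨V, hVo, hqV, φ, hφ, hφ0, hφR⟩ := h.a3.boundary_R _ hb
  have hop := (h.continuousOn_branchInv S.one).isOpen_inter_preimage (h.isOpen_TU S.one) hVo
  refine ⟨S.T '' S.U S.one ∩ S.branchInv S.one ⁻¹' V, hop, ⟨hqT, hqV⟩, φ ∘ S.branchInv S.one,
    hφ.comp ((h.contDiffOn_branchInv S.one).mono inter_subset_left) (fun x hx => hx.2), ?_, ?_⟩
  · rintro _ ⟨⟨y, hy, rfl⟩, hxV⟩
    have hyV : y ∈ V := by rwa [mem_preimage, h.branchInv_T hy] at hxV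
    obtain ⟨L, -, -, hL⟩ := h.exists_hasStrictFDerivAt_equiv hy
    have h1 : HasFDerivAt φ (fderiv ℝ φ y) (S.branchInv S.one (S.T y)) := by
      rw [h.branchInv_T hy]
      exact ((hφ.differentiableOn one_ne_zero).differentiableAt (hVo.mem_nhds hyV)).hasFDerivAt
    rw [(h1.comp (S.T y) hL.hasFDerivAt).fderiv]
    intro h0
    refine hφ0 y hyV ?_
    ext v
    have := congrArg (fun A : Eucl m →L[ℝ] ℝ => A (L v)) h0
    simpa using this
  · ext x
    constructor
    · rintro ⟨hxR, hxT, hxV⟩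
      exact ⟨⟨hxT, hxV⟩, (hφR.subset ⟨h.branchInv_mem_R hxR, hxV⟩).2⟩
    · rintro ⟨⟨hxT, hxV⟩, hneg⟩
      have := (hφR.symm.subset ⟨hxV, hneg⟩ : _ ∈ S.R ∩ V)
      exact ⟨⟨_, this.1, h.T_branchInv hxT⟩, hxT, hxV⟩

theorem frontier_R_subset : frontier S.R ⊆ S.R₀ := by
  intro q hq
  rw [h.frontier_R] at hq
  exact ⟨h.a3.closure_R hq.1, hq.2⟩

/-- With `frontier_R_subset`, this places thin collars of both surfaces in neighbourhoods of `R₀`,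
where the distortion assumption applies. -/
theorem frontier_TR_subset : frontier (S.T '' S.R) ⊆ closure S.R₀ := by
  intro q hq
  rw [h.frontier_TR] at hq
  rw [mem_closure_iff_frequently]
  refine ((mem_closure_iff_frequently.1 hq.1).and_eventually
    (isClosed_closure.isOpen_compl.eventually_mem fun hR => hq.2 (h.a3.closure_R hR))).mono ?_
  exact fun z hz => ⟨hz.1, fun hR => hz.2 (subset_closure hR)⟩

end Assumptions
end PiecewiseSystem
end

/-! ### Inverse branches of the first return map and their contraction. -/

section

namespace PiecewiseSystem

variable {m : ℕ} {S : PiecewiseSystem m} {α η₀ ε₂ I Cξ : ℝ}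

/-- Neighbourhoods of `R` and of `TR` which the inverse of the first branch maps well into
themselves. -/
structure Collar (S : PiecewiseSystem m) (s' τ ρ : ℝ) : Prop where
  s_lt : S.s < s'
  τ_pos : 0 < τ
  τ_le : τ ≤ ρ
  image : Metric.cthickening ρ (closure S.R) ⊆ S.T '' S.R
  feeds : ∀ j, S.Feeds j → Metric.cthickening ρ (closure S.R) ⊆ S.T '' S.U j
  contracts : ∀ w ∈ Metric.cthickening ρ (closure S.R),
    S.branchInv S.one w ∈ S.R ∧ S.branchInv S.one w ∉ Metric.cthickening ρ (frontier S.R)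
  image_TR : Metric.cthickening τ (closure (S.T '' S.R)) ⊆ S.T '' S.U S.one
  contracts_TR : ∀ w ∈ Metric.cthickening τ (closure (S.T '' S.R)),
    S.branchInv S.one w ∈ Metric.cthickening ρ (closure S.R) ∧
      S.branchInv S.one w ∉ Metric.cthickening τ (frontier (S.T '' S.R))
  norm_lt : ∀ w ∈ Metric.cthickening τ (frontier (S.T '' S.R)),
    ‖fderiv ℝ (S.branchInv S.one) w‖ < s'

/-- Inverse branches of the first return map: `T_1^{-n}` followed by `T_j^{-1}`. -/
def branchMap (S : PiecewiseSystem m) (i : Fin S.K × ℕ) : Eucl m → Eucl m :=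
  S.branchInv i.1 ∘ (S.branchInv S.one)^[i.2]

/-- An open set on which the inverse branch is defined and contracting. -/
def branchDom (S : PiecewiseSystem m) (s' τ : ℝ) (i : Fin S.K × ℕ) : Set (Eucl m) :=
  if i.2 = 0 then {w | w ∈ S.T '' S.U i.1 ∧ ‖fderiv ℝ (S.branchInv i.1) w‖ < s'}
  else {w | S.Feeds i.1 ∧ w ∈ Metric.thickening τ (closure (S.T '' S.R))}

/-- The points of `branchDom` at which the inverse branch is a branch of the first return map. -/
def branchSide (S : PiecewiseSystem m) (i : Fin S.K × ℕ) : Set (Eucl m) :=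
  if i.2 = 0 then (if i.1 = S.one then (S.T '' S.R)ᶜ else S.Rᶜ) else S.R₀

theorem branchDom_zero (s' τ : ℝ) (j : Fin S.K) : S.branchDom s' τ (j, 0) =
    {w | w ∈ S.T '' S.U j ∧ ‖fderiv ℝ (S.branchInv j) w‖ < s'} := if_pos rfl

theorem branchDom_succ (s' τ : ℝ) (j : Fin S.K) (n : ℕ) : S.branchDom s' τ (j, n + 1) =
    {w | S.Feeds j ∧ w ∈ Metric.thickening τ (closure (S.T '' S.R))} := if_neg n.succ_ne_zero

theorem branchSide_succ (j : Fin S.K) (n : ℕ) : S.branchSide (j, n + 1) = S.R₀ :=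
  if_neg n.succ_ne_zero

theorem branchSide_zero_one : S.branchSide (S.one, 0) = (S.T '' S.R)ᶜ := by simp [branchSide]

theorem branchSide_zero {j : Fin S.K} (hj : j ≠ S.one) : S.branchSide (j, 0) = S.Rᶜ := by
  simp [branchSide, hj]

namespace Assumptions

variable (h : S.Assumptions α η₀ ε₂ I Cξ)
include h

/-- `T_1^{-1}` maps the closure of `R` into `R`, away from `∂R`, and the closure of `TR` into the
closure of `R`, away from `∂TR`; by compactness this leaves room (`exists_absorbing`). Preimages of
`∂TR` lie outside the open set `R`, where the derivative of the inverse is at most `s < s'`, and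
this also extends to a neighbourhood. -/
theorem exists_collar {s' : ℝ} (hs' : S.s < s') : ∃ τ ρ : ℝ, S.Collar s' τ ρ := by
  have hTR1 : S.T '' S.R ⊆ S.T '' S.U S.one := image_mono h.R_subset
  obtain ⟨ρ₁, hρ₁, hρ₁a, hρ₁b⟩ := exists_absorbing (h.continuousOn_branchInv S.one)
    (h.isOpen_TU S.one) h.isCompact_closure_R (h.a3.closure_R.trans hTR1) h.a3.isOpen_R
    (Q := frontier S.R) isClosed_frontier (fun y hy => by
      have := h.branchInv_mem_R (h.a3.closure_R hy)
      exact ⟨this, fun hf => by rw [h.frontier_R] at hf; exact hf.2 this⟩)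
  have hopen : IsOpen (S.T '' S.R ∩ ⋂ j : {j // S.Feeds j}, S.T '' S.U j) :=
    h.isOpen_TR.inter (isOpen_iInter_of_finite fun j => h.isOpen_TU j)
  obtain ⟨ρ₂, hρ₂, hρ₂a⟩ := h.isCompact_closure_R.exists_cthickening_subset_open hopen
    (subset_inter h.a3.closure_R (subset_iInter fun j => j.2.2))
  set ρ := min ρ₁ ρ₂ with hρ
  have hρ0 : 0 < ρ := lt_min hρ₁ hρ₂
  obtain ⟨τ₁, hτ₁, hτ₁a, hτ₁b⟩ := exists_absorbing (h.continuousOn_branchInv S.one)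
    (h.isOpen_TU S.one) h.isCompact_closure_TR h.closure_TR_subset
    (Metric.isOpen_thickening (δ := ρ) (E := closure S.R))
    (Q := frontier (S.T '' S.R)) isClosed_frontier (fun y hy => by
      have := h.branchInv_mem_closure_R hy
      exact ⟨Metric.self_subset_thickening hρ0 _ this,
        fun hf => by rw [h.frontier_TR] at hf; exact hf.2 (h.a3.closure_R this)⟩)
  have hop2 : IsOpen (S.T '' S.U S.one ∩
      fderiv ℝ (S.branchInv S.one) ⁻¹' {A | ‖A‖ < s'}) := by
    refine ContinuousOn.isOpen_inter_preimage
      (fun w hw => (h.continuousAt_fderiv_branchInv hw).continuousWithinAt) (h.isOpen_TU S.one) ?_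
    exact isOpen_lt continuous_norm continuous_const
  obtain ⟨τ₂, hτ₂, hτ₂a⟩ := h.isCompact_frontier_TR.exists_cthickening_subset_open hop2 (by
    intro w hw
    have h1 := h.closure_TR_subset (frontier_subset_closure hw)
    rw [h.frontier_TR] at hw
    exact ⟨h1, (h.norm_fderiv_branchInv_le_s h1 (h.branchInv_notMem_R h1 hw.2)).trans_lt hs'⟩)
  set τ := min ρ (min τ₁ τ₂) with hτ
  have hm1 : Metric.cthickening ρ (closure S.R) ⊆ Metric.cthickening ρ₁ (closure S.R) :=
    Metric.cthickening_mono (min_le_left _ _) _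
  have hm2 : Metric.cthickening ρ (closure S.R) ⊆ Metric.cthickening ρ₂ (closure S.R) :=
    Metric.cthickening_mono (min_le_right _ _) _
  have ht1 : τ ≤ τ₁ := (min_le_right _ _).trans (min_le_left _ _)
  have ht2 : τ ≤ τ₂ := (min_le_right _ _).trans (min_le_right _ _)
  refine ⟨τ, ρ, hs', lt_min hρ0 (lt_min hτ₁ hτ₂), min_le_left _ _, ?_, ?_, ?_, ?_, ?_, ?_⟩
  · exact hm2.trans (hρ₂a.trans inter_subset_left)
  · exact fun j hj => hm2.trans (hρ₂a.trans (inter_subset_right.trans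
      (iInter_subset (fun j : {j // S.Feeds j} => S.T '' S.U j) ⟨j, hj⟩)))
  · exact fun w hw => ⟨(hρ₁b w (hm1 hw)).1, fun hf => (hρ₁b w (hm1 hw)).2
      (Metric.cthickening_mono (min_le_left _ _) _ hf)⟩
  · exact (Metric.cthickening_mono ht1 _).trans hτ₁a
  · intro w hw
    have h1 := hτ₁b w (Metric.cthickening_mono ht1 _ hw)
    exact ⟨Metric.thickening_subset_cthickening _ _ h1.1,
      fun hf => h1.2 (Metric.cthickening_mono ht1 _ hf)⟩
  · exact fun w hw => (hτ₂a (Metric.cthickening_mono ht2 _ hw)).2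

variable {s' τ ρ : ℝ} (hc : S.Collar s' τ ρ)
include hc

theorem cthickening_R_subset : Metric.cthickening ρ (closure S.R) ⊆ S.T '' S.U S.one :=
  hc.image.trans (image_mono h.R_subset)

theorem iterate_mem_cthickening_R {w : Eucl m} (hw : w ∈ Metric.cthickening ρ (closure S.R))
    (n : ℕ) : (S.branchInv S.one)^[n] w ∈ Metric.cthickening ρ (closure S.R) ∧
      (n ≠ 0 → (S.branchInv S.one)^[n] w ∈ S.R ∧
        (S.branchInv S.one)^[n] w ∉ Metric.cthickening ρ (frontier S.R)) := by
  induction n with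
  | zero => simpa using hw
  | succ n ih =>
    rw [Function.iterate_succ_apply']
    have := hc.contracts _ ih.1
    exact ⟨Metric.self_subset_cthickening _ (subset_closure this.1), fun _ => this⟩

theorem iterate_succ_mem {w : Eucl m} (hw : w ∈ Metric.cthickening τ (closure (S.T '' S.R)))
    (n : ℕ) : (S.branchInv S.one)^[n + 1] w ∈ Metric.cthickening ρ (closure S.R) := by
  rw [Function.iterate_succ_apply]
  exact (h.iterate_mem_cthickening_R hc (hc.contracts_TR w hw).1 n).1

theorem iterate_succ_notMem {w : Eucl m} (hw : w ∈ Metric.cthickening τ (closure (S.T '' S.R)))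
    (n : ℕ) : (S.branchInv S.one)^[n + 1] w ∉ Metric.cthickening τ (frontier (S.T '' S.R)) := by
  rw [Function.iterate_succ_apply']
  refine (hc.contracts_TR _ ?_).2
  rcases n with _ | n
  · exact hw
  · exact Metric.self_subset_cthickening _ (subset_closure (hc.image (h.iterate_succ_mem hc hw n)))

theorem iterate_mem_image {w : Eucl m} (hw : w ∈ Metric.cthickening τ (closure (S.T '' S.R)))
    (n : ℕ) : (S.branchInv S.one)^[n] w ∈ S.T '' S.U S.one := by
  rcases n with _ | n
  · exact hc.image_TR hw
  · exact h.cthickening_R_subset hc (h.iterate_succ_mem hc hw n)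

theorem hasStrictFDerivAt_iterate {w : Eucl m}
    (hw : w ∈ Metric.cthickening τ (closure (S.T '' S.R))) (n : ℕ) :
    HasStrictFDerivAt ((S.branchInv S.one)^[n]) (fderiv ℝ ((S.branchInv S.one)^[n]) w) w ∧
      ‖fderiv ℝ ((S.branchInv S.one)^[n]) w‖ ≤ 1 := by
  induction n with
  | zero =>
    have h1 : HasStrictFDerivAt ((S.branchInv S.one)^[0]) (ContinuousLinearMap.id ℝ (Eucl m)) w :=
      hasStrictFDerivAt_id w
    rw [h1.hasFDerivAt.fderiv]
    exact ⟨h1, ContinuousLinearMap.norm_id_le⟩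
  | succ n ih =>
    have h1 := h.iterate_mem_image hc hw n
    have h2 := (h.hasStrictFDerivAt_branchInv h1).comp w ih.1
    have h3 : (fun x => S.branchInv S.one ((S.branchInv S.one)^[n] x)) =
        (S.branchInv S.one)^[n + 1] := (Function.iterate_succ' _ n).symm
    rw [h3] at h2
    rw [h2.hasFDerivAt.fderiv]
    refine ⟨h2, (ContinuousLinearMap.opNorm_comp_le _ _).trans ?_⟩
    exact mul_le_one₀ (h.norm_fderiv_branchInv_le_one h1) (norm_nonneg _) ih.2

theorem injOn_iterate (n : ℕ) :
    InjOn ((S.branchInv S.one)^[n]) (Metric.cthickening τ (closure (S.T '' S.R))) := by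
  induction n with
  | zero => simp
  | succ n ih =>
    intro w hw w' hw' he
    rw [Function.iterate_succ_apply', Function.iterate_succ_apply'] at he
    exact ih hw hw' (h.injOn_branchInv S.one (h.iterate_mem_image hc hw n)
      (h.iterate_mem_image hc hw' n) he)

theorem T_iterate {w : Eucl m} (hw : w ∈ Metric.cthickening τ (closure (S.T '' S.R))) {k n : ℕ}
    (hkn : k ≤ n) : S.T^[k] ((S.branchInv S.one)^[n] w) = (S.branchInv S.one)^[n - k] w := by
  induction k with
  | zero => rfl
  | succ k ih =>
    rw [Function.iterate_succ_apply', ih (by omega), show n - k = n - (k + 1) + 1 by omega,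
      Function.iterate_succ_apply', h.T_branchInv (h.iterate_mem_image hc hw _)]

/-! Properties of the inverse branches. -/

theorem iterate_mem_TU {i : Fin S.K × ℕ} {w : Eucl m} (hw : w ∈ S.branchDom s' τ i) :
    (S.branchInv S.one)^[i.2] w ∈ S.T '' S.U i.1 := by
  obtain ⟨j, _ | n⟩ := i
  · rw [branchDom_zero] at hw; exact hw.1
  · rw [branchDom_succ] at hw
    exact hc.feeds j hw.1 (h.iterate_succ_mem hc (Metric.thickening_subset_cthickening _ _ hw.2) n)

theorem mem_cthickening_TR {j : Fin S.K} {n : ℕ} {w : Eucl m}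
    (hw : w ∈ S.branchDom s' τ (j, n + 1)) : w ∈ Metric.cthickening τ (closure (S.T '' S.R)) := by
  rw [branchDom_succ] at hw
  exact Metric.thickening_subset_cthickening _ _ hw.2

theorem branchMap_mem {i : Fin S.K × ℕ} {w : Eucl m} (hw : w ∈ S.branchDom s' τ i) :
    S.branchMap i w ∈ S.U i.1 := h.mapsTo_branchInv _ (h.iterate_mem_TU hc hw)

theorem isOpen_branchDom (i : Fin S.K × ℕ) : IsOpen (S.branchDom s' τ i) := by
  obtain ⟨j, _ | n⟩ := i
  · rw [branchDom_zero]
    refine ContinuousOn.isOpen_inter_preimage (t := {A | ‖A‖ < s'})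
      (fun w hw => (h.continuousAt_fderiv_branchInv hw).continuousWithinAt) (h.isOpen_TU j) ?_
    exact isOpen_lt continuous_norm continuous_const
  · rw [branchDom_succ]
    by_cases hj : S.Feeds j
    · simp only [hj, true_and]; exact Metric.isOpen_thickening
    · simp [hj]

theorem hasStrictFDerivAt_iterate_of_mem {i : Fin S.K × ℕ} {w : Eucl m}
    (hw : w ∈ S.branchDom s' τ i) :
    HasStrictFDerivAt ((S.branchInv S.one)^[i.2]) (fderiv ℝ ((S.branchInv S.one)^[i.2]) w) w ∧
      ‖fderiv ℝ ((S.branchInv S.one)^[i.2]) w‖ ≤ 1 := by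
  obtain ⟨j, _ | n⟩ := i
  · have h1 : HasStrictFDerivAt ((S.branchInv S.one)^[0]) (ContinuousLinearMap.id ℝ (Eucl m)) w :=
      hasStrictFDerivAt_id w
    change HasStrictFDerivAt ((S.branchInv S.one)^[0]) (fderiv ℝ ((S.branchInv S.one)^[0]) w) w ∧
      ‖fderiv ℝ ((S.branchInv S.one)^[0]) w‖ ≤ 1
    rw [h1.hasFDerivAt.fderiv]
    exact ⟨h1, ContinuousLinearMap.norm_id_le⟩
  · exact h.hasStrictFDerivAt_iterate hc (h.mem_cthickening_TR hc hw) _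

theorem hasStrictFDerivAt_branchMap {i : Fin S.K × ℕ} {w : Eucl m}
    (hw : w ∈ S.branchDom s' τ i) : HasStrictFDerivAt (S.branchMap i)
      ((fderiv ℝ (S.branchInv i.1) ((S.branchInv S.one)^[i.2] w)).comp
        (fderiv ℝ ((S.branchInv S.one)^[i.2]) w)) w :=
  (h.hasStrictFDerivAt_branchInv (h.iterate_mem_TU hc hw)).comp w
    (h.hasStrictFDerivAt_iterate_of_mem hc hw).1

theorem fderiv_branchMap {i : Fin S.K × ℕ} {w : Eucl m} (hw : w ∈ S.branchDom s' τ i) :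
    fderiv ℝ (S.branchMap i) w = (fderiv ℝ (S.branchInv i.1) ((S.branchInv S.one)^[i.2] w)).comp
        (fderiv ℝ ((S.branchInv S.one)^[i.2]) w) :=
  (h.hasStrictFDerivAt_branchMap hc hw).hasFDerivAt.fderiv

theorem hasFDerivAt_branchMap {i : Fin S.K × ℕ} {w : Eucl m} (hw : w ∈ S.branchDom s' τ i) :
    HasFDerivAt (S.branchMap i) (fderiv ℝ (S.branchMap i) w) w :=
  (h.hasStrictFDerivAt_branchMap hc hw).hasFDerivAt.differentiableAt.hasFDerivAt

theorem abs_det_branchMap {i : Fin S.K × ℕ} {w : Eucl m} (hw : w ∈ S.branchDom s' τ i) :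
    |(fderiv ℝ (S.branchMap i) w).det| =
      |(fderiv ℝ (S.branchInv i.1) ((S.branchInv S.one)^[i.2] w)).det| * S.absDetInv i.2 w := by
  rw [h.fderiv_branchMap hc hw, absDetInv, ← abs_mul]
  congr 1
  exact LinearMap.det_comp _ _

/-- For `n = 0` the bound is built into the domain. For `n ≥ 1` the iterates do not expand, and the
last inverse branch belongs to a piece other than `U_1`, so it ends outside `R` and contracts by
`s`. -/
theorem norm_fderiv_branchMap_le {i : Fin S.K × ℕ} {w : Eucl m} (hw : w ∈ S.branchDom s' τ i) :
    ‖fderiv ℝ (S.branchMap i) w‖ ≤ s' := by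
  have hs0 : 0 ≤ s' := h.s_nonneg.trans hc.s_lt.le
  rw [h.fderiv_branchMap hc hw]
  refine (ContinuousLinearMap.opNorm_comp_le _ _).trans ?_
  have h1 : ‖fderiv ℝ (S.branchInv i.1) ((S.branchInv S.one)^[i.2] w)‖ ≤ s' := by
    obtain ⟨j, _ | n⟩ := i
    · rw [branchDom_zero] at hw; exact hw.2.le
    · have hj : S.Feeds j := by rw [branchDom_succ] at hw; exact hw.1
      exact (h.norm_fderiv_branchInv_le_s (h.iterate_mem_TU hc hw)
        (h.notMem_R_of_ne hj.1 (h.branchMap_mem hc hw))).trans hc.s_lt.le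
  calc _ ≤ s' * 1 := mul_le_mul h1 (h.hasStrictFDerivAt_iterate_of_mem hc hw).2 (norm_nonneg _) hs0
    _ = s' := mul_one _

theorem injOn_branchMap (i : Fin S.K × ℕ) : InjOn (S.branchMap i) (S.branchDom s' τ i) := by
  intro w hw w' hw' he
  have h1 := h.injOn_branchInv i.1 (h.iterate_mem_TU hc hw) (h.iterate_mem_TU hc hw') he
  obtain ⟨j, _ | n⟩ := i
  · exact h1
  · exact h.injOn_iterate hc _ (h.mem_cthickening_TR hc hw) (h.mem_cthickening_TR hc hw') h1

/-- The inverse branches are contracting on balls contained in their domains. -/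
theorem dist_branchMap_le {i : Fin S.K × ℕ} {B : Set (Eucl m)} (hB : Convex ℝ B)
    (hBW : B ⊆ S.branchDom s' τ i) {u w : Eucl m} (hu : u ∈ B) (hw : w ∈ B) :
    dist (S.branchMap i u) (S.branchMap i w) ≤ s' * dist u w := by
  rw [dist_eq_norm, dist_eq_norm]
  exact hB.norm_image_sub_le_of_norm_hasFDerivWithin_le
    (fun z hz => (h.hasFDerivAt_branchMap hc (hBW hz)).hasFDerivWithinAt)
    (fun z hz => h.norm_fderiv_branchMap_le hc (hBW hz)) hw hu

end Assumptions
end PiecewiseSystem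
end

/-! ### The inverse branches are exactly those of the first return map. -/

section

theorem exists_mem_frontier_of_convex {m : ℕ} {B A : Set (Eucl m)} (hB : Convex ℝ B)
    {u v : Eucl m} (hu : u ∈ B) (hv : v ∈ B) (huA : u ∈ A) (hvA : v ∉ A) :
    ∃ f ∈ frontier A, f ∈ B := by
  by_contra! hcon
  have hsub : B ⊆ interior A ∪ (closure A)ᶜ := by
    intro z hz
    by_contra hz'
    rw [mem_union, not_or, notMem_compl_iff] at hz'
    exact hcon z ⟨hz'.2, hz'.1⟩ hz
  have hu' : u ∈ interior A := (hsub hu).resolve_right fun h => h (subset_closure huA)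
  have hv' : v ∈ (closure A)ᶜ := (hsub hv).resolve_left fun h => hvA (interior_subset h)
  obtain ⟨z, -, hz1, hz2⟩ := hB.isPreconnected _ _ isOpen_interior isClosed_closure.isOpen_compl
    hsub ⟨u, hu, hu'⟩ ⟨v, hv, hv'⟩
  exact hz2 (subset_closure (interior_subset hz1))

namespace PiecewiseSystem

variable {m : ℕ} {S : PiecewiseSystem m} {α η₀ ε₂ I Cξ : ℝ}

/-- The part of the domain of an inverse branch on which it is a branch of the first return map. -/
def branchSet (S : PiecewiseSystem m) (s' τ : ℝ) (i : Fin S.K × ℕ) : Set (Eucl m) :=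
  S.branchDom s' τ i ∩ S.branchSide i

namespace Assumptions

variable (h : S.Assumptions α η₀ ε₂ I Cξ) {s' τ ρ : ℝ} (hc : S.Collar s' τ ρ)
include h

theorem measurableSet_branchSide (i : Fin S.K × ℕ) : MeasurableSet (S.branchSide i) := by
  obtain ⟨j, _ | n⟩ := i
  · by_cases hj : j = S.one
    · subst hj
      rw [branchSide_zero_one]
      exact h.isOpen_TR.measurableSet.compl
    · rw [branchSide_zero hj]
      exact h.a3.isOpen_R.measurableSet.compl
  · rw [branchSide_succ]
    exact h.isOpen_TR.measurableSet.diff h.a3.isOpen_R.measurableSet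

include hc

theorem measurableSet_branchSet (i : Fin S.K × ℕ) : MeasurableSet (S.branchSet s' τ i) :=
  (h.isOpen_branchDom hc i).measurableSet.inter (h.measurableSet_branchSide i)

theorem T_iterate_branchMap {i : Fin S.K × ℕ} {w : Eucl m} (hw : w ∈ S.branchDom s' τ i) {k : ℕ}
    (hk : k ≤ i.2) : S.T^[k + 1] (S.branchMap i w) = (S.branchInv S.one)^[i.2 - k] w := by
  rw [Function.iterate_succ_apply, branchMap, Function.comp_apply,
    h.T_branchInv (h.iterate_mem_TU hc hw)]
  obtain ⟨j, _ | n⟩ := i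
  · obtain rfl : k = 0 := by simpa using hk
    rfl
  · exact h.T_iterate hc (h.mem_cthickening_TR hc hw) hk

theorem branchMap_notMem_R {i : Fin S.K × ℕ} {w : Eucl m} (hw : w ∈ S.branchSet s' τ i) :
    S.branchMap i w ∉ S.R := by
  by_cases hj : i.1 = S.one
  · obtain ⟨j, _ | n⟩ := i
    · obtain rfl : j = S.one := hj
      have h1 := hw.2
      rw [branchSide_zero_one] at h1
      have h2 := hw.1
      rw [branchDom_zero] at h2
      exact h.branchInv_notMem_R h2.1 h1
    · have h1 := hw.1
      rw [branchDom_succ] at h1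
      exact absurd hj h1.1.1
  · exact h.notMem_R_of_ne hj (h.branchMap_mem hc hw.1)

theorem notMem_R_of_mem_branchSide {i : Fin S.K × ℕ} {w : Eucl m} (hw : w ∈ S.branchSide i) :
    w ∉ S.R := by
  obtain ⟨j, _ | n⟩ := i
  · by_cases hj : j = S.one
    · subst hj
      rw [branchSide_zero_one] at hw
      exact fun hR => hw (h.R_subset_TR hR)
    · rw [branchSide_zero hj] at hw
      exact hw
  · rw [branchSide_succ] at hw
    exact hw.2

/-- The forward orbit retraces the points `T_1^{-k} w`. When `n ≥ 1`, `w` lies in `TR`, so all of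
these with `k ≥ 1` lie in `R`, while `w` itself does not. -/
theorem returnTime_branchMap {i : Fin S.K × ℕ} {w : Eucl m} (hw : w ∈ S.branchSet s' τ i) :
    S.branchMap i w ∈ S.inducedDomain ∧ S.returnTime (S.branchMap i w) = i.2 + 1 ∧
      S.inducedMap (S.branchMap i w) = w := by
  have h1 : S.T^[i.2 + 1] (S.branchMap i w) = w := by
    rw [h.T_iterate_branchMap hc hw.1 le_rfl, Nat.sub_self, Function.iterate_zero, id]
  have hwR := h.notMem_R_of_mem_branchSide hc hw.2
  have hmem : i.2 + 1 ∈ {n : ℕ | 0 < n ∧ S.T^[n] (S.branchMap i w) ∉ S.R} :=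
    ⟨Nat.succ_pos _, by rwa [h1]⟩
  have hrt : S.returnTime (S.branchMap i w) = i.2 + 1 := by
    refine le_antisymm (Nat.sInf_le hmem) (le_csInf ⟨_, hmem⟩ ?_)
    rintro n ⟨hn0, hn⟩
    by_contra! hlt
    obtain ⟨k, rfl⟩ : ∃ k, n = k + 1 := ⟨n - 1, by omega⟩
    rw [h.T_iterate_branchMap hc hw.1 (by omega)] at hn
    obtain ⟨j, _ | l⟩ := i
    · simp at hlt
    · have hk : k < l + 1 := by simpa using hlt
      have h2 := hw.2
      rw [branchSide_succ] at h2
      rw [show l + 1 - k = (l - k) + 1 by omega] at hn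
      have h3 := h.branchInv_mem_R h2.1
      have h4 := h.iterate_mem_cthickening_R hc
        (Metric.self_subset_cthickening _ (subset_closure h3)) (l - k)
      rw [← Function.iterate_succ_apply] at h4
      rcases Nat.eq_zero_or_pos (l - k) with h0 | h0
      · rw [h0] at hn; exact hn h3
      · exact hn (h4.2 h0.ne').1
  refine ⟨⟨⟨i.1, h.branchMap_mem hc hw.1⟩, h.branchMap_notMem_R hc hw, _, hmem⟩, hrt, ?_⟩
  rw [inducedMap, hrt, h1]

/-- Follow the orbit backwards. A return at the first step is the case `n = 0`. Otherwise the orbit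
enters `R`, and it cannot do so from `U_1 \ R`, because `R ⊆ TR` and `T` is injective on `U_1`. It
therefore enters from a piece whose image contains `R`, and every later backward step is `T_1^{-1}`.
-/
theorem exists_branch {y : Eucl m} (hy : y ∈ S.inducedDomain) :
    ∃ i : Fin S.K × ℕ, S.inducedMap y ∈ S.branchSet s' τ i ∧ S.branchMap i (S.inducedMap y) = y := by
  obtain ⟨⟨j, hj⟩, hyR, hex⟩ := hy
  have hspec : S.returnTime y ∈ {n : ℕ | 0 < n ∧ S.T^[n] y ∉ S.R} := Nat.sInf_mem hex
  have hmin : ∀ n, 0 < n → n < S.returnTime y → S.T^[n] y ∈ S.R := by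
    intro n hn hlt
    by_contra hnR
    exact absurd (Nat.sInf_le (show n ∈ {n : ℕ | 0 < n ∧ S.T^[n] y ∉ S.R} from ⟨hn, hnR⟩))
      (not_le.2 hlt)
  obtain ⟨n, hn⟩ : ∃ n, S.returnTime y = n + 1 := ⟨S.returnTime y - 1, by have := hspec.1; omega⟩
  rw [hn] at hmin hspec
  have hTy : S.T y ∈ S.T '' S.U j := ⟨y, hj, rfl⟩
  rcases n with _ | n
  · have he : S.inducedMap y = S.T y := by rw [inducedMap, hn]; rfl
    refine ⟨(j, 0), ⟨?_, ?_⟩, ?_⟩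
    · rw [branchDom_zero, he]
      refine ⟨hTy, (h.norm_fderiv_branchInv_le_s hTy ?_).trans_lt hc.s_lt⟩
      rwa [h.branchInv_T hj]
    · rw [he]
      by_cases hj1 : j = S.one
      · subst hj1
        rw [branchSide_zero_one]
        rintro ⟨z, hz, hzy⟩
        exact hyR ((h.a1.injOn S.one (h.R_subset hz) hj hzy) ▸ hz)
      · rw [branchSide_zero hj1]
        exact hspec.2
    · rw [he]
      exact h.branchInv_T hj
  · have hTR : S.T y ∈ S.R := hmin 1 one_pos (by omega)
    have hj1 : j ≠ S.one := by
      rintro rfl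
      obtain ⟨z, hz, hzy⟩ := h.R_subset_TR hTR
      exact hyR ((h.a1.injOn S.one (h.R_subset hz) hj hzy) ▸ hz)
    have hfeed : S.Feeds j := by
      refine ⟨hj1, (h.a3.images j).resolve_right fun h0 => ?_⟩
      exact (h0.subset ⟨subset_closure hTR, hTy⟩ : S.T y ∈ (∅ : Set (Eucl m)))
    have he : S.inducedMap y = S.T (S.T^[n + 1] y) := by
      rw [inducedMap, hn, Function.iterate_succ_apply']
    have hRn : S.T^[n + 1] y ∈ S.R := hmin (n + 1) (by omega) (by omega)
    have hmem : S.inducedMap y ∈ S.T '' S.R := he ▸ ⟨_, hRn, rfl⟩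
    have hback : ∀ k, k ≤ n + 1 →
        (S.branchInv S.one)^[k] (S.inducedMap y) = S.T^[n + 2 - k] y := by
      intro k hk
      induction k with
      | zero => rw [inducedMap, hn]; rfl
      | succ k ih =>
        rw [Function.iterate_succ_apply', ih (by omega),
          show n + 2 - k = (n + 2 - (k + 1)) + 1 by omega, Function.iterate_succ_apply']
        exact h.branchInv_T (h.R_subset (hmin _ (by omega) (by omega)))
    refine ⟨(j, n + 1), ⟨?_, ?_⟩, ?_⟩
    · rw [branchDom_succ]
      exact ⟨hfeed, Metric.self_subset_thickening hc.τ_pos _ (subset_closure hmem)⟩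
    · rw [branchSide_succ]
      refine ⟨hmem, ?_⟩
      rw [inducedMap, hn]
      exact hspec.2
    · change S.branchInv j ((S.branchInv S.one)^[n + 1] (S.inducedMap y)) = y
      rw [hback _ le_rfl, show n + 2 - (n + 1) = 1 by omega]
      exact h.branchInv_T hj

/-- The piece containing the point determines the first index and the return time determines the
second. -/
theorem branch_unique {i i' : Fin S.K × ℕ} {w w' : Eucl m} (hw : w ∈ S.branchSet s' τ i)
    (hw' : w' ∈ S.branchSet s' τ i') (he : S.branchMap i w = S.branchMap i' w') : i = i' := by
  have h1 := (h.returnTime_branchMap hc hw).2.1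
  have h2 := (h.returnTime_branchMap hc hw').2.1
  rw [he, h2] at h1
  have h3 := h.branchMap_mem hc hw.1
  rw [he] at h3
  exact Prod.ext (h.eq_of_mem h3 (h.branchMap_mem hc hw'.1)) (by omega)

theorem differentiableAt_T_iterate {i : Fin S.K × ℕ} {w : Eucl m} (hw : w ∈ S.branchDom s' τ i)
    {k : ℕ} (hk : k ≤ i.2 + 1) : DifferentiableAt ℝ (S.T^[k]) (S.branchMap i w) := by
  induction k with
  | zero => exact differentiableAt_id
  | succ k ih =>
    rw [Function.iterate_succ']
    refine DifferentiableAt.comp _ ?_ (ih (by omega))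
    rcases k with _ | k
    · exact (h.hasStrictFDerivAt_T (h.branchMap_mem hc hw)).hasFDerivAt.differentiableAt
    · rw [h.T_iterate_branchMap hc hw (by omega)]
      have hR : (S.branchInv S.one)^[i.2 - k] w ∈ S.U S.one := by
        obtain ⟨j, _ | l⟩ := i
        · simp at hk
        · simp only at hk ⊢
          rw [show l + 1 - k = (l - k) + 1 by omega, Function.iterate_succ_apply']
          exact h.mapsTo_branchInv _ (h.iterate_mem_image hc (h.mem_cthickening_TR hc hw) _)
      exact (h.hasStrictFDerivAt_T hR).hasFDerivAt.differentiableAt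

/-- Chain rule for `T^[n + 1]` composed with the branch, which is the identity on an open
neighbourhood; membership in the branch set identifies `n + 1` as the return time. -/
theorem inducedWeight_branchMap {i : Fin S.K × ℕ} {w : Eucl m} (hw : w ∈ S.branchSet s' τ i) :
    S.inducedWeight (S.branchMap i w) = |(fderiv ℝ (S.branchMap i) w).det| := by
  have hrt := (h.returnTime_branchMap hc hw).2.1
  have hid : S.T^[i.2 + 1] ∘ S.branchMap i =ᶠ[𝓝 w] id := by
    filter_upwards [(h.isOpen_branchDom hc i).mem_nhds hw.1] with z hz
    rw [Function.comp_apply, h.T_iterate_branchMap hc hz le_rfl, Nat.sub_self,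
      Function.iterate_zero]
  have h1 := ((h.differentiableAt_T_iterate hc hw.1 le_rfl).hasFDerivAt.comp w
    (h.hasFDerivAt_branchMap hc hw.1)).fderiv
  rw [hid.fderiv_eq, fderiv_id] at h1
  have h2 : (fderiv ℝ (S.T^[i.2 + 1]) (S.branchMap i w)).det *
      (fderiv ℝ (S.branchMap i) w).det = 1 := by
    have h3 := congrArg ContinuousLinearMap.det h1
    have h4 : (ContinuousLinearMap.id ℝ (Eucl m)).det = 1 := LinearMap.det_id
    rw [h4] at h3
    exact ((LinearMap.det_comp _ _).symm.trans h3.symm)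
  rw [inducedWeight, hrt, ← abs_inv]
  congr 1
  exact inv_eq_of_mul_eq_one_right h2

end Assumptions
end PiecewiseSystem
end

/-! ### Collars of `∂R` and `∂TR`, and the compact set receiving their preimages. -/

section

namespace PiecewiseSystem

variable {m : ℕ} {S : PiecewiseSystem m} {α η₀ ε₂ I Cξ : ℝ}

/-- The collar of `∂R`, for the branches which it affects. -/
def collarR (S : PiecewiseSystem m) (ε : ℝ) (i : Fin S.K × ℕ) : Set (Eucl m) :=
  {x | S.Feeds i.1 ∧ x ∈ Metric.cthickening ε (frontier S.R)}

/-- The collar of `∂TR`, for the branches which it affects. -/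
def collarTR (S : PiecewiseSystem m) (ε : ℝ) (i : Fin S.K × ℕ) : Set (Eucl m) :=
  {x | (if i.2 = 0 then i.1 = S.one else S.Feeds i.1) ∧
    x ∈ Metric.cthickening ε (frontier (S.T '' S.R))}

/-- A compact set of points that are mapped close to `∂R` or to `∂TR` by the branches. -/
def trap (S : PiecewiseSystem m) (τ ρ : ℝ) : Set (Eucl m) :=
  (⋃ j : {j // S.Feeds j}, S.branchInv j '' Metric.cthickening ρ (closure S.R)) ∪
    S.branchInv S.one '' Metric.cthickening τ (frontier (S.T '' S.R))

theorem measurableSet_const_and {m : ℕ} (p : Prop) {A : Set (Eucl m)} (hA : MeasurableSet A) :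
    MeasurableSet {x | p ∧ x ∈ A} := by
  by_cases hp : p
  · have : {x | p ∧ x ∈ A} = A := by ext x; simp [hp]
    rwa [this]
  · have : {x | p ∧ x ∈ A} = ∅ := by ext x; simp [hp]
    rw [this]
    exact MeasurableSet.empty

theorem measurableSet_collarR (ε : ℝ) (i : Fin S.K × ℕ) : MeasurableSet (S.collarR ε i) :=
  measurableSet_const_and _ Metric.isClosed_cthickening.measurableSet

theorem measurableSet_collarTR (ε : ℝ) (i : Fin S.K × ℕ) : MeasurableSet (S.collarTR ε i) :=
  measurableSet_const_and _ Metric.isClosed_cthickening.measurableSet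

namespace Assumptions

variable (h : S.Assumptions α η₀ ε₂ I Cξ) {s' τ ρ : ℝ} (hc : S.Collar s' τ ρ)
include h

theorem disjoint_of_not_feeds {j : Fin S.K} (hj : j ≠ S.one) (hf : ¬ S.Feeds j) :
    Disjoint (closure S.R) (S.T '' S.U j) :=
  disjoint_iff_inter_eq_empty.2 ((h.a3.images j).resolve_left fun h0 => hf ⟨hj, h0⟩)

include hc

theorem cthickening_frontier_R_subset {ε : ℝ} (hε : ε ≤ ρ) :
    Metric.cthickening ε (frontier S.R) ⊆ Metric.cthickening ρ (closure S.R) :=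
  (Metric.cthickening_mono hε _).trans (Metric.cthickening_subset_of_subset _
    frontier_subset_closure)

theorem notMem_R_of_mem_cthickening {ε : ℝ} (hε0 : 0 ≤ ε) (hε : ε ≤ ρ) {x : Eucl m}
    (hx : x ∈ Metric.cthickening ε (frontier (S.T '' S.R))) : x ∉ S.R := by
  intro hR
  rw [h.isCompact_frontier_TR.cthickening_eq_biUnion_closedBall hε0] at hx
  obtain ⟨f, hf, hxf⟩ := mem_iUnion₂.1 hx
  rw [Metric.mem_closedBall, dist_comm] at hxf
  have h1 : f ∈ Metric.cthickening ρ (closure S.R) :=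
    Metric.mem_cthickening_of_dist_le f x ρ _ (subset_closure hR) (hxf.trans hε)
  rw [h.frontier_TR] at hf
  exact hf.2 (hc.image h1)

/-- A ball which meets a branch and stays away from the boundary of the image of the corresponding
piece is contained in the domain of the branch. -/
theorem closedBall_subset_branchDom {i : Fin S.K × ℕ} {x u : Eucl m} {ε : ℝ}
    (hε : 2 * ε < τ) (hu : u ∈ Metric.closedBall x ε) (huS : u ∈ S.branchSet s' τ i)
    (hx : i.2 = 0 → x ∉ Metric.cthickening ε (frontier (S.T '' S.U i.1))) :
    Metric.closedBall x ε ⊆ S.branchDom s' τ i := by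
  have hdist : ∀ z ∈ Metric.closedBall x ε, dist z u ≤ 2 * ε := fun z hz => by
    rw [Metric.mem_closedBall] at hz hu
    linarith [dist_triangle z x u, dist_comm u x]
  obtain ⟨j, _ | n⟩ := i
  · have hu1 := huS.1
    rw [branchDom_zero] at hu1 ⊢
    have hsub : Metric.closedBall x ε ⊆ S.T '' S.U j := by
      intro z hz
      by_contra hzT
      obtain ⟨f, hf, hfB⟩ := exists_mem_frontier_of_convex (convex_closedBall x ε) hu hz hu1.1 hzT
      refine hx rfl (Metric.mem_cthickening_of_dist_le x f ε _ hf ?_)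
      rwa [Metric.mem_closedBall, dist_comm] at hfB
    intro z hz
    refine ⟨hsub hz, ?_⟩
    by_cases hj : j = S.one
    · subst hj
      -- For the first piece the ball may contain points coming from inside `R`, where `s` is no
      -- bound. As `u` is outside `TR`, such points are within `2ε < τ` of `∂TR`, where the collar
      -- supplies the contraction.
      by_cases hzR : z ∈ S.T '' S.R
      · have hu2 := huS.2
        rw [branchSide_zero_one] at hu2
        obtain ⟨f, hf, hfB⟩ := exists_mem_frontier_of_convex (convex_closedBall z (2 * ε))
          (Metric.mem_closedBall_self (dist_nonneg.trans (hdist z hz)))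
          (by rw [Metric.mem_closedBall, dist_comm]; exact hdist z hz) hzR hu2
        refine hc.norm_lt z (Metric.mem_cthickening_of_dist_le z f τ _ hf ?_)
        rw [Metric.mem_closedBall, dist_comm] at hfB
        exact hfB.trans hε.le
      · exact (h.norm_fderiv_branchInv_le_s (hsub hz)
          (h.branchInv_notMem_R (hsub hz) hzR)).trans_lt hc.s_lt
    · exact (h.norm_fderiv_branchInv_le_s (hsub hz)
        (h.notMem_R_of_ne hj (h.mapsTo_branchInv j (hsub hz)))).trans_lt hc.s_lt
  · have hu1 := huS.1
    have hu2 := huS.2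
    rw [branchDom_succ] at hu1 ⊢
    rw [branchSide_succ] at hu2
    exact fun z hz => ⟨hu1.1, Metric.mem_thickening_iff.2
      ⟨u, subset_closure hu2.1, (hdist z hz).trans_lt hε⟩⟩

/-- If a branch is not present on a whole ball, this ball meets the boundary of `R` or of `TR`. -/
theorem mem_collar {i : Fin S.K × ℕ} {x u v : Eucl m} {ε : ℝ}
    (hsub : Metric.closedBall x ε ⊆ S.branchDom s' τ i) (hu : u ∈ Metric.closedBall x ε)
    (hv : v ∈ Metric.closedBall x ε) (huS : u ∈ S.branchSide i) (hvS : v ∉ S.branchSide i) :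
    x ∈ S.collarR ε i ∪ S.collarTR ε i := by
  have key : ∀ A : Set (Eucl m), ∀ a ∈ Metric.closedBall x ε, ∀ b ∈ Metric.closedBall x ε,
      a ∈ A → b ∉ A → x ∈ Metric.cthickening ε (frontier A) := by
    intro A a ha b hb haA hbA
    obtain ⟨f, hf, hfB⟩ := exists_mem_frontier_of_convex (convex_closedBall x ε) ha hb haA hbA
    rw [Metric.mem_closedBall, dist_comm] at hfB
    exact Metric.mem_cthickening_of_dist_le x f ε _ hf hfB
  obtain ⟨j, _ | n⟩ := i
  · by_cases hj : j = S.one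
    · subst hj
      rw [branchSide_zero_one] at huS hvS
      exact Or.inr ⟨by simp, key _ v hv u hu (not_not.1 hvS) huS⟩
    · rw [branchSide_zero hj] at huS hvS
      have hvR : v ∈ S.R := not_not.1 hvS
      refine Or.inl ⟨?_, key _ v hv u hu hvR huS⟩
      by_contra hf
      have h1 := hsub hv
      rw [branchDom_zero] at h1
      exact disjoint_left.1 (h.disjoint_of_not_feeds hj hf) (subset_closure hvR) h1.1
  · rw [branchSide_succ] at huS hvS
    have hf : S.Feeds j := by
      have h1 := hsub hu
      rw [branchDom_succ] at h1
      exact h1.1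
    by_cases hvT : v ∈ S.T '' S.R
    · have hvR : v ∈ S.R := by
        by_contra hvR
        exact hvS ⟨hvT, hvR⟩
      exact Or.inl ⟨hf, key _ v hv u hu hvR huS.2⟩
    · exact Or.inr ⟨by simpa using hf, key _ u hu v hv huS.1 hvT⟩

theorem collarR_inter_side (ε : ℝ) (i : Fin S.K × ℕ) :
    S.collarR ε i ∩ S.branchSide i ⊆ Metric.cthickening ε (frontier S.R) \ S.R :=
  fun _ hx => ⟨hx.1.2, h.notMem_R_of_mem_branchSide hc hx.2⟩

theorem collarR_diff_side {ε : ℝ} (hε : ε ≤ ρ) (i : Fin S.K × ℕ) :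
    S.collarR ε i \ S.branchSide i ⊆ S.R ∩ Metric.cthickening ε (frontier S.R) := by
  rintro x ⟨⟨hf, hx⟩, hxS⟩
  refine ⟨?_, hx⟩
  obtain ⟨j, _ | n⟩ := i
  · rw [branchSide_zero hf.1] at hxS
    exact not_not.1 hxS
  · rw [branchSide_succ] at hxS
    by_contra hxR
    exact hxS ⟨hc.image (h.cthickening_frontier_R_subset hc hε hx), hxR⟩

/-- Within the collar, presence of a branch means lying on one fixed side of `∂TR`: outside for the
first piece with `n = 0`, inside for `n ≥ 1`, since the collar avoids `R`. One-sided volume bounds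
therefore suffice. -/
theorem measure_collarTR_le {ε : ℝ} (hε0 : 0 ≤ ε) (hε : ε ≤ ρ) {b : ℝ≥0∞} (w : Eucl m) (r : ℝ)
    (h1 : volume (S.T '' S.R ∩ Metric.cthickening ε (frontier (S.T '' S.R)) ∩
      Metric.closedBall w r) ≤ b)
    (h2 : volume (Metric.cthickening ε (frontier (S.T '' S.R)) \ S.T '' S.R ∩
      Metric.closedBall w r) ≤ b) (i : Fin S.K × ℕ) :
    volume (S.collarTR ε i ∩ S.branchSide i ∩ Metric.closedBall w r) ≤ b ∧
      volume (S.collarTR ε i \ S.branchSide i ∩ Metric.closedBall w r) ≤ b := by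
  obtain ⟨j, _ | n⟩ := i
  · by_cases hj : j = S.one
    · subst hj
      rw [branchSide_zero_one]
      refine ⟨le_trans (measure_mono ?_) h2, le_trans (measure_mono ?_) h1⟩
      · exact fun x hx => ⟨⟨hx.1.1.2, hx.1.2⟩, hx.2⟩
      · exact fun x hx => ⟨⟨not_not.1 hx.1.2, hx.1.1.2⟩, hx.2⟩
    · have : S.collarTR ε (j, 0) = ∅ := by simp [collarTR, hj]
      simp [this]
  · rw [branchSide_succ]
    refine ⟨le_trans (measure_mono ?_) h1, le_trans (measure_mono ?_) h2⟩
    · exact fun x hx => ⟨⟨hx.1.2.1, hx.1.1.2⟩, hx.2⟩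
    · refine fun x hx => ⟨⟨hx.1.1.2, fun hT => hx.1.2 ⟨hT, ?_⟩⟩, hx.2⟩
      exact h.notMem_R_of_mem_cthickening hc hε0 hε hx.1.1.2

theorem measure_collarR_le {ε : ℝ} (hε : ε ≤ ρ) {b : ℝ≥0∞} (w : Eucl m) (r : ℝ)
    (h1 : volume (S.R ∩ Metric.cthickening ε (frontier S.R) ∩ Metric.closedBall w r) ≤ b)
    (h2 : volume (Metric.cthickening ε (frontier S.R) \ S.R ∩ Metric.closedBall w r) ≤ b)
    (i : Fin S.K × ℕ) :
    volume (S.collarR ε i ∩ S.branchSide i ∩ Metric.closedBall w r) ≤ b ∧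
      volume (S.collarR ε i \ S.branchSide i ∩ Metric.closedBall w r) ≤ b :=
  ⟨(measure_mono (inter_subset_inter_left _ (h.collarR_inter_side hc ε i))).trans h2,
    (measure_mono (inter_subset_inter_left _ (h.collarR_diff_side hc hε i))).trans h1⟩

theorem collarR_subset_branchDom {τ' : ℝ} (hτ : τ' < τ) (i : Fin S.K × ℕ) :
    S.collarR τ' i ⊆ S.branchDom s' τ i := by
  rintro w ⟨hf, hw⟩
  have hwR := h.cthickening_frontier_R_subset hc (hτ.le.trans hc.τ_le) hw
  obtain ⟨j, _ | n⟩ := i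
  · rw [branchDom_zero]
    have hT := hc.feeds j hf hwR
    exact ⟨hT, (h.norm_fderiv_branchInv_le_s hT
      (h.notMem_R_of_ne hf.1 (h.mapsTo_branchInv j hT))).trans_lt hc.s_lt⟩
  · rw [branchDom_succ]
    refine ⟨hf, Metric.cthickening_subset_thickening' hc.τ_pos hτ _ ?_⟩
    exact Metric.cthickening_subset_of_subset _ (frontier_subset_closure.trans
      (closure_mono h.R_subset_TR)) hw

theorem collarTR_subset_branchDom {τ' : ℝ} (hτ : τ' < τ) (i : Fin S.K × ℕ) :
    S.collarTR τ' i ⊆ S.branchDom s' τ i := by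
  rintro w ⟨hf, hw⟩
  obtain ⟨j, _ | n⟩ := i
  · obtain rfl : j = S.one := by simpa using hf
    rw [branchDom_zero]
    have hw' := Metric.cthickening_mono hτ.le _ hw
    exact ⟨hc.image_TR (Metric.cthickening_subset_of_subset _ frontier_subset_closure hw'),
      hc.norm_lt w hw'⟩
  · rw [branchDom_succ]
    refine ⟨by simpa using hf, Metric.cthickening_subset_thickening' hc.τ_pos hτ _ ?_⟩
    exact Metric.cthickening_subset_of_subset _ frontier_subset_closure hw

theorem image_collarR_subset_trap {τ' : ℝ} (hτ : τ' < τ) (i : Fin S.K × ℕ) :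
    S.branchMap i '' S.collarR τ' i ⊆ S.trap τ ρ := by
  rintro _ ⟨w, ⟨hf, hw⟩, rfl⟩
  have hwR := h.cthickening_frontier_R_subset hc (hτ.le.trans hc.τ_le) hw
  exact Or.inl (mem_iUnion.2 ⟨⟨i.1, hf⟩, _, (h.iterate_mem_cthickening_R hc hwR i.2).1, rfl⟩)

theorem image_collarTR_subset_trap {τ' : ℝ} (hτ : τ' < τ) (i : Fin S.K × ℕ) :
    S.branchMap i '' S.collarTR τ' i ⊆ S.trap τ ρ := by
  rintro _ ⟨w, ⟨hf, hw⟩, rfl⟩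
  have hw' := Metric.cthickening_mono hτ.le _ hw
  obtain ⟨j, _ | n⟩ := i
  · obtain rfl : j = S.one := by simpa using hf
    exact Or.inr ⟨w, hw', rfl⟩
  · refine Or.inl (mem_iUnion.2 ⟨⟨j, by simpa using hf⟩, _,
      h.iterate_succ_mem hc ?_ n, rfl⟩)
    exact Metric.cthickening_subset_of_subset _ frontier_subset_closure hw'

/-- If `n < n'`, applying `T^n` to the coincidence would exhibit `w` as a proper backward iterate of
`w'`, and such iterates avoid `X`. -/
theorem iterate_ne_of_frontier {X : Set (Eucl m)} {w w' : Eucl m} {n n' : ℕ} {j : Fin S.K}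
    (hw : (S.branchInv S.one)^[n] w ∈ S.T '' S.U j) (hw' : (S.branchInv S.one)^[n'] w' ∈ S.T '' S.U j)
    (hwT : w ∈ Metric.cthickening τ (closure (S.T '' S.R)))
    (hwT' : w' ∈ Metric.cthickening τ (closure (S.T '' S.R))) (hwX : w ∈ X)
    (hX : ∀ k, (S.branchInv S.one)^[k + 1] w' ∉ X)
    (he : S.branchMap (j, n) w = S.branchMap (j, n') w') : n' ≤ n := by
  by_contra! hlt
  have h1 : (S.branchInv S.one)^[n] w = (S.branchInv S.one)^[n'] w' :=
    h.injOn_branchInv j hw hw' he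
  have h2 := congrArg (S.T^[n]) h1
  rw [h.T_iterate hc hwT le_rfl, h.T_iterate hc hwT' hlt.le, Nat.sub_self,
    Function.iterate_zero, id, show n' - n = (n' - n - 1) + 1 by omega] at h2
  exact hX _ (h2 ▸ hwX)

/-- Backward iterates leave the collar at once and never come back, so `iterate_ne_of_frontier`,
used in both directions, forces equal exponents. Disjointness makes all branch contributions over
the collars fit into a single integral. -/
theorem disjoint_image_collarR {τ' : ℝ} (hτ : τ' < τ) :
    Pairwise fun i i' : Fin S.K × ℕ =>
      Disjoint (S.branchMap i '' S.collarR τ' i) (S.branchMap i' '' S.collarR τ' i') := by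
  intro i i' hne
  rw [disjoint_left]
  rintro _ ⟨w, hw, rfl⟩ ⟨w', hw', he⟩
  have hd := h.collarR_subset_branchDom hc hτ i hw
  have hd' := h.collarR_subset_branchDom hc hτ i' hw'
  have hj : i.1 = i'.1 := h.eq_of_mem (h.branchMap_mem hc hd) (he ▸ h.branchMap_mem hc hd')
  have hT : ∀ w ∈ Metric.cthickening τ' (frontier S.R),
      w ∈ Metric.cthickening τ (closure (S.T '' S.R)) ∧
      ∀ k, (S.branchInv S.one)^[k + 1] w ∉ Metric.cthickening τ' (frontier S.R) := by
    intro w hw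
    refine ⟨Metric.cthickening_subset_of_subset _ (frontier_subset_closure.trans
      (closure_mono h.R_subset_TR)) (Metric.cthickening_mono hτ.le _ hw), fun k hk => ?_⟩
    have h1 := h.cthickening_frontier_R_subset hc (hτ.le.trans hc.τ_le) hw
    exact ((h.iterate_mem_cthickening_R hc h1 (k + 1)).2 k.succ_ne_zero).2
      (Metric.cthickening_mono (hτ.le.trans hc.τ_le) _ hk)
  obtain ⟨j, n⟩ := i
  obtain ⟨j', n'⟩ := i'
  obtain rfl : j = j' := hj
  have a1 := h.iterate_ne_of_frontier hc (n := n) (n' := n') (j := j) (h.iterate_mem_TU hc hd) (h.iterate_mem_TU hc hd')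
    (hT w hw.2).1 (hT w' hw'.2).1 hw.2 (hT w' hw'.2).2 he.symm
  have a2 := h.iterate_ne_of_frontier hc (n := n') (n' := n) (j := j) (h.iterate_mem_TU hc hd') (h.iterate_mem_TU hc hd)
    (hT w' hw'.2).1 (hT w hw.2).1 hw'.2 (hT w hw.2).2 he
  exact hne (Prod.ext rfl (le_antisymm a2 a1))

theorem disjoint_image_collarTR {τ' : ℝ} (hτ : τ' < τ) :
    Pairwise fun i i' : Fin S.K × ℕ =>
      Disjoint (S.branchMap i '' S.collarTR τ' i) (S.branchMap i' '' S.collarTR τ' i') := by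
  intro i i' hne
  rw [disjoint_left]
  rintro _ ⟨w, hw, rfl⟩ ⟨w', hw', he⟩
  have hd := h.collarTR_subset_branchDom hc hτ i hw
  have hd' := h.collarTR_subset_branchDom hc hτ i' hw'
  have hj : i.1 = i'.1 := h.eq_of_mem (h.branchMap_mem hc hd) (he ▸ h.branchMap_mem hc hd')
  have hT : ∀ w ∈ Metric.cthickening τ' (frontier (S.T '' S.R)),
      w ∈ Metric.cthickening τ (closure (S.T '' S.R)) ∧
      ∀ k, (S.branchInv S.one)^[k + 1] w ∉ Metric.cthickening τ' (frontier (S.T '' S.R)) := by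
    intro w hw
    have h1 := Metric.cthickening_subset_of_subset τ frontier_subset_closure
      (Metric.cthickening_mono hτ.le _ hw)
    exact ⟨h1, fun k hk => h.iterate_succ_notMem hc h1 k (Metric.cthickening_mono hτ.le _ hk)⟩
  obtain ⟨j, n⟩ := i
  obtain ⟨j', n'⟩ := i'
  obtain rfl : j = j' := hj
  have a1 := h.iterate_ne_of_frontier hc (n := n) (n' := n') (j := j) (h.iterate_mem_TU hc hd) (h.iterate_mem_TU hc hd')
    (hT w hw.2).1 (hT w' hw'.2).1 hw.2 (hT w' hw'.2).2 he.symm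
  have a2 := h.iterate_ne_of_frontier hc (n := n') (n' := n) (j := j) (h.iterate_mem_TU hc hd') (h.iterate_mem_TU hc hd)
    (hT w' hw'.2).1 (hT w hw.2).1 hw'.2 (hT w hw.2).2 he
  exact hne (Prod.ext rfl (le_antisymm a2 a1))

theorem isCompact_trap : IsCompact (S.trap τ ρ) := by
  refine IsCompact.union (isCompact_iUnion fun j => ?_) ?_
  · exact (h.isCompact_closure_R.cthickening).image_of_continuousOn
      ((h.continuousOn_branchInv j.1).mono (hc.feeds j.1 j.2))
  · exact (h.isCompact_frontier_TR.cthickening).image_of_continuousOn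
      ((h.continuousOn_branchInv S.one).mono
        ((Metric.cthickening_subset_of_subset _ frontier_subset_closure).trans hc.image_TR))

theorem trap_subset : S.trap τ ρ ⊆ ⋃ j, S.U j := by
  rintro y (hy | ⟨w, hw, rfl⟩)
  · obtain ⟨j, w, hw, rfl⟩ := mem_iUnion.1 hy
    exact mem_iUnion.2 ⟨j, h.mapsTo_branchInv _ (hc.feeds j.1 j.2 hw)⟩
  · exact mem_iUnion.2 ⟨S.one, h.mapsTo_branchInv _
      (hc.image_TR (Metric.cthickening_subset_of_subset _ frontier_subset_closure hw))⟩

end Assumptions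
end PiecewiseSystem
end

/-! ### Layers along the discontinuities and their separation from the trap. -/

section

/-- Quantitative inverse function theorem. Near `c` the map differs from its derivative by an error
of slope `s⁻¹ - s₁⁻¹`, which leaves expansion `s₁⁻¹`, so a ball of radius `s₁ ε` covers one of
radius `ε`. Determinants are kept within a factor `√(1 + κ)` of the one at `c`. -/
theorem HasStrictFDerivAt.exists_covering_nhd {m : ℕ} [Nontrivial (Eucl m)] {F : Eucl m → Eucl m}
    {F' : Eucl m → Eucl m →L[ℝ] Eucl m} {c : Eucl m} (hF : HasStrictFDerivAt F (F' c) c)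
    (hcont : ContinuousAt F' c) {s s₁ κ : ℝ} (hs : 0 < s) (hss : s < s₁) (hκ : 0 < κ)
    (hexp : ∀ v, ‖v‖ ≤ s * ‖F' c v‖) :
    ∃ W : Set (Eucl m), IsOpen W ∧ c ∈ W ∧ ∀ v : Eucl m, ∀ ε : ℝ, 0 ≤ ε →
      Metric.closedBall v (s₁ * ε) ⊆ W → ∀ x, dist x (F v) ≤ ε →
      ∃ y ∈ Metric.closedBall v (s₁ * ε), F y = x ∧ (F' y).det ≠ 0 ∧
        |(F' y).det| ≤ (1 + κ) * |(F' v).det| := by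
  have hdet := det_ne_zero_of_norm_le hexp
  set L := (F' c).toContinuousLinearEquivOfDetNeZero hdet with hL
  have hLc : (L : Eucl m →L[ℝ] Eucl m) = F' c := by simp [hL]
  have hLs : ‖(L.symm : Eucl m →L[ℝ] Eucl m)‖ ≤ s := by
    refine ContinuousLinearMap.opNorm_le_bound _ hs.le fun w => ?_
    have := hexp (L.symm w)
    rw [← hLc] at this
    simpa using this
  have hs1 : 0 < s₁ := hs.trans hss
  have hc0 : 0 < s⁻¹ - s₁⁻¹ := sub_pos.2 (inv_strictAnti₀ hs hss)
  obtain ⟨W₁, hW₁, hW₁a⟩ := hF.approximates_deriv_on_nhds (c := ⟨s⁻¹ - s₁⁻¹, hc0.le⟩)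
    (Or.inr (by exact_mod_cast hc0))
  set q := √(1 + κ) with hq
  have hq1 : 1 < q := by rw [hq, Real.lt_sqrt (by norm_num)]; linarith
  have hq2 : q * q = 1 + κ := Real.mul_self_sqrt (by linarith)
  have hD : 0 < |(F' c).det| := abs_pos.2 hdet
  have hdc : ContinuousAt (fun y => |(F' y).det|) c :=
    (ContinuousLinearMap.continuous_det.continuousAt.comp hcont).abs
  have e1 : ∀ᶠ y in 𝓝 c, |(F' y).det| < |(F' c).det| * q :=
    hdc.eventually_lt_const (lt_mul_of_one_lt_right hD hq1)
  have e2 : ∀ᶠ y in 𝓝 c, |(F' c).det| / q < |(F' y).det| :=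
    hdc.eventually_const_lt (div_lt_self hD hq1)
  obtain ⟨W, hWsub, hWo, hcW⟩ := mem_nhds_iff.1 (inter_mem hW₁ (e1.and e2))
  refine ⟨W, hWo, hcW, fun v ε hε hball x hx => ?_⟩
  have hW₁b : ApproximatesLinearOn F (L : Eucl m →L[ℝ] Eucl m) W₁ ⟨s⁻¹ - s₁⁻¹, hc0.le⟩ := by
    rwa [hLc]
  have hsurj := hW₁b.surjOn_closedBall_of_nonlinearRightInverse
    L.toNonlinearRightInverse (b := v) (ε := s₁ * ε) (by positivity)
    (hball.trans (hWsub.trans inter_subset_left))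
  have hr : ε ≤ (((L.toNonlinearRightInverse).nnnorm : ℝ)⁻¹ -
      ((⟨s⁻¹ - s₁⁻¹, hc0.le⟩ : ℝ≥0) : ℝ)) * (s₁ * ε) := by
    have h1 : ((L.toNonlinearRightInverse).nnnorm : ℝ) =
      ‖(L.symm : Eucl m →L[ℝ] Eucl m)‖ := rfl
    have h2 : 0 < ‖(L.symm : Eucl m →L[ℝ] Eucl m)‖ := L.symm.norm_pos
    have h3 : s⁻¹ ≤ ‖(L.symm : Eucl m →L[ℝ] Eucl m)‖⁻¹ := inv_anti₀ h2 hLs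
    rw [h1]
    change ε ≤ (_ - (s⁻¹ - s₁⁻¹)) * (s₁ * ε)
    calc ε = s₁⁻¹ * (s₁ * ε) := by field_simp
      _ ≤ _ := by gcongr; linarith
  obtain ⟨y, hy, hyx⟩ := hsurj (Metric.closedBall_subset_closedBall hr hx)
  have hyW := hWsub (hball hy)
  have hvW := hWsub (hball (Metric.mem_closedBall_self (by positivity)))
  have hq0 : 0 < q := by linarith
  refine ⟨y, hy, hyx, ?_, ?_⟩
  · exact abs_pos.1 ((div_pos hD hq0).trans hyW.2.2)
  · have h1 := hvW.2.2
    rw [div_lt_iff₀ hq0] at h1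
    calc |(F' y).det| ≤ |(F' c).det| * q := hyW.2.1.le
      _ ≤ |(F' v).det| * q * q := by gcongr
      _ = _ := by rw [mul_assoc, hq2, mul_comm]

/-- If a point is close to the compact set `C` and its image is close to `Q`, then the point is close
to the part of `C` which is mapped to `Q`. -/
theorem exists_mem_thickening_of_image {m : ℕ} {F : Eucl m → Eucl m} {U C Q L : Set (Eucl m)}
    (hU : IsOpen U) (hF : ContinuousOn F U) (hC : IsCompact C) (hCU : C ⊆ U) (hQ : IsClosed Q)
    (hL : ∀ y ∈ C, F y ∈ Q → y ∈ L) {δ : ℝ} (hδ : 0 < δ) :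
    ∃ e > 0, ∀ y ∈ Metric.cthickening e C, F y ∈ Metric.cthickening e Q →
      y ∈ Metric.thickening δ L := by
  set K' := C \ Metric.thickening δ L with hK'
  have hK'c : IsCompact K' := hC.diff Metric.isOpen_thickening
  have hK'd : Disjoint (F '' K') Q := by
    rw [disjoint_left]
    rintro _ ⟨y, hy, rfl⟩ hf
    exact hy.2 (Metric.self_subset_thickening hδ _ (hL y hy.1 hf))
  obtain ⟨δ', hδ', hδd'⟩ := hK'd.exists_cthickenings
    (hK'c.image_of_continuousOn (hF.mono (sdiff_subset.trans hCU))) hQ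
  have hop : IsOpen (Metric.thickening δ L ∪ (U ∩ F ⁻¹' Metric.thickening δ' (F '' K'))) :=
    Metric.isOpen_thickening.union (hF.isOpen_inter_preimage hU Metric.isOpen_thickening)
  obtain ⟨δ'', hδ'', hδs⟩ := hC.exists_cthickening_subset_open hop (by
    intro y hy
    by_cases hyL : y ∈ Metric.thickening δ L
    · exact Or.inl hyL
    · have h0 : F y ∈ F '' K' := mem_image_of_mem F ⟨hy, hyL⟩
      have h1 : F y ∈ Metric.thickening δ' (F '' K') := Metric.self_subset_thickening hδ' _ h0
      exact mem_union_right _ (mem_inter (hCU hy) (mem_preimage.2 h1)))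
  refine ⟨min δ' δ'', lt_min hδ' hδ'', fun y hy hyQ => ?_⟩
  rcases hδs (Metric.cthickening_mono (min_le_right _ _) _ hy) with h1 | h1
  · exact h1
  · have h2 : F y ∈ Metric.thickening δ' (F '' K') := h1.2
    have h3 : F y ∈ Metric.cthickening δ' (F '' K') := Metric.thickening_subset_cthickening _ _ h2
    have h4 : F y ∈ Metric.cthickening δ' Q := Metric.cthickening_mono (min_le_left _ _) _ hyQ
    exact (disjoint_left.1 hδd' h3 h4).elim

namespace PiecewiseSystem

variable {m : ℕ} {S : PiecewiseSystem m} {α η₀ ε₂ I Cξ : ℝ}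

/-- Points close to the piece `U_j` but outside `R` whose image is close to the boundary of
`TU_j`. -/
def layer (S : PiecewiseSystem m) (ε : ℝ) (j : Fin S.K) : Set (Eucl m) :=
  (S.Ut j ∩ S.Tt j ⁻¹' Metric.cthickening ε (frontier (S.T '' S.U j))) ∩
    (Metric.cthickening ε (closure (S.U j) \ S.R) ∩ {y | (fderiv ℝ (S.Tt j) y).det ≠ 0})

theorem layer_mono {ε ε' : ℝ} (hε : ε ≤ ε') (j : Fin S.K) : S.layer ε j ⊆ S.layer ε' j :=
  inter_subset_inter
    (inter_subset_inter_right _ (preimage_mono (Metric.cthickening_mono hε _)))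
    (inter_subset_inter_left _ (Metric.cthickening_mono hε _))

namespace Assumptions

variable (h : S.Assumptions α η₀ ε₂ I Cξ)
include h

theorem continuousOn_Tt (j : Fin S.K) : ContinuousOn (S.Tt j) (S.Ut j) := fun _ hy =>
  (h.hasStrictFDerivAt_Tt hy).continuousAt.continuousWithinAt

theorem isCompact_outer (j : Fin S.K) : IsCompact (closure (S.U j) \ S.R) :=
  (h.isCompact_closure_U j).diff h.a3.isOpen_R

theorem outer_subset (j : Fin S.K) : closure (S.U j) \ S.R ⊆ S.Ut j :=
  sdiff_subset.trans (h.a1.closure_subset j)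

/-- At boundary points of the piece the bound is a limit of the bounds at points of `U_j` outside
`R`. Such points accumulate there because the closure of `R` lies in the open piece `U_1`. -/
theorem norm_le_s_of_mem_outer {j : Fin S.K} {y : Eucl m} (hy : y ∈ closure (S.U j) \ S.R)
    (v : Eucl m) : ‖v‖ ≤ S.s * ‖fderiv ℝ (S.Tt j) y v‖ := by
  by_cases hyU : y ∈ S.U j
  · rw [h.fderiv_Tt hyU]
    exact h.norm_le_s hyU hy.2 v
  have hyR : y ∈ (closure S.R)ᶜ ∨ ∀ z ∈ S.U j, z ∉ S.R := by
    by_cases hj : j = S.one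
    · subst hj
      exact Or.inl fun hR => hyU (h.closure_R_subset hR)
    · exact Or.inr fun z hz => h.notMem_R_of_ne hj hz
  have hfr : ∃ᶠ z in 𝓝 y, z ∈ S.U j ∧ z ∉ S.R := by
    have h1 := mem_closure_iff_frequently.1 hy.1
    rcases hyR with h2 | h2
    · refine (h1.and_eventually (isClosed_closure.isOpen_compl.eventually_mem h2)).mono ?_
      exact fun z hz => ⟨hz.1, fun hR => hz.2 (subset_closure hR)⟩
    · exact h1.mono fun z hz => ⟨hz, h2 z hz⟩
  have hcont : ContinuousAt (fun z => S.s * ‖fderiv ℝ (S.Tt j) z v‖) y :=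
    continuousAt_const.mul (((h.a1.smooth_ext j).continuousAt_fderiv h.α_pos (h.a1.isOpen_Ut j)
      (h.outer_subset j hy)).clm_apply continuousAt_const).norm
  by_contra! hlt
  obtain ⟨z, hz1, hz2⟩ := (hfr.and_eventually (hcont.eventually_lt_const hlt)).exists
  rw [h.fderiv_Tt hz1.1] at hz2
  exact absurd (h.norm_le_s hz1.1 hz1.2 v) (not_le.2 hz2)

/-- Points close to the image of a point of `U_j \ R` have a preimage under the extended map. -/
theorem exists_preimage {s₁ κ : ℝ} (hs : S.s < s₁) (hκ : 0 < κ) :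
    ∃ r > 0, ∀ j, ∀ v ∈ S.U j, v ∉ S.R → ∀ ε : ℝ, 0 ≤ ε → s₁ * ε ≤ r → ∀ x, dist x (S.T v) ≤ ε →
      ∃ y ∈ Metric.closedBall v (s₁ * ε), y ∈ S.Ut j ∧ S.Tt j y = x ∧
        (fderiv ℝ (S.Tt j) y).det ≠ 0 ∧
        |(fderiv ℝ (S.Tt j) y).det| ≤ (1 + κ) * |(fderiv ℝ S.T v).det| := by
  have := h.nontrivial
  have key : ∀ j, ∃ r > 0, ∀ v ∈ S.U j, v ∉ S.R → ∀ ε : ℝ, 0 ≤ ε → s₁ * ε ≤ r →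
      ∀ x, dist x (S.T v) ≤ ε →
      ∃ y ∈ Metric.closedBall v (s₁ * ε), y ∈ S.Ut j ∧ S.Tt j y = x ∧
        (fderiv ℝ (S.Tt j) y).det ≠ 0 ∧
        |(fderiv ℝ (S.Tt j) y).det| ≤ (1 + κ) * |(fderiv ℝ S.T v).det| := by
    intro j
    have hloc : ∀ c : ↥(closure (S.U j) \ S.R), _ := fun c =>
      (h.hasStrictFDerivAt_Tt (h.outer_subset j c.2)).exists_covering_nhd
        (F' := fderiv ℝ (S.Tt j)) ((h.a1.smooth_ext j).continuousAt_fderiv h.α_pos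
          (h.a1.isOpen_Ut j) (h.outer_subset j c.2)) h.s_pos hs hκ (h.norm_le_s_of_mem_outer c.2)
    choose W hWo hcW hW using hloc
    obtain ⟨δ, hδ, hleb⟩ := lebesgue_number_lemma_of_metric (h.isCompact_outer j)
      (fun c => (hWo c).inter (h.a1.isOpen_Ut j))
      (fun c hc => mem_iUnion.2 ⟨⟨c, hc⟩, hcW ⟨c, hc⟩, h.outer_subset j hc⟩)
    refine ⟨δ / 2, by positivity, fun v hv hvR ε hε hle x hx => ?_⟩
    obtain ⟨c, hc⟩ := hleb v ⟨subset_closure hv, hvR⟩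
    have hball : Metric.closedBall v (s₁ * ε) ⊆ W c ∩ S.Ut j :=
      (Metric.closedBall_subset_ball (by linarith)).trans hc
    obtain ⟨y, hy, hyx, hd, hle'⟩ := hW c v ε hε (hball.trans inter_subset_left) x
      (by rwa [h.a1.extends_T j hv])
    refine ⟨y, hy, (hball hy).2, hyx, hd, ?_⟩
    rwa [h.fderiv_Tt hv] at hle'
  choose r hr hrP using key
  obtain ⟨r₀, hr₀, hr₀r⟩ : ∃ r₀ > 0, ∀ j, r₀ ≤ r j := by
    have : Nonempty (Fin S.K) := ⟨S.one⟩
    obtain ⟨j₀, hj₀⟩ := Finite.exists_min r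
    exact ⟨r j₀, hr j₀, hj₀⟩
  exact ⟨r₀, hr₀, fun j v hv hvR ε hε hle => hrP j v hv hvR ε hε (hle.trans (hr₀r j))⟩

theorem measurableSet_layer (ε : ℝ) (j : Fin S.K) : MeasurableSet (S.layer ε j) := by
  refine MeasurableSet.inter ?_ (Metric.isClosed_cthickening.measurableSet.inter ?_)
  · obtain ⟨Z, hZ, hZe⟩ := (continuousOn_iff_isClosed.1 (h.continuousOn_Tt j))
      (Metric.cthickening ε (frontier (S.T '' S.U j))) Metric.isClosed_cthickening
    rw [inter_comm, hZe]
    exact hZ.measurableSet.inter (h.a1.isOpen_Ut j).measurableSet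
  · exact (ContinuousLinearMap.continuous_det.measurable.comp (measurable_fderiv ℝ (S.Tt j)))
      (measurableSet_singleton (0 : ℝ)).compl

/-- Thin layers are close to the compact set `L` of points of `closure U_j \ R` that the extended
map sends to the boundary of `TU_j`. A point of `L` lies in no open piece: the piece would have to
be `U_j`, whose image is open and misses its own boundary. The trap is a compact subset of the union
of the pieces, hence at positive distance from `L`. -/
theorem exists_layer_separation_of_piece {s' τ ρ : ℝ} (hc : S.Collar s' τ ρ) (j : Fin S.K) :
    ∃ e > 0, ∀ y ∈ S.layer e j, ∀ z, dist z y < e → z ∉ S.trap τ ρ := by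
  have hCc : IsCompact (closure (S.U j) \ S.R) := h.isCompact_outer j
  obtain ⟨L, hLdef⟩ : ∃ L : Set (Eucl m), L = (closure (S.U j) \ S.R) ∩
    S.Tt j ⁻¹' frontier (S.T '' S.U j) := ⟨_, rfl⟩
  have hcont : ContinuousOn (S.Tt j) (closure (S.U j) \ S.R) :=
    (h.continuousOn_Tt j).mono (h.outer_subset j)
  have hLc : IsCompact L := hLdef ▸ hCc.of_isClosed_subset
    (hcont.preimage_isClosed_of_isClosed hCc.isClosed isClosed_frontier) inter_subset_left
  have hdisj : Disjoint L (S.trap τ ρ) := by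
    rw [disjoint_left]
    intro y hy hyt
    rw [hLdef] at hy
    obtain ⟨i, hi⟩ := mem_iUnion.1 (h.trap_subset hc hyt)
    obtain ⟨z, hz1, hz2⟩ := mem_closure_iff.1 hy.1.1 (S.U i) (h.isOpen_U i) hi
    obtain rfl : i = j := h.eq_of_mem hz1 hz2
    have h1 : S.Tt i y ∈ frontier (S.T '' S.U i) := hy.2
    rw [h.a1.extends_T i hi, (h.isOpen_TU i).frontier_eq] at h1
    exact h1.2 ⟨y, hi, rfl⟩
  obtain ⟨δ, hδ, hδd⟩ := hdisj.exists_cthickenings hLc (h.isCompact_trap hc).isClosed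
  obtain ⟨e, he, heL⟩ := exists_mem_thickening_of_image (h.a1.isOpen_Ut j)
    (h.continuousOn_Tt j) hCc (h.outer_subset j)
    (isClosed_frontier (s := S.T '' S.U j)) (L := L)
    (fun y hy hyQ => by rw [hLdef]; exact ⟨hy, hyQ⟩) hδ
  refine ⟨min δ e, lt_min hδ he, fun y hy z hz hzt => ?_⟩
  have hyL : y ∈ Metric.thickening δ L :=
    heL y (Metric.cthickening_mono (min_le_right _ _) _ hy.2.1)
      (Metric.cthickening_mono (min_le_right _ _) _ hy.1.2)
  have hyL' : y ∈ Metric.cthickening δ L := Metric.thickening_subset_cthickening _ _ hyL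
  have hyz : dist y z ≤ δ := by
    rw [dist_comm]
    exact hz.le.trans (min_le_left _ _)
  have hyt : y ∈ Metric.cthickening δ (S.trap τ ρ) :=
    Metric.mem_cthickening_of_dist_le y z δ _ hzt hyz
  exact (disjoint_left.1 hδd hyL' hyt).elim

/-- The points close to a given layer stay away from the trap. -/
theorem exists_layer_separation {s' τ ρ : ℝ} (hc : S.Collar s' τ ρ) :
    ∃ e > 0, ∀ ε ≤ e, ∀ j, ∀ y ∈ S.layer ε j, ∀ z, dist z y < e → z ∉ S.trap τ ρ := by
  choose e he heP using h.exists_layer_separation_of_piece hc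
  have : Nonempty (Fin S.K) := ⟨S.one⟩
  obtain ⟨j₀, hj₀⟩ := Finite.exists_min e
  refine ⟨e j₀, he j₀, fun ε hε j y hy z hz => ?_⟩
  have hε' : ε ≤ e j := hε.trans (hj₀ j)
  exact heP j y (layer_mono hε' j hy) z (hz.trans_le (hj₀ j))

/-- The density of the layers in balls. -/
theorem measure_layer_le {v : Eucl m} (hv : v ∈ S.M) {ε r : ℝ} (hε : 0 < ε)
    (hεr : ε ≤ r / (1 - S.s)) (hr : r / (1 - S.s) ≤ ε₂) :
    ∑ j, volume (S.layer ε j ∩ Metric.closedBall v r) ≤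
      S.lam α ε₂ / 2 * ENNReal.ofReal ((ε / (r / (1 - S.s))) ^ α) *
        volume (Metric.closedBall (0 : Eucl m) r) := by
  have h1s : 0 < 1 - S.s := sub_pos.2 h.s_lt_one
  -- The bound on `G_U` is used at the scale `t`, for which its balls have radius exactly `r`. The
  -- half of `λ` obtained here is doubled again by the packing inequality.
  set t := r / (1 - S.s) with ht
  have htr : (1 - S.s) * t = r := by rw [ht]; field_simp
  have ht0 : 0 < t := hε.trans_le hεr
  have hr0 : 0 < r := htr ▸ mul_pos h1s ht0
  have hv0 : volume (Metric.closedBall v r) ≠ 0 := (Metric.measure_closedBall_pos _ _ hr0).ne'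
  have hvt : volume (Metric.closedBall v r) ≠ ∞ := measure_closedBall_lt_top.ne
  have e1 : ∑ j, volume (S.layer ε j ∩ Metric.closedBall v r) ≤
      S.GUAt v ε t * volume (Metric.closedBall v r) := by
    rw [GUAt, htr, Finset.sum_mul]
    refine Finset.sum_le_sum fun j _ => ?_
    rw [ENNReal.div_mul_cancel hv0 hvt]
    exact measure_mono (inter_subset_inter_left _ inter_subset_left)
  have e2 : S.GUAt v ε t ≤ S.GU ε t := le_iSup₂_of_le (f := fun x _ => S.GUAt x ε t) v hv le_rfl
  have hεα : 0 < ε ^ α := Real.rpow_pos_of_pos hε α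
  have htα : 0 < t ^ α := Real.rpow_pos_of_pos ht0 α
  have e3 : 2 * (S.GU ε t / ENNReal.ofReal (ε ^ α) * ENNReal.ofReal (t ^ α)) ≤ S.lam α ε₂ := by
    refine le_trans ?_ (le_max_left _ _)
    refine mul_le_mul_right ?_ 2
    exact le_iSup₂_of_le t ⟨ht0, hr⟩ (le_iSup₂_of_le ε ⟨hε, hεr⟩ le_rfl)
  have e4 : S.GU ε t ≤ S.lam α ε₂ / 2 * ENNReal.ofReal ((ε / t) ^ α) := by
    rw [Real.div_rpow hε.le ht0.le, ENNReal.ofReal_div_of_pos htα, ENNReal.div_eq_inv_mul,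
      ENNReal.div_eq_inv_mul]
    have a0 : ENNReal.ofReal (ε ^ α) ≠ 0 := by simpa using hεα
    have a1 : ENNReal.ofReal (ε ^ α) ≠ ∞ := ENNReal.ofReal_ne_top
    have b0 : ENNReal.ofReal (t ^ α) ≠ 0 := by simpa using htα
    have b1 : ENNReal.ofReal (t ^ α) ≠ ∞ := ENNReal.ofReal_ne_top
    calc S.GU ε t = 2⁻¹ * (2 * (S.GU ε t / ENNReal.ofReal (ε ^ α) * ENNReal.ofReal (t ^ α))) *
          ((ENNReal.ofReal (t ^ α))⁻¹ * ENNReal.ofReal (ε ^ α)) := by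
          rw [← mul_assoc 2⁻¹, ENNReal.inv_mul_cancel two_ne_zero ENNReal.ofNat_ne_top, one_mul,
            mul_assoc, ← mul_assoc (ENNReal.ofReal (t ^ α)), ENNReal.mul_inv_cancel b0 b1, one_mul,
            ENNReal.div_mul_cancel a0 a1]
      _ ≤ _ := by gcongr
  rw [← Measure.addHaar_closedBall_center volume v r]
  exact e1.trans (mul_le_mul_left (e2.trans e4) _)

end Assumptions
end PiecewiseSystem
end

/-! ### The transfer operator as a sum over branches, and its distortion. -/

section

theorem ContinuousOn.measurable_indicator_comp {m : ℕ} {f : Eucl m → Eucl m} {s : Set (Eucl m)}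
    (hf : ContinuousOn f s) (hs : MeasurableSet s) {g : Eucl m → ℝ≥0∞} (hg : Measurable g) :
    Measurable (s.indicator fun x => g (f x)) := by
  classical
  have h1 : Measurable (s.piecewise f fun _ => 0) :=
    hf.measurable_piecewise continuousOn_const hs
  have h2 : (s.indicator fun x => g (f x)) = s.indicator (g ∘ s.piecewise f fun _ => 0) := by
    ext x
    by_cases hx : x ∈ s
    · simp [hx]
    · simp [hx]
  rw [h2]
  exact (hg.comp h1).indicator hs

namespace PiecewiseSystem

variable {m : ℕ} {S : PiecewiseSystem m} {α η₀ ε₂ I Cξ : ℝ}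

/-- The weight of an inverse branch. -/
def branchWeight (S : PiecewiseSystem m) (i : Fin S.K × ℕ) (x : Eucl m) : ℝ≥0∞ :=
  ENNReal.ofReal |(fderiv ℝ (S.branchMap i) x).det|

/-- The contribution of an inverse branch to the transfer operator, on its whole domain. -/
def branchTerm (S : PiecewiseSystem m) (s' τ : ℝ) (i : Fin S.K × ℕ) (g : Eucl m → ℝ≥0∞) :
    Eucl m → ℝ≥0∞ :=
  (S.branchDom s' τ i).indicator fun x => S.branchWeight i x * g (S.branchMap i x)

/-- The transfer operator of the first return map, acting on nonnegative functions. -/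
def branchOp (S : PiecewiseSystem m) (s' τ : ℝ) (g : Eucl m → ℝ≥0∞) (x : Eucl m) : ℝ≥0∞ :=
  ∑' i, (S.branchSide i).indicator (S.branchTerm s' τ i g) x

theorem measurable_branchWeight (i : Fin S.K × ℕ) : Measurable (S.branchWeight i) :=
  ENNReal.measurable_ofReal.comp
    (ContinuousLinearMap.continuous_det.measurable.comp (measurable_fderiv ℝ _)).abs

theorem branchTerm_mono (s' τ : ℝ) (i : Fin S.K × ℕ) {g g' : Eucl m → ℝ≥0∞} (hg : g ≤ g') :
    S.branchTerm s' τ i g ≤ S.branchTerm s' τ i g' := by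
  intro x
  refine indicator_le_indicator (mul_le_mul_right (hg _) _)

namespace Assumptions

variable (h : S.Assumptions α η₀ ε₂ I Cξ)
include h

section
variable {s' τ ρ : ℝ} (hc : S.Collar s' τ ρ)
include hc

theorem measurable_branchTerm (i : Fin S.K × ℕ) {g : Eucl m → ℝ≥0∞} (hg : Measurable g) :
    Measurable (S.branchTerm s' τ i g) := by
  have h1 : S.branchTerm s' τ i g = fun x => S.branchWeight i x *
      (S.branchDom s' τ i).indicator (fun x => g (S.branchMap i x)) x := by
    ext x
    by_cases hx : x ∈ S.branchDom s' τ i <;> simp [branchTerm, hx]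
  rw [h1]
  refine (measurable_branchWeight i).mul (ContinuousOn.measurable_indicator_comp ?_
    (h.isOpen_branchDom hc i).measurableSet hg)
  exact fun x hx => (h.hasFDerivAt_branchMap hc hx).continuousAt.continuousWithinAt

theorem measurable_branchOp {g : Eucl m → ℝ≥0∞} (hg : Measurable g) :
    Measurable (S.branchOp s' τ g) :=
  Measurable.tsum fun i =>
    (h.measurable_branchTerm hc i hg).indicator (h.measurableSet_branchSide i)

/-- Integration of branch contributions over sets with disjoint images. -/
theorem lintegral_tsum_branchTerm_le {B : Fin S.K × ℕ → Set (Eucl m)}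
    (hB : ∀ i, MeasurableSet (B i)) (hsub : ∀ i, B i ⊆ S.branchDom s' τ i) {Z : Set (Eucl m)}
    (hdisj : Pairwise fun i j => Disjoint (S.branchMap i '' B i) (S.branchMap j '' B j))
    (hZ : ∀ i, S.branchMap i '' B i ⊆ Z) (g : Eucl m → ℝ≥0∞) :
    ∑' i, ∫⁻ x in B i, S.branchTerm s' τ i g x ≤ ∫⁻ y in Z, g y := by
  refine le_of_eq_of_le ?_ (tsum_lintegral_branch_le hB
    (fun i w hw => h.hasFDerivAt_branchMap hc (hsub i hw))
    (fun i => (h.injOn_branchMap hc i).mono (hsub i)) hdisj hZ g)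
  congr 1
  ext i
  refine setLIntegral_congr_fun (hB i) fun x hx => ?_
  rw [branchTerm, indicator_of_mem (hsub i hx), branchWeight]

/-- The branch sets have disjoint images by `branch_unique`, so change of variables gives
contraction in `L¹`. -/
theorem lintegral_branchOp_le {g : Eucl m → ℝ≥0∞} (hg : Measurable g) :
    ∫⁻ x, S.branchOp s' τ g x ≤ ∫⁻ y, g y := by
  unfold branchOp
  rw [lintegral_tsum fun i => ((h.measurable_branchTerm hc i hg).indicator
    (h.measurableSet_branchSide i)).aemeasurable, ← setLIntegral_univ g]
  refine le_of_eq_of_le ?_ (h.lintegral_tsum_branchTerm_le hc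
    (B := fun i => S.branchSet s' τ i) (h.measurableSet_branchSet hc)
    (fun i => inter_subset_left) ?_ (fun i => subset_univ _) g)
  · congr 1
    ext i
    rw [← lintegral_indicator (h.measurableSet_branchSet hc i)]
    refine lintegral_congr fun x => ?_
    by_cases hx : x ∈ S.branchDom s' τ i <;> by_cases hx' : x ∈ S.branchSide i <;>
      simp [branchTerm, branchSet, hx, hx']
  · intro i j hij
    rw [disjoint_left]
    rintro _ ⟨w, hw, rfl⟩ ⟨w', hw', he⟩
    exact hij (h.branch_unique hc hw hw' he.symm)

/-- The fibre sums which define the transfer operator, rewritten as sums over the branches. -/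
theorem tsum_fiber_eq_branchOp (g : Eucl m → ℝ≥0∞) (u : Eucl m) :
    ∑' y : {y : Eucl m // y ∈ S.inducedDomain ∧ S.inducedMap y = u},
      g y * ENNReal.ofReal (S.inducedWeight y) = S.branchOp s' τ g u := by
  have h1 : S.branchOp s' τ g u = ∑' i : {i : Fin S.K × ℕ // u ∈ S.branchSet s' τ i},
      g (S.branchMap i u) * ENNReal.ofReal (S.inducedWeight (S.branchMap i u)) := by
    refine Eq.trans ?_ (tsum_subtype {i | u ∈ S.branchSet s' τ i}
      (fun i => g (S.branchMap i u) * ENNReal.ofReal (S.inducedWeight (S.branchMap i u)))).symm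
    refine tsum_congr fun i => ?_
    by_cases hi : u ∈ S.branchSet s' τ i
    · rw [indicator_of_mem hi.2, branchTerm, indicator_of_mem hi.1,
        indicator_of_mem (show i ∈ {i | u ∈ S.branchSet s' τ i} from hi),
        h.inducedWeight_branchMap hc hi, mul_comm, branchWeight]
    · rw [indicator_of_notMem (show i ∉ {i | u ∈ S.branchSet s' τ i} from hi)]
      by_cases hs : u ∈ S.branchSide i
      · rw [indicator_of_mem hs, branchTerm, indicator_of_notMem fun hd => hi ⟨hd, hs⟩]
      · rw [indicator_of_notMem hs]
  rw [h1]
  let e : {i : Fin S.K × ℕ // u ∈ S.branchSet s' τ i} →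
      {y : Eucl m // y ∈ S.inducedDomain ∧ S.inducedMap y = u} := fun i =>
    ⟨S.branchMap i u, (h.returnTime_branchMap hc i.2).1, (h.returnTime_branchMap hc i.2).2.2⟩
  have he : Function.Bijective e := by
    constructor
    · intro i i' hii
      exact Subtype.ext (h.branch_unique hc i.2 i'.2 (congrArg Subtype.val hii))
    · rintro ⟨y, hy, rfl⟩
      obtain ⟨i, hi1, hi2⟩ := h.exists_branch hc hy
      exact ⟨⟨i, hi1⟩, Subtype.ext hi2⟩
  exact ((Equiv.ofBijective e he).tsum_eq
    (fun y : {y : Eucl m // y ∈ S.inducedDomain ∧ S.inducedMap y = u} =>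
      g y * ENNReal.ofReal (S.inducedWeight y))).symm

theorem inducedPF_eq (f : Eucl m → ℝ) {u : Eucl m}
    (h1 : S.branchOp s' τ (fun y => ENNReal.ofReal (f y)) u ≠ ∞)
    (h2 : S.branchOp s' τ (fun y => ENNReal.ofReal (-f y)) u ≠ ∞) :
    S.inducedPF f u = (S.branchOp s' τ (fun y => ENNReal.ofReal (f y)) u).toReal -
      (S.branchOp s' τ (fun y => ENNReal.ofReal (-f y)) u).toReal := by
  rw [← h.tsum_fiber_eq_branchOp hc] at h1 h2 ⊢
  rw [← h.tsum_fiber_eq_branchOp hc, ENNReal.tsum_toReal_eq (ENNReal.ne_top_of_tsum_ne_top h1),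
    ENNReal.tsum_toReal_eq (ENNReal.ne_top_of_tsum_ne_top h2),
    ← (ENNReal.summable_toReal h1).tsum_sub (ENNReal.summable_toReal h2), inducedPF]
  congr 1
  ext y
  have hw : 0 ≤ S.inducedWeight y := inv_nonneg.2 (abs_nonneg _)
  rw [ENNReal.toReal_mul, ENNReal.toReal_mul, ENNReal.toReal_ofReal hw, ← sub_mul]
  congr 1
  rcases le_total 0 (f y) with hf | hf
  · rw [ENNReal.toReal_ofReal hf, ENNReal.ofReal_of_nonpos (p := -f y) (by linarith)]; simp
  · rw [ENNReal.toReal_ofReal (by linarith : 0 ≤ -f y), ENNReal.ofReal_of_nonpos hf]; simp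

theorem dist_iterate_le {i : Fin S.K × ℕ} {x w : Eucl m}
    (hseg : segment ℝ x w ⊆ S.branchDom s' τ i) :
    dist ((S.branchInv S.one)^[i.2] x) ((S.branchInv S.one)^[i.2] w) ≤ dist x w := by
  rw [dist_eq_norm, dist_eq_norm, ← one_mul ‖x - w‖]
  exact (convex_segment x w).norm_image_sub_le_of_norm_hasFDerivWithin_le
    (fun z hz => (h.hasStrictFDerivAt_iterate_of_mem hc
      (hseg hz)).1.hasFDerivAt.hasFDerivWithinAt)
    (fun z hz => (h.hasStrictFDerivAt_iterate_of_mem hc (hseg hz)).2)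
    (right_mem_segment ℝ x w) (left_mem_segment ℝ x w)

theorem branchWeight_le_absDetInv {i : Fin S.K × ℕ} {w : Eucl m} (hw : w ∈ S.branchDom s' τ i) :
    S.branchWeight i w ≤ ENNReal.ofReal (S.absDetInv i.2 w) := by
  rw [branchWeight, h.abs_det_branchMap hc hw]
  refine ENNReal.ofReal_le_ofReal (mul_le_of_le_one_left (abs_nonneg _) ?_)
  exact abs_det_le_one (h.norm_fderiv_branchInv_le_one (h.iterate_mem_TU hc hw))

/-- Distortion of the inverse branches of moderate length, and smallness of the remaining ones. -/
theorem exists_distortion {b : ℝ} (hb : 0 < b) :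
    ∃ J > 0, ∃ e > 0, ∀ r ∈ Ioc (0 : ℝ) e, ∃ N : ℕ∞, 0 < N ∧
      (∀ i : Fin S.K × ℕ, (i.2 : ℕ∞) < N → ∀ x w, segment ℝ x w ⊆ S.branchDom s' τ i →
        dist x w ≤ r → (i.2 ≠ 0 → w ∈ Metric.cthickening e S.R₀) →
        S.branchWeight i x ≤ (1 + ENNReal.ofReal (J * r ^ α)) * S.branchWeight i w) ∧
      ∀ x ∈ Metric.cthickening e S.R₀,
        ∑' n : ℕ, {n : ℕ | N ≤ (n : ℕ∞)}.indicator
          (fun n => ⨆ y ∈ Metric.closedBall x r, ENNReal.ofReal (S.absDetInv n y)) n ≤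
          ENNReal.ofReal (b * r ^ ((m : ℝ) + α)) := by
  obtain ⟨c, hc0, hcdet⟩ := h.a4.det_inv
  obtain ⟨J, hJ, ε₄, hε₄, hdet⟩ := h.a4.det_iter b hb
  -- From the product `(1 + c r^α)(1 + J r^α)` of the distortions of the last factor and of the
  -- iterate, using `r ≤ 1`.
  refine ⟨c + J + c * J, by positivity, min S.ε₁ (min ε₄ 1),
    lt_min h.a1.ε₁_pos (lt_min hε₄ one_pos), fun r hr => ?_⟩
  have hrε₁ : r ≤ S.ε₁ := hr.2.trans (min_le_left _ _)
  have hrε₄ : r ≤ ε₄ := hr.2.trans ((min_le_right _ _).trans (min_le_left _ _))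
  have hr1 : r ≤ 1 := hr.2.trans ((min_le_right _ _).trans (min_le_right _ _))
  have hR4 : Metric.cthickening (min S.ε₁ (min ε₄ 1)) S.R₀ ⊆ Metric.cthickening ε₄ S.R₀ :=
    Metric.cthickening_mono ((min_le_right _ _).trans (min_le_left _ _)) _
  obtain ⟨N, hN, hN1, hN2⟩ := hdet r ⟨hr.1, hrε₄⟩
  have hrα0 : 0 < r ^ α := Real.rpow_pos_of_pos hr.1 α
  have hrα1 : r ^ α ≤ 1 := Real.rpow_le_one hr.1.le hr1 h.α_pos.le
  refine ⟨N, hN, fun i hi x w hseg hd hw => ?_, fun x hx => ?_⟩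
  · have hx := hseg (left_mem_segment ℝ x w)
    have hw' := hseg (right_mem_segment ℝ x w)
    have hdi := h.dist_iterate_le hc hseg
    rw [branchWeight, branchWeight, h.abs_det_branchMap hc hx, h.abs_det_branchMap hc hw',
      ← ENNReal.ofReal_one, ← ENNReal.ofReal_add zero_le_one (by positivity),
      ← ENNReal.ofReal_mul (by positivity)]
    refine ENNReal.ofReal_le_ofReal ?_
    have e1 : |(fderiv ℝ (S.branchInv i.1) ((S.branchInv S.one)^[i.2] x)).det| ≤
        (1 + c * r ^ α) *
          |(fderiv ℝ (S.branchInv i.1) ((S.branchInv S.one)^[i.2] w)).det| := by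
      have h1 := hcdet i.1 _ (h.iterate_mem_TU hc hw') _ (h.iterate_mem_TU hc hx)
        (by rw [dist_comm]; exact hdi.trans (hd.trans hrε₁))
      rw [dist_comm] at h1
      have h2 : dist ((S.branchInv S.one)^[i.2] x) ((S.branchInv S.one)^[i.2] w) ^ α ≤ r ^ α :=
        Real.rpow_le_rpow dist_nonneg (hdi.trans hd) h.α_pos.le
      set A := (fderiv ℝ (S.branchInv i.1) ((S.branchInv S.one)^[i.2] x)).det
      set B := (fderiv ℝ (S.branchInv i.1) ((S.branchInv S.one)^[i.2] w)).det
      have h3 : |A| - |B| ≤ |B - A| := by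
        rw [abs_sub_comm]; exact abs_sub_abs_le_abs_sub A B
      have h4 : c * |B| * dist ((S.branchInv S.one)^[i.2] x) ((S.branchInv S.one)^[i.2] w) ^ α ≤
          c * |B| * r ^ α := by gcongr
      nlinarith
    have e2 : S.absDetInv i.2 x ≤ (1 + J * r ^ α) * S.absDetInv i.2 w := by
      rcases Nat.eq_zero_or_pos i.2 with h0 | h0
      · have h1 : ∀ z, S.absDetInv i.2 z = 1 := fun z => by
          rw [absDetInv, h0]
          have : fderiv ℝ ((S.branchInv S.one)^[0]) z = ContinuousLinearMap.id ℝ (Eucl m) :=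
            fderiv_id
          rw [this]
          have h4 : (ContinuousLinearMap.id ℝ (Eucl m)).det = 1 := LinearMap.det_id
          rw [h4, abs_one]
        rw [h1, h1]
        nlinarith
      · exact hN1 w (hR4 (hw h0.ne')) x (by rwa [Metric.mem_closedBall]) _ h0 hi.le
    have hA : 0 ≤ S.absDetInv i.2 w := abs_nonneg _
    calc _ ≤ ((1 + c * r ^ α) *
          |(fderiv ℝ (S.branchInv i.1) ((S.branchInv S.one)^[i.2] w)).det|) *
          ((1 + J * r ^ α) * S.absDetInv i.2 w) :=
          mul_le_mul e1 e2 (abs_nonneg _) (by positivity)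
      _ = ((1 + c * r ^ α) * (1 + J * r ^ α)) *
          (|(fderiv ℝ (S.branchInv i.1) ((S.branchInv S.one)^[i.2] w)).det| *
            S.absDetInv i.2 w) := by ring
      _ ≤ _ := by
          refine mul_le_mul_of_nonneg_right ?_ (by positivity)
          have : c * r ^ α * (J * r ^ α) ≤ c * J * r ^ α := by
            calc c * r ^ α * (J * r ^ α) = c * J * r ^ α * r ^ α := by ring
              _ ≤ c * J * r ^ α * 1 := by gcongr
              _ = _ := mul_one _
          linarith
  · rw [← tsum_subtype {n : ℕ | N ≤ (n : ℕ∞)}]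
    exact hN2 x (hR4 hx)
end

end Assumptions
end PiecewiseSystem
end

/-! ### Contribution of the branches that end at the boundary of the images of the pieces. -/

section

namespace PiecewiseSystem

namespace Assumptions

section
variable {k : ℕ} {S : PiecewiseSystem (k + 1)} {α η₀ ε₂ I Cξ : ℝ}
variable (h : S.Assumptions α η₀ ε₂ I Cξ)
include h

theorem measurableSet_M : MeasurableSet S.M := h.standing.compact.isClosed.measurableSet

theorem volume_layer_lt_top (ε : ℝ) (j : Fin S.K) : volume (S.layer ε j) < ∞ := by
  refine (measure_mono fun y hy => ?_).trans_lt
    ((h.isCompact_outer j).cthickening (r := ε)).measure_lt_top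
  exact hy.2.1

/-- The packing inequality is applied to the sum of the Lebesgue measures on the layers, which
counts overlaps with the same multiplicity as `G_U`. Its factor 2 turns `λ/2` into `λ`, and the
separation of layers and trap confines the integral to the complement of the trap. -/
theorem eventually_lintegral_layer_le :
    ∀ᶠ s₁ in 𝓝[>] S.s, ∀ s' τ ρ, S.Collar s' τ ρ → ∃ e > 0, ∀ ε₀ ≤ e, ∀ ε ∈ Ioc 0 ε₀,
      ∀ φ : Eucl (k + 1) → ℝ≥0∞, Measurable φ →
        ∑ j, ∫⁻ y in S.layer ε j, ballSup (S.M.indicator φ) (s₁ * ε) y ≤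
          S.lam α ε₂ * ENNReal.ofReal ((ε / ε₀) ^ α) *
            ∫⁻ z in (S.trap τ ρ)ᶜ, ballSup φ ε₀ z := by
  filter_upwards [eventually_lintegral_ballSup_le k h.s_pos h.s_lt_one h.packing_ratio_lt,
    self_mem_nhdsWithin] with s₁ hs₁ hss₁ s' τ ρ hc
  obtain ⟨e, he, hsep⟩ := h.exists_layer_separation hc
  have h1s : 0 < 1 - S.s := sub_pos.2 h.s_lt_one
  have hs₁0 : 0 < s₁ := h.s_pos.trans hss₁
  -- Radii up to `3ε₀` occur in the packing argument, and each must satisfy `r/(1 - s) ≤ ε₂`.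
  refine ⟨min e (ε₂ * (1 - S.s) / 3), lt_min he (by have := h.a3.ε₂_pos; positivity),
    fun ε₀ hε₀ ε hε φ hφ => ?_⟩
  have hε₀0 : 0 < ε₀ := hε.1.trans_le hε.2
  set μ : Measure (Eucl (k + 1)) := ∑ j, volume.restrict (S.layer ε j) with hμ
  have hfin : IsFiniteMeasure μ := by
    refine ⟨?_⟩
    rw [hμ, Measure.finsetSum_apply]
    refine ENNReal.sum_lt_top.2 fun j _ => ?_
    rw [Measure.restrict_apply MeasurableSet.univ, univ_inter]
    exact h.volume_layer_lt_top ε j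
  have hYm : MeasurableSet (⋃ j, S.layer ε j) :=
    MeasurableSet.iUnion fun j => h.measurableSet_layer ε j
  have key := hs₁ ε₀ (s₁ * ε) hε₀0 (mul_pos hs₁0 hε.1) (mul_le_mul_of_nonneg_left hε.2 hs₁0.le)
    μ S.M (⋃ j, S.layer ε j) (S.trap τ ρ)ᶜ (S.lam α ε₂ / 2 * ENNReal.ofReal ((ε / ε₀) ^ α)) φ
    h.measurableSet_M hYm (h.isCompact_trap hc).isClosed.measurableSet.compl hφ ?_ ?_ ?_
  · rw [hμ, lintegral_finsetSum_measure] at key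
    refine key.trans_eq ?_
    rw [← mul_assoc, ENNReal.mul_div_cancel two_ne_zero ENNReal.ofNat_ne_top]
  · rw [hμ, Measure.finsetSum_apply]
    refine Finset.sum_eq_zero fun j _ => ?_
    rw [Measure.restrict_apply hYm.compl]
    have : (⋃ j, S.layer ε j)ᶜ ∩ S.layer ε j = ∅ := by
      rw [← disjoint_iff_inter_eq_empty]
      exact disjoint_compl_left_iff_subset.2 (subset_iUnion (fun j => S.layer ε j) j)
    rw [this, measure_empty]
  · intro y hy z hz
    obtain ⟨j, hj⟩ := mem_iUnion.1 hy
    have h1 : ε₀ ≤ e := hε₀.trans (min_le_left _ _)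
    exact hsep ε (hε.2.trans h1) j y hj z ((Metric.mem_ball.1 hz).trans_le h1)
  · intro v hv r hr1 hr2
    have h2 : ε₀ ≤ r / (1 - S.s) := by rw [le_div_iff₀ h1s]; linarith
    have h3 : r / (1 - S.s) ≤ ε₂ := by
      have := hε₀.trans (min_le_right _ _)
      rw [div_le_iff₀ h1s]
      linarith
    have h4 := h.measure_layer_le hv hε.1 (hε.2.trans h2) h3
    rw [hμ, Measure.finsetSum_apply]
    refine le_trans (le_of_eq_of_le ?_ h4) ?_
    · refine Finset.sum_congr rfl fun j _ => ?_
      rw [Measure.restrict_apply Metric.isClosed_closedBall.measurableSet, inter_comm]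
    · gcongr
      · exact div_nonneg hε.1.le (hε₀0.le.trans h2)
      · exact h.α_pos.le
      · exact hε.1.le

end

variable {m : ℕ} {S : PiecewiseSystem m} {α η₀ ε₂ I Cξ : ℝ}
variable (h : S.Assumptions α η₀ ε₂ I Cξ) {s' τ ρ : ℝ} (hc : S.Collar s' τ ρ)
include h hc

theorem branchWeight_zero_le {j : Fin S.K} {u y : Eucl m} {κ : ℝ} (hκ : 0 ≤ κ)
    (hu : u ∈ S.branchDom s' τ (j, 0)) (hy0 : (fderiv ℝ (S.Tt j) y).det ≠ 0)
    (hy : |(fderiv ℝ (S.Tt j) y).det| ≤ (1 + κ) * |(fderiv ℝ S.T (S.branchInv j u)).det|) :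
    S.branchWeight (j, 0) u ≤
      (1 + ENNReal.ofReal κ) * (ENNReal.ofReal |(fderiv ℝ (S.Tt j) y).det|)⁻¹ := by
  have hu' := hu
  rw [branchDom_zero] at hu'
  have hv := h.mapsTo_branchInv j hu'.1
  have h1 : S.branchWeight (j, 0) u =
      ENNReal.ofReal |(fderiv ℝ S.T (S.branchInv j u)).det|⁻¹ := by
    rw [branchWeight, ← abs_inv, ← h.det_fderiv_branchInv hv, h.T_branchInv hu'.1]
    rfl
  have hd := abs_pos.2 (h.det_fderiv_T_ne_zero hv)
  have hy1 := abs_pos.2 hy0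
  rw [h1, ← ENNReal.ofReal_inv_of_pos hy1, ← ENNReal.ofReal_one,
    ← ENNReal.ofReal_add zero_le_one hκ, ← ENNReal.ofReal_mul (by linarith)]
  refine ENNReal.ofReal_le_ofReal ?_
  rw [inv_le_iff_one_le_mul₀ hd, mul_assoc, mul_comm (_⁻¹), ← mul_assoc, ← div_eq_mul_inv,
    one_le_div hy1]
  exact hy

/-- The contribution of the branches which end near a given point. -/
theorem exists_layerCost {s₁ κ : ℝ} (hs : s' < s₁) (hs' : s' ≤ 1) (hκ : 0 < κ) :
    ∃ e > 0, ∀ ε ∈ Ioc 0 e, ∀ φ : Eucl m → ℝ≥0∞, Measurable φ → ∃ Y : Fin S.K → Eucl m → ℝ≥0∞,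
      (∀ j, Measurable (Y j)) ∧
      (∀ j, ∫⁻ x, Y j x ≤ (1 + ENNReal.ofReal κ) *
        ∫⁻ y in S.layer ε j, ballSup (S.M.indicator φ) (s₁ * ε) y) ∧
      ∀ j x u, u ∈ S.branchSet s' τ (j, 0) → dist x u ≤ ε →
        x ∈ Metric.cthickening ε (frontier (S.T '' S.U j)) →
        (∀ y r, dist y (S.branchMap (j, 0) u) < r →
          φ (S.branchMap (j, 0) u) ≤ ballSup (S.M.indicator φ) r y) →
        S.branchWeight (j, 0) u * φ (S.branchMap (j, 0) u) ≤ Y j x := by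
  obtain ⟨r, hr, hpre⟩ := h.exists_preimage hc.s_lt hκ
  refine ⟨r, hr, fun ε hε φ hφ => ?_⟩
  have hφM : Measurable (ballSup (S.M.indicator φ) (s₁ * ε)) :=
    measurable_ballSup (hφ.indicator h.standing.compact.isClosed.measurableSet) _
  have hs'0 : 0 < s' := h.s_pos.trans hc.s_lt
  have hdm : ∀ j, Measurable fun y => ENNReal.ofReal |(fderiv ℝ (S.Tt j) y).det| := fun j =>
    ENNReal.measurable_ofReal.comp
      (ContinuousLinearMap.continuous_det.measurable.comp (measurable_fderiv ℝ _)).abs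
  have hY : ∀ j, ∃ G : Eucl m → ℝ≥0∞, Measurable G ∧
      (∀ y ∈ S.layer ε j, (1 + ENNReal.ofReal κ) *
        (ENNReal.ofReal |(fderiv ℝ (S.Tt j) y).det|)⁻¹ *
          ballSup (S.M.indicator φ) (s₁ * ε) y ≤ G (S.Tt j y)) ∧
      ∫⁻ x, G x ≤ ∫⁻ y in S.layer ε j, ENNReal.ofReal |(fderiv ℝ (S.Tt j) y).det| *
        ((1 + ENNReal.ofReal κ) * (ENNReal.ofReal |(fderiv ℝ (S.Tt j) y).det|)⁻¹ *
          ballSup (S.M.indicator φ) (s₁ * ε) y) := fun j =>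
    exists_measurable_fiber_majorant (h.measurableSet_layer ε j)
      (fun y hy => h.hasStrictFDerivAt_Tt hy.1.1) (fun y hy => hy.2.2)
      (((hdm j).inv.const_mul _).mul hφM)
  choose Y hYm hYp hYi using hY
  refine ⟨Y, hYm, fun j => (hYi j).trans ?_, fun j x u hu hxu hx hgood => ?_⟩
  -- The Jacobian of the change of variables cancels the inverse determinant in the majorant.
  · rw [← lintegral_const_mul _ hφM]
    refine setLIntegral_mono' (h.measurableSet_layer ε j) fun y hy => ?_
    have hd : ENNReal.ofReal |(fderiv ℝ (S.Tt j) y).det| ≠ 0 :=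
      (ENNReal.ofReal_pos.2 (abs_pos.2 hy.2.2)).ne'
    refine le_of_eq ?_
    calc _ = (ENNReal.ofReal |(fderiv ℝ (S.Tt j) y).det| *
          (ENNReal.ofReal |(fderiv ℝ (S.Tt j) y).det|)⁻¹) * ((1 + ENNReal.ofReal κ) *
          ballSup (S.M.indicator φ) (s₁ * ε) y) := by ring
      _ = _ := by rw [ENNReal.mul_inv_cancel hd ENNReal.ofReal_ne_top, one_mul]
  · have hu' := hu.1
    rw [branchDom_zero] at hu'
    have hv := h.mapsTo_branchInv j hu'.1
    have hvR : S.branchInv j u ∉ S.R := h.branchMap_notMem_R hc hu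
    -- The centre `x` may lie outside `TU_j`. The extended map still has a preimage of it within `s'
    -- ε` of the branch point, with comparable determinant; this preimage lies in the layer and
    -- carries the loss.
    obtain ⟨y, hy, hyU, hyx, hyd, hyw⟩ := hpre j _ hv hvR ε hε.1.le
      ((mul_le_of_le_one_left hε.1.le hs').trans hε.2) x (by rwa [h.T_branchInv hu'.1])
    rw [Metric.mem_closedBall] at hy
    have hyl : y ∈ S.layer ε j := by
      have h1 : y ∈ Metric.cthickening ε (closure (S.U j) \ S.R) :=
        Metric.mem_cthickening_of_dist_le y (S.branchInv j u) ε _ ⟨subset_closure hv, hvR⟩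
          (hy.trans (mul_le_of_le_one_left hε.1.le hs'))
      have h2 : S.Tt j y ∈ Metric.cthickening ε (frontier (S.T '' S.U j)) := by rwa [hyx]
      exact ⟨⟨hyU, h2⟩, h1, hyd⟩
    have h3 := hYp j y hyl
    rw [hyx] at h3
    refine le_trans (mul_le_mul' (h.branchWeight_zero_le hc hκ.le hu.1 hyd hyw) ?_) h3
    exact hgood y (s₁ * ε) (hy.trans_lt (mul_lt_mul_of_pos_right hs hε.1))

/-- A property that holds almost everywhere holds along all inverse branches. -/
theorem ae_branchMap {p : Eucl m → Prop} (hp : ∀ᵐ v, p v) :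
    ∀ᵐ u, ∀ i, u ∈ S.branchDom s' τ i → p (S.branchMap i u) := by
  rw [ae_all_iff]
  intro i
  rw [ae_iff] at hp ⊢
  -- The exceptional points are images, under an iterate of `T` that is differentiable there, of
  -- exceptional points upstairs, so they form a null set.
  have h1 : {u | ¬(u ∈ S.branchDom s' τ i → p (S.branchMap i u))} ⊆
      S.T^[i.2 + 1] '' ({v | ¬p v} ∩ S.branchMap i '' S.branchDom s' τ i) := by
    intro u hu
    have hu1 : u ∈ S.branchDom s' τ i := by by_contra hn; exact hu fun h => absurd h hn
    have hu2 : ¬p (S.branchMap i u) := fun h => hu fun _ => h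
    refine ⟨S.branchMap i u, ⟨hu2, u, hu1, rfl⟩, ?_⟩
    rw [h.T_iterate_branchMap hc hu1 le_rfl, Nat.sub_self, Function.iterate_zero, id]
  refine measure_mono_null h1 (addHaar_image_eq_zero_of_differentiableOn_of_addHaar_eq_zero _ ?_
    (measure_mono_null inter_subset_left hp))
  rintro _ ⟨-, u, hu, rfl⟩
  exact (h.differentiableAt_T_iterate hc hu le_rfl).differentiableWithinAt

end Assumptions
end PiecewiseSystem
end

/-! ### Branch contributions over thin sets, including the long branches. -/

section

namespace PiecewiseSystem

variable {m : ℕ} {S : PiecewiseSystem m} {α η₀ ε₂ I Cξ : ℝ}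

theorem measurable_absDetInv (n : ℕ) : Measurable (S.absDetInv n) :=
  (ContinuousLinearMap.continuous_det.measurable.comp (measurable_fderiv ℝ _)).abs

theorem tsum_tail_le {N : ℕ∞} {r : ℝ} (hr : 0 ≤ r) {x : Eucl m} {t : ℝ≥0∞}
    (ht : ∑' n : ℕ, {n : ℕ | N ≤ (n : ℕ∞)}.indicator
      (fun n => ⨆ y ∈ Metric.closedBall x r, ENNReal.ofReal (S.absDetInv n y)) n ≤ t)
    (Φ : ℝ≥0∞) :
    ∑' i : Fin S.K × ℕ, {i : Fin S.K × ℕ | N ≤ (i.2 : ℕ∞)}.indicator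
      (fun i => ENNReal.ofReal (S.absDetInv i.2 x) * Φ) i ≤ S.K * (t * Φ) := by
  have h1 : ∀ i : Fin S.K × ℕ, {i : Fin S.K × ℕ | N ≤ (i.2 : ℕ∞)}.indicator
      (fun i => ENNReal.ofReal (S.absDetInv i.2 x) * Φ) i ≤
      {n : ℕ | N ≤ (n : ℕ∞)}.indicator
        (fun n => ⨆ y ∈ Metric.closedBall x r, ENNReal.ofReal (S.absDetInv n y)) i.2 * Φ := by
    intro i
    by_cases hi : N ≤ (i.2 : ℕ∞)
    · rw [indicator_of_mem (by exact hi), indicator_of_mem (by exact hi)]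
      gcongr
      exact le_iSup₂_of_le x (Metric.mem_closedBall_self hr) le_rfl
    · rw [indicator_of_notMem (by exact hi)]
      exact zero_le
  refine (ENNReal.tsum_le_tsum h1).trans ?_
  rw [ENNReal.tsum_prod', tsum_fintype]
  simp only [ENNReal.tsum_mul_right]
  rw [Finset.sum_const, Finset.card_univ, Fintype.card_fin, nsmul_eq_mul]
  gcongr

namespace Assumptions

variable (h : S.Assumptions α η₀ ε₂ I Cξ) {s' τ ρ : ℝ} (hc : S.Collar s' τ ρ)
include h hc

/-- The contribution of thin sets, one for each inverse branch. -/
theorem lintegral_boundary_le {H W : Fin S.K × ℕ → Set (Eucl m)} {Z H₁ : Set (Eucl m)} {r e : ℝ}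
    (hr : 0 < r) (hH : ∀ i, MeasurableSet (H i)) (hW : ∀ i, MeasurableSet (W i))
    (hHW : ∀ i, ∀ x ∈ H i, Metric.closedBall x r ⊆ W i) (hWD : ∀ i, W i ⊆ S.branchDom s' τ i)
    (hdisj : Pairwise fun i j => Disjoint (S.branchMap i '' W i) (S.branchMap j '' W j))
    (hZ : ∀ i, S.branchMap i '' W i ⊆ Z)
    (hWe : ∀ i, i.2 ≠ 0 → W i ⊆ Metric.cthickening e S.R₀) {a β t Φ : ℝ≥0∞}
    (hβ : ∀ i w, volume (H i ∩ Metric.closedBall w r) ≤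
      β * volume (Metric.closedBall (0 : Eucl m) r))
    (hH₁ : MeasurableSet H₁) (hHH₁ : ∀ i, i.2 ≠ 0 → H i ⊆ H₁)
    (hH₁e : H₁ ⊆ Metric.cthickening e S.R₀) {N : ℕ∞} (hN0 : 0 < N)
    (hN : ∀ i : Fin S.K × ℕ, (i.2 : ℕ∞) < N → ∀ x w, segment ℝ x w ⊆ S.branchDom s' τ i →
        dist x w ≤ r → (i.2 ≠ 0 → w ∈ Metric.cthickening e S.R₀) →
        S.branchWeight i x ≤ (1 + a) * S.branchWeight i w)
    (ht : ∀ x ∈ Metric.cthickening e S.R₀, ∑' n : ℕ, {n : ℕ | N ≤ (n : ℕ∞)}.indicator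
      (fun n => ⨆ y ∈ Metric.closedBall x r, ENNReal.ofReal (S.absDetInv n y)) n ≤ t)
    {ψ U : Eucl m → ℝ≥0∞} (hU : Measurable U)
    (hψU : ∀ y z, dist y z ≤ s' * r → ψ y ≤ U z) (hψΦ : ∀ y, ψ y ≤ Φ) :
    ∑' i, ∫⁻ x in H i, S.branchTerm s' τ i ψ x ≤
      (1 + a) * (β * ∫⁻ z in Z, U z) + S.K * (t * Φ) * volume H₁ := by
  set c : Fin S.K × ℕ → Eucl m → ℝ≥0∞ := fun i x => {i : Fin S.K × ℕ | N ≤ (i.2 : ℕ∞)}.indicator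
      (fun i => ENNReal.ofReal (S.absDetInv i.2 x) * Φ) i with hcdef
  have hs'0 : 0 < s' := h.s_pos.trans hc.s_lt
  have hcm : ∀ i, Measurable (c i) := fun i => by
    by_cases hi : N ≤ (i.2 : ℕ∞)
    · have : c i = fun x => ENNReal.ofReal (S.absDetInv i.2 x) * Φ := by
        ext x; exact indicator_of_mem (by exact hi) _
      rw [this]
      exact (ENNReal.measurable_ofReal.comp (measurable_absDetInv _)).mul_const _
    · have : c i = fun x => 0 := by
        ext x; exact indicator_of_notMem (by exact hi) _
      rw [this]
      exact measurable_const
  have h1 : ∀ i, ∫⁻ x in H i, S.branchTerm s' τ i ψ x ≤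
      (1 + a) * (β * ∫⁻ w in W i, S.branchTerm s' τ i U w) + ∫⁻ x in H₁, c i x := by
    intro i
    -- Long branches are bounded by their weight times a global bound for `ψ`. For the others,
    -- distortion and contraction compare the value at `x` with values over a ball of radius `r`, so
    -- averaging brings in the density of the thin set.
    by_cases hi : N ≤ (i.2 : ℕ∞)
    · have hi0 : i.2 ≠ 0 := fun h0 => by
        rw [h0] at hi
        exact absurd hi (not_le.2 (by simpa using hN0))
      refine le_trans (le_trans (setLIntegral_mono' (hH i) fun x hx => ?_)
        (lintegral_mono_set (hHH₁ i hi0))) le_add_self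
      have hxD : x ∈ S.branchDom s' τ i := hWD i (hHW i x hx (Metric.mem_closedBall_self hr.le))
      rw [branchTerm, indicator_of_mem hxD]
      have : c i x = ENNReal.ofReal (S.absDetInv i.2 x) * Φ := indicator_of_mem (by exact hi) _
      rw [this]
      exact mul_le_mul' (h.branchWeight_le_absDetInv hc hxD) (hψΦ _)
    · refine le_trans (le_of_le_of_eq (lintegral_le_of_thin
        (h := fun w => (1 + a) * S.branchTerm s' τ i U w)
        (hH i) (hW i) hr (hβ i)
        ((h.measurable_branchTerm hc i hU).const_mul _) fun x hx => ae_of_all _ fun w hw => ?_) ?_)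
        le_self_add
      · have hB := (hHW i x hx).trans (hWD i)
        have hxB := Metric.mem_closedBall_self (x := x) hr.le
        refine ⟨hHW i x hx hw, ?_⟩
        rw [branchTerm, branchTerm, indicator_of_mem (hB hw), indicator_of_mem (hB hxB),
          ← mul_assoc]
        refine mul_le_mul' (hN i (not_le.1 hi) x w ?_ ?_ ?_) (hψU _ _ ?_)
        · exact ((convex_closedBall x r).segment_subset hxB hw).trans hB
        · rw [dist_comm]; exact hw
        · exact fun hi0 => hWe i hi0 (hHW i x hx hw)
        · refine (h.dist_branchMap_le hc (convex_closedBall x r) hB hxB hw).trans ?_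
          rw [dist_comm]
          exact mul_le_mul_of_nonneg_left hw hs'0.le
      · rw [lintegral_const_mul _ (h.measurable_branchTerm hc i hU)]
        ring
  refine (ENNReal.tsum_le_tsum h1).trans ?_
  rw [ENNReal.tsum_add, ENNReal.tsum_mul_left, ENNReal.tsum_mul_left,
    ← lintegral_tsum fun i => (hcm i).aemeasurable]
  refine add_le_add ?_ ?_
  · gcongr
    exact h.lintegral_tsum_branchTerm_le hc hW hWD hdisj hZ U
  · rw [← setLIntegral_const]
    exact setLIntegral_mono' hH₁ fun x hx => tsum_tail_le hr.le (ht x (hH₁e hx)) Φ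

end Assumptions
end PiecewiseSystem
end

/-! ### Contribution of the collars of `∂R` and `∂TR`. -/

section

theorem closedBall_subset_cthickening_add {m : ℕ} {F : Set (Eucl m)} {ε r : ℝ} (hε : 0 ≤ ε)
    (hr : 0 ≤ r) {x : Eucl m} (hx : x ∈ Metric.cthickening ε F) :
    Metric.closedBall x r ⊆ Metric.cthickening (ε + r) F := by
  intro w hw
  rw [add_comm, ← cthickening_cthickening hr hε]
  exact Metric.mem_cthickening_of_dist_le w x r _ hx hw

/-- The density of a slab in a ball of this radius is, up to `1 + κ`, one third of the volume ratio
in `λ`, taken at `s₁`, times `ε/ε₀`. -/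
theorem volume_slab_eq (k : ℕ) {s₁ κ ε ε₀ : ℝ} (hs₁ : 0 < s₁) (hs₁' : s₁ < 1) (hκ : 0 < κ)
    (hε : 0 ≤ ε) (hε₀ : 0 < ε₀) :
    ENNReal.ofReal ((1 + κ) * ε) *
        volume (Metric.closedBall (0 : Eucl k) (ε₀ * (1 - s₁) / s₁)) =
      ENNReal.ofReal ((1 + κ) * (s₁ * unitBallVol k / ((1 - s₁) * unitBallVol (k + 1))) *
        (ε / ε₀)) * volume (Metric.closedBall (0 : Eucl (k + 1)) (ε₀ * (1 - s₁) / s₁)) := by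
  have h1 : 0 < 1 - s₁ := sub_pos.2 hs₁'
  have hr : 0 ≤ ε₀ * (1 - s₁) / s₁ := by positivity
  have hk := unitBallVol_pos k
  have hk' := unitBallVol_pos (k + 1)
  rw [volume_closedBall_eucl _ hr, volume_closedBall_eucl _ hr,
    ← ENNReal.ofReal_mul (by positivity), ← ENNReal.ofReal_mul (by positivity)]
  congr 1
  rw [pow_succ]
  field_simp

namespace PiecewiseSystem
namespace Assumptions

variable {k : ℕ} {S : PiecewiseSystem (k + 1)} {α η₀ ε₂ I Cξ : ℝ}
variable (h : S.Assumptions α η₀ ε₂ I Cξ) {s' τ ρ : ℝ} (hc : S.Collar s' τ ρ)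
include h hc

/-- Common treatment of the two collars. The averaging radius `r = ε₀ (1 - s₁)/s₁` satisfies `s₁ r +
s₁ ε₀ = ε₀`. Hence the contracted image of a ball of radius `r`, enlarged by `s₁ ε`, remains within
radius `ε₀`, and suprema at scale `s₁ ε` are dominated by suprema at scale `ε₀`. -/
theorem lintegral_family_le {s₁ κ ε ε₀ : ℝ} (hs : s' < s₁) (hs₁ : s₁ < 1) (hκ : 0 < κ)
    (hε : 0 < ε) (hεε₀ : ε ≤ ε₀) {e : ℝ} (he1 : e ≤ 1) (hε₀e : ε₀ / s₁ ≤ e) (hε₀τ : ε₀ / s₁ < τ)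
    {X : ℝ → Fin S.K × ℕ → Set (Eucl (k + 1))} {F A : Set (Eucl (k + 1))}
    (hXm : ∀ ε i, MeasurableSet (X ε i)) (hXF : ∀ ε i, X ε i ⊆ Metric.cthickening ε F)
    (hXb : ∀ i, ∀ x ∈ X ε i, ∀ r, 0 ≤ r → Metric.closedBall x r ⊆ X (ε + r) i)
    (hXD : ∀ τ' < τ, ∀ i, X τ' i ⊆ S.branchDom s' τ i)
    (hXi : ∀ τ' < τ, Pairwise fun i j =>
      Disjoint (S.branchMap i '' X τ' i) (S.branchMap j '' X τ' j))
    (hXt : ∀ τ' < τ, ∀ i, S.branchMap i '' X τ' i ⊆ S.trap τ ρ)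
    (hFR : F ⊆ closure S.R₀)
    (hvol : ∀ w,
      volume (A ∩ Metric.cthickening ε F ∩ Metric.closedBall w (ε₀ * (1 - s₁) / s₁)) ≤
        ENNReal.ofReal ((1 + κ) * ε) *
          volume (Metric.closedBall (0 : Eucl k) (ε₀ * (1 - s₁) / s₁)) ∧
      volume (Metric.cthickening ε F \ A ∩ Metric.closedBall w (ε₀ * (1 - s₁) / s₁)) ≤
        ENNReal.ofReal ((1 + κ) * ε) *
          volume (Metric.closedBall (0 : Eucl k) (ε₀ * (1 - s₁) / s₁)))
    {H : Fin S.K × ℕ → Set (Eucl (k + 1))} (hH : ∀ i, MeasurableSet (H i))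
    (hHX : ∀ i, H i ⊆ X ε i)
    (hHvol : ∀ i w b, volume (A ∩ Metric.cthickening ε F ∩
        Metric.closedBall w (ε₀ * (1 - s₁) / s₁)) ≤ b →
      volume (Metric.cthickening ε F \ A ∩ Metric.closedBall w (ε₀ * (1 - s₁) / s₁)) ≤ b →
      volume (H i ∩ Metric.closedBall w (ε₀ * (1 - s₁) / s₁)) ≤ b)
    {a t Φ : ℝ≥0∞} {N : ℕ∞} (hN0 : 0 < N)
    (hN : ∀ i : Fin S.K × ℕ, (i.2 : ℕ∞) < N → ∀ x w, segment ℝ x w ⊆ S.branchDom s' τ i →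
        dist x w ≤ ε₀ * (1 - s₁) / s₁ → (i.2 ≠ 0 → w ∈ Metric.cthickening e S.R₀) →
        S.branchWeight i x ≤ (1 + a) * S.branchWeight i w)
    (ht : ∀ x ∈ Metric.cthickening e S.R₀, ∑' n : ℕ, {n : ℕ | N ≤ (n : ℕ∞)}.indicator
      (fun n => ⨆ y ∈ Metric.closedBall x (ε₀ * (1 - s₁) / s₁),
        ENNReal.ofReal (S.absDetInv n y)) n ≤ t)
    {ψ φ : Eucl (k + 1) → ℝ≥0∞} (hφ : Measurable φ) (hψ : ∀ y, ψ y ≤ ballSup φ (s₁ * ε) y)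
    (hψΦ : ∀ y, ψ y ≤ Φ) :
    ∑' i, ∫⁻ x in H i, S.branchTerm s' τ i ψ x ≤
      (1 + a) * (ENNReal.ofReal ((1 + κ) *
          (s₁ * unitBallVol k / ((1 - s₁) * unitBallVol (k + 1))) * (ε / ε₀)) *
        ∫⁻ z in S.trap τ ρ, ballSup φ ε₀ z) +
      S.K * (t * Φ) * (2 * ENNReal.ofReal ((1 + κ) *
          (s₁ * unitBallVol k / ((1 - s₁) * unitBallVol (k + 1))) * (ε / ε₀)) *
        volume (Metric.cthickening 1 S.R₀)) := by
  have hs'0 : 0 < s' := h.s_pos.trans hc.s_lt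
  have hs₁0 : 0 < s₁ := hs'0.trans hs
  have h1s : 0 < 1 - s₁ := sub_pos.2 hs₁
  have hε₀ : 0 < ε₀ := hε.trans_le hεε₀
  have hadd : ε₀ + ε₀ * (1 - s₁) / s₁ = ε₀ / s₁ := by field_simp; ring
  rw [volume_slab_eq k hs₁0 hs₁ hκ hε.le hε₀] at hvol
  set r := ε₀ * (1 - s₁) / s₁ with hr
  set β := ENNReal.ofReal ((1 + κ) *
          (s₁ * unitBallVol k / ((1 - s₁) * unitBallVol (k + 1))) * (ε / ε₀)) with hβ
  have hr0 : 0 < r := by positivity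
  have hεr : ε + r ≤ ε₀ / s₁ := by linarith
  have hF : ∀ τ' ≤ e, Metric.cthickening τ' F ⊆ Metric.cthickening e S.R₀ := fun τ' hτ' =>
    (Metric.cthickening_mono hτ' _).trans ((Metric.cthickening_subset_of_subset _ hFR).trans
      (Metric.cthickening_closure).subset)
  have hmain := h.lintegral_boundary_le hc (H := H) (W := fun i => X (ε + r) i)
    (Z := S.trap τ ρ) (H₁ := Metric.cthickening ε F) (e := e) hr0 hH (fun i => hXm _ i)
    (fun i x hx => hXb i x (hHX i hx) r hr0.le) (hXD _ (hεr.trans_lt hε₀τ))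
    (hXi _ (hεr.trans_lt hε₀τ)) (hXt _ (hεr.trans_lt hε₀τ))
    (fun i _ => (hXF _ i).trans (hF _ (hεr.trans hε₀e))) (β := β)
    (fun i w => hHvol i w _ (hvol w).1 (hvol w).2) Metric.isClosed_cthickening.measurableSet
    (fun i _ => (hHX i).trans (hXF ε i)) (hF _ (by linarith)) hN0 hN ht
    (measurable_ballSup hφ ε₀) (ψ := ψ) (Φ := Φ) (fun y z hyz => (hψ y).trans
      (ballSup_mono_ball φ ?_)) hψΦ
  · refine hmain.trans ?_
    gcongr
    -- Averaging with constant integrands bounds the volume of the full collar; its two sides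
    -- account for the factor 2.
    have h2 := lintegral_le_of_thin (H := Metric.cthickening ε F)
      (W := Metric.cthickening 1 S.R₀) (a := fun _ => 1) (h := fun _ => 1) (β := 2 * β)
      Metric.isClosed_cthickening.measurableSet Metric.isClosed_cthickening.measurableSet hr0
      (fun w => ?_) measurable_const (fun x hx => ae_of_all _ fun w hw => ⟨?_, le_rfl⟩)
    · simpa using h2
    · have h3 : Metric.cthickening ε F ∩ Metric.closedBall w r ⊆
          (A ∩ Metric.cthickening ε F ∩ Metric.closedBall w r) ∪
            (Metric.cthickening ε F \ A ∩ Metric.closedBall w r) := by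
        intro z hz
        by_cases hzA : z ∈ A
        · exact Or.inl ⟨⟨hzA, hz.1⟩, hz.2⟩
        · exact Or.inr ⟨⟨hz.1, hzA⟩, hz.2⟩
      refine (measure_mono h3).trans ((measure_union_le _ _).trans ?_)
      rw [two_mul, add_mul]
      exact add_le_add (hvol w).1 (hvol w).2
    · exact Metric.cthickening_mono he1 _
        (hF _ (hεr.trans hε₀e) (closedBall_subset_cthickening_add hε.le hr0.le hx hw))
  · have h4 : s' * r ≤ s₁ * r := by gcongr
    have h5 : s₁ * r = ε₀ - s₁ * ε₀ := by rw [hr]; field_simp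
    have h6 : s₁ * ε ≤ s₁ * ε₀ := by gcongr
    linarith

/-- The contributions of the collars of `∂R` and of `∂TR`. -/
theorem exists_lintegral_collar_le {s₁ κ : ℝ} (hs : s' < s₁) (hs₁ : s₁ < 1) (hκ : 0 < κ) :
    ∃ e₁ > 0, ∀ e ≤ 1, ∀ ε₀, ε₀ ≤ e₁ → ε₀ / s₁ ≤ e → ∀ ε ∈ Ioc 0 ε₀,
    ∀ (a t Φ : ℝ≥0∞) (N : ℕ∞), 0 < N →
    (∀ i : Fin S.K × ℕ, (i.2 : ℕ∞) < N → ∀ x w, segment ℝ x w ⊆ S.branchDom s' τ i →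
        dist x w ≤ ε₀ * (1 - s₁) / s₁ → (i.2 ≠ 0 → w ∈ Metric.cthickening e S.R₀) →
        S.branchWeight i x ≤ (1 + a) * S.branchWeight i w) →
    (∀ x ∈ Metric.cthickening e S.R₀, ∑' n : ℕ, {n : ℕ | N ≤ (n : ℕ∞)}.indicator
      (fun n => ⨆ y ∈ Metric.closedBall x (ε₀ * (1 - s₁) / s₁),
        ENNReal.ofReal (S.absDetInv n y)) n ≤ t) →
    ∀ ψ φ : Eucl (k + 1) → ℝ≥0∞, Measurable φ → (∀ y, ψ y ≤ ballSup φ (s₁ * ε) y) →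
    (∀ y, ψ y ≤ Φ) →
    ∀ X ∈ ({S.collarR, S.collarTR} : Set (ℝ → Fin S.K × ℕ → Set (Eucl (k + 1)))),
    ∀ C ∈ ({S.branchSide, fun i => (S.branchSide i)ᶜ} : Set (Fin S.K × ℕ → Set (Eucl (k + 1)))),
    ∑' i, ∫⁻ x in X ε i ∩ C i, S.branchTerm s' τ i ψ x ≤
      (1 + a) * (ENNReal.ofReal ((1 + κ) *
          (s₁ * unitBallVol k / ((1 - s₁) * unitBallVol (k + 1))) * (ε / ε₀)) *
        ∫⁻ z in S.trap τ ρ, ballSup φ ε₀ z) +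
      S.K * (t * Φ) * (2 * ENNReal.ofReal ((1 + κ) *
          (s₁ * unitBallVol k / ((1 - s₁) * unitBallVol (k + 1))) * (ε / ε₀)) *
        volume (Metric.cthickening 1 S.R₀)) := by
  have hs'0 : 0 < s' := h.s_pos.trans hc.s_lt
  have hs₁0 : 0 < s₁ := hs'0.trans hs
  obtain ⟨ρ₁, hρ₁, hv₁⟩ := h.a3.boundary_R.volume_collar_le h.a3.isOpen_R
    h.isCompact_frontier_R hκ
  obtain ⟨ρ₂, hρ₂, hv₂⟩ := h.hasSmoothBoundary_TR.volume_collar_le h.isOpen_TR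
    h.isCompact_frontier_TR hκ
  have hτ := hc.τ_pos
  refine ⟨s₁ * min (τ / 2) (min ρ₁ ρ₂), by positivity, fun e he ε₀ hε₀ hε₀e ε hε a t Φ N hN0 hN ht
    ψ φ hφ hψ hψΦ X hX C hC => ?_⟩
  have hε₀0 : 0 < ε₀ := hε.1.trans_le hε.2
  have hd : ε₀ / s₁ ≤ min (τ / 2) (min ρ₁ ρ₂) := by rwa [div_le_iff₀' hs₁0]
  have hdτ : ε₀ / s₁ < τ := (hd.trans (min_le_left _ _)).trans_lt (by linarith)
  have hd1 : ε₀ / s₁ ≤ ρ₁ := hd.trans ((min_le_right _ _).trans (min_le_left _ _))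
  have hd2 : ε₀ / s₁ ≤ ρ₂ := hd.trans ((min_le_right _ _).trans (min_le_right _ _))
  have hadd : ε₀ + ε₀ * (1 - s₁) / s₁ = ε₀ / s₁ := by field_simp; ring
  have hr0 : 0 < ε₀ * (1 - s₁) / s₁ := by
    have := sub_pos.2 hs₁; positivity
  have hsum : ε + ε₀ * (1 - s₁) / s₁ ≤ ε₀ / s₁ := by linarith [hε.2]
  have hερ : ε ≤ ρ := by linarith [hc.τ_le]
  have hCm : ∀ i, MeasurableSet (C i) := by
    rcases hC with rfl | rfl
    · exact h.measurableSet_branchSide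
    · exact fun i => (h.measurableSet_branchSide i).compl
  rcases hX with rfl | rfl
  · refine h.lintegral_family_le hc hs hs₁ hκ hε.1 hε.2 he hε₀e hdτ (X := S.collarR)
      (F := frontier S.R) (A := S.R) measurableSet_collarR (fun _ _ _ hx => hx.2)
      (fun i x hx r hr w hw => ⟨hx.1, closedBall_subset_cthickening_add hε.1.le hr hx.2 hw⟩)
      (fun _ => h.collarR_subset_branchDom hc) (fun _ => h.disjoint_image_collarR hc)
      (fun _ => h.image_collarR_subset_trap hc) (h.frontier_R_subset.trans subset_closure)
      (hv₁ _ _ hε.1.le hr0.le (hsum.trans hd1))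
      (fun i => (measurableSet_collarR ε i).inter (hCm i)) (fun i => inter_subset_left)
      ?_ hN0 hN ht hφ hψ hψΦ
    intro i w b h1 h2
    have h3 := h.measure_collarR_le hc hερ w _ h1 h2 i
    rcases hC with rfl | rfl
    · exact h3.1
    · exact h3.2
  · refine h.lintegral_family_le hc hs hs₁ hκ hε.1 hε.2 he hε₀e hdτ (X := S.collarTR)
      (F := frontier (S.T '' S.R)) (A := S.T '' S.R) measurableSet_collarTR
      (fun _ _ _ hx => hx.2)
      (fun i x hx r hr w hw => ⟨hx.1, closedBall_subset_cthickening_add hε.1.le hr hx.2 hw⟩)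
      (fun _ => h.collarTR_subset_branchDom hc) (fun _ => h.disjoint_image_collarTR hc)
      (fun _ => h.image_collarTR_subset_trap hc) h.frontier_TR_subset
      (hv₂ _ _ hε.1.le hr0.le (hsum.trans hd2))
      (fun i => (measurableSet_collarTR ε i).inter (hCm i)) (fun i => inter_subset_left)
      ?_ hN0 hN ht hφ hψ hψΦ
    intro i w b h1 h2
    have h3 := h.measure_collarTR_le hc hε.1.le hερ w _ h1 h2 i
    rcases hC with rfl | rfl
    · exact h3.1
    · exact h3.2

end Assumptions
end PiecewiseSystem
end

/-! ### Variation of the transfer operator over a ball. -/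

section

namespace PiecewiseSystem

variable {m : ℕ} {S : PiecewiseSystem m} {α η₀ ε₂ I Cξ : ℝ}

/-- Bound for the contribution of one branch to the variation of the transfer operator at `x`. -/
def branchCost (S : PiecewiseSystem m) (s' τ ε σ : ℝ) (a : ℝ≥0∞) (φ : Eucl m → ℝ≥0∞)
    (i : Fin S.K × ℕ) (x : Eucl m) : ℝ≥0∞ :=
  (S.branchSide i).indicator
      (S.branchTerm s' τ i fun y => a * φ y + (1 + 2 * a) * ballOsc φ σ y) x +
    ((S.collarR ε i ∩ S.branchSide i).indicator
        (S.branchTerm s' τ i (φ ⊓ ballSup (S.M.indicator φ) σ)) x +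
      (S.collarTR ε i ∩ S.branchSide i).indicator
        (S.branchTerm s' τ i (φ ⊓ ballSup (S.M.indicator φ) σ)) x +
      ((S.collarR ε i ∩ (S.branchSide i)ᶜ).indicator
        (S.branchTerm s' τ i (ballSup (S.M.indicator φ) σ)) x +
      (S.collarTR ε i ∩ (S.branchSide i)ᶜ).indicator
        (S.branchTerm s' τ i (ballSup (S.M.indicator φ) σ)) x))

namespace Assumptions

variable (h : S.Assumptions α η₀ ε₂ I Cξ) {s' τ ρ : ℝ} (hc : S.Collar s' τ ρ)
include h hc

/-- The values along the inverse branches at `u` are within the essential bounds of `φ`. -/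
theorem ae_good_branches {φ : Eucl m → ℝ≥0∞} (hφ : Measurable φ) :
    ∀ᵐ u, ∀ i, u ∈ S.branchDom s' τ i → GoodPoint φ (S.branchMap i u) ∧
      (∀ y r, dist y (S.branchMap i u) < r →
        φ (S.branchMap i u) ≤ ballSup (S.M.indicator φ) r y) ∧
      φ (S.branchMap i u) ≤ essSup φ volume := by
  have h1 : ∀ᵐ v, GoodPoint φ v ∧ (v ∈ S.M → ∀ y r, dist y v < r →
      φ v ≤ ballSup (S.M.indicator φ) r y) ∧ φ v ≤ essSup φ volume := by
    filter_upwards [ae_goodPoint hφ, ae_le_ballSup_indicator hφ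
      h.standing.compact.isClosed.measurableSet, ae_le_essSup (f := φ) (μ := volume)] with v h1 h2 h3
    exact ⟨h1, h2, h3⟩
  filter_upwards [h.ae_branchMap hc h1] with u hu i hi
  have h2 := hu i hi
  exact ⟨h2.1, h2.2.1 (h.closure_U_subset _ (subset_closure (h.branchMap_mem hc hi))), h2.2.2⟩

/-- Variation of one branch, when it is defined on a whole ball. -/
theorem branch_le_add_branchCost {ε σ : ℝ} (hσ : s' * ε < σ) (hσ0 : 0 < σ)
    {a : ℝ≥0∞} {φ : Eucl m → ℝ≥0∞} {i : Fin S.K × ℕ}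
    {x u u' : Eucl m} (hu : u ∈ Metric.closedBall x ε) (hu' : u' ∈ Metric.closedBall x ε)
    (hsub : Metric.closedBall x ε ⊆ S.branchDom s' τ i) (huS : u ∈ S.branchSide i)
    (hw : ∀ y ∈ Metric.closedBall x ε, ∀ z ∈ Metric.closedBall x ε,
      S.branchWeight i y ≤ (1 + a) * S.branchWeight i z)
    (hG : ∀ y ∈ Metric.closedBall x ε, y = u ∨ y = u' ∨ y = x → GoodPoint φ (S.branchMap i y) ∧
      (∀ z r, dist z (S.branchMap i y) < r →
        φ (S.branchMap i y) ≤ ballSup (S.M.indicator φ) r z)) :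
    S.branchTerm s' τ i φ u ≤ (S.branchSide i).indicator (S.branchTerm s' τ i φ) u' +
      (1 + a) * S.branchCost s' τ ε σ a φ i x := by
  have hε : 0 ≤ ε := dist_nonneg.trans hu
  have hx : x ∈ Metric.closedBall x ε := Metric.mem_closedBall_self hε
  have hs'0 : 0 < s' := h.s_pos.trans hc.s_lt
  have hdist : ∀ y ∈ Metric.closedBall x ε, dist (S.branchMap i x) (S.branchMap i y) < σ :=
    fun y hy => by
      refine (h.dist_branchMap_le hc (convex_closedBall x ε) hsub hx hy).trans_lt
        (lt_of_le_of_lt ?_ hσ)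
      rw [dist_comm]
      exact mul_le_mul_of_nonneg_left hy hs'0.le
  have hterm : ∀ g : Eucl m → ℝ≥0∞, ∀ y ∈ Metric.closedBall x ε,
      S.branchTerm s' τ i g y = S.branchWeight i y * g (S.branchMap i y) := fun g y hy =>
    indicator_of_mem (hsub hy) _
  have key := branch_variation (φ := φ) (ω := S.branchWeight i) (Ψ := S.branchMap i)
    (C := S.branchSide i) (M := S.M) (H := S.collarR ε i ∪ S.collarTR ε i) (σ := σ)
    (hw u hu u' hu') (hw u hu x hx) (hw u' hu' x hx) hσ0 (hdist u hu) (hdist u' hu')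
    (hG u hu (by simp)).1 (hG u' hu' (by simp)).1 (hG x hx (by simp)).1
    ((hG u hu (by simp)).2 _ _ (hdist u hu)) (fun _ hor => by
      rcases hor with h1 | h1
      · exact h.mem_collar hc hsub hu hu' huS h1
      · exact h.mem_collar hc hsub hu hx huS h1)
  have e1 : (S.branchSide i).indicator (S.branchTerm s' τ i φ) u' =
      (S.branchSide i).indicator (fun z => S.branchWeight i z * φ (S.branchMap i z)) u' := by
    by_cases hC : u' ∈ S.branchSide i
    · rw [indicator_of_mem hC, indicator_of_mem hC, hterm _ _ hu']
    · rw [indicator_of_notMem hC, indicator_of_notMem hC]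
  rw [hterm _ _ hu, e1]
  rw [indicator_of_mem huS] at key
  refine key.trans (add_le_add le_rfl (mul_le_mul_right ?_ _))
  -- Where the branch is present at the centre, the minimum retains both available bounds: `φ` gives
  -- an `L¹` estimate, the local supremum gives the collar estimate.
  have hmin : φ (S.branchMap i x) ≤
      (φ ⊓ ballSup (S.M.indicator φ) σ) (S.branchMap i x) :=
    le_inf le_rfl ((hG x hx (by simp)).2 _ _ (by simpa))
  unfold branchCost
  refine add_le_add (le_of_eq ?_) ?_
  · by_cases hC : x ∈ S.branchSide i
    · rw [indicator_of_mem hC, indicator_of_mem hC, hterm _ _ hx]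
    · rw [indicator_of_notMem hC, indicator_of_notMem hC]
  · by_cases hH : x ∈ S.collarR ε i ∪ S.collarTR ε i
    swap
    · rw [indicator_of_notMem hH]; exact zero_le
    rw [indicator_of_mem hH]
    by_cases hC : x ∈ S.branchSide i
    · rw [indicator_of_mem hC, indicator_of_notMem (by simpa using hC), add_zero]
      refine le_trans ?_ le_self_add
      have h1 : S.branchWeight i x * φ (S.branchMap i x) ≤
          S.branchTerm s' τ i (φ ⊓ ballSup (S.M.indicator φ) σ) x := by
        rw [hterm _ _ hx]
        exact mul_le_mul_right hmin _
      rcases hH with hH | hH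
      · rw [indicator_of_mem (show x ∈ S.collarR ε i ∩ S.branchSide i from ⟨hH, hC⟩)]
        exact h1.trans le_self_add
      · rw [indicator_of_mem (show x ∈ S.collarTR ε i ∩ S.branchSide i from ⟨hH, hC⟩)]
        exact h1.trans le_add_self
    · have hC' : x ∈ (S.branchSide i)ᶜ := hC
      rw [indicator_of_notMem hC, indicator_of_mem hC', zero_add]
      refine le_trans ?_ le_add_self
      have h1 : S.branchWeight i x * ballSup (S.M.indicator φ) σ (S.branchMap i x) ≤
          S.branchTerm s' τ i (ballSup (S.M.indicator φ) σ) x := by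
        rw [hterm _ _ hx]
      rcases hH with hH | hH
      · rw [indicator_of_mem (show x ∈ S.collarR ε i ∩ (S.branchSide i)ᶜ from ⟨hH, hC'⟩)]
        exact h1.trans le_self_add
      · rw [indicator_of_mem (show x ∈ S.collarTR ε i ∩ (S.branchSide i)ᶜ from ⟨hH, hC'⟩)]
        exact h1.trans le_add_self

/-- Variation of the transfer operator over a ball centred at `x`. -/
theorem branchOp_le_add {ε σ : ℝ} (hε : 0 < ε) (hετ : 2 * ε < τ) (hσ : s' * ε < σ)
    {e : ℝ} (he : 2 * ε ≤ e) {a t : ℝ≥0∞} {N : ℕ∞} (hN0 : 0 < N)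
    (hN : ∀ i : Fin S.K × ℕ, (i.2 : ℕ∞) < N → ∀ x w, segment ℝ x w ⊆ S.branchDom s' τ i →
        dist x w ≤ 2 * ε → (i.2 ≠ 0 → w ∈ Metric.cthickening e S.R₀) →
        S.branchWeight i x ≤ (1 + a) * S.branchWeight i w)
    (ht : ∀ x ∈ Metric.cthickening e S.R₀, ∑' n : ℕ, {n : ℕ | N ≤ (n : ℕ∞)}.indicator
      (fun n => ⨆ y ∈ Metric.closedBall x (2 * ε), ENNReal.ofReal (S.absDetInv n y)) n ≤ t)
    {φ : Eucl m → ℝ≥0∞} {Y : Fin S.K → Eucl m → ℝ≥0∞}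
    (hY : ∀ j x u, u ∈ S.branchSet s' τ (j, 0) → dist x u ≤ ε →
        x ∈ Metric.cthickening ε (frontier (S.T '' S.U j)) →
        (∀ y r, dist y (S.branchMap (j, 0) u) < r →
          φ (S.branchMap (j, 0) u) ≤ ballSup (S.M.indicator φ) r y) →
        S.branchWeight (j, 0) u * φ (S.branchMap (j, 0) u) ≤ Y j x)
    {x u u' : Eucl m} (hu : u ∈ Metric.closedBall x ε) (hu' : u' ∈ Metric.closedBall x ε)
    (hG : ∀ y, y = u ∨ y = u' ∨ y = x → ∀ i, y ∈ S.branchDom s' τ i →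
      GoodPoint φ (S.branchMap i y) ∧ (∀ z r, dist z (S.branchMap i y) < r →
        φ (S.branchMap i y) ≤ ballSup (S.M.indicator φ) r z) ∧
      φ (S.branchMap i y) ≤ essSup φ volume) :
    S.branchOp s' τ φ u ≤ S.branchOp s' τ φ u' +
      ((1 + a) * (∑' i, S.branchCost s' τ ε σ a φ i x) + (∑ j, Y j x +
        (Metric.cthickening e S.R₀).indicator (fun _ => S.K * (t * essSup φ volume)) x)) := by
  have hs'0 : 0 < s' := h.s_pos.trans hc.s_lt
  have hR₀ : ∀ y ∈ Metric.closedBall x ε, ∀ z ∈ Metric.closedBall x ε, y ∈ S.R₀ →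
      z ∈ Metric.cthickening e S.R₀ := fun y hy z hz hyR => by
    refine Metric.mem_cthickening_of_dist_le z y e _ hyR (le_trans ?_ he)
    have := dist_triangle_right z y x
    rw [Metric.mem_closedBall] at hy hz
    linarith
  have hx : x ∈ Metric.closedBall x ε := Metric.mem_closedBall_self hε.le
  set Yc : Fin S.K × ℕ → ℝ≥0∞ := fun i => if i.2 = 0 then Y i.1 x else 0 with hYc
  set tl : Fin S.K × ℕ → ℝ≥0∞ := fun i => S.R₀.indicator (fun u =>
    {i : Fin S.K × ℕ | N ≤ (i.2 : ℕ∞)}.indicator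
      (fun i => ENNReal.ofReal (S.absDetInv i.2 u) * essSup φ volume) i) u with htl
  have hpt : ∀ i, (S.branchSide i).indicator (S.branchTerm s' τ i φ) u ≤
      (S.branchSide i).indicator (S.branchTerm s' τ i φ) u' +
        ((1 + a) * S.branchCost s' τ ε σ a φ i x + (Yc i + tl i)) := by
    intro i
    by_cases huS : u ∈ S.branchSide i
    swap
    · rw [indicator_of_notMem huS]; exact zero_le
    rw [indicator_of_mem huS]
    by_cases huD : u ∈ S.branchDom s' τ i
    swap
    · rw [branchTerm, indicator_of_notMem huD]; exact zero_le
    have hGu := hG u (Or.inl rfl) i huD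
    -- Three kinds of branches: those with `n = 0` whose image boundary is near `x`, charged to `Y`;
    -- the long ones, charged to the tail; and the rest, which are defined on the whole ball with
    -- bounded distortion.
    by_cases hY0 : i.2 = 0 ∧ x ∈ Metric.cthickening ε (frontier (S.T '' S.U i.1))
    · obtain ⟨j, n⟩ := i
      obtain ⟨rfl, hxj⟩ : n = 0 ∧ _ := hY0
      refine le_trans ?_ (le_add_self.trans le_add_self)
      refine le_trans ?_ le_self_add
      rw [branchTerm, indicator_of_mem huD, hYc]
      simp only [if_true]
      exact hY j x u ⟨huD, huS⟩ (by rw [dist_comm]; exact hu) hxj hGu.2.1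
    by_cases hNi : N ≤ (i.2 : ℕ∞)
    · have hi0 : i.2 ≠ 0 := fun h0 => by
        rw [h0] at hNi
        exact absurd hNi (not_le.2 (by simpa using hN0))
      have huR : u ∈ S.R₀ := by rwa [branchSide, if_neg hi0] at huS
      refine le_trans ?_ (le_add_self.trans le_add_self)
      refine le_trans ?_ le_add_self
      rw [branchTerm, indicator_of_mem huD, htl]
      simp only
      rw [indicator_of_mem huR, indicator_of_mem (by exact hNi)]
      exact mul_le_mul' (h.branchWeight_le_absDetInv hc huD) hGu.2.2
    · have hsub := h.closedBall_subset_branchDom hc hετ hu ⟨huD, huS⟩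
        fun h0 hx0 => hY0 ⟨h0, hx0⟩
      refine (h.branch_le_add_branchCost hc hσ ((mul_pos hs'0 hε).trans hσ) hu hu' hsub huS ?_
        ?_).trans (add_le_add le_rfl le_self_add)
      · intro y hy z hz
        refine hN i (not_le.1 hNi) y z
          (((convex_closedBall x ε).segment_subset hy hz).trans hsub) ?_ ?_
        · have := dist_triangle_right y z x
          rw [Metric.mem_closedBall] at hy hz
          linarith
        · intro hi0
          have huR : u ∈ S.R₀ := by rwa [branchSide, if_neg hi0] at huS
          exact hR₀ u hu z hz huR
      · intro y hy hor
        have := hG y hor i (hsub hy)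
        exact ⟨this.1, this.2.1⟩
  refine (ENNReal.tsum_le_tsum hpt).trans ?_
  rw [ENNReal.tsum_add, ENNReal.tsum_add, ENNReal.tsum_add, ENNReal.tsum_mul_left]
  refine add_le_add le_rfl (add_le_add le_rfl (add_le_add ?_ ?_))
  · rw [ENNReal.tsum_prod', tsum_fintype]
    refine Finset.sum_le_sum fun j _ => le_of_eq ?_
    rw [tsum_eq_single 0 fun n hn => by simp [hYc, hn]]
    simp [hYc]
  · by_cases huR : u ∈ S.R₀
    · rw [indicator_of_mem (hR₀ u hu x hx huR)]
      simp only [htl]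
      have h1 : ∀ i : Fin S.K × ℕ, S.R₀.indicator (fun u =>
          {i : Fin S.K × ℕ | N ≤ (i.2 : ℕ∞)}.indicator
            (fun i => ENNReal.ofReal (S.absDetInv i.2 u) * essSup φ volume) i) u =
          {i : Fin S.K × ℕ | N ≤ (i.2 : ℕ∞)}.indicator
            (fun i => ENNReal.ofReal (S.absDetInv i.2 u) * essSup φ volume) i := fun i =>
        indicator_of_mem huR _
      simp only [h1]
      exact tsum_tail_le (by positivity) (ht u (hR₀ u hu u hu huR)) _
    · simp only [htl, indicator_of_notMem huR, tsum_zero]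
      exact zero_le

end Assumptions
end PiecewiseSystem
end

/-! ### Integrated bounds for the error terms. -/

section

theorem essSup_mul_volume_le {m : ℕ} {φ : Eucl m → ℝ≥0∞} (hφ : Measurable φ) {r : ℝ}
    (hr : 0 < r) : essSup φ volume * ENNReal.ofReal (unitBallVol m * (r / 2) ^ m) ≤
      ∫⁻ z, (φ z + ballOsc φ r z) := by
  have hv : 0 < unitBallVol m * (r / 2) ^ m := mul_pos (unitBallVol_pos m) (by positivity)
  have hv0 : ENNReal.ofReal (unitBallVol m * (r / 2) ^ m) ≠ 0 := (ENNReal.ofReal_pos.2 hv).ne'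
  rw [← ENNReal.le_div_iff_mul_le (Or.inl hv0) (Or.inl ENNReal.ofReal_ne_top)]
  refine essSup_le_of_ae_le _ ?_
  filter_upwards [ae_goodPoint hφ] with v hv
  rw [ENNReal.le_div_iff_mul_le (Or.inl hv0) (Or.inl ENNReal.ofReal_ne_top),
    ← volume_closedBall_eucl v (by positivity : 0 ≤ r / 2)]
  exact hv.mul_volume_le hφ hr

theorem lintegral_ballSup_le {m : ℕ} {φ : Eucl m → ℝ≥0∞} (hφ : Measurable φ) {r : ℝ}
    (hr : 0 < r) : ∫⁻ z, ballSup φ r z ≤ ∫⁻ z, (φ z + ballOsc φ r z) := by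
  refine lintegral_mono_ae ?_
  filter_upwards [ae_goodPoint hφ] with v hv
  exact hv.ballSup_le hr

/-- The tails of the distortion estimate are small multiples of the norm of `φ`. -/
theorem tail_mul_essSup_le {m : ℕ} {φ : Eucl m → ℝ≥0∞} (hφ : Measurable φ) {α b q r : ℝ}
    (hα : 0 < α) (hb : 0 ≤ b) (hq : 0 ≤ q) (hr : 0 < r) (hr1 : r ≤ 1) :
    ENNReal.ofReal (b * (q * r) ^ ((m : ℝ) + α)) * essSup φ volume ≤
      ENNReal.ofReal (b * (q ^ ((m : ℝ) + α) * 2 ^ m / unitBallVol m)) *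
        ∫⁻ z, (φ z + ballOsc φ r z) := by
  have hγ := unitBallVol_pos m
  have h1 : b * (q * r) ^ ((m : ℝ) + α) ≤ b * (q ^ ((m : ℝ) + α) * 2 ^ m / unitBallVol m) *
      (unitBallVol m * (r / 2) ^ m) := by
    rw [Real.mul_rpow hq hr.le, Real.rpow_add hr, Real.rpow_natCast]
    have h2 : r ^ α ≤ 1 := Real.rpow_le_one hr.le hr1 hα.le
    have h3 : b * (q ^ ((m : ℝ) + α) * 2 ^ m / unitBallVol m) *
      (unitBallVol m * (r / 2) ^ m) = b * (q ^ ((m : ℝ) + α) * (r ^ m * 1)) := by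
      rw [div_pow]; field_simp
    rw [h3]
    have : 0 ≤ q ^ ((m : ℝ) + α) := Real.rpow_nonneg hq _
    gcongr
  have hq0 : 0 ≤ q ^ ((m : ℝ) + α) := Real.rpow_nonneg hq _
  calc _ ≤ ENNReal.ofReal (b * (q ^ ((m : ℝ) + α) * 2 ^ m / unitBallVol m) *
        (unitBallVol m * (r / 2) ^ m)) * essSup φ volume := by gcongr
    _ = ENNReal.ofReal (b * (q ^ ((m : ℝ) + α) * 2 ^ m / unitBallVol m)) *
        (essSup φ volume * ENNReal.ofReal (unitBallVol m * (r / 2) ^ m)) := by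
        rw [ENNReal.ofReal_mul (by positivity)]; ring
    _ ≤ _ := by gcongr; exact essSup_mul_volume_le hφ hr

/-- Here `J` and `J'` stand for integrals over the trap and over its complement. Bounding only their
sum by `A + B` is what makes `l`, which stands for `λ (ε/ε₀)^α`, enter once. -/
theorem accumulate_le {a κ l d A B B' J J' T T' X kr : ℝ≥0∞} (ha : a ≤ κ) (hJ : J + J' ≤ A + B)
    (hT : T ≤ kr * (A + B)) (hT' : T' ≤ kr * (A + B)) (hX : X ≤ l * J + 4 * T' + d * A) :
    (1 + a) * (a * A + (1 + 2 * a) * B' + X) + ((1 + κ) * (l * J') + T) ≤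
      (1 + κ) * (1 + 2 * κ) * B' + ((1 + κ) * (l + 4 * kr) + kr) * B +
        ((1 + κ) * (a + d) + ((1 + κ) * (l + 4 * kr) + kr)) * A := by
  calc _ ≤ (1 + κ) * (a * A + (1 + 2 * κ) * B' + (l * J + 4 * (kr * (A + B)) + d * A)) +
        ((1 + κ) * (l * J') + kr * (A + B)) := by
        gcongr
        exact hX.trans (by gcongr)
    _ = (1 + κ) * (1 + 2 * κ) * B' + (1 + κ) * l * (J + J') +
        ((1 + κ) * (4 * kr) + kr) * (A + B) + (1 + κ) * (a + d) * A := by ring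
    _ ≤ (1 + κ) * (1 + 2 * κ) * B' + (1 + κ) * l * (A + B) +
        ((1 + κ) * (4 * kr) + kr) * (A + B) + (1 + κ) * (a + d) * A := by gcongr
    _ = _ := by ring

namespace PiecewiseSystem

variable {m : ℕ} {S : PiecewiseSystem m} {α η₀ ε₂ I Cξ : ℝ}

namespace Assumptions

variable (h : S.Assumptions α η₀ ε₂ I Cξ) {s' τ ρ : ℝ} (hc : S.Collar s' τ ρ)
include h hc

theorem measurable_branchCost (ε σ : ℝ) (a : ℝ≥0∞) {φ : Eucl m → ℝ≥0∞} (hφ : Measurable φ)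
    (i : Fin S.K × ℕ) : Measurable (S.branchCost s' τ ε σ a φ i) := by
  have hS := h.measurableSet_branchSide i
  have h1 := measurableSet_collarR (S := S) ε i
  have h2 := measurableSet_collarTR (S := S) ε i
  have hM : Measurable (ballSup (S.M.indicator φ) σ) :=
    measurable_ballSup (hφ.indicator h.standing.compact.isClosed.measurableSet) _
  have ht := fun {g : Eucl m → ℝ≥0∞} (hg : Measurable g) => h.measurable_branchTerm hc i hg
  unfold branchCost
  exact ((ht ((hφ.const_mul a).add ((measurable_ballOsc hφ σ).const_mul _))).indicator hS).add
    ((((ht (hφ.inf hM)).indicator (h1.inter hS)).add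
      ((ht (hφ.inf hM)).indicator (h2.inter hS))).add
      (((ht hM).indicator (h1.inter hS.compl)).add ((ht hM).indicator (h2.inter hS.compl))))

theorem lintegral_branchCost_le (ε σ : ℝ) (a : ℝ≥0∞) {φ : Eucl m → ℝ≥0∞} (hφ : Measurable φ) :
    ∫⁻ x, ∑' i, S.branchCost s' τ ε σ a φ i x ≤
      a * (∫⁻ y, φ y) + (1 + 2 * a) * (∫⁻ y, ballOsc φ σ y) +
      ((∑' i, (∫⁻ x in S.collarR ε i ∩ S.branchSide i,
          S.branchTerm s' τ i (φ ⊓ ballSup (S.M.indicator φ) σ) x) +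
        ∑' i, (∫⁻ x in S.collarTR ε i ∩ S.branchSide i,
          S.branchTerm s' τ i (φ ⊓ ballSup (S.M.indicator φ) σ) x)) +
      (∑' i, (∫⁻ x in S.collarR ε i ∩ (S.branchSide i)ᶜ,
          S.branchTerm s' τ i (ballSup (S.M.indicator φ) σ) x) +
        ∑' i, (∫⁻ x in S.collarTR ε i ∩ (S.branchSide i)ᶜ,
          S.branchTerm s' τ i (ballSup (S.M.indicator φ) σ) x))) := by
  have hS := h.measurableSet_branchSide
  have h1 := measurableSet_collarR (S := S) ε
  have h2 := measurableSet_collarTR (S := S) ε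
  have hM : Measurable (ballSup (S.M.indicator φ) σ) :=
    measurable_ballSup (hφ.indicator h.standing.compact.isClosed.measurableSet) _
  have ht := fun {g : Eucl m → ℝ≥0∞} (hg : Measurable g) i => h.measurable_branchTerm hc i hg
  have hO : Measurable fun y => a * φ y + (1 + 2 * a) * ballOsc φ σ y :=
    (hφ.const_mul a).add ((measurable_ballOsc hφ σ).const_mul _)
  have h3 : ∑' i, ∫⁻ x, (S.branchSide i).indicator
      (S.branchTerm s' τ i fun y => a * φ y + (1 + 2 * a) * ballOsc φ σ y) x ≤
      a * (∫⁻ y, φ y) + (1 + 2 * a) * (∫⁻ y, ballOsc φ σ y) := by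
    rw [← lintegral_tsum fun i => ((ht hO i).indicator (hS i)).aemeasurable]
    refine (h.lintegral_branchOp_le hc hO).trans_eq ?_
    rw [lintegral_add_left (hφ.const_mul a), lintegral_const_mul _ hφ,
      lintegral_const_mul _ (measurable_ballOsc hφ σ)]
  rw [lintegral_tsum fun i => (h.measurable_branchCost hc ε σ a hφ i).aemeasurable]
  refine le_trans (le_of_eq ?_) (add_le_add h3 le_rfl)
  rw [← ENNReal.tsum_add, ← ENNReal.tsum_add, ← ENNReal.tsum_add, ← ENNReal.tsum_add]
  refine tsum_congr fun i => ?_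
  unfold branchCost
  have hadd : ∀ {f₁ f₂ f₃ f₄ f₅ : Eucl m → ℝ≥0∞}, Measurable f₁ → Measurable f₂ → Measurable f₃ →
      Measurable f₄ → ∫⁻ x, f₁ x + (f₂ x + f₃ x + (f₄ x + f₅ x)) = (∫⁻ x, f₁ x) +
        ((∫⁻ x, f₂ x) + (∫⁻ x, f₃ x) + ((∫⁻ x, f₄ x) + (∫⁻ x, f₅ x))) := by
    intro f₁ f₂ f₃ f₄ f₅ e1 e2 e3 e4
    rw [lintegral_add_left e1, lintegral_add_left (show Measurable fun x => f₂ x + f₃ x from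
      e2.add e3), lintegral_add_left e2, lintegral_add_left e4]
  rw [hadd ((ht hO i).indicator (hS i)) ((ht (hφ.inf hM) i).indicator ((h1 i).inter (hS i)))
    ((ht (hφ.inf hM) i).indicator ((h2 i).inter (hS i)))
    ((ht hM i).indicator ((h1 i).inter (hS i).compl)),
    lintegral_indicator ((h1 i).inter (hS i)), lintegral_indicator ((h2 i).inter (hS i)),
    lintegral_indicator ((h1 i).inter (hS i).compl),
    lintegral_indicator ((h2 i).inter (hS i).compl)]

/-- Present sides are parts of sets with disjoint preimages, so their total is at most an `L¹` norm.
This is used when `ε` is comparable to `ε₀`. -/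
theorem tsum_lintegral_side_le {X : Fin S.K × ℕ → Set (Eucl m)} {φ ψ : Eucl m → ℝ≥0∞}
    (hφ : Measurable φ) (hψ : ψ ≤ φ) :
    ∑' i, ∫⁻ x in X i ∩ S.branchSide i, S.branchTerm s' τ i ψ x ≤ ∫⁻ y, φ y := by
  refine le_trans ?_ (h.lintegral_branchOp_le hc hφ)
  unfold branchOp
  rw [lintegral_tsum fun i => ((h.measurable_branchTerm hc i hφ).indicator
    (h.measurableSet_branchSide i)).aemeasurable]
  refine ENNReal.tsum_le_tsum fun i => ?_
  rw [lintegral_indicator (h.measurableSet_branchSide i)]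
  exact (lintegral_mono (branchTerm_mono s' τ i hψ)).trans (lintegral_mono_set inter_subset_right)

end Assumptions
end PiecewiseSystem
end

/-! ### Choice of constants and the variation bound for nonnegative functions. -/

section

theorem exists_pos_rpow_mul_le {J κ α : ℝ} (hJ : 0 < J) (hκ : 0 < κ) (hα : 0 < α) :
    ∃ y > 0, ∀ r, 0 ≤ r → r ≤ y → J * r ^ α ≤ κ := by
  refine ⟨(κ / J) ^ (1 / α), Real.rpow_pos_of_pos (div_pos hκ hJ) _, fun r hr hry => ?_⟩
  have h1 : r ^ α ≤ κ / J := by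
    calc r ^ α ≤ ((κ / J) ^ (1 / α)) ^ α := Real.rpow_le_rpow hr hry hα.le
      _ = κ / J := by
        rw [← Real.rpow_mul (div_pos hκ hJ).le, one_div, inv_mul_cancel₀ hα.ne', Real.rpow_one]
  calc J * r ^ α ≤ J * (κ / J) := by gcongr
    _ = κ := by field_simp

/-- Small radii make the boundary terms small, the others are absorbed by the weak norm. -/
theorem collar_sum_le {x₁ x₂ y₁ y₂ A J T : ℝ≥0∞} {g lam ε ε₀ α : ℝ} (hα1 : α < 1)
    (hlam : 0 ≤ lam) (hε : 0 < ε) (hεε₀ : ε ≤ ε₀) (hg : 2 * g ≤ lam)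
    (hx₁ : x₁ ≤ A) (hx₂ : x₂ ≤ A) (hx₁' : x₁ ≤ ENNReal.ofReal (g * (ε / ε₀)) * J + T)
    (hx₂' : x₂ ≤ ENNReal.ofReal (g * (ε / ε₀)) * J + T)
    (hy₁ : y₁ ≤ ENNReal.ofReal (g * (ε / ε₀)) * J + T)
    (hy₂ : y₂ ≤ ENNReal.ofReal (g * (ε / ε₀)) * J + T) (hα : 0 < α) :
    x₁ + x₂ + (y₁ + y₂) ≤ ENNReal.ofReal (lam * (ε / ε₀) ^ α) * J + 4 * T +
      ENNReal.ofReal (2 * ((1 / 2) ^ (1 / (1 - α)) * ε₀) ^ (-α) * ε ^ α) * A := by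
  have h1α : 0 < 1 - α := sub_pos.2 hα1
  have hε₀ : 0 < ε₀ := hε.trans_le hεε₀
  set δ : ℝ := (1 / 2) ^ (1 / (1 - α)) with hδ
  have hδ0 : 0 < δ := Real.rpow_pos_of_pos (by norm_num) _
  set q := ε / ε₀ with hq
  have hq0 : 0 < q := div_pos hε hε₀
  have hq1 : q ≤ 1 := (div_le_one hε₀).2 hεε₀
  have hqα : q ≤ q ^ α := by
    simpa using Real.rpow_le_rpow_of_exponent_ge hq0 hq1 hα1.le
  -- Since `δ^(1-α) = 1/2`, small `q` satisfies `2q ≤ q^α`, and all four terms fit into `lam * q^α`.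
  -- Otherwise only `q ≤ q^α` is available, which pays for two terms; the other two are bounded by
  -- `A`, and `ε ≥ δ ε₀` allows a factor `ε^α` in front of it.
  rcases lt_or_ge ε (δ * ε₀) with hlt | hge
  · have hqδ : q ≤ δ := ((div_lt_iff₀ hε₀).2 hlt).le
    have h2 : 2 * q ≤ q ^ α := by
      have e1 : q = q ^ (1 - α) * q ^ α := by
        rw [← Real.rpow_add hq0]; simp
      have e2 : q ^ (1 - α) ≤ 1 / 2 := by
        calc q ^ (1 - α) ≤ δ ^ (1 - α) := Real.rpow_le_rpow hq0.le hqδ h1α.le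
          _ = 1 / 2 := by
            rw [hδ, ← Real.rpow_mul (by norm_num), one_div_mul_cancel h1α.ne', Real.rpow_one]
      have e3 : 0 ≤ q ^ α := Real.rpow_nonneg hq0.le _
      nlinarith
    have h3 : 4 * ENNReal.ofReal (g * q) ≤ ENNReal.ofReal (lam * q ^ α) := by
      rw [← ENNReal.ofReal_ofNat, ← ENNReal.ofReal_mul (by norm_num)]
      refine ENNReal.ofReal_le_ofReal ?_
      calc (4 : ℝ) * (g * q) = (2 * g) * (2 * q) := by ring
        _ ≤ lam * q ^ α := by gcongr
    calc _ ≤ (ENNReal.ofReal (g * q) * J + T) + (ENNReal.ofReal (g * q) * J + T) +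
          ((ENNReal.ofReal (g * q) * J + T) + (ENNReal.ofReal (g * q) * J + T)) := by gcongr
      _ = 4 * ENNReal.ofReal (g * q) * J + 4 * T := by ring
      _ ≤ ENNReal.ofReal (lam * q ^ α) * J + 4 * T := by gcongr
      _ ≤ _ := le_self_add
  · have h2 : (2 : ℝ≥0∞) ≤ ENNReal.ofReal (2 * (δ * ε₀) ^ (-α) * ε ^ α) := by
      rw [← ENNReal.ofReal_ofNat]
      refine ENNReal.ofReal_le_ofReal ?_
      have e1 : (δ * ε₀) ^ α ≤ ε ^ α := Real.rpow_le_rpow (by positivity) hge hα.le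
      have e2 : 0 < (δ * ε₀) ^ α := Real.rpow_pos_of_pos (by positivity) _
      rw [Real.rpow_neg (by positivity), mul_assoc, inv_mul_eq_div]
      have := (one_le_div e2).2 e1
      linarith
    have h3 : 2 * ENNReal.ofReal (g * q) ≤ ENNReal.ofReal (lam * q ^ α) := by
      rw [← ENNReal.ofReal_ofNat, ← ENNReal.ofReal_mul (by norm_num)]
      refine ENNReal.ofReal_le_ofReal ?_
      calc (2 : ℝ) * (g * q) = (2 * g) * q := by ring
        _ ≤ lam * q ^ α := by gcongr
    calc _ ≤ A + A + ((ENNReal.ofReal (g * q) * J + T) + (ENNReal.ofReal (g * q) * J + T)) := by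
          gcongr
      _ = 2 * ENNReal.ofReal (g * q) * J + 2 * T + 2 * A := by ring
      _ ≤ _ := by gcongr; norm_num

namespace PiecewiseSystem
namespace Assumptions

variable {k : ℕ} {S : PiecewiseSystem (k + 1)} {α η₀ ε₂ I Cξ : ℝ}
variable (h : S.Assumptions α η₀ ε₂ I Cξ)
include h

/-- Strictness of `s^α + λ ≤ η₀ < 1` survives small `κ` and then `s₁` close to `s`. The last
inequality has room because the surface constant at `s` is at most `λ/3`, while only its double is
compared with `λ`. -/
theorem exists_constants : ∃ κ > 0, ∀ᶠ s₁ in 𝓝[>] S.s, s₁ < 1 ∧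
    (1 + κ) * (1 + 2 * κ) * s₁ ^ α + ((1 + κ) * ((S.lam α ε₂).toReal + 4 * κ) + κ) < 1 ∧
    2 * ((1 + κ) * ((1 + κ) * (s₁ * unitBallVol k / ((1 - s₁) * unitBallVol (k + 1))))) ≤
      (S.lam α ε₂).toReal := by
  set l := (S.lam α ε₂).toReal with hl
  set q : ℝ → ℝ := fun x => x * unitBallVol k / ((1 - x) * unitBallVol (k + 1)) with hq
  have h1s := sub_pos.2 h.s_lt_one
  have hγ := unitBallVol_pos k
  have hγ' := unitBallVol_pos (k + 1)
  have hs := h.s_pos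
  have hqs : 0 < q S.s := by simp only [hq]; positivity
  have h3q : 3 * q S.s ≤ l := by
    refine le_of_eq_of_le ?_ h.packing_ratio_le
    simp only [hq, Nat.add_sub_cancel]
    ring
  have hsl := h.rpow_s_add_lam_le
  have hη := h.a3.η₀_mem.2
  have c1 : ContinuousAt (fun κ : ℝ => (1 + κ) * (1 + 2 * κ) * S.s ^ α +
      ((1 + κ) * (l + 4 * κ) + κ)) 0 := by fun_prop
  have c2 : ContinuousAt (fun κ : ℝ => 2 * ((1 + κ) * ((1 + κ) * q S.s))) 0 := by fun_prop
  have e1 := (c1.eventually_lt_const (show _ < (1 : ℝ) by simp; linarith)).filter_mono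
    (nhdsWithin_le_nhds (s := Ioi 0))
  have e2 := (c2.eventually_lt_const (show _ < 3 * q S.s by simp; linarith)).filter_mono
    (nhdsWithin_le_nhds (s := Ioi 0))
  obtain ⟨κ, ⟨hκ1, hκ2⟩, hκ⟩ := ((e1.and e2).and self_mem_nhdsWithin).exists
  refine ⟨κ, hκ, ?_⟩
  have hqc : ContinuousAt q S.s := by
    simp only [hq]
    refine ContinuousAt.div (by fun_prop) (by fun_prop) (by positivity)
  have hsc : ContinuousAt (fun x : ℝ => x ^ α) S.s :=
    Real.continuousAt_rpow_const _ _ (Or.inl hs.ne')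
  have c3 : ContinuousAt (fun x : ℝ => (1 + κ) * (1 + 2 * κ) * x ^ α +
      ((1 + κ) * (l + 4 * κ) + κ)) S.s := by fun_prop
  have c4 : ContinuousAt (fun x : ℝ => 2 * ((1 + κ) * ((1 + κ) * q x))) S.s := by fun_prop
  filter_upwards [nhdsWithin_le_nhds (continuousAt_id.eventually_lt_const h.s_lt_one),
    nhdsWithin_le_nhds (c3.eventually_lt_const hκ1),
    nhdsWithin_le_nhds (c4.eventually_lt_const (hκ2.trans_le h3q))] with s₁ f1 f2 f3
  exact ⟨f1, f2, f3.le⟩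

/-- Variation of the transfer operator, applied to nonnegative functions. -/
theorem exists_variation_bound : ∃ s₁ c₁ c₂ : ℝ, 0 < s₁ ∧ s₁ ≤ 1 ∧ 0 ≤ c₁ ∧ 0 ≤ c₂ ∧
    c₁ * s₁ ^ α + c₂ < 1 ∧ ∃ s' τ ρ, S.Collar s' τ ρ ∧ ∃ εs > 0, ∀ ε₀ ∈ Ioc 0 εs, ∃ D : ℝ≥0,
    ∀ φ : Eucl (k + 1) → ℝ≥0∞, Measurable φ → ∀ ε ∈ Ioc 0 ε₀, ∃ C : Eucl (k + 1) → ℝ≥0∞,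
      Measurable C ∧ (∀ᵐ x, ∃ G : Set (Eucl (k + 1)), (∀ᵐ u, u ∈ G) ∧
        ∀ u ∈ G ∩ Metric.closedBall x ε, ∀ u' ∈ G ∩ Metric.closedBall x ε,
          S.branchOp s' τ φ u ≤ S.branchOp s' τ φ u' + C x) ∧
      ∫⁻ x, C x ≤ ENNReal.ofReal c₁ * (∫⁻ y, ballOsc φ (s₁ * ε) y) +
        ENNReal.ofReal (c₂ * (ε / ε₀) ^ α) * (∫⁻ y, ballOsc φ ε₀ y) +
        D * ENNReal.ofReal (ε ^ α) * ∫⁻ y, φ y := by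
  obtain ⟨κ, hκ, hev⟩ := h.exists_constants
  obtain ⟨s₁, ⟨⟨hs₁1, hconst, hβ0⟩, hlayer⟩, hss₁⟩ :=
    ((hev.and h.eventually_lintegral_layer_le).and self_mem_nhdsWithin).exists
  replace hss₁ : S.s < s₁ := hss₁
  obtain ⟨s', hss', hs's₁⟩ := exists_between hss₁
  obtain ⟨τ, ρ, hc⟩ := h.exists_collar hss'
  have hs₁0 : 0 < s₁ := h.s_pos.trans hss₁
  have h1s : 0 < 1 - s₁ := sub_pos.2 hs₁1
  set l := (S.lam α ε₂).toReal with hl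
  have hl0 : 0 ≤ l := ENNReal.toReal_nonneg
  set β₀ := (1 + κ) * (s₁ * unitBallVol k / ((1 - s₁) * unitBallVol (k + 1))) with hβ₀
  have hγ := unitBallVol_pos k
  have hγ' := unitBallVol_pos (k + 1)
  have hβ₀0 : 0 ≤ β₀ := by positivity
  have hα := h.α_pos
  obtain ⟨e₁, he₁, hlayer⟩ := hlayer s' τ ρ hc
  obtain ⟨e₂, he₂, hcost⟩ := h.exists_layerCost hc hs's₁ (hs's₁.trans hs₁1).le hκ
  obtain ⟨e₃, he₃, hcollar⟩ := h.exists_lintegral_collar_le hc hs's₁ hs₁1 hκ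
  set V := volume (Metric.cthickening 1 S.R₀) with hV
  have hVt : V ≠ ∞ := by
    have hb : Bornology.IsBounded S.R₀ := (h.isCompact_closure_TR.isBounded.subset
      subset_closure).subset sdiff_subset
    exact hb.cthickening.measure_lt_top.ne
  set v := V.toReal with hv
  have hv0 : 0 ≤ v := ENNReal.toReal_nonneg
  have hVv : V = ENNReal.ofReal v := (ENNReal.ofReal_toReal hVt).symm
  set c := (1 - s₁) / s₁ with hcdef
  have hc0 : 0 ≤ c := by positivity
  set Ca : ℝ := (2 : ℝ) ^ (((k + 1 : ℕ) : ℝ) + α) * 2 ^ (k + 1) / unitBallVol (k + 1) with hCa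
  set Cb : ℝ := c ^ (((k + 1 : ℕ) : ℝ) + α) * 2 ^ (k + 1) / unitBallVol (k + 1) with hCb
  have hCa0 : 0 ≤ Ca := by positivity
  have hCb0 : 0 ≤ Cb := by positivity
  -- Both tail contributions, over a neighbourhood of `R₀` and over the collars, are to have
  -- coefficient at most `κ`.
  obtain ⟨b, hb, hb1, hb2⟩ : ∃ b > 0, S.K * (b * Ca) * v ≤ κ ∧
      S.K * (b * Cb) * (2 * β₀ * v) ≤ κ := by
    set Q := S.K * Ca * v + S.K * Cb * (2 * β₀ * v) + 1 with hQ
    have h1 : 0 ≤ S.K * Ca * v := by positivity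
    have h2 : 0 ≤ S.K * Cb * (2 * β₀ * v) := by positivity
    have hQ0 : 0 < Q := by positivity
    have hbQ : κ / Q * Q = κ := by field_simp
    have hκQ : 0 < κ / Q := by positivity
    refine ⟨κ / Q, hκQ, ?_, ?_⟩
    · calc S.K * (κ / Q * Ca) * v = κ / Q * (S.K * Ca * v) := by ring
        _ ≤ κ / Q * Q := by gcongr; linarith
        _ = κ := hbQ
    · calc S.K * (κ / Q * Cb) * (2 * β₀ * v) = κ / Q * (S.K * Cb * (2 * β₀ * v)) := by ring
        _ ≤ κ / Q * Q := by gcongr; linarith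
        _ = κ := hbQ
  obtain ⟨J, hJ, e₄, he₄, hdist⟩ := h.exists_distortion hc hb
  obtain ⟨y, hy, hJy⟩ := exists_pos_rpow_mul_le hJ hκ hα
  have hτ := hc.τ_pos
  set e := min e₄ 1 with he
  have he0 : 0 < e := lt_min he₄ one_pos
  have hee₄ : Metric.cthickening e S.R₀ ⊆ Metric.cthickening e₄ S.R₀ :=
    Metric.cthickening_mono (min_le_left _ _) _
  -- Common bound for the two scales `2ε` and `r`: below it the distortion is at most `κ`, and balls
  -- stay inside the collar neighbourhoods.
  set z := min (min e (τ / 2)) y with hz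
  have hz0 : 0 < z := lt_min (lt_min he0 (by positivity)) hy
  have hze : z ≤ e := (min_le_left _ _).trans (min_le_left _ _)
  have hzτ : z ≤ τ / 2 := (min_le_left _ _).trans (min_le_right _ _)
  have hzy : z ≤ y := min_le_right _ _
  refine ⟨s₁, (1 + κ) * (1 + 2 * κ), (1 + κ) * (l + 4 * κ) + κ, hs₁0, hs₁1.le, by positivity,
    by positivity, hconst, s', τ, ρ, hc,
    min (min e₁ e₂) (min (min e₃ 1) (z / 2 * s₁)), by positivity, fun ε₀ hε₀ => ?_⟩
  have hε₀0 := hε₀.1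
  have hε₀e₁ : ε₀ ≤ e₁ := hε₀.2.trans ((min_le_left _ _).trans (min_le_left _ _))
  have hε₀e₂ : ε₀ ≤ e₂ := hε₀.2.trans ((min_le_left _ _).trans (min_le_right _ _))
  have hε₀e₃ : ε₀ ≤ e₃ := hε₀.2.trans ((min_le_right _ _).trans
    ((min_le_left _ _).trans (min_le_left _ _)))
  have hε₀1 : ε₀ ≤ 1 := hε₀.2.trans ((min_le_right _ _).trans
    ((min_le_left _ _).trans (min_le_right _ _)))
  have hε₀z : ε₀ ≤ z / 2 * s₁ := hε₀.2.trans ((min_le_right _ _).trans (min_le_right _ _))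
  have hε₀z2 : ε₀ ≤ z / 2 := hε₀z.trans (mul_le_of_le_one_right (by positivity) hs₁1.le)
  have hε₀s : ε₀ / s₁ ≤ z / 2 := (div_le_iff₀ hs₁0).2 hε₀z
  set r := ε₀ * (1 - s₁) / s₁ with hr
  have hrc : r = c * ε₀ := by rw [hr, hcdef]; ring
  have hr0 : 0 < r := by positivity
  have hrz : r ≤ z := by
    have h1 : r = ε₀ / s₁ - ε₀ := by rw [hr]; field_simp
    linarith
  have hzε₄ : z ≤ e₄ := hze.trans (min_le_left _ _)
  set d₀ : ℝ := 2 * ((1 / 2) ^ (1 / (1 - α)) * ε₀) ^ (-α) with hd₀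
  have hd₀0 : 0 ≤ d₀ := by positivity
  -- Collects what multiplies the weak norm: distortion, the collar terms at scales comparable to
  -- `ε₀`, and the weak part of the local suprema and tails, where `(ε/ε₀)^α` is written as `ε₀^(-α)
  -- ε^α`.
  set D : ℝ := (1 + κ) * (J * 2 ^ α + d₀) +
    ((1 + κ) * (l * ε₀ ^ (-α) + 4 * (κ * ε₀ ^ (-α))) + κ * ε₀ ^ (-α)) with hD
  have hD0 : 0 ≤ D := by positivity
  refine ⟨D.toNNReal, fun φ hφ ε hε => ?_⟩
  have hε0 := hε.1
  have hεα : 0 < ε ^ α := Real.rpow_pos_of_pos hε0 _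
  have h2ε : 2 * ε ≤ z := by linarith [hε.2]
  -- Distortion is needed at two scales, the diameter `2ε` of the ball over which the oscillation is
  -- taken and the averaging radius `r` for the collars, each with its own cutoff between short and
  -- long branches.
  obtain ⟨N, hN0, hN, ht⟩ := hdist (2 * ε) ⟨by positivity, h2ε.trans hzε₄⟩
  obtain ⟨N', hN0', hN', ht'⟩ := hdist r ⟨hr0, hrz.trans hzε₄⟩
  obtain ⟨Y, hYm, hYi, hYp⟩ := hcost ε ⟨hε0, hε.2.trans hε₀e₂⟩ φ hφ
  set a := ENNReal.ofReal (J * (2 * ε) ^ α) with ha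
  set t := ENNReal.ofReal (b * (2 * ε) ^ (((k + 1 : ℕ) : ℝ) + α)) with htdef
  set t' := ENNReal.ofReal (b * r ^ (((k + 1 : ℕ) : ℝ) + α)) with ht'def
  set Φ := essSup φ volume with hΦ
  set U := ballSup φ ε₀ with hU
  set q := ε / ε₀ with hq
  have hq0 : 0 < q := div_pos hε0 hε₀0
  have hq1 : q ≤ 1 := (div_le_one hε₀0).2 hε.2
  have hqα : q ≤ q ^ α := by
    simpa using Real.rpow_le_rpow_of_exponent_ge hq0 hq1 h.α_lt.le
  have hqα0 : 0 < q ^ α := Real.rpow_pos_of_pos hq0 _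
  have haκ : a ≤ ENNReal.ofReal κ :=
    ENNReal.ofReal_le_ofReal (hJy _ (by positivity) (h2ε.trans hzy))
  have haκ' : ENNReal.ofReal (J * r ^ α) ≤ ENNReal.ofReal κ :=
    ENNReal.ofReal_le_ofReal (hJy _ hr0.le (hrz.trans hzy))
  have hE : ∫⁻ z, (φ z + ballOsc φ ε₀ z) = (∫⁻ z, φ z) + ∫⁻ z, ballOsc φ ε₀ z :=
    lintegral_add_left hφ _
  set tail := (Metric.cthickening e S.R₀).indicator fun _ : Eucl (k + 1) =>
    (S.K : ℝ≥0∞) * (t * Φ) with htail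
  have htailm : Measurable tail :=
    measurable_const.indicator Metric.isClosed_cthickening.measurableSet
  have hCm : Measurable fun x => ∑' i, S.branchCost s' τ ε (s₁ * ε) a φ i x :=
    Measurable.tsum fun i => h.measurable_branchCost hc ε _ a hφ i
  have hYsm : Measurable fun x => ∑ j, Y j x := Finset.measurable_sum _ fun j _ => hYm j
  refine ⟨fun x => (1 + a) * (∑' i, S.branchCost s' τ ε (s₁ * ε) a φ i x) +
    (∑ j, Y j x + tail x), (hCm.const_mul _).add (hYsm.add htailm), ?_, ?_⟩
  · have hGae := h.ae_good_branches hc hφ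
    filter_upwards [hGae] with x hx
    refine ⟨_, hGae, fun u hu u' hu' => ?_⟩
    refine h.branchOp_le_add hc hε0 (by linarith) (by gcongr) (h2ε.trans hze) hN0
      (fun i hi x w hs hd hw => hN i hi x w hs hd fun h0 => hee₄ (hw h0))
      (fun x hx => ht x (hee₄ hx)) hYp hu.2 hu'.2 ?_
    rintro y (rfl | rfl | rfl)
    · exact hu.1
    · exact hu'.1
    · exact hx
  set A := ∫⁻ y, φ y with hA
  set B := ∫⁻ y, ballOsc φ ε₀ y with hB
  have hbound : ∀ ψ : Eucl (k + 1) → ℝ≥0∞, (∀ y, ψ y ≤ ballSup (S.M.indicator φ) (s₁ * ε) y) →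
      ∀ X ∈ ({S.collarR, S.collarTR} : Set (ℝ → Fin S.K × ℕ → Set (Eucl (k + 1)))),
      ∀ C ∈ ({S.branchSide, fun i => (S.branchSide i)ᶜ} :
        Set (Fin S.K × ℕ → Set (Eucl (k + 1)))),
      ∑' i, ∫⁻ x in X ε i ∩ C i, S.branchTerm s' τ i ψ x ≤
        ENNReal.ofReal ((1 + κ) * β₀ * q) * (∫⁻ z in S.trap τ ρ, U z) +
          S.K * (t' * Φ) * (2 * ENNReal.ofReal (β₀ * q) * V) := by
    intro ψ hψ X hX C hC
    have hψφ : ∀ y, ψ y ≤ ballSup φ (s₁ * ε) y := fun y =>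
      (hψ y).trans (ballSup_mono_fun (indicator_le_self _ _) _ _)
    refine (hcollar e (min_le_right _ _) ε₀ hε₀e₃ (hε₀s.trans (by linarith)) ε hε _ t' Φ N' hN0'
      (fun i hi x w hs hd hw => hN' i hi x w hs hd fun h0 => hee₄ (hw h0))
      (fun x hx => ht' x (hee₄ hx)) ψ φ hφ hψφ
      (fun y => (hψφ y).trans (essSup_mono_measure Measure.restrict_le_self.absolutelyContinuous))
      X hX C hC).trans (add_le_add ?_ le_rfl)
    have hg : (1 + ENNReal.ofReal (J * r ^ α)) * ENNReal.ofReal (β₀ * q) ≤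
        ENNReal.ofReal ((1 + κ) * β₀ * q) := by
      rw [mul_assoc (1 + κ) β₀ q, ENNReal.ofReal_mul (by positivity : 0 ≤ 1 + κ),
        ENNReal.ofReal_add zero_le_one hκ.le, ENNReal.ofReal_one]
      exact mul_le_mul' (add_le_add le_rfl haκ') le_rfl
    rw [← mul_assoc]
    exact mul_le_mul' hg le_rfl
  have hX1 : S.collarR ∈ ({S.collarR, S.collarTR} :
    Set (ℝ → Fin S.K × ℕ → Set (Eucl (k + 1)))) := by simp
  have hX2 : S.collarTR ∈ ({S.collarR, S.collarTR} :
    Set (ℝ → Fin S.K × ℕ → Set (Eucl (k + 1)))) := by simp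
  have hC1 : S.branchSide ∈ ({S.branchSide, fun i => (S.branchSide i)ᶜ} :
        Set (Fin S.K × ℕ → Set (Eucl (k + 1)))) := by simp
  have hC2 : (fun i => (S.branchSide i)ᶜ) ∈ ({S.branchSide, fun i => (S.branchSide i)ᶜ} :
        Set (Fin S.K × ℕ → Set (Eucl (k + 1)))) := by simp
  have hX := collar_sum_le h.α_lt hl0 hε0 hε.2 hβ0
    (h.tsum_lintegral_side_le hc (X := S.collarR ε) hφ
      (inf_le_left (a := φ) (b := ballSup (S.M.indicator φ) (s₁ * ε))))
    (h.tsum_lintegral_side_le hc (X := S.collarTR ε) hφ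
      (inf_le_left (a := φ) (b := ballSup (S.M.indicator φ) (s₁ * ε))))
    (hbound _ (fun y => inf_le_right) _ hX1 _ hC1) (hbound _ (fun y => inf_le_right) _ hX2 _ hC1)
    (hbound _ (fun y => le_rfl) _ hX1 _ hC2) (hbound _ (fun y => le_rfl) _ hX2 _ hC2) hα
  have hJJ : (∫⁻ z in S.trap τ ρ, U z) + (∫⁻ z in (S.trap τ ρ)ᶜ, U z) ≤ A + B := by
    rw [lintegral_add_compl _ (h.isCompact_trap hc).isClosed.measurableSet, ← hE]
    exact lintegral_ballSup_le hφ hε₀0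
  have hT : ∫⁻ x, tail x ≤ ENNReal.ofReal (κ * q ^ α) * (A + B) := by
    rw [htail, lintegral_indicator_const Metric.isClosed_cthickening.measurableSet]
    have h1 : t * Φ ≤ ENNReal.ofReal (b * (Ca * q ^ α)) * (A + B) := by
      have h2 := tail_mul_essSup_le hφ (b := b) (q := 2 * q) hα hb.le (by positivity) hε₀0 hε₀1
      rw [hE] at h2
      have h3 : 2 * q * ε₀ = 2 * ε := by rw [hq]; field_simp
      rw [h3] at h2
      refine h2.trans ?_
      gcongr
      rw [hCa, Real.mul_rpow (by norm_num) hq0.le]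
      have h4 : q ^ (((k + 1 : ℕ) : ℝ) + α) ≤ q ^ α :=
        Real.rpow_le_rpow_of_exponent_ge hq0 hq1 (by
          have : (0 : ℝ) ≤ ((k + 1 : ℕ) : ℝ) := Nat.cast_nonneg _
          linarith)
      rw [div_mul_eq_mul_div, div_le_div_iff_of_pos_right hγ']
      calc (2 : ℝ) ^ (((k + 1 : ℕ) : ℝ) + α) * q ^ (((k + 1 : ℕ) : ℝ) + α) * 2 ^ (k + 1) ≤
            (2 : ℝ) ^ (((k + 1 : ℕ) : ℝ) + α) * q ^ α * 2 ^ (k + 1) := by gcongr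
        _ = _ := by ring
    have h5 : volume (Metric.cthickening e S.R₀) ≤ ENNReal.ofReal v := by
      rw [← hVv]
      exact measure_mono (Metric.cthickening_mono (min_le_right _ _) _)
    calc _ ≤ (S.K : ℝ≥0∞) * (ENNReal.ofReal (b * (Ca * q ^ α)) * (A + B)) *
          ENNReal.ofReal v := by gcongr
      _ = ENNReal.ofReal (S.K * (b * Ca) * v * q ^ α) * (A + B) := by
          rw [ENNReal.ofReal_mul (p := S.K * (b * Ca) * v) (by positivity),
            ENNReal.ofReal_mul (p := S.K * (b * Ca)) (by positivity),
            ENNReal.ofReal_mul (p := (S.K : ℝ)) (by positivity), ENNReal.ofReal_natCast,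
            ← mul_assoc b, ENNReal.ofReal_mul (p := b * Ca) (by positivity)]
          ring
      _ ≤ _ := by gcongr
  -- Here the tail is taken at the scale `r`, proportional to `ε₀`, and the gain `ε/ε₀` comes from
  -- the volume of the collar. In `hT` it came from the power of `2ε` in the tail itself.
  have hT' : S.K * (t' * Φ) * (2 * ENNReal.ofReal (β₀ * q) * V) ≤
      ENNReal.ofReal (κ * q ^ α) * (A + B) := by
    have h1 : t' * Φ ≤ ENNReal.ofReal (b * Cb) * (A + B) := by
      have h2 := tail_mul_essSup_le hφ (b := b) (q := c) hα hb.le hc0 hε₀0 hε₀1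
      rw [hE, ← hrc] at h2
      exact h2
    calc _ ≤ (S.K : ℝ≥0∞) * (ENNReal.ofReal (b * Cb) * (A + B)) *
          (2 * ENNReal.ofReal (β₀ * q) * V) := by gcongr
      _ = ENNReal.ofReal (S.K * (b * Cb) * (2 * β₀ * v) * q) * (A + B) := by
          rw [hVv, ENNReal.ofReal_mul (p := S.K * (b * Cb) * (2 * β₀ * v)) (by positivity),
            ENNReal.ofReal_mul (p := S.K * (b * Cb)) (by positivity),
            ENNReal.ofReal_mul (p := (S.K : ℝ)) (by positivity), ENNReal.ofReal_natCast,
            ENNReal.ofReal_mul (p := 2 * β₀) (by positivity),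
            ENNReal.ofReal_mul (p := 2) (by positivity),
            ENNReal.ofReal_mul (p := β₀) (by positivity), ENNReal.ofReal_ofNat]
          ring
      _ ≤ _ := by gcongr
  have hYs : ∫⁻ x, ∑ j, Y j x ≤ (1 + ENNReal.ofReal κ) *
      (ENNReal.ofReal (l * q ^ α) * ∫⁻ z in (S.trap τ ρ)ᶜ, U z) := by
    rw [lintegral_finsetSum _ fun j _ => hYm j]
    refine (Finset.sum_le_sum fun j _ => hYi j).trans ?_
    rw [← Finset.mul_sum]
    gcongr
    refine (hlayer ε₀ hε₀e₁ ε hε φ hφ).trans_eq ?_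
    rw [ENNReal.ofReal_mul hl0, hl, ENNReal.ofReal_toReal h.lam_ne_top]
  have hacc := accumulate_le (B' := ∫⁻ y, ballOsc φ (s₁ * ε) y) haκ hJJ hT hT' hX
  have hpow : q ^ α = ε₀ ^ (-α) * ε ^ α := by
    rw [hq, Real.div_rpow hε0.le hε₀0.le, Real.rpow_neg hε₀0.le]; ring
  have h1 : ∫⁻ x, ((1 + a) * (∑' i, S.branchCost s' τ ε (s₁ * ε) a φ i x) +
      (∑ j, Y j x + tail x)) = (1 + a) * (∫⁻ x, ∑' i, S.branchCost s' τ ε (s₁ * ε) a φ i x) +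
        ((∫⁻ x, ∑ j, Y j x) + ∫⁻ x, tail x) := by
    rw [lintegral_add_left (hCm.const_mul _), lintegral_const_mul _ hCm, lintegral_add_left hYsm]
  rw [h1]
  refine le_trans (add_le_add (mul_le_mul_right (h.lintegral_branchCost_le hc ε (s₁ * ε) a hφ) _)
    (add_le_add hYs le_rfl)) (hacc.trans (le_of_eq ?_))
  have ek : (1 + ENNReal.ofReal κ) = ENNReal.ofReal (1 + κ) := by
    rw [ENNReal.ofReal_add zero_le_one hκ.le, ENNReal.ofReal_one]
  have e2k : (1 + 2 * ENNReal.ofReal κ) = ENNReal.ofReal (1 + 2 * κ) := by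
    rw [ENNReal.ofReal_add zero_le_one (by positivity), ENNReal.ofReal_one,
      ENNReal.ofReal_mul (by norm_num), ENNReal.ofReal_ofNat]
  have e4 : (4 : ℝ≥0∞) = ENNReal.ofReal 4 := by rw [ENNReal.ofReal_ofNat]
  have f1 : (1 + ENNReal.ofReal κ) * (1 + 2 * ENNReal.ofReal κ) =
      ENNReal.ofReal ((1 + κ) * (1 + 2 * κ)) := by
    rw [ek, e2k, ← ENNReal.ofReal_mul (by positivity)]
  have f2 : (1 + ENNReal.ofReal κ) * (ENNReal.ofReal (l * q ^ α) +
      4 * ENNReal.ofReal (κ * q ^ α)) + ENNReal.ofReal (κ * q ^ α) =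
      ENNReal.ofReal (((1 + κ) * (l + 4 * κ) + κ) * q ^ α) := by
    rw [ek, e4, ← ENNReal.ofReal_mul (by positivity), ← ENNReal.ofReal_add (by positivity)
      (by positivity), ← ENNReal.ofReal_mul (by positivity), ← ENNReal.ofReal_add (by positivity)
      (by positivity)]
    congr 1
    ring
  have f3 : (1 + ENNReal.ofReal κ) * (a + ENNReal.ofReal (d₀ * ε ^ α)) =
      ENNReal.ofReal ((1 + κ) * (J * 2 ^ α + d₀) * ε ^ α) := by
    rw [ek, ha, ← ENNReal.ofReal_add (by positivity) (by positivity),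
      ← ENNReal.ofReal_mul (by positivity), Real.mul_rpow (by norm_num) hε0.le]
    congr 1
    ring
  have f4 : (D.toNNReal : ℝ≥0∞) * ENNReal.ofReal (ε ^ α) = ENNReal.ofReal (D * ε ^ α) := by
    rw [ENNReal.ofReal_mul hD0]; rfl
  rw [f1, f2, f3, f4, ← ENNReal.ofReal_add (by positivity) (by positivity)]
  congr 3
  rw [hpow, hD]
  ring

end Assumptions
end PiecewiseSystem
end

/-! ### Passage to signed functions and the Lasota–Yorke inequality. -/

section

theorem ofReal_toReal_sub_le {p p' c : ℝ≥0∞} (hp : p ≠ ∞) (hp' : p' ≠ ∞) (h : p ≤ p' + c) :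
    ENNReal.ofReal (p.toReal - p'.toReal) ≤ c := by
  rw [ENNReal.ofReal_sub _ ENNReal.toReal_nonneg, ENNReal.ofReal_toReal hp,
    ENNReal.ofReal_toReal hp']
  exact tsub_le_iff_left.2 h

theorem lintegral_osc_le {m : ℕ} (f : Eucl m → ℝ) {α ε₀ r : ℝ} (hr : r ∈ Ioc 0 ε₀) :
    ∫⁻ x, osc f (Metric.closedBall x r) ≤ ENNReal.ofReal (r ^ α) * quasiSeminorm α ε₀ f := by
  have h1 : ENNReal.ofReal (r ^ (-α)) * ∫⁻ x, osc f (Metric.closedBall x r) ≤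
      quasiSeminorm α ε₀ f :=
    le_iSup₂ (f := fun ε (_ : ε ∈ Ioc (0 : ℝ) ε₀) =>
      ENNReal.ofReal (ε ^ (-α)) * ∫⁻ x, osc f (Metric.closedBall x ε)) r hr
  have h2 : ENNReal.ofReal (r ^ α) * ENNReal.ofReal (r ^ (-α)) = 1 := by
    rw [← ENNReal.ofReal_mul (Real.rpow_nonneg hr.1.le _), ← Real.rpow_add hr.1]
    simp
  calc ∫⁻ x, osc f (Metric.closedBall x r) = ENNReal.ofReal (r ^ α) *
        (ENNReal.ofReal (r ^ (-α)) * ∫⁻ x, osc f (Metric.closedBall x r)) := by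
        rw [← mul_assoc, h2, one_mul]
    _ ≤ _ := by gcongr

theorem lintegral_ballOsc_add_le {m : ℕ} {f : Eucl m → ℝ} (hf : Measurable f) (r : ℝ) :
    (∫⁻ x, ballOsc (fun z => ENNReal.ofReal (f z)) r x) +
      (∫⁻ x, ballOsc (fun z => ENNReal.ofReal (-f z)) r x) ≤
      ∫⁻ x, osc f (Metric.closedBall x r) := by
  rw [← lintegral_add_left (measurable_ballOsc hf.ennreal_ofReal r)]
  exact lintegral_mono fun x => ballOsc_add_le_osc f r x

theorem ofReal_add_ofReal_neg (x : ℝ) :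
    ENNReal.ofReal x + ENNReal.ofReal (-x) = ‖x‖ₑ := by
  rw [Real.enorm_eq_ofReal_abs]
  rcases le_total 0 x with hx | hx
  · rw [abs_of_nonneg hx, ENNReal.ofReal_of_nonpos (neg_nonpos.2 hx), add_zero]
  · rw [abs_of_nonpos hx, ENNReal.ofReal_of_nonpos hx, zero_add]

theorem quasiSeminorm_congr_ae {m : ℕ} {f g : Eucl m → ℝ} (h : f =ᵐ[volume] g) (α ε₀ : ℝ) :
    quasiSeminorm α ε₀ f = quasiSeminorm α ε₀ g := by
  unfold quasiSeminorm
  simp only [osc_congr_ae h]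

namespace PiecewiseSystem
namespace Assumptions

section
variable {m : ℕ} {S : PiecewiseSystem m} {α η₀ ε₂ I Cξ : ℝ}
variable (h : S.Assumptions α η₀ ε₂ I Cξ) {s' τ ρ : ℝ} (hc : S.Collar s' τ ρ)
include h hc

/-- Permits replacing `f` by a measurable representative, although fibre sums depend on pointwise
values. -/
theorem inducedPF_congr_ae {f g : Eucl m → ℝ} (hfg : f =ᵐ[volume] g) :
    S.inducedPF f =ᵐ[volume] S.inducedPF g := by
  filter_upwards [h.ae_branchMap hc hfg] with u hu
  unfold inducedPF
  refine tsum_congr fun y => ?_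
  obtain ⟨y, hy, rfl⟩ := y
  obtain ⟨i, hi, hiy⟩ := h.exists_branch hc hy
  have := hu i hi.1
  rw [hiy] at this
  change f y * _ = g y * _
  rw [this]

theorem branchOp_ne_top_ae {φ : Eucl m → ℝ≥0∞} (hφ : Measurable φ) (hfin : ∫⁻ y, φ y ≠ ∞) :
    ∀ᵐ u, S.branchOp s' τ φ u ≠ ∞ := by
  filter_upwards [ae_lt_top (h.measurable_branchOp hc hφ)
    ((h.lintegral_branchOp_le hc hφ).trans_lt hfin.lt_top).ne] with u hu using hu.ne

theorem inducedPF_eq_ae {f : Eucl m → ℝ} (hf : Measurable f) (hfi : Integrable f) :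
    S.inducedPF f =ᵐ[volume] fun u =>
      (S.branchOp s' τ (fun y => ENNReal.ofReal (f y)) u).toReal -
        (S.branchOp s' τ (fun y => ENNReal.ofReal (-f y)) u).toReal := by
  filter_upwards [h.branchOp_ne_top_ae hc hf.ennreal_ofReal hfi.lintegral_lt_top.ne,
    h.branchOp_ne_top_ae hc hf.neg.ennreal_ofReal hfi.neg.lintegral_lt_top.ne] with u h1 h2
  exact h.inducedPF_eq hc f h1 h2

theorem integrable_inducedPF {f : Eucl m → ℝ} (hf : Measurable f) (hfi : Integrable f) :
    Integrable (S.inducedPF f) := by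
  refine Integrable.congr (Integrable.sub ?_ ?_) (h.inducedPF_eq_ae hc hf hfi).symm
  · exact integrable_toReal_of_lintegral_ne_top
      (h.measurable_branchOp hc hf.ennreal_ofReal).aemeasurable
      ((h.lintegral_branchOp_le hc hf.ennreal_ofReal).trans_lt hfi.lintegral_lt_top).ne
  · exact integrable_toReal_of_lintegral_ne_top
      (h.measurable_branchOp hc hf.neg.ennreal_ofReal).aemeasurable
      ((h.lintegral_branchOp_le hc hf.neg.ennreal_ofReal).trans_lt hfi.neg.lintegral_lt_top).ne

/-- Oscillation of the transfer operator from variations of its positive and negative parts. -/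
theorem lintegral_osc_inducedPF_le {f : Eucl m → ℝ} (hf : Measurable f) (hfi : Integrable f)
    {ε : ℝ} {C C' : Eucl m → ℝ≥0∞} (hCm : Measurable C)
    (hC : ∀ᵐ x, ∃ G : Set (Eucl m), (∀ᵐ u, u ∈ G) ∧
        ∀ u ∈ G ∩ Metric.closedBall x ε, ∀ u' ∈ G ∩ Metric.closedBall x ε,
          S.branchOp s' τ (fun y => ENNReal.ofReal (f y)) u ≤
            S.branchOp s' τ (fun y => ENNReal.ofReal (f y)) u' + C x)
    (hC' : ∀ᵐ x, ∃ G : Set (Eucl m), (∀ᵐ u, u ∈ G) ∧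
        ∀ u ∈ G ∩ Metric.closedBall x ε, ∀ u' ∈ G ∩ Metric.closedBall x ε,
          S.branchOp s' τ (fun y => ENNReal.ofReal (-f y)) u ≤
            S.branchOp s' τ (fun y => ENNReal.ofReal (-f y)) u' + C' x) :
    ∫⁻ x, osc (S.inducedPF f) (Metric.closedBall x ε) ≤ (∫⁻ x, C x) + ∫⁻ x, C' x := by
  rw [← lintegral_add_left hCm]
  refine lintegral_mono_ae ?_
  filter_upwards [hC, hC'] with x ⟨G, hG, hGC⟩ ⟨G', hG', hGC'⟩
  have hfin := h.branchOp_ne_top_ae hc hf.ennreal_ofReal hfi.lintegral_lt_top.ne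
  have hfin' := h.branchOp_ne_top_ae hc hf.neg.ennreal_ofReal hfi.neg.lintegral_lt_top.ne
  refine osc_le_of_forall (G := {u | u ∈ G ∧ u ∈ G' ∧
    S.branchOp s' τ (fun y => ENNReal.ofReal (f y)) u ≠ ∞ ∧
    S.branchOp s' τ (fun y => ENNReal.ofReal (-f y)) u ≠ ∞})
    Metric.isClosed_closedBall.measurableSet ?_ ?_
  · filter_upwards [hG, hG', hfin, hfin'] with u h1 h2 h3 h4 using ⟨h1, h2, h3, h4⟩
  · rintro u ⟨⟨hu1, hu2, hu3, hu4⟩, hu⟩ v ⟨⟨hv1, hv2, hv3, hv4⟩, hv⟩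
    rw [h.inducedPF_eq hc f hu3 hu4, h.inducedPF_eq hc f hv3 hv4]
    have e1 := ofReal_toReal_sub_le hu3 hv3 (hGC u ⟨hu1, hu⟩ v ⟨hv1, hv⟩)
    have e2 := ofReal_toReal_sub_le hv4 hu4 (hGC' v ⟨hv2, hv⟩ u ⟨hu2, hu⟩)
    refine le_trans ?_ (add_le_add e1 e2)
    refine le_trans (le_of_eq ?_) ENNReal.ofReal_add_le
    congr 1
    ring

end

/-- The variation bound is applied to the positive and negative parts of a measurable
representative. Both `s₁ ε` and `ε₀` are admissible radii in the seminorm, so the two oscillation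
integrals carry `s₁^α ε^α` and `ε₀^α`. The contraction factor is therefore `c₁ s₁^α + c₂ < 1`. -/
theorem lasota_yorke {k : ℕ} {S : PiecewiseSystem (k + 1)} {α η₀ ε₂ I Cξ : ℝ}
    (h : S.Assumptions α η₀ ε₂ I Cξ) :
    ∃ η : ℝ≥0, η < 1 ∧ ∃ εs : ℝ, 0 < εs ∧ ∀ ε₀ ∈ Ioc (0 : ℝ) εs, ∃ D : ℝ≥0,
      ∀ f : Eucl (k + 1) → ℝ, MemQuasiHolder α ε₀ f →
        MemQuasiHolder α ε₀ (S.inducedPF f) ∧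
        quasiSeminorm α ε₀ (S.inducedPF f) ≤
          η * quasiSeminorm α ε₀ f + D * ∫⁻ x, ‖f x‖ₑ := by
  obtain ⟨s₁, c₁, c₂, hs₁, hs₁1, hc₁, hc₂, hη, s', τ, ρ, hc, εs, hεs, hvar⟩ :=
    h.exists_variation_bound
  have hη0 : 0 ≤ c₁ * s₁ ^ α + c₂ := by positivity
  refine ⟨(c₁ * s₁ ^ α + c₂).toNNReal, ?_, εs, hεs, fun ε₀ hε₀ => ?_⟩
  · rw [Real.toNNReal_lt_one]
    exact hη
  obtain ⟨D, hD⟩ := hvar ε₀ hε₀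
  refine ⟨D, fun f ⟨hfi, hfs⟩ => ?_⟩
  suffices hle : Integrable (S.inducedPF f) ∧ quasiSeminorm α ε₀ (S.inducedPF f) ≤
      (c₁ * s₁ ^ α + c₂).toNNReal * quasiSeminorm α ε₀ f + D * ∫⁻ x, ‖f x‖ₑ from
    ⟨⟨hle.1, hle.2.trans_lt (ENNReal.add_lt_top.2
      ⟨ENNReal.mul_lt_top ENNReal.coe_lt_top hfs,
        ENNReal.mul_lt_top ENNReal.coe_lt_top hfi.2⟩)⟩, hle.2⟩
  obtain ⟨g, hgm, hfg⟩ := hfi.1.aemeasurable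
  have hgi : Integrable g := hfi.congr hfg
  have hPF := h.inducedPF_congr_ae hc hfg
  have hnorm : ∫⁻ x, ‖f x‖ₑ = ∫⁻ x, ‖g x‖ₑ :=
    lintegral_congr_ae (hfg.mono fun x hx => congrArg (fun t : ℝ => ‖t‖ₑ) hx)
  rw [quasiSeminorm_congr_ae hPF, quasiSeminorm_congr_ae hfg, hnorm]
  refine ⟨(h.integrable_inducedPF hc hgm hgi).congr hPF.symm, ?_⟩
  refine iSup₂_le fun ε hε => ?_
  obtain ⟨C, hCm, hC, hCi⟩ := hD _ hgm.ennreal_ofReal ε hε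
  obtain ⟨C', -, hC', hCi'⟩ := hD _ hgm.neg.ennreal_ofReal ε hε
  set Q := quasiSeminorm α ε₀ g with hQ
  have hε0 := hε.1
  have hε₀0 := hε₀.1
  have e1 := (lintegral_ballOsc_add_le hgm (s₁ * ε)).trans (lintegral_osc_le (α := α) g
    (⟨by positivity, (mul_le_of_le_one_left hε0.le hs₁1).trans hε.2⟩ : s₁ * ε ∈ Ioc 0 ε₀))
  have e2 := (lintegral_ballOsc_add_le hgm ε₀).trans (lintegral_osc_le (α := α) g
    (⟨hε₀0, le_rfl⟩ : ε₀ ∈ Ioc 0 ε₀))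
  have e3 : (∫⁻ y, ENNReal.ofReal (g y)) + ∫⁻ y, ENNReal.ofReal (-g y) = ∫⁻ y, ‖g y‖ₑ := by
    rw [← lintegral_add_left hgm.ennreal_ofReal]
    exact lintegral_congr fun y => ofReal_add_ofReal_neg (g y)
  have hpow : ENNReal.ofReal (ε ^ (-α)) * ENNReal.ofReal (ε ^ α) = 1 := by
    rw [← ENNReal.ofReal_mul (Real.rpow_nonneg hε0.le _), ← Real.rpow_add hε0]
    simp
  have hsum : ∫⁻ x, osc (S.inducedPF g) (Metric.closedBall x ε) ≤
      ENNReal.ofReal c₁ * (ENNReal.ofReal ((s₁ * ε) ^ α) * Q) +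
        ENNReal.ofReal (c₂ * (ε / ε₀) ^ α) * (ENNReal.ofReal (ε₀ ^ α) * Q) +
        D * ENNReal.ofReal (ε ^ α) * ∫⁻ y, ‖g y‖ₑ := by
    refine (h.lintegral_osc_inducedPF_le hc hgm hgi hCm hC hC').trans
      ((add_le_add hCi hCi').trans ?_)
    calc _ = ENNReal.ofReal c₁ * ((∫⁻ x, ballOsc (fun z => ENNReal.ofReal (g z)) (s₁ * ε) x) +
            (∫⁻ x, ballOsc (fun z => ENNReal.ofReal (-g z)) (s₁ * ε) x)) +
          ENNReal.ofReal (c₂ * (ε / ε₀) ^ α) *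
            ((∫⁻ x, ballOsc (fun z => ENNReal.ofReal (g z)) ε₀ x) +
            (∫⁻ x, ballOsc (fun z => ENNReal.ofReal (-g z)) ε₀ x)) +
          D * ENNReal.ofReal (ε ^ α) *
            ((∫⁻ y, ENNReal.ofReal (g y)) + ∫⁻ y, ENNReal.ofReal (-g y)) := by
          simp only [Pi.neg_apply]
          ring
      _ ≤ _ := by
          rw [e3]
          gcongr
  have hcoef : ENNReal.ofReal c₁ * ENNReal.ofReal ((s₁ * ε) ^ α) +
      ENNReal.ofReal (c₂ * (ε / ε₀) ^ α) * ENNReal.ofReal (ε₀ ^ α) =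
      ENNReal.ofReal (c₁ * s₁ ^ α + c₂) * ENNReal.ofReal (ε ^ α) := by
    have hε₀α : 0 < ε₀ ^ α := Real.rpow_pos_of_pos hε₀0 _
    rw [← ENNReal.ofReal_mul hc₁, ← ENNReal.ofReal_mul (by positivity),
      ← ENNReal.ofReal_add (by positivity) (by positivity), ← ENNReal.ofReal_mul hη0]
    congr 1
    rw [Real.mul_rpow hs₁.le hε0.le, Real.div_rpow hε0.le hε₀0.le]
    field_simp
  calc _ ≤ ENNReal.ofReal (ε ^ (-α)) *
        (ENNReal.ofReal c₁ * (ENNReal.ofReal ((s₁ * ε) ^ α) * Q) +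
        ENNReal.ofReal (c₂ * (ε / ε₀) ^ α) * (ENNReal.ofReal (ε₀ ^ α) * Q) +
        D * ENNReal.ofReal (ε ^ α) * ∫⁻ y, ‖g y‖ₑ) := by gcongr
    _ = ENNReal.ofReal (ε ^ (-α)) * ((ENNReal.ofReal c₁ * ENNReal.ofReal ((s₁ * ε) ^ α) +
          ENNReal.ofReal (c₂ * (ε / ε₀) ^ α) * ENNReal.ofReal (ε₀ ^ α)) * Q) +
        (ENNReal.ofReal (ε ^ (-α)) * ENNReal.ofReal (ε ^ α)) * (D * ∫⁻ y, ‖g y‖ₑ) := by ring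
    _ = (ENNReal.ofReal (ε ^ (-α)) * ENNReal.ofReal (ε ^ α)) *
          (ENNReal.ofReal (c₁ * s₁ ^ α + c₂) * Q) +
        (ENNReal.ofReal (ε ^ (-α)) * ENNReal.ofReal (ε ^ α)) * (D * ∫⁻ y, ‖g y‖ₑ) := by
        rw [hcoef]; ring
    _ = _ := by rw [hpow, one_mul, one_mul]; rfl

end Assumptions
end PiecewiseSystem
end

end

theorem mainTheorem2 (m : ℕ) (hm : 1 ≤ m) (α : ℝ) (hα₀ : 0 < α) (hα₁ : α < 1)
    (S : PiecewiseSystem m) (hS : S.Standing) (η₀ ε₂ I Cξ : ℝ)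
    (h₁ : S.Assumption1 α) (h₂ : S.Assumption2)
    (h₃ : S.Assumption3 α η₀ ε₂ I Cξ) (h₄ : S.Assumption4 α I Cξ) :
    ∃ η : ℝ≥0, η < 1 ∧ ∃ εs : ℝ, 0 < εs ∧ ∀ ε₀ ∈ Ioc (0 : ℝ) εs, ∃ D : ℝ≥0,
      ∀ f : Eucl m → ℝ, MemQuasiHolder α ε₀ f →
        MemQuasiHolder α ε₀ (S.inducedPF f) ∧
        quasiSeminorm α ε₀ (S.inducedPF f) ≤
          η * quasiSeminorm α ε₀ f + D * ∫⁻ x, ‖f x‖ₑ := by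
  have h : S.Assumptions α η₀ ε₂ I Cξ := ⟨hm, hα₀, hα₁, hS, h₁, h₂, h₃, h₄⟩
  obtain ⟨k, rfl⟩ : ∃ k, m = k + 1 := ⟨m - 1, by omega⟩
  exact h.lasota_yorke
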